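/- Let $(X,g)$ be a compact Kähler manifold of dimension $n$ with Kähler form $\omega=\sqrt{-1}\sum g_{i\bar j}\,dz^i\wedge d\bar z^j$, let $Y$ be a complex manifold of dimension $p\ge 1$, and let $f:X\dashrightarrow Y$ be a dominant meromorphic map with indeterminacy locus $Z$. Let $\mathcal F\subset\Omega_X^p$ be the reflexive extension of $f^*K_Y=(f|_{X\setminus Z})^*K_Y$, i.e. the subsheaf of holomorphic $p$-forms which, on $X\setminus Z$, are locally holomorphic multiples of $f^*(dw^1\wedge\dots\wedge dw^p)$ for local coordinates $w$ of $Y$. Assume that $\mathcal F$ is invertible and pseudo-effective: there are an open cover $\{U_\alpha\}$ of $X$, generators $\eta_\alpha$ of $\mathcal F|_{U_\alpha}$, and a singular Hermitian metric $h$ on $\mathcal F$ with $|\eta_\alpha|_h^2=e^{-\varphi_\alpha}$, where $\varphi_\alpha\in PSH(U_\alpha)\cap L^1_{\mathrm{loc}}(U_\alpha)$. Let $\psi:=e^{\varphi_\alpha}|\eta_\alpha|^2_{\Lambda^pg^*}$ on $U_\alpha$, a globally defined function on $X$ (the Hermitian ratio). Let $R$ be the Chern curvature tensor of $g$. For a $p$-dimensional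 subspace $\Sigma\subset T_{X,x}$ and $a,b\in\mathbb R$ put $$S_{a,b,p}(x,\Sigma):=\frac{1}{\mathrm{vol}(\mathbb S_\Sigma)}\int_{v\in\mathbb S_\Sigma}\bigl(a\,\mathrm{Ric}(v,\bar v)+b\,H(v)\bigr)\,d\mu(v),\qquad H(v)=\frac{R(v,\bar v,v,\bar v)}{|v|_g^4},$$ where $\mathbb S_\Sigma=\{v\in\Sigma:|v|_g=1\}$ and $d\mu$ is its standard surface measure. Suppose that $a\ge 0$ and $\frac ap+\frac{2b}{p(p+1)}\ge 0$. Then: (i) $\eta_\alpha$ is decomposable at every point $x\in U_\alpha$: there are a unitary coframe $e_1,\dots,e_p\in T_{X,x}^*$ (orthonormal covectors) and $t\in\mathbb C$ with $\eta_\alpha(x)=t\,e_1\wedge\dots\wedge e_p$. Let $e_i^*\in T_{X,x}$ be the dual vectors, so that $e_i=g(\cdot,\overline{e_i^*})$, and let $\Sigma=\Sigma_x:=\mathrm{span}\{e_1^*,\dots,e_p^*\}$. Such a $\Sigma_x$ can be chosen independently of $\alpha$. (ii) The weak derivative $\partial\psi$ exists and $|\partial\psi|^2$ is integrable for $\omega^n$.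 (iii) For every choice of subspaces $\Sigma_x$ as in (i), the function $x\mapsto\psi(x)^2S_{a,b,p}(x,\Sigma_x)$ is integrable for $\omega^n$, and $$-\Bigl(\frac ap+\frac{2b}{p(p+1)}\Bigr)\int_X|\partial\psi|^2\,\omega^n\ \ge\ \int_X\psi^2\,S_{a,b,p}(x,\Sigma_x)\,\omega^n .$$ -/

import Mathlib

open scoped Manifold ContDiff ComplexConjugate
open MeasureTheory

noncomputable section

namespace BochnerRatio

/-! ### Holomorphic coordinates -/

/-- The model space `ℂⁿ` (only its topology, its smooth structure and its Lebesgue measure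
are used; the measure is the product of the Lebesgue measures `dx dy` of the factors `ℂ`). -/
abbrev Cn (n : ℕ) : Type := Fin n → ℂ

/-- Wirtinger derivative `∂F/∂zⁱ`. -/
def wd {n : ℕ} (i : Fin n) (F : Cn n → ℂ) (z : Cn n) : ℂ :=
  (fderiv ℝ F z (Pi.single i 1) - Complex.I * fderiv ℝ F z (Pi.single i Complex.I)) / 2

/-- Wirtinger derivative `∂F/∂z̄ⁱ`. -/
def wdBar {n : ℕ} (i : Fin n) (F : Cn n → ℂ) (z : Cn n) : ℂ :=
  (fderiv ℝ F z (Pi.single i 1) + Complex.I * fderiv ℝ F z (Pi.single i Complex.I)) / 2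

section Manifold

variable {n : ℕ} {X : Type*} [TopologicalSpace X] [ChartedSpace (Cn n) X]

/-- The holomorphic tangent space of an `n`-dimensional complex manifold. -/
abbrev Tan (n : ℕ) {X : Type*} [TopologicalSpace X] [ChartedSpace (Cn n) X] (x : X) : Type :=
  TangentSpace 𝓘(ℂ, Cn n) x

/-- The components `(u¹, …, uⁿ)` of a tangent vector `u = ∑ uⁱ ∂/∂zⁱ` in the coordinates `χ`. -/
def coord (χ : OpenPartialHomeomorph X (Cn n)) (x : X) (u : Tan n x) : Cn n :=
  mfderiv 𝓘(ℂ, Cn n) 𝓘(ℂ, Cn n) χ x u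

/-- The coordinate vector `∂/∂zⁱ` at `x` of the coordinates `χ`. -/
def coordVec (χ : OpenPartialHomeomorph X (Cn n)) (x : X) (i : Fin n) : Tan n x :=
  (mfderiv 𝓘(ℂ, Cn n) 𝓘(ℂ, Cn n) χ x).inverse (Pi.single i (1 : ℂ) : Cn n)

/-- A (rough) field of `(p,0)`-forms. -/
abbrev FormField (n p : ℕ) (X : Type*) [TopologicalSpace X] [ChartedSpace (Cn n) X] : Type _ :=
  ∀ x : X, (Tan n x) [⋀^Fin p]→ₗ[ℂ] ℂ

/-- The wedge product `e₁ ∧ ⋯ ∧ e_p` of covectors, `(v₁, …, v_p) ↦ det (e_j (v_i))`. -/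
def wedge {p : ℕ} {V : Type*} [AddCommGroup V] [Module ℂ V] (e : Fin p → (V →ₗ[ℂ] ℂ)) :
    V [⋀^Fin p]→ₗ[ℂ] ℂ :=
  (Matrix.detRowAlternating (n := Fin p) (R := ℂ)).compLinearMap (LinearMap.pi e)

/-- `η` is a holomorphic `p`-form on the open set `U`: its coefficients in holomorphic
coordinates are holomorphic functions. -/
def IsHolomorphicForm {p : ℕ} (U : Set X) (η : FormField n p X) : Prop :=
  ∀ χ ∈ atlas (Cn n) X, ∀ J : Fin p → Fin n,
    ContDiffOn ℂ ω (fun z => η (χ.symm z) (fun k => coordVec χ (χ.symm z) (J k)))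
      (χ.target ∩ χ.symm ⁻¹' U)

/-- `c` is a holomorphic function on the open set `U`. -/
def IsHolomorphicFun (n : ℕ) {X : Type*} [TopologicalSpace X] [ChartedSpace (Cn n) X]
    (U : Set X) (c : X → ℂ) : Prop :=
  ContMDiffOn 𝓘(ℂ, Cn n) 𝓘(ℂ, ℂ) ω c U

end Manifold

/-! ### Hermitian metrics and their curvature -/

/-- A smooth Hermitian metric on the holomorphic tangent bundle, `form x u v = g_x(u, v̄)`. -/
structure HermitianMetric (n : ℕ) (X : Type*) [TopologicalSpace X] [ChartedSpace (Cn n) X] where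
  form : ∀ x : X, Tan n x →ₗ[ℂ] Tan n x →ₗ⋆[ℂ] ℂ
  conj_symm : ∀ (x : X) (u v : Tan n x), conj (form x u v) = form x v u
  pos : ∀ (x : X) (u : Tan n x), u ≠ 0 → 0 < (form x u u).re
  smooth : ∀ χ ∈ atlas (Cn n) X, ∀ i j : Fin n,
    ContDiffOn ℝ ∞
      (fun z => form (χ.symm z) (coordVec χ (χ.symm z) i) (coordVec χ (χ.symm z) j)) χ.target

/-- The average of `F` over the unit sphere, for its standard surface measure, of a finite
dimensional complex inner product space. -/
def sphereMean {V : Type*} [NormedAddCommGroup V] [InnerProductSpace ℂ V]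
    [FiniteDimensional ℂ V] (F : V → ℝ) : ℝ :=
  letI : InnerProductSpace ℝ V := InnerProductSpace.complexToReal
  haveI : FiniteDimensional ℝ V := FiniteDimensional.complexToReal V
  letI : MeasurableSpace V := borel V
  haveI : BorelSpace V := ⟨rfl⟩
  letI : MeasureSpace V := measureSpaceOfInnerProductSpace
  ⨍ v : Metric.sphere (0 : V) 1, F v ∂((volume : Measure V).toSphere)

/-- The average over the unit sphere for a given inner product on a complex vector space. -/
def sphereAverage {V : Type*} [AddCommGroup V] [Module ℂ V] [FiniteDimensional ℂ V]
    (c : InnerProductSpace.Core ℂ V) (F : V → ℝ) : ℝ :=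
  letI : NormedAddCommGroup V := c.toNormedAddCommGroup
  letI : InnerProductSpace ℂ V := InnerProductSpace.ofCore c.toCore
  sphereMean F

namespace HermitianMetric

variable {n : ℕ} {X : Type*} [TopologicalSpace X] [ChartedSpace (Cn n) X]
  (g : HermitianMetric n X)

/-- The matrix `g_{i j̄}` at `x` in the coordinates `χ`. -/
def gram (χ : OpenPartialHomeomorph X (Cn n)) (x : X) : Matrix (Fin n) (Fin n) ℂ :=
  Matrix.of fun i j => g.form x (coordVec χ x i) (coordVec χ x j)

/-- The inverse metric `g^{i j̄}`, normalized by `∑_q g^{i q̄} g_{k q̄} = δ_{ik}`. -/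
def gramInv (χ : OpenPartialHomeomorph X (Cn n)) (x : X) (i j : Fin n) : ℂ :=
  (g.gram χ x)⁻¹ j i

/-- The function `z ↦ g_{i j̄}(z)` in the coordinates `χ`. -/
def coeff (χ : OpenPartialHomeomorph X (Cn n)) (i j : Fin n) (z : Cn n) : ℂ :=
  g.gram χ (χ.symm z) i j

/-- The metric is Kähler: `ω = √-1 ∑ g_{i j̄} dzⁱ ∧ dz̄ʲ` is closed, that is,
`∂g_{i j̄}/∂zᵏ = ∂g_{k j̄}/∂zⁱ` in all coordinates of the atlas. -/
def IsKahler : Prop :=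
  ∀ χ ∈ atlas (Cn n) X, ∀ z ∈ χ.target, ∀ i j k : Fin n,
    wd k (g.coeff χ i j) z = wd i (g.coeff χ k j) z

/-- The components of the Chern curvature tensor,
`R_{i j̄ k l̄} = -∂_i ∂_{j̄} g_{k l̄} + ∑ g^{r q̄} ∂_i g_{k q̄} ∂_{j̄} g_{r l̄}`. -/
def curvCoeff (χ : OpenPartialHomeomorph X (Cn n)) (x : X) (i j k l : Fin n) : ℂ :=
  -wd i (wdBar j (g.coeff χ k l)) (χ x)
    + ∑ r, ∑ q, g.gramInv χ x r q * wd i (g.coeff χ k q) (χ x) * wdBar j (g.coeff χ r l) (χ x)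

/-- The Chern curvature tensor `R(u, v̄, w, s̄)`, evaluated in the preferred coordinates at `x`. -/
def curv (x : X) (u v w s : Tan n x) : ℂ :=
  let χ := chartAt (Cn n) x
  ∑ i, ∑ j, ∑ k, ∑ l, g.curvCoeff χ x i j k l *
    coord χ x u i * conj (coord χ x v j) * coord χ x w k * conj (coord χ x s l)

/-- The Ricci curvature `Ric(u, v̄)`, with components `∑ g^{k l̄} R_{i j̄ k l̄}`. -/
def ric (x : X) (u v : Tan n x) : ℂ :=
  let χ := chartAt (Cn n) x
  ∑ i, ∑ j, (∑ k, ∑ l, g.gramInv χ x k l * g.curvCoeff χ x i j k l) *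
    coord χ x u i * conj (coord χ x v j)

/-- The holomorphic sectional curvature `R(v, v̄, v, v̄) / |v|⁴`. -/
def hsc (x : X) (v : Tan n x) : ℝ :=
  (g.curv x v v v v).re / (g.form x v v).re ^ 2

/-- The inner product that the metric induces on a subspace of a tangent space (Mathlib's
convention: conjugate linear in the first variable). -/
@[reducible]
def core (x : X) (S : Submodule ℂ (Tan n x)) : InnerProductSpace.Core ℂ S where
  inner u v := g.form x v u
  conj_inner_symm u v := g.conj_symm x u v
  re_inner_nonneg u := by
    by_cases h : (u : Tan n x) = 0
    · simp [h]
    · exact (g.pos x u h).le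
  add_left u v w := by simp
  smul_left u v r := by simp
  definite u h := by
    by_contra hu
    have h1 : (u : Tan n x) ≠ 0 := fun h0 => hu (Subtype.ext h0)
    have h2 := g.pos x u h1
    rw [h] at h2
    simp at h2

instance finiteDimensional_tan (x : X) : FiniteDimensional ℂ (Tan n x) :=
  inferInstanceAs (FiniteDimensional ℂ (Fin n → ℂ))

/-- The mixed curvature `S_{a,b,k}(x, Σ)` for a `k`-dimensional subspace `Σ` of the tangent space:
the average of `a Ric(v, v̄) + b H(v)` over the unit vectors `v` of `Σ`. -/
def mixedCurv (a b : ℝ) (x : X) (S : Submodule ℂ (Tan n x)) : ℝ :=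
  sphereAverage (g.core x S) fun v => a * (g.ric x v v).re + b * g.hsc x v

/-- The squared norm of a covector, `|θ|² = ∑ g^{i j̄} θ_i θ̄_j`. -/
def covectorNormSq (x : X) (θ : Tan n x →ₗ[ℂ] ℂ) : ℝ :=
  let χ := chartAt (Cn n) x
  (∑ i, ∑ j, g.gramInv χ x i j * θ (coordVec χ x i) * conj (θ (coordVec χ x j))).re

/-- The squared norm of a `(p,0)`-form for the metric `Λᵖg*`, in which `e₁ ∧ ⋯ ∧ e_p` has norm
one for a unitary coframe:
`|η|² = (1/p!) ∑_{I,J} g^{i₁ j̄₁} ⋯ g^{i_p j̄_p} η_I η̄_J`. -/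
def formNormSq {p : ℕ} (x : X) (η : (Tan n x) [⋀^Fin p]→ₗ[ℂ] ℂ) : ℝ :=
  let χ := chartAt (Cn n) x
  ((1 / (p.factorial : ℂ)) * ∑ I : Fin p → Fin n, ∑ J : Fin p → Fin n,
    (∏ k, g.gramInv χ x (I k) (J k)) * η (fun k => coordVec χ x (I k))
      * conj (η (fun k => coordVec χ x (J k)))).re

theorem formNormSq_smul {p : ℕ} (x : X) (b : ℂ) (η : (Tan n x) [⋀^Fin p]→ₗ[ℂ] ℂ) :
    g.formNormSq x (b • η) = ‖b‖ ^ 2 * g.formNormSq x η := by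
  have hb : b * conj b = ((‖b‖ ^ 2 : ℝ) : ℂ) := by
    rw [Complex.mul_conj, Complex.normSq_eq_norm_sq]
  simp only [formNormSq]
  rw [← Complex.re_ofReal_mul, ← hb]
  refine congrArg Complex.re ?_
  simp only [AlternatingMap.smul_apply, smul_eq_mul, map_mul, Finset.mul_sum]
  refine Finset.sum_congr rfl fun I _ => ?_
  refine Finset.sum_congr rfl fun J _ => ?_
  ring

/-- The measure `ωⁿ = n! 2ⁿ det(g_{i j̄}) dλ` on the domain of the coordinates `χ`. -/
def chartVolume [MeasurableSpace X] (χ : OpenPartialHomeomorph X (Cn n)) : Measure X :=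
  (((volume : Measure (Cn n)).restrict χ.target).withDensity fun z =>
    ENNReal.ofReal (n.factorial * 2 ^ n * (g.gram χ (χ.symm z)).det.re)).map χ.symm

/-- The measure `ωⁿ` on `X`. The measures `chartVolume χ` agree on overlaps of coordinate domains;
their supremum is the measure that restricts to `chartVolume χ` on the domain of each `χ`. -/
def volumeMeasure [MeasurableSpace X] : Measure X :=
  ⨆ χ ∈ atlas (Cn n) X, g.chartVolume χ

/-- `S = span(e₁*, …, e_p*)` for covectors `e₁, …, e_p` that form a unitary coframe with
`η = t e₁ ∧ ⋯ ∧ e_p`. The coframe is given by its dual vectors `v i = e_i*`, so that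
`e_i = g(·, v̄_i)`. -/
def IsDecompositionSpan {p : ℕ} (x : X) (η : (Tan n x) [⋀^Fin p]→ₗ[ℂ] ℂ)
    (S : Submodule ℂ (Tan n x)) : Prop :=
  ∃ (v : Fin p → Tan n x) (t : ℂ),
    (∀ i j, g.form x (v i) (v j) = if i = j then 1 else 0) ∧
    η = t • wedge (fun i => ((g.form x).flip (v i) : Tan n x →ₗ[ℂ] ℂ)) ∧
    S = Submodule.span ℂ (Set.range v)

end HermitianMetric

/-! ### Weak derivatives -/

/-- `G` is the weak `(1,0)`-derivative `∂ψ` of `ψ`, tested in all coordinates of the atlas. -/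
def IsWeakDel (n : ℕ) {X : Type*} [TopologicalSpace X] [ChartedSpace (Cn n) X]
    (ψ : X → ℝ) (G : ∀ x : X, Tan n x →ₗ[ℂ] ℂ) : Prop :=
  ∀ χ ∈ atlas (Cn n) X,
    LocallyIntegrableOn (fun z => ψ (χ.symm z)) χ.target ∧
    ∀ i : Fin n,
      LocallyIntegrableOn (fun z => G (χ.symm z) (coordVec χ (χ.symm z) i)) χ.target ∧
      ∀ θ : Cn n → ℂ, ContDiff ℝ ∞ θ → HasCompactSupport θ → tsupport θ ⊆ χ.target →
        ∫ z, (ψ (χ.symm z) : ℂ) * wd i θ z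
          = -∫ z, G (χ.symm z) (coordVec χ (χ.symm z) i) * θ z

/-! ### Plurisubharmonic functions -/

/-- Plurisubharmonic functions on an open set of `ℂⁿ`, with values in `[-∞, ∞)`: upper
semicontinuous, with the sub-mean value inequality on closed discs. The mean value, possibly `-∞`,
of `u` is the limit (infimum) of the mean values of the bounded functions `max u m`, `m → -∞`. -/
def IsPlurisubharmonicOn {n : ℕ} (u : Cn n → EReal) (Ω : Set (Cn n)) : Prop :=
  UpperSemicontinuousOn u Ω ∧ (∀ z ∈ Ω, u z ≠ ⊤) ∧
  ∀ z w : Cn n, (∀ ζ : ℂ, ‖ζ‖ ≤ 1 → z + ζ • w ∈ Ω) → ∀ m : ℝ,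
    u z ≤ (Real.circleAverage (fun ζ : ℂ => (max (u (z + ζ • w)) (m : EReal)).toReal) 0 1 : ℝ)

/-- `φ ∈ PSH(U) ∩ L¹_loc(U)` for an open set `U` of a complex manifold. -/
def IsPshWeight (n : ℕ) {X : Type*} [TopologicalSpace X] [ChartedSpace (Cn n) X]
    (U : Set X) (φ : X → EReal) : Prop :=
  ∀ χ ∈ atlas (Cn n) X,
    IsPlurisubharmonicOn (fun z => φ (χ.symm z)) (χ.target ∩ χ.symm ⁻¹' U) ∧
    (∀ᵐ z ∂((volume : Measure (Cn n)).restrict (χ.target ∩ χ.symm ⁻¹' U)), φ (χ.symm z) ≠ ⊥) ∧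
    LocallyIntegrableOn (fun z => (φ (χ.symm z)).toReal) (χ.target ∩ χ.symm ⁻¹' U)

/-! ### Meromorphic maps -/

/-- Analytic subsets of a complex manifold: near every point of the manifold, the common zeros of
finitely many holomorphic functions. -/
def IsAnalyticSubset {E H M : Type*} [NormedAddCommGroup E] [NormedSpace ℂ E]
    [TopologicalSpace H] (I : ModelWithCorners ℂ E H) [TopologicalSpace M] [ChartedSpace H M]
    (S : Set M) : Prop :=
  ∀ x : M, ∃ V : Set M, IsOpen V ∧ x ∈ V ∧ ∃ (k : ℕ) (h : M → (Fin k → ℂ)),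
    ContMDiffOn I 𝓘(ℂ, Fin k → ℂ) ω h V ∧ ∀ y ∈ V, y ∈ S ↔ h y = 0

/-- A meromorphic map `X ⇢ Y` (in the sense of Remmert), given by its graph: an analytic subset of
`X × Y`, proper over `X`, which is the closure of the graph of a holomorphic map defined on the
complement of a nowhere dense analytic subset of `X`. -/
structure MeromorphicMap (n p : ℕ) (X Y : Type*) [TopologicalSpace X] [ChartedSpace (Cn n) X]
    [TopologicalSpace Y] [ChartedSpace (Cn p) Y] where
  graph : Set (X × Y)
  analytic : IsAnalyticSubset (𝓘(ℂ, Cn n).prod 𝓘(ℂ, Cn p)) graph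
  proper : IsProperMap (fun q : graph => q.1.1)
  generically_holomorphic : ∃ (A : Set X) (f₀ : X → Y),
    IsAnalyticSubset 𝓘(ℂ, Cn n) A ∧ interior A = ∅ ∧
    ContMDiffOn 𝓘(ℂ, Cn n) 𝓘(ℂ, Cn p) ω f₀ Aᶜ ∧
    graph = closure ((fun x => (x, f₀ x)) '' Aᶜ)

namespace MeromorphicMap

variable {n p : ℕ} {X Y : Type*} [TopologicalSpace X] [ChartedSpace (Cn n) X]
  [TopologicalSpace Y] [ChartedSpace (Cn p) Y] (f : MeromorphicMap n p X Y)

/-- Over the open set `V`, the meromorphic map `f` is the holomorphic map `F`. -/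
def RepresentedBy (V : Set X) (F : X → Y) : Prop :=
  IsOpen V ∧ ContMDiffOn 𝓘(ℂ, Cn n) 𝓘(ℂ, Cn p) ω F V ∧
    ∀ x ∈ V, ∀ y : Y, (x, y) ∈ f.graph ↔ y = F x

/-- The indeterminacy locus: the points near which `f` is not a holomorphic map. -/
def indeterminacy : Set X :=
  {x | ¬∃ (V : Set X) (F : X → Y), x ∈ V ∧ f.RepresentedBy V F}

/-- `f` is dominant: the image of the complement of the indeterminacy locus is dense. -/
def Dominant : Prop :=
  Dense {y : Y | ∃ x : X, x ∉ f.indeterminacy ∧ (x, y) ∈ f.graph}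

/-- The form `F*(dw¹ ∧ ⋯ ∧ dwᵖ) = d(w¹ ∘ F) ∧ ⋯ ∧ d(wᵖ ∘ F)` at `x`. -/
def pullbackForm (w : OpenPartialHomeomorph Y (Cn p)) (F : X → Y) : FormField n p X :=
  fun x => wedge fun j : Fin p =>
    (LinearMap.proj j : (Fin p → ℂ) →ₗ[ℂ] ℂ) ∘ₗ
      (mfderiv 𝓘(ℂ, Cn n) 𝓘(ℂ, Cn p) (fun y => w (F y)) x : Tan n x →L[ℂ] Cn p).toLinearMap

/-- The reflexive extension of `f* K_Y` as a subsheaf of `Ω_Xᵖ`: its sections over the open set `U`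
are the holomorphic `p`-forms on `U` that, off the indeterminacy locus, are locally multiples
`c · f*(dw¹ ∧ ⋯ ∧ dwᵖ)` with `c` holomorphic and `w` local coordinates of `Y`. -/
def reflexivePullback (U : Set X) (η : FormField n p X) : Prop :=
  IsHolomorphicForm U η ∧
  ∀ x ∈ U, x ∉ f.indeterminacy →
    ∃ (V : Set X) (F : X → Y) (w : OpenPartialHomeomorph Y (Cn p)) (c : X → ℂ),
      x ∈ V ∧ V ⊆ U ∧ f.RepresentedBy V F ∧ w ∈ atlas (Cn p) Y ∧ (∀ y ∈ V, F y ∈ w.source) ∧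
      IsHolomorphicFun n V c ∧ ∀ y ∈ V, η y = c y • pullbackForm w F y

end MeromorphicMap

/-! ### Pseudo-effective invertible subsheaves and the Hermitian ratio -/

section Ratio

variable {n p : ℕ} {X : Type*} [TopologicalSpace X] [ChartedSpace (Cn n) X]

/-- `η` generates the subsheaf `ℱ ⊆ Ω_Xᵖ` freely on `U`: multiplication by `η` is an isomorphism
`𝒪_U ≅ ℱ|_U`. -/
def IsGenerator (ℱ : Set X → FormField n p X → Prop) (U : Set X) (η : FormField n p X) : Prop :=
  ℱ U η ∧ ∀ V ⊆ U, IsOpen V →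
    (∀ σ, ℱ V σ → ∃ c : X → ℂ, IsHolomorphicFun n V c ∧ ∀ x ∈ V, σ x = c x • η x) ∧
    ∀ c c' : X → ℂ, IsHolomorphicFun n V c → IsHolomorphicFun n V c' →
      (∀ x ∈ V, c x • η x = c' x • η x) → Set.EqOn c c' V

/-- A pseudo-effective invertible subsheaf `ℱ ⊆ Ω_Xᵖ`, presented by local generators `η α` on an
open cover `U α` and by a singular Hermitian metric `h = e^{-φ}` with plurisubharmonic weights
`φ α`, `e^{-φ α} = |η α|²_h`. If `η β = b · η α`, then `|η β|²_h = |b|² |η α|²_h`, that is,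
`φ α = φ β + log |b|²`. -/
structure PseudoEffectiveMetric (ℱ : Set X → FormField n p X → Prop) (ι : Type*) where
  U : ι → Set X
  isOpen_U : ∀ α, IsOpen (U α)
  cover : ∀ x, ∃ α, x ∈ U α
  η : ι → FormField n p X
  generator : ∀ α, IsGenerator ℱ (U α) (η α)
  φ : ι → X → EReal
  psh : ∀ α, IsPshWeight n (U α) (φ α)
  compatible : ∀ α β, ∃ b : X → ℂ, IsHolomorphicFun n (U α ∩ U β) b ∧
    ∀ x ∈ U α ∩ U β, b x ≠ 0 ∧ η β x = b x • η α x ∧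
      φ α x = φ β x + ((2 * Real.log ‖b x‖ : ℝ) : EReal)

/-- The Hermitian ratio `ψ = e^{φ α} |η α|²`, computed with some `α` such that `x ∈ U α`;
the value does not depend on `α`. -/
def hermitianRatio {ℱ : Set X → FormField n p X → Prop} {ι : Type*}
    (g : HermitianMetric n X) (h : PseudoEffectiveMetric ℱ ι) (x : X) : ℝ :=
  (EReal.exp (h.φ (h.cover x).choose x)).toReal *
    g.formNormSq x (h.η (h.cover x).choose x)

theorem hermitianRatio_eq {ℱ : Set X → FormField n p X → Prop} {ι : Type*}
    (g : HermitianMetric n X) (h : PseudoEffectiveMetric ℱ ι) (x : X) (α : ι) (hx : x ∈ h.U α) :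
    hermitianRatio g h x = (EReal.exp (h.φ α x)).toReal * g.formNormSq x (h.η α x) := by
  obtain ⟨b, -, hb⟩ := h.compatible (h.cover x).choose α
  obtain ⟨hb0, hη, hφ⟩ := hb x ⟨(h.cover x).choose_spec, hx⟩
  have hpos : 0 < ‖b x‖ := norm_pos_iff.mpr hb0
  have h2 : Real.exp (2 * Real.log ‖b x‖) = ‖b x‖ ^ 2 := by
    rw [two_mul, Real.exp_add, Real.exp_log hpos, sq]
  rw [hermitianRatio, hφ, hη, g.formNormSq_smul, EReal.exp_add, ENNReal.toReal_mul,
    EReal.exp_coe, ENNReal.toReal_ofReal (Real.exp_pos _).le, h2]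
  ring

end Ratio

end BochnerRatio

end

noncomputable section

namespace BochnerRatio

open Equiv (Perm)
open Function (update)
open Module (finrank)
open Finset (mul_sum sum_comm sum_mul sum_add_distrib sum_neg_distrib sum_sub_distrib
  sum_eq_single sum_eq_zero sum_div sum_const_zero sum_nonneg sum_le_sum single_le_sum
  sum_mul_sum)
open Metric (ball isOpen_ball closedBall ball_subset_closedBall closedBall_subset_ball
  ball_subset_ball mem_ball sphere)
open Complex (I re_ofReal_mul normSq_eq_norm_sq ofReal_re mul_conj add_re re_sum norm_real
  continuous_re ofReal_mul neg_re continuous_ofReal continuous_conj sub_re reCLM ofRealCLM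
  conj_conj I_sq conj_re real_smul mul_re ofReal_sum conj_ofReal)
open Real (norm_of_nonneg circleAverage exp_pos exp cos sin norm_eq_abs circleAverage_mono
  circleAverage_def exp_add exp_le_exp)

open Filter

theorem sum_ext {ι M : Type*} [AddCommMonoid M] {s : Finset ι} {f g : ι → M}
    (h : ∀ i, f i = g i) : s.sum f = s.sum g := Finset.sum_congr rfl fun i _ => h i

/-- Matrix fields on `ℂⁿ`. -/
abbrev LocalMatrix (n : ℕ) := Cn n → Matrix (Fin n) (Fin n) ℂ

/-- Fields of `p`-forms on `ℂⁿ`. -/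
abbrev LocalForm (n p : ℕ) := Cn n → (Cn n) [⋀^Fin p]→ₗ[ℂ] ℂ

theorem sum_comm_ext {ι κ M : Type*} [AddCommMonoid M] {s : Finset ι} {t : Finset κ}
    {f : ι → κ → M} {g : κ → M} (h : ∀ j, ∑ i ∈ s, f i j = g j) :
    ∑ i ∈ s, ∑ j ∈ t, f i j = ∑ j ∈ t, g j := by
  rw [sum_comm]
  exact sum_ext h

theorem sum_ext_comm {ι κ M : Type*} [AddCommMonoid M] {s : Finset ι} {t : Finset κ}
    {f : ι → κ → M} {g : κ → M} (h : ∀ j, g j = ∑ i ∈ s, f i j) :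
    ∑ j ∈ t, g j = ∑ i ∈ s, ∑ j ∈ t, f i j := (sum_comm_ext fun j => (h j).symm).symm

/-! ### Directional Wirtinger operators -/

/-- `(∂_v F + e ∂_{iv} F) / 2`; the Wirtinger derivatives are the cases `e = ∓ i`. -/
def wirt {n : ℕ} (e : ℂ) (v : Cn n) (F : Cn n → ℂ) (z : Cn n) : ℂ :=
  (fderiv ℝ F z v + e * fderiv ℝ F z (I • v)) / 2

/-- The `(1,0)`-derivative in the direction `v`. -/
notation "dz" => wirt (-I)

/-- The `(0,1)`-derivative in the direction `v`. -/
notation "dzb" => wirt I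

/-- Smoothness at a point. -/
abbrev Sm {n : ℕ} (F : Cn n → ℂ) (z : Cn n) : Prop := ContDiffAt ℝ ∞ F z

section Wirtinger

variable {n : ℕ} {e e' : ℂ} {v w : Cn n} {F H : Cn n → ℂ} {z : Cn n}

theorem wd_eq_dz (i : Fin n) (F : Cn n → ℂ) (z : Cn n) : wd i F z = dz (Pi.single i 1) F z := by
  have : (I • (Pi.single i (1 : ℂ) : Cn n)) = Pi.single i I := by rw [← Pi.single_smul]; simp
  simp only [wd, wirt, this]; ring

theorem wdBar_eq_dzb (i : Fin n) (F : Cn n → ℂ) (z : Cn n) :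
    wdBar i F z = dzb (Pi.single i 1) F z := by
  have : (I • (Pi.single i (1 : ℂ) : Cn n)) = Pi.single i I := by rw [← Pi.single_smul]; simp
  simp only [wdBar, wirt, this]

theorem Sm.diff (h : Sm F z) : DifferentiableAt ℝ F z := h.differentiableAt (by simp)

theorem Sm.eventually (h : Sm F z) : ∀ᶠ y in nhds z, DifferentiableAt ℝ F y := by
  have h1 : ContDiffAt ℝ 1 F z := h.of_le (by exact_mod_cast le_top)
  exact (h1.eventually (by simp)).mono fun y hy => hy.differentiableAt (by simp)

theorem Sm.wirt (h : Sm F z) (e : ℂ) (v : Cn n) : Sm (wirt e v F) z := by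
  have h1 : ContDiffAt ℝ ∞ (fderiv ℝ F) z := h.fderiv_right (by simp)
  have h2 : ∀ w : Cn n, ContDiffAt ℝ ∞ (fun y => fderiv ℝ F y w) z := fun w =>
    h1.clm_apply contDiffAt_const
  exact (((h2 v).add (contDiffAt_const.mul (h2 _))).div_const 2)

theorem Sm.conj (h : Sm F z) : Sm (fun y => conj (F y)) z :=
  (Complex.conjCLE.contDiff (n := ∞)).contDiffAt.comp z h

theorem wirt_congr (h : F =ᶠ[nhds z] H) : wirt e v F z = wirt e v H z := by
  simp only [wirt, h.fderiv_eq]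

theorem wirt_congr_eventually (h : F =ᶠ[nhds z] H) : wirt e v F =ᶠ[nhds z] wirt e v H :=
  h.eventuallyEq_nhds.mono fun _ hy => wirt_congr hy

@[simp] theorem wirt_const (c : ℂ) : wirt e v (fun _ : Cn n => c) z = 0 := by simp [wirt]

theorem wirt_add (hF : DifferentiableAt ℝ F z) (hH : DifferentiableAt ℝ H z) :
    wirt e v (fun y => F y + H y) z = wirt e v F z + wirt e v H z := by
  simp only [wirt, fderiv_fun_add hF hH, _root_.add_apply]; ring

theorem wirt_sub (hF : DifferentiableAt ℝ F z) (hH : DifferentiableAt ℝ H z) :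
    wirt e v (fun y => F y - H y) z = wirt e v F z - wirt e v H z := by
  simp only [wirt, fderiv_fun_sub hF hH, _root_.sub_apply]; ring

theorem wirt_neg : wirt e v (fun y => -F y) z = -wirt e v F z := by
  simp only [wirt, fderiv_fun_neg, _root_.neg_apply]; ring

theorem wirt_mul (hF : DifferentiableAt ℝ F z) (hH : DifferentiableAt ℝ H z) :
    wirt e v (fun y => F y * H y) z = wirt e v F z * H z + F z * wirt e v H z := by
  simp only [wirt, fderiv_fun_mul hF hH, _root_.add_apply, _root_.smul_apply, smul_eq_mul]; ring

theorem wirt_const_mul (c : ℂ) (hF : DifferentiableAt ℝ F z) :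
    wirt e v (fun y => c * F y) z = c * wirt e v F z := by
  rw [wirt_mul (differentiableAt_const c) hF]; simp

theorem wirt_sum {ι : Type*} (s : Finset ι) {F : ι → Cn n → ℂ}
    (hF : ∀ i ∈ s, DifferentiableAt ℝ (F i) z) :
    wirt e v (fun y => ∑ i ∈ s, F i y) z = ∑ i ∈ s, wirt e v (F i) z := by
  simp only [wirt, fderiv_fun_sum hF, _root_.sum_apply, ← sum_div, sum_add_distrib, mul_sum]

theorem wirt_prod {ι : Type*} [Fintype ι] [DecidableEq ι] {F : ι → Cn n → ℂ}
    (hF : ∀ i, DifferentiableAt ℝ (F i) z) :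
    wirt e v (fun y => ∏ i, F i y) z
      = ∑ i, ∏ j, update (fun j => F j z) i (wirt e v (F i) z) j := by
  have h := HasFDerivAt.finsetProd (u := Finset.univ) (x := z)
    (fun i _ => (hF i).hasFDerivAt)
  simp only [wirt, h.fderiv, _root_.sum_apply, _root_.smul_apply,
    smul_eq_mul, mul_sum, ← sum_add_distrib, sum_div]
  refine sum_ext fun i => ?_
  rw [← Finset.mul_prod_erase _ _ (Finset.mem_univ i), Function.update_self]
  have h2 : ∀ a : ℂ, ∏ j ∈ Finset.univ.erase i, update (fun j => F j z) i a j
      = ∏ j ∈ Finset.univ.erase i, F j z := fun a =>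
    Finset.prod_congr rfl fun j hj => Function.update_of_ne (Finset.ne_of_mem_erase hj) _ _
  rw [h2]
  ring

theorem wirt_conj (hF : DifferentiableAt ℝ F z) :
    wirt e v (fun y => conj (F y)) z = conj (wirt (conj e) v F z) := by
  have h : fderiv ℝ (fun y => conj (F y)) z = (Complex.conjCLE : ℂ →L[ℝ] ℂ).comp (fderiv ℝ F z) :=
    ((Complex.conjCLE : ℂ →L[ℝ] ℂ).hasFDerivAt.comp z hF.hasFDerivAt).fderiv
  simp only [wirt, h, ContinuousLinearMap.comp_apply, map_div₀, map_add, map_mul, conj_conj]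
  simp [Complex.conj_ofNat]

theorem dz_conj (hF : DifferentiableAt ℝ F z) :
    dz v (fun y => conj (F y)) z = conj (dzb v F z) := by
  rw [wirt_conj hF]; simp

theorem dzb_conj (hF : DifferentiableAt ℝ F z) :
    dzb v (fun y => conj (F y)) z = conj (dz v F z) := by
  rw [wirt_conj hF]; simp

theorem wirt_add_vec : wirt e (v + w) F z = wirt e v F z + wirt e w F z := by
  simp only [wirt, smul_add, map_add]; ring

theorem fderiv_smul_complex (c : ℂ) (v : Cn n) :
    fderiv ℝ F z (c • v) = c.re * fderiv ℝ F z v + c.im * fderiv ℝ F z (I • v) := by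
  have : c • v = c.re • v + c.im • (I • v) := by
    ext i
    simp only [Pi.smul_apply, smul_eq_mul, Pi.add_apply, real_smul]
    conv_lhs => rw [← Complex.re_add_im c]
    ring
  rw [this, map_add, map_smul, map_smul, real_smul, real_smul]

theorem dz_smul_vec (c : ℂ) : dz (c • v) F z = c * dz v F z := by
  have hI : I • c • v = (I * c) • v := by rw [smul_smul]
  simp only [wirt, hI, fderiv_smul_complex c, fderiv_smul_complex (I * c)]
  conv_rhs => rw [← Complex.re_add_im c]
  simp only [mul_re, Complex.mul_im, Complex.I_re, Complex.I_im]
  push_cast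
  linear_combination (-(c.im : ℂ) * fderiv ℝ F z (I • v) / 2 +
    (0 : ℂ)) * I_sq + (fderiv ℝ F z (I • v) * (c.im : ℂ)) * I_sq

theorem dzb_smul_vec (hF : DifferentiableAt ℝ F z) (c : ℂ) :
    dzb (c • v) F z = conj c * dzb v F z := by
  have h1 := dz_conj (v := c • v) hF
  rw [dz_smul_vec, dz_conj hF] at h1
  have := congrArg conj h1
  simpa using this.symm

theorem dz_zero_vec : wirt e (0 : Cn n) F z = 0 := by simp [wirt]

theorem wirt_sum_vec {ι : Type*} (s : Finset ι) (f : ι → Cn n) :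
    wirt e (∑ i ∈ s, f i) F z = ∑ i ∈ s, wirt e (f i) F z := by
  classical
  induction s using Finset.induction_on with
  | empty => simp [dz_zero_vec]
  | insert a s ha ih => rw [Finset.sum_insert ha, Finset.sum_insert ha, wirt_add_vec, ih]

theorem dz_eq_sum (v : Cn n) (F : Cn n → ℂ) (z : Cn n) : dz v F z = ∑ i, v i * wd i F z := by
  conv_lhs => rw [← Finset.univ_sum_single v]
  rw [wirt_sum_vec]
  refine sum_ext fun i => ?_
  rw [wd_eq_dz, ← dz_smul_vec, ← Pi.single_smul]; simp

theorem dzb_eq_sum (hF : DifferentiableAt ℝ F z) (v : Cn n) :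
    dzb v F z = ∑ i, conj (v i) * wdBar i F z := by
  conv_lhs => rw [← Finset.univ_sum_single v]
  rw [wirt_sum_vec]
  refine sum_ext fun i => ?_
  rw [wdBar_eq_dzb, ← dzb_smul_vec hF, ← Pi.single_smul]; simp

theorem fderiv_eq_restrict (hF : DifferentiableAt ℂ F z) (v : Cn n) :
    fderiv ℝ F z v = fderiv ℂ F z v := by
  rw [(hF.hasFDerivAt.restrictScalars ℝ).fderiv]; rfl

theorem dzb_holomorphic (hF : DifferentiableAt ℂ F z) : dzb v F z = 0 := by
  simp only [wirt, fderiv_eq_restrict hF, map_smul, smul_eq_mul, ← mul_assoc, Complex.I_mul_I]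
  ring

theorem dz_holomorphic (hF : DifferentiableAt ℂ F z) : dz v F z = fderiv ℂ F z v := by
  simp only [wirt, fderiv_eq_restrict hF, map_smul, smul_eq_mul, ← mul_assoc]
  simp

theorem wirt_comm (h : Sm F z) : wirt e v (wirt e' w F) z = wirt e' w (wirt e v F) z := by
  have h1 : DifferentiableAt ℝ (fderiv ℝ F) z :=
    (h.fderiv_right (m := 1) (by norm_num; norm_cast)).differentiableAt (by simp)
  have key : ∀ (e : ℂ) (w y : Cn n), fderiv ℝ (wirt e w F) z y
      = (fderiv ℝ (fderiv ℝ F) z y w + e * fderiv ℝ (fderiv ℝ F) z y (I • w)) / 2 := by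
    intro e w y
    have h2 : ∀ w : Cn n, HasFDerivAt (fun y => fderiv ℝ F y w)
        ((fderiv ℝ (fderiv ℝ F) z).flip w) z := fun w => by
      have := h1.hasFDerivAt.clm_apply (hasFDerivAt_const w z)
      simpa using this
    have h3 := ((h2 w).add ((h2 (I • w)).const_mul e)).mul_const (2 : ℂ)⁻¹
    have h4 : (wirt e w F) = fun y => (fderiv ℝ F y w + e * fderiv ℝ F y (I • w)) * 2⁻¹ := by
      funext y; simp [wirt, div_eq_mul_inv]
    rw [h4]
    refine (congrArg (fun l => l y) h3.fderiv).trans ?_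
    simp [div_eq_mul_inv]; ring
  have hs : IsSymmSndFDerivAt ℝ F z := h.isSymmSndFDerivAt (by simp; norm_cast)
  have hs' : ∀ a b, fderiv ℝ (fderiv ℝ F) z a b = fderiv ℝ (fderiv ℝ F) z b a := fun a b => hs a b
  rw [wirt, wirt, key, key, key, key, hs' v w, hs' (I • v) w, hs' v (I • w), hs' (I • v) (I • w)]
  ring

theorem wirt_comp {m : ℕ} {τ : Cn m → Cn n} {z : Cn m} {v : Cn m} {F : Cn n → ℂ}
    (hτ : DifferentiableAt ℂ τ z) (hF : DifferentiableAt ℝ F (τ z)) :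
    wirt e v (fun y => F (τ y)) z = wirt e (fderiv ℂ τ z v) F (τ z) := by
  have h1 := hF.hasFDerivAt.comp z (hτ.hasFDerivAt.restrictScalars ℝ)
  have h2 : fderiv ℝ (fun y => F (τ y)) z = _ := h1.fderiv
  simp only [wirt, h2]
  simp

theorem wirt_det {p : ℕ} {G : Cn n → Matrix (Fin p) (Fin p) ℂ}
    (hG : ∀ i j, DifferentiableAt ℝ (fun y => G y i j) z) :
    wirt e v (fun y => (G y).det) z
      = ∑ i, ∑ j, (G z).adjugate i j * wirt e v (fun y => G y j i) z := by
  have hd : ∀ σ : Perm (Fin p), DifferentiableAt ℝ (fun y => ∏ i, G y (σ i) i) z :=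
    fun σ => (HasFDerivAt.finsetProd fun i _ => (hG (σ i) i).hasFDerivAt).differentiableAt
  have h1 : (fun y => (G y).det)
      = fun y => ∑ σ : Perm (Fin p), ((σ.sign : ℤ) : ℂ) * ∏ i, G y (σ i) i := by
    funext y; rw [Matrix.det_apply']
  rw [h1, wirt_sum _ fun σ _ => (hd σ).const_mul _]
  simp_rw [fun σ : Perm (Fin p) => wirt_const_mul (e := e) (v := v) ((σ.sign : ℤ) : ℂ) (hd σ)]
  simp_rw [fun σ : Perm (Fin p) => wirt_prod (e := e) (v := v) fun i => hG (σ i) i, mul_sum]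
  refine sum_comm_ext fun i => ?_
  have h2 := congrFun (Matrix.cramer_eq_adjugate_mulVec (G z)
    fun j => wirt e v (fun y => G y j i) z) i
  rw [Matrix.cramer_apply, Matrix.mulVec, dotProduct, Matrix.det_apply'] at h2
  rw [← h2]
  refine sum_ext fun σ => ?_
  congr 1
  refine Finset.prod_congr rfl fun j _ => ?_
  by_cases hj : j = i
  · subst hj; simp
  · simp [hj]

theorem integral_wirt_eq_zero (hF : ContDiff ℝ 1 F) (hc : HasCompactSupport F) :
    ∫ z, wirt e v F z = 0 := by
  have hint : Integrable F := hF.continuous.integrable_of_hasCompactSupport hc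
  have hd : ∀ v : Cn n, Integrable (fun z => fderiv ℝ F z v) := fun v => by
    refine Continuous.integrable_of_hasCompactSupport ?_ ?_
    · exact (hF.continuous_fderiv (by simp)).clm_apply continuous_const
    · exact (hc.fderiv_apply (𝕜 := ℝ) v)
  have h0 : ∀ v : Cn n, ∫ z, fderiv ℝ F z v = 0 := fun v => by
    have := integral_bilinear_hasLineDerivAt_right_eq_neg_left_of_integrable
      (μ := (volume : Measure (Cn n))) (f := fun _ : Cn n => (1 : ℂ)) (f' := fun _ => 0)
      (g := F) (g' := fun z => fderiv ℝ F z v) (v := v) (B := ContinuousLinearMap.mul ℝ ℂ)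
      (by simp) (by simpa using hd v) (by simpa using hint)
      (fun x _ => by simpa using (hasFDerivAt_const (1 : ℂ) x).hasLineDerivAt (𝕜 := ℝ) v)
      (fun x _ => ((hF.differentiable (by simp) x).hasFDerivAt.hasLineDerivAt v))
    simpa using this
  simp only [wirt, div_eq_mul_inv]
  rw [integral_mul_const, integral_add (hd _) ((hd _).const_mul _), integral_const_mul, h0, h0]
  simp

end Wirtinger

/-! ### Sub-mean value inequalities and the Levi form -/

section Submean

variable {n : ℕ} {v w : Cn n} {z : Cn n}

theorem Sm.ofReal {F : Cn n → ℝ} (hF : ContDiffAt ℝ ∞ F z) : Sm (fun y => (F y : ℂ)) z :=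
  ofRealCLM.contDiff.contDiffAt.comp z hF

theorem fderiv_ofReal {F : Cn n → ℝ} (hF : DifferentiableAt ℝ F z) (w : Cn n) :
    fderiv ℝ (fun y => (F y : ℂ)) z w = (fderiv ℝ F z w : ℝ) := by
  have h : fderiv ℝ (fun y => (F y : ℂ)) z = _ :=
    (ofRealCLM.hasFDerivAt.comp z hF.hasFDerivAt).fderiv
  rw [h]; rfl

theorem dzb_eq_conj_dz {F : Cn n → ℝ} (hF : DifferentiableAt ℝ F z) :
    dzb v (fun y => (F y : ℂ)) z = conj (dz v (fun y => (F y : ℂ)) z) := by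
  simp [wirt, fderiv_ofReal hF, Complex.conj_ofNat]

theorem dz_dzb_eq {F : Cn n → ℝ} (hF : ContDiffAt ℝ ∞ F z) :
    dz v (dzb v fun y => (F y : ℂ)) z
      = (((fderiv ℝ (fderiv ℝ F) z v v
        + fderiv ℝ (fderiv ℝ F) z (I • v) (I • v)) / 4 : ℝ) : ℂ) := by
  have h1 : DifferentiableAt ℝ (fderiv ℝ F) z :=
    (hF.fderiv_right (m := 1) (by norm_num; norm_cast)).differentiableAt (by simp)
  have hs : IsSymmSndFDerivAt ℝ F z := hF.isSymmSndFDerivAt (by simp; norm_cast)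
  have hev : ∀ᶠ y in nhds z, DifferentiableAt ℝ F y :=
    ((hF.of_le (m := 1) (by exact_mod_cast le_top)).eventually (by simp)).mono
      fun y hy => hy.differentiableAt (by simp)
  have hb : (dzb v fun y => (F y : ℂ)) =ᶠ[nhds z] fun y =>
      ((fderiv ℝ F y v : ℝ) + I * (fderiv ℝ F y (I • v) : ℝ)) * 2⁻¹ := by
    filter_upwards [hev] with y hy
    simp [wirt, fderiv_ofReal hy, div_eq_mul_inv]
  have h2 : ∀ w : Cn n, HasFDerivAt (fun y => fderiv ℝ F y w)
      ((fderiv ℝ (fderiv ℝ F) z).flip w) z := fun w => by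
    have := h1.hasFDerivAt.clm_apply (hasFDerivAt_const w z)
    simpa using this
  have h3 : ∀ w : Cn n, HasFDerivAt (fun y => ((fderiv ℝ F y w : ℝ) : ℂ))
      (ofRealCLM.comp ((fderiv ℝ (fderiv ℝ F) z).flip w)) z := fun w =>
    ofRealCLM.hasFDerivAt.comp z (h2 w)
  have h4 := ((h3 v).add ((h3 (I • v)).const_mul I)).mul_const (2 : ℂ)⁻¹
  have h5 : ∀ y, fderiv ℝ (dzb v fun y => (F y : ℂ)) z y
      = ((fderiv ℝ (fderiv ℝ F) z y v : ℝ)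
        + I * (fderiv ℝ (fderiv ℝ F) z y (I • v) : ℝ)) * 2⁻¹ := fun y => by
    rw [hb.fderiv_eq]
    refine (congrArg (fun l => l y) h4.fderiv).trans ?_
    simp
    ring
  have hs' : fderiv ℝ (fderiv ℝ F) z (I • v) v = fderiv ℝ (fderiv ℝ F) z v (I • v) := hs _ _
  rw [wirt, h5, h5, hs']
  push_cast
  linear_combination (-((fderiv ℝ (fderiv ℝ F) z (I • v) (I • v) : ℝ) : ℂ) / 4)
    * I_sq

theorem taylor_two {F : Cn n → ℝ} (hF : ContDiffAt ℝ ∞ F z) {ε : ℝ} (hε : 0 < ε) :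
    ∃ δ > 0, ∀ y : Cn n, ‖y‖ < δ → |F (z + y) - (F z + fderiv ℝ F z y
      + fderiv ℝ (fderiv ℝ F) z y y / 2)| ≤ ε * ‖y‖ ^ 2 := by
  have h1 : HasFDerivAt (fderiv ℝ F) (fderiv ℝ (fderiv ℝ F) z) z :=
    ((hF.fderiv_right (m := 1) (by norm_num; norm_cast)).differentiableAt (by simp)).hasFDerivAt
  have hs : IsSymmSndFDerivAt ℝ F z := hF.isSymmSndFDerivAt (by simp; norm_cast)
  have hev : ∀ᶠ y in nhds z, DifferentiableAt ℝ F y :=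
    ((hF.of_le (m := 1) (by exact_mod_cast le_top)).eventually (by simp)).mono
      fun y hy => hy.differentiableAt (by simp)
  have h2 := (hasFDerivAt_iff_isLittleO_nhds_zero.1 h1).def hε
  have h3 : ∀ᶠ y in nhds (0 : Cn n), DifferentiableAt ℝ F (z + y) := by
    have : Tendsto (fun y : Cn n => z + y) (nhds 0) (nhds z) := by
      have hc : Continuous fun y : Cn n => z + y := by fun_prop
      simpa using hc.tendsto 0
    exact this.eventually hev
  obtain ⟨δ, hδ, hball⟩ := Metric.eventually_nhds_iff.1 (h2.and h3)
  refine ⟨δ, hδ, fun y hy => ?_⟩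
  set B := fderiv ℝ (fderiv ℝ F) z
  set R : Cn n → ℝ := fun x => F (z + x) - (F z + fderiv ℝ F z x + B x x / 2) with hR
  have hderiv : ∀ x ∈ closedBall (0 : Cn n) ‖y‖, HasFDerivWithinAt R
      (fderiv ℝ F (z + x) - fderiv ℝ F z - B x) (closedBall (0 : Cn n) ‖y‖) x := by
    intro x hx
    have hx' : dist x 0 < δ := lt_of_le_of_lt (by simpa using hx) hy
    have hd := (hball hx').2.hasFDerivAt
    have e1 : HasFDerivAt (fun x => F (z + x)) (fderiv ℝ F (z + x)) x := by
      exact (hd.comp x ((hasFDerivAt_id x).const_add z)).congr_fderiv (by ext w; simp)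
    have e2 : HasFDerivAt (fun x => B x x) (B.flip x + B x) x := by
      have := (B.hasFDerivAt (x := x)).clm_apply (hasFDerivAt_id x)
      simpa [add_comm] using this
    have e3 : B.flip x = B x := by ext w; exact hs _ _
    have e4 := e1.sub (((hasFDerivAt_const (F z) x).add (fderiv ℝ F z).hasFDerivAt).add
      (e2.mul_const (2⁻¹ : ℝ)))
    refine (e4.congr_fderiv ?_).hasFDerivWithinAt.congr_of_eventuallyEq ?_ ?_
    · rw [e3]; ext w; simp; ring
    · exact .of_forall fun x => by simp [hR, div_eq_mul_inv]
    · simp [hR, div_eq_mul_inv]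
  have hbound : ∀ x ∈ closedBall (0 : Cn n) ‖y‖,
      ‖fderiv ℝ F (z + x) - fderiv ℝ F z - B x‖ ≤ ε * ‖y‖ := by
    intro x hx
    have hx' : dist x 0 < δ := lt_of_le_of_lt (by simpa using hx) hy
    refine (hball hx').1.trans ?_
    gcongr
    simpa using hx
  have := (convex_closedBall (0 : Cn n) ‖y‖).norm_image_sub_le_of_norm_hasFDerivWithin_le hderiv
    hbound (x := 0) (y := y) (by simp) (by simp)
  have hR0 : R 0 = 0 := by simp [hR]
  rw [hR0, sub_zero, sub_zero, norm_eq_abs] at this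
  calc _ ≤ _ := this
    _ = _ := by ring

theorem circleAverage_quadratic (c : ℝ) (A : Cn n →L[ℝ] ℝ) (B : Cn n →L[ℝ] Cn n →L[ℝ] ℝ)
    (v : Cn n) :
    circleAverage (fun ζ : ℂ => c + A (ζ • v) + B (ζ • v) (ζ • v) / 2) 0 1
      = c + (B v v + B (I • v) (I • v)) / 4 := by
  have hm : ∀ t : ℝ, circleMap 0 1 t • v = cos t • v + sin t • (I • v) := by
    intro t
    have : circleMap 0 1 t = (cos t : ℂ) + (sin t : ℂ) * I := by simp [circleMap, Complex.exp_mul_I]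
    rw [this, add_smul, mul_smul]
    ext i; simp
  rw [circleAverage_def]
  simp only [hm, map_add, map_smul, _root_.add_apply, _root_.smul_apply, smul_eq_mul]
  set b1 := B v v
  set b2 := B v (I • v)
  set b3 := B (I • v) v
  set b4 := B (I • v) (I • v)
  have : (fun t : ℝ => c + (cos t * A v + sin t * A (I • v))
      + (cos t * (cos t * b1 + sin t * b3)
        + sin t * (cos t * b2 + sin t * b4)) / 2)
      = fun t : ℝ => c + cos t * A v + sin t * A (I • v)
        + cos t ^ 2 * (b1 / 2) + sin t * cos t * ((b2 + b3) / 2)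
        + sin t ^ 2 * (b4 / 2) := by
    funext t; ring
  rw [this]
  have i1 : ∀ f : ℝ → ℝ, Continuous f → IntervalIntegrable f volume 0 (2 * Real.pi) :=
    fun f hf => hf.intervalIntegrable _ _
  rw [intervalIntegral.integral_add (i1 _ (by fun_prop)) (i1 _ (by fun_prop)),
    intervalIntegral.integral_add (i1 _ (by fun_prop)) (i1 _ (by fun_prop)),
    intervalIntegral.integral_add (i1 _ (by fun_prop)) (i1 _ (by fun_prop)),
    intervalIntegral.integral_add (i1 _ (by fun_prop)) (i1 _ (by fun_prop)),
    intervalIntegral.integral_add (i1 _ (by fun_prop)) (i1 _ (by fun_prop))]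
  simp only [intervalIntegral.integral_mul_const, intervalIntegral.integral_const, integral_cos,
    integral_sin, integral_cos_sq, integral_sin_sq, integral_sin_mul_cos₁]
  have hp := Real.pi_ne_zero
  simp
  field_simp
  ring

theorem levi_nonneg_of_submean {F : Cn n → ℝ} (hF : ContDiffAt ℝ ∞ F z)
    (h : ∃ δ > 0, ∀ r : ℝ, 0 < r → r < δ →
      F z ≤ circleAverage (fun ζ : ℂ => F (z + ζ • ((r : ℂ) • v))) 0 1)
    (hcont : ∀ᶠ y in nhds z, ContinuousAt F y) :
    0 ≤ (dz v (dzb v fun y => (F y : ℂ)) z).re := by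
  rw [dz_dzb_eq hF, ofReal_re]
  set A := fderiv ℝ F z
  set B := fderiv ℝ (fderiv ℝ F) z
  obtain ⟨δ₀, hδ₀, h⟩ := h
  obtain ⟨δ₁, hδ₁, hc⟩ := Metric.eventually_nhds_iff.1 hcont
  have key : ∀ ε > 0, 0 ≤ (B v v + B (I • v) (I • v)) / 4 + ε * ‖v‖ ^ 2 := by
    intro ε hε
    obtain ⟨δ₂, hδ₂, ht⟩ := taylor_two hF hε
    obtain ⟨r, hr, hr0, hr1, hr2⟩ : ∃ r : ℝ, 0 < r ∧ r < δ₀ ∧ r * ‖v‖ < δ₁ ∧ r * ‖v‖ < δ₂ := by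
      have hv : 0 < ‖v‖ + 1 := by positivity
      refine ⟨min (δ₀ / 2) (min (δ₁ / (‖v‖ + 1)) (δ₂ / (‖v‖ + 1)) / 2), by positivity, ?_, ?_, ?_⟩
      · exact (min_le_left _ _).trans_lt (by linarith)
      · have : min (δ₀ / 2) (min (δ₁ / (‖v‖ + 1)) (δ₂ / (‖v‖ + 1)) / 2) < δ₁ / (‖v‖ + 1) := by
          have h0 : 0 < δ₁ / (‖v‖ + 1) := by positivity
          refine (min_le_right _ _).trans_lt ?_
          have := min_le_left (δ₁ / (‖v‖ + 1)) (δ₂ / (‖v‖ + 1))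
          linarith
        calc _ ≤ _ * (‖v‖ + 1) := by gcongr; linarith
          _ < δ₁ / (‖v‖ + 1) * (‖v‖ + 1) := by gcongr
          _ = δ₁ := by field_simp
      · have : min (δ₀ / 2) (min (δ₁ / (‖v‖ + 1)) (δ₂ / (‖v‖ + 1)) / 2) < δ₂ / (‖v‖ + 1) := by
          have h0 : 0 < δ₂ / (‖v‖ + 1) := by positivity
          refine (min_le_right _ _).trans_lt ?_
          have := min_le_right (δ₁ / (‖v‖ + 1)) (δ₂ / (‖v‖ + 1))
          linarith
        calc _ ≤ _ * (‖v‖ + 1) := by gcongr; linarith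
          _ < δ₂ / (‖v‖ + 1) * (‖v‖ + 1) := by gcongr
          _ = δ₂ := by field_simp
    have hn : ∀ ζ ∈ sphere (0 : ℂ) |(1 : ℝ)|, ‖ζ • ((r : ℂ) • v)‖ = r * ‖v‖ := by
      intro ζ hζ
      rw [norm_smul, norm_smul]
      have : ‖ζ‖ = 1 := by simpa using hζ
      rw [this, one_mul, norm_real, norm_of_nonneg hr.le]
    have hle : circleAverage (fun ζ : ℂ => F (z + ζ • ((r : ℂ) • v))) 0 1
        ≤ circleAverage (fun ζ : ℂ => (F z + ε * (r * ‖v‖) ^ 2) + A (ζ • ((r : ℂ) • v))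
          + B (ζ • ((r : ℂ) • v)) (ζ • ((r : ℂ) • v)) / 2) 0 1 := by
      refine circleAverage_mono ?_ ?_ ?_
      · refine ContinuousOn.circleIntegrable' fun ζ hζ => ContinuousAt.continuousWithinAt ?_
        have : ContinuousAt F (z + ζ • ((r : ℂ) • v)) := hc (by
          rw [dist_eq_norm, add_sub_cancel_left, hn ζ hζ]; exact hr1)
        exact ContinuousAt.comp (f := fun ζ : ℂ => z + ζ • ((r : ℂ) • v)) this (by fun_prop)
      · refine ContinuousOn.circleIntegrable' (Continuous.continuousOn ?_)
        fun_prop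
      · intro ζ hζ
        have h1 := ht (ζ • ((r : ℂ) • v)) (by rw [hn ζ hζ]; exact hr2)
        rw [hn ζ hζ] at h1
        have := (abs_le.1 h1).2
        linarith
    rw [circleAverage_quadratic] at hle
    have h2 := (h r hr hr0).trans hle
    have hI : I • ((r : ℂ) • v) = r • (I • v) := by ext i; simp; ring
    have hrv : ((r : ℂ) • v) = r • v := by ext i; simp
    rw [hI, hrv] at h2
    simp only [map_smul, _root_.smul_apply, smul_eq_mul] at h2
    have h3 : 0 ≤ r ^ 2 * ((B v v + B (I • v) (I • v)) / 4 + ε * ‖v‖ ^ 2) := by nlinarith [h2]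
    exact (mul_nonneg_iff_of_pos_left (by positivity)).1 h3
  by_contra hneg
  push Not at hneg
  have hv : 0 < ‖v‖ ^ 2 + 1 := by positivity
  set L := (B v v + B (I • v) (I • v)) / 4
  have := key (-L / (2 * (‖v‖ ^ 2 + 1))) (by apply div_pos <;> linarith)
  have h4 : -L / (2 * (‖v‖ ^ 2 + 1)) * ‖v‖ ^ 2 ≤ -L / 2 := by
    rw [div_mul_eq_mul_div, div_le_div_iff₀ (by positivity) (by positivity)]
    nlinarith
  linarith

theorem levi_nonneg_of_isLocalMin {F : Cn n → ℝ} (hF : ContDiffAt ℝ ∞ F z) (h : IsLocalMin F z) :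
    0 ≤ (dz v (dzb v fun y => (F y : ℂ)) z).re := by
  have hcont : ∀ᶠ y in nhds z, ContinuousAt F y :=
    ((hF.of_le (m := 1) (by exact_mod_cast le_top)).eventually (by simp)).mono
      fun y hy => hy.continuousAt
  refine levi_nonneg_of_submean hF ?_ hcont
  obtain ⟨δ, hδ, hd⟩ := Metric.eventually_nhds_iff.1 (h.and hcont)
  refine ⟨δ / (‖v‖ + 1), by positivity, fun r hr hrδ => ?_⟩
  have hrv : r * ‖v‖ < δ := by
    calc r * ‖v‖ ≤ r * (‖v‖ + 1) := by gcongr; linarith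
      _ < δ / (‖v‖ + 1) * (‖v‖ + 1) := by gcongr
      _ = δ := by field_simp
  have hn : ∀ ζ ∈ sphere (0 : ℂ) |(1 : ℝ)|, dist (z + ζ • ((r : ℂ) • v)) z < δ := by
    intro ζ hζ
    have : ‖ζ‖ = 1 := by simpa using hζ
    rw [dist_eq_norm, add_sub_cancel_left, norm_smul, norm_smul, this, one_mul, norm_real,
      norm_of_nonneg hr.le]
    exact hrv
  rw [← Real.circleAverage_const (F z) (0 : ℂ) 1]
  refine circleAverage_mono (by simp) ?_ ?_
  · refine ContinuousOn.circleIntegrable' fun ζ hζ => ContinuousAt.continuousWithinAt ?_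
    exact ContinuousAt.comp (f := fun ζ : ℂ => z + ζ • ((r : ℂ) • v)) (hd (hn ζ hζ)).2 (by fun_prop)
  · intro ζ hζ
    exact (hd (hn ζ hζ)).1

theorem dz_eq_zero_of_isLocalMin {F : Cn n → ℝ} (hF : DifferentiableAt ℝ F z)
    (h : IsLocalMin F z) (e : ℂ) : wirt e v (fun y => (F y : ℂ)) z = 0 := by
  simp [wirt, fderiv_ofReal hF, h.fderiv_eq_zero]

/-! ### Log-plurisubharmonic functions -/

/-- The Levi form inequality that characterizes smooth `u ≥ 0` with `log u` plurisubharmonic. -/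
def LogPshAt (u : Cn n → ℝ) (z : Cn n) : Prop :=
  ∀ (c : ℂ) (v : Cn n), 0 ≤ (dz v (dzb v fun y => (u y : ℂ)) z).re
    + 2 * (conj c * dz v (fun y => (u y : ℂ)) z).re + ‖c‖ ^ 2 * u z

/-- `|eᵃ|² u` satisfies the sub-mean value inequality on closed discs in `Ω`, for all linear
forms `a`. -/
def LogSubmean (u : Cn n → ℝ) (Ω : Set (Cn n)) : Prop :=
  ∀ (a : Cn n →L[ℂ] ℂ) (z w : Cn n), (∀ ζ : ℂ, ‖ζ‖ ≤ 1 → z + ζ • w ∈ Ω) →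
    exp (2 * (a z).re) * u z ≤ circleAverage
      (fun ζ : ℂ => exp (2 * (a (z + ζ • w)).re) * u (z + ζ • w)) 0 1

theorem levi_exp_mul {u : Cn n → ℝ} (hu : ContDiffAt ℝ ∞ u z) (a : Cn n →L[ℂ] ℂ) (v : Cn n) :
    (dz v (dzb v fun y => ((exp (2 * (a y).re) * u y : ℝ) : ℂ)) z).re
      = exp (2 * (a z).re) * ((dz v (dzb v fun y => (u y : ℂ)) z).re
    + 2 * (conj (a v) * dz v (fun y => (u y : ℂ)) z).re + ‖a v‖ ^ 2 * u z) := by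
  set E : Cn n → ℂ := fun y => Complex.exp (a y) with hE
  have hEd : ∀ y, HasFDerivAt E (Complex.exp (a y) • (a : Cn n →L[ℂ] ℂ)) y := fun y =>
    (a.hasFDerivAt).cexp
  have hEdc : ∀ y, DifferentiableAt ℂ E y := fun y => (hEd y).differentiableAt
  have hEr : ∀ y, DifferentiableAt ℝ E y := fun y => (hEdc y).restrictScalars ℝ
  have hEb : ∀ y, DifferentiableAt ℝ (fun y => conj (E y)) y := fun y =>
    Complex.conjCLE.differentiableAt.comp y (hEr y)
  have hU := Sm.ofReal hu
  have hdzE : ∀ y, dz v E y = E y * a v := fun y => by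
    rw [dz_holomorphic (hEdc y), (hEd y).fderiv]; simp [hE]
  have hfun : (fun y => ((exp (2 * (a y).re) * u y : ℝ) : ℂ))
      = fun y => (E y * conj (E y)) * (u y : ℂ) := by
    funext y
    rw [hE, ofReal_mul]
    congr 1
    simp only
    rw [← Complex.exp_conj, ← Complex.exp_add, Complex.add_conj, Complex.ofReal_exp]
  have h1 : ∀ y, DifferentiableAt ℝ (fun y => E y * conj (E y)) y := fun y => (hEr y).mul (hEb y)
  have hb1 : ∀ y, dzb v (fun y => E y * conj (E y)) y = E y * conj (E y) * conj (a v) := fun y => by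
    rw [wirt_mul (hEr y) (hEb y), dzb_holomorphic (hEdc y), dzb_conj (hEr y), hdzE, map_mul]
    ring
  have ha1 : ∀ y, dz v (fun y => E y * conj (E y)) y = E y * conj (E y) * a v := fun y => by
    rw [wirt_mul (hEr y) (hEb y), dz_conj (hEr y), dzb_holomorphic (hEdc y), hdzE]
    simp; ring
  have hb2 : (dzb v fun y => (E y * conj (E y)) * (u y : ℂ)) =ᶠ[nhds z] fun y =>
      (E y * conj (E y)) * (conj (a v) * (u y : ℂ) + dzb v (fun y => (u y : ℂ)) y) := by
    filter_upwards [hU.eventually] with y hy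
    rw [wirt_mul (h1 y) hy, hb1]; ring
  have hDb := (hU.wirt I v).diff
  rw [hfun, wirt_congr hb2, wirt_mul (h1 z) (by exact (hU.diff.const_mul _).add hDb), ha1,
    wirt_add (hU.diff.const_mul _) hDb, wirt_const_mul _ hU.diff,
    dzb_eq_conj_dz (hu.differentiableAt (by simp))]
  have hEE : E z * conj (E z) = (exp (2 * (a z).re) : ℂ) := by
    rw [hE]
    simp only
    rw [← Complex.exp_conj, ← Complex.exp_add, Complex.add_conj, Complex.ofReal_exp]
  rw [hEE]
  set X := dz v (dzb v fun y => (u y : ℂ)) z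
  set D := dz v (fun y => (u y : ℂ)) z
  have : (exp (2 * (a z).re) : ℂ) * a v * (conj (a v) * (u z : ℂ) + conj D)
      + (exp (2 * (a z).re) : ℂ) * (conj (a v) * D + X)
      = (exp (2 * (a z).re) : ℂ) * ((a v * conj (a v)) * (u z : ℂ) + a v * conj D
        + conj (a v) * D + X) := by ring
  rw [this, re_ofReal_mul, mul_conj, normSq_eq_norm_sq]
  congr 1
  simp only [add_re, mul_re, conj_re, Complex.conj_im, ofReal_re, Complex.ofReal_im]
  ring

theorem LogPshAt.of_submean {u : Cn n → ℝ} {Ω : Set (Cn n)} (hΩ : IsOpen Ω) (hz : z ∈ Ω)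
    (hu : ContDiff ℝ ∞ u) (h0 : 0 ≤ u z) (h : LogSubmean u Ω) : LogPshAt u z := by
  intro c v
  by_cases hv : v = 0
  · subst hv
    simp only [dz_zero_vec]
    simp; positivity
  obtain ⟨a, ha⟩ : ∃ a : Cn n →L[ℂ] ℂ, a v = c := by
    obtain ⟨i, hi⟩ : ∃ i, v i ≠ 0 := by
      by_contra hcon
      push Not at hcon
      exact hv (funext hcon)
    exact ⟨(c / v i) • ContinuousLinearMap.proj i, by simp [hi]⟩
  have hF : ContDiff ℝ ∞ fun y => exp (2 * (a y).re) * u y := by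
    have : ContDiff ℝ ∞ fun y => (a y).re := reCLM.contDiff.comp (a.restrictScalars ℝ).contDiff
    exact (Real.contDiff_exp.comp (contDiff_const.mul this)).mul hu
  have key := levi_nonneg_of_submean (v := v) hF.contDiffAt (z := z) ?_
    (.of_forall fun y => hF.continuous.continuousAt)
  · rw [levi_exp_mul hu.contDiffAt, ha] at key
    exact (mul_nonneg_iff_of_pos_left (exp_pos _)).1 key
  · obtain ⟨δ, hδ, hball⟩ := Metric.isOpen_iff.1 hΩ z hz
    refine ⟨δ / (‖v‖ + 1), by positivity, fun r hr hrδ => h a z _ fun ζ hζ => hball ?_⟩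
    rw [mem_ball, dist_eq_norm, add_sub_cancel_left, norm_smul, norm_smul, norm_real,
      norm_of_nonneg hr.le]
    calc ‖ζ‖ * (r * ‖v‖) ≤ 1 * (r * (‖v‖ + 1)) := by gcongr; linarith
      _ = r * (‖v‖ + 1) := one_mul _
      _ < δ / (‖v‖ + 1) * (‖v‖ + 1) := by gcongr
      _ = δ := by field_simp

end Submean

/-! ### Integration by parts -/

section IntegrationByParts

variable {n : ℕ} {e e' : ℂ} {v w : Cn n} {F H θ : Cn n → ℂ} {z : Cn n} {Ω : Set (Cn n)}

/-- Functions that are smooth at every point of `Ω`. -/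
abbrev SmOn (F : Cn n → ℂ) (Ω : Set (Cn n)) : Prop := ∀ z ∈ Ω, Sm F z

/-- Smooth functions on `ℂⁿ` with compact support in `Ω`. -/
structure IsTest (θ : Cn n → ℂ) (Ω : Set (Cn n)) : Prop where
  smooth : ContDiff ℝ ∞ θ
  compact : HasCompactSupport θ
  subset : tsupport θ ⊆ Ω

theorem tsupport_wirt_subset : tsupport (wirt e v θ) ⊆ tsupport θ := by
  refine closure_minimal (fun z hz => ?_) (isClosed_tsupport θ)
  by_contra h
  refine hz ?_
  rw [wirt_congr (notMem_tsupport_iff_eventuallyEq.1 h)]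
  exact wirt_const 0

theorem IsTest.wirt (h : IsTest θ Ω) (e : ℂ) (v : Cn n) : IsTest (wirt e v θ) Ω where
  smooth := contDiff_iff_contDiffAt.2 fun _ => Sm.wirt h.smooth.contDiffAt e v
  compact := h.compact.of_isClosed_subset (isClosed_tsupport _) tsupport_wirt_subset
  subset := tsupport_wirt_subset.trans h.subset

theorem IsTest.mono {Ω' : Set (Cn n)} (h : IsTest θ Ω) (hs : Ω ⊆ Ω') : IsTest θ Ω' :=
  ⟨h.smooth, h.compact, h.subset.trans hs⟩

theorem IsTest.eventually_zero (h : IsTest θ Ω) (hz : z ∉ Ω) : θ =ᶠ[nhds z] fun _ => 0 :=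
  notMem_tsupport_iff_eventuallyEq.1 fun h' => hz (h.subset h')

theorem IsTest.zero_of_notMem (h : IsTest θ Ω) (hz : z ∉ Ω) : θ z = 0 :=
  (h.eventually_zero hz).eq_of_nhds

theorem IsTest.mul (h : IsTest θ Ω) (hF : SmOn F Ω) : IsTest (fun z => F z * θ z) Ω where
  smooth := contDiff_iff_contDiffAt.2 fun z => by
    by_cases hz : z ∈ Ω
    · exact (hF z hz).mul h.smooth.contDiffAt
    · refine (contDiffAt_const (c := (0 : ℂ))).congr_of_eventuallyEq ?_
      filter_upwards [h.eventually_zero hz] with y hy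
      simp [hy]
  compact := h.compact.mul_left
  subset := (tsupport_mul_subset_right).trans h.subset

theorem IsTest.continuous (h : IsTest θ Ω) : Continuous θ := h.smooth.continuous

theorem IsTest.integrable (h : IsTest θ Ω) : Integrable θ :=
  h.continuous.integrable_of_hasCompactSupport h.compact

theorem IsTest.integral_wirt (h : IsTest θ Ω) : ∫ z, BochnerRatio.wirt e v θ z = 0 :=
  integral_wirt_eq_zero (h.smooth.of_le (by exact_mod_cast le_top)) h.compact

theorem integral_mul_wirt (h : IsTest θ Ω) (hF : SmOn F Ω) :
    ∫ z, F z * wirt e v θ z = -∫ z, wirt e v F z * θ z := by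
  have hsum : ∀ z, wirt e v (fun y => F y * θ y) z = wirt e v F z * θ z + F z * wirt e v θ z := by
    intro z
    by_cases hz : z ∈ Ω
    · exact wirt_mul (hF z hz).diff (h.smooth.contDiffAt.differentiableAt (by simp))
    · rw [h.zero_of_notMem hz, (h.wirt e v).zero_of_notMem hz]
      have : (fun y => F y * θ y) =ᶠ[nhds z] fun _ => 0 := by
        filter_upwards [h.eventually_zero hz] with y hy
        simp [hy]
      rw [wirt_congr this]; simp
  have h0 := (h.mul hF).integral_wirt (e := e) (v := v)
  simp_rw [hsum] at h0
  rw [integral_add (h.mul fun z hz => (hF z hz).wirt e v).integrable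
    ((h.wirt e v).mul hF).integrable] at h0
  linear_combination h0

theorem integral_mul_wirt_wirt (h : IsTest θ Ω) (hF : SmOn F Ω) :
    ∫ z, F z * wirt e v (wirt e' w θ) z = ∫ z, wirt e' w (wirt e v F) z * θ z := by
  rw [integral_mul_wirt (h.wirt e' w) hF, integral_mul_wirt h fun z hz => (hF z hz).wirt e v,
    neg_neg]

end IntegrationByParts

section LogPsh

variable {n : ℕ} {v : Cn n} {z : Cn n} {u : Cn n → ℝ}

theorem LogPshAt.form_bound (h : LogPshAt u z) (h0 : 0 ≤ u z) (c : ℂ) (v : Cn n) :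
    ‖dz v (fun y => (u y : ℂ)) z + c * u z‖ ^ 2 ≤ u z * ((dz v (dzb v fun y => (u y : ℂ)) z).re
    + 2 * (conj c * dz v (fun y => (u y : ℂ)) z).re + ‖c‖ ^ 2 * u z) := by
  set L := (dz v (dzb v fun y => (u y : ℂ)) z).re
  set D := dz v (fun y => (u y : ℂ)) z
  have hD : ‖D‖ ^ 2 ≤ u z * L := by
    rcases h0.eq_or_lt with hz | hz
    · have hc : ∀ t : ℝ, 0 ≤ L - 2 * t * ‖D‖ ^ 2 := fun t => by
        have := h (-(t * D)) v
        rw [← hz] at this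
        have e1 : (conj (-((t : ℂ) * D)) * D).re = -(t * ‖D‖ ^ 2) := by
          have : conj (-((t : ℂ) * D)) * D = -((t : ℂ) * (D * conj D)) := by simp; ring
          rw [this, mul_conj, normSq_eq_norm_sq, ← ofReal_mul]
          simp only [neg_re, ofReal_re]
        change 0 ≤ L + 2 * (conj (-((t : ℂ) * D)) * D).re + _ at this
        rw [e1] at this
        linarith
      have hL : 0 ≤ L := by simpa using hc 0
      rw [← hz, zero_mul]
      by_contra hneg
      push Not at hneg
      have := hc ((L + 1) / (2 * ‖D‖ ^ 2))
      have e2 : 2 * ((L + 1) / (2 * ‖D‖ ^ 2)) * ‖D‖ ^ 2 = L + 1 := by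
        have : ‖D‖ ≠ 0 := fun h => by simp [h] at hneg
        field_simp
      rw [e2] at this
      linarith
    · have := h (-(D / u z)) v
      have e1 : (conj (-(D / (u z : ℂ))) * D).re = -(‖D‖ ^ 2 / u z) := by
        have : conj (-(D / (u z : ℂ))) * D = -((D * conj D) / (u z : ℂ)) := by simp; ring
        rw [this, mul_conj, normSq_eq_norm_sq, ← Complex.ofReal_div]
        simp only [neg_re, ofReal_re]
      have e2 : ‖-(D / (u z : ℂ))‖ ^ 2 * u z = ‖D‖ ^ 2 / u z := by
        rw [norm_neg, norm_div, norm_real, norm_of_nonneg h0]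
        field_simp
      change 0 ≤ L + 2 * (conj (-(D / (u z : ℂ))) * D).re + _ at this
      rw [e1, e2] at this
      have h3 : ‖D‖ ^ 2 / u z ≤ L := by linarith
      rw [div_le_iff₀ hz] at h3
      linarith
  have e3 : ‖D + c * u z‖ ^ 2 = ‖D‖ ^ 2 + 2 * u z * (conj c * D).re + ‖c‖ ^ 2 * u z ^ 2 := by
    rw [← normSq_eq_norm_sq, ← normSq_eq_norm_sq, ← normSq_eq_norm_sq, Complex.normSq_add]
    simp [Complex.normSq_apply]
    ring
  rw [e3]
  nlinarith [hD]

theorem LogPshAt.norm_dz_sq_le (h : LogPshAt u z) (h0 : 0 ≤ u z) (v : Cn n) :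
    ‖dz v (fun y => (u y : ℂ)) z‖ ^ 2 ≤ u z * (dz v (dzb v fun y => (u y : ℂ)) z).re := by
  simpa using h.form_bound h0 0 v

theorem levi_sq (hu : ContDiffAt ℝ ∞ u z) (v : Cn n) :
    (dz v (dzb v fun y => ((u y ^ 2 : ℝ) : ℂ)) z).re
      = 2 * u z * (dz v (dzb v fun y => (u y : ℂ)) z).re
        + 2 * ‖dz v (fun y => (u y : ℂ)) z‖ ^ 2 := by
  have hU := Sm.ofReal hu
  have h1 : (dzb v fun y => ((u y ^ 2 : ℝ) : ℂ)) =ᶠ[nhds z]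
      fun y => 2 * ((u y : ℂ) * dzb v (fun y => (u y : ℂ)) y) := by
    filter_upwards [hU.eventually] with y hy
    have : (fun y => ((u y ^ 2 : ℝ) : ℂ)) = fun y => (u y : ℂ) * (u y : ℂ) := by
      funext y; push_cast; ring
    rw [this, wirt_mul hy hy]; ring
  have hb := (hU.wirt I v).diff
  rw [wirt_congr h1, wirt_const_mul _ (hU.diff.fun_mul hb), wirt_mul hU.diff hb,
    dzb_eq_conj_dz (hu.differentiableAt (by simp)), mul_conj, normSq_eq_norm_sq,
    mul_re, add_re, re_ofReal_mul, ofReal_re]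
  simp
  ring

theorem caccioppoli {Ω : Set (Cn n)} (hu : ContDiff ℝ ∞ u) (hlp : ∀ z ∈ Ω, LogPshAt u z)
    {C : ℝ} (h0 : ∀ z, 0 ≤ u z) (hC : ∀ z, u z ≤ C) {θ : Cn n → ℝ}
    (hθ : IsTest (fun z => (θ z : ℂ)) Ω) (hθ0 : ∀ z, 0 ≤ θ z) (v : Cn n) :
    ∫ z, θ z * ‖dz v (fun y => (u y : ℂ)) z‖ ^ 2
      ≤ C ^ 2 * ∫ z, ‖dz v (dzb v fun z => (θ z : ℂ)) z‖ := by
  have hu2 : ContDiff ℝ ∞ fun z => u z ^ 2 := hu.pow 2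
  have hS : SmOn (fun z => ((u z ^ 2 : ℝ) : ℂ)) Ω := fun z _ => Sm.ofReal hu2.contDiffAt
  have hSu : SmOn (fun z => (u z : ℂ)) Ω := fun z _ => Sm.ofReal hu.contDiffAt
  have hibp := integral_mul_wirt_wirt (e := -I) (e' := I) (v := v) (w := v) hθ hS
  have hcomm : ∀ z, dzb v (dz v fun z => ((u z ^ 2 : ℝ) : ℂ)) z * (θ z : ℂ)
      = dz v (dzb v fun z => ((u z ^ 2 : ℝ) : ℂ)) z * (θ z : ℂ) := fun z => by
    rw [wirt_comm (Sm.ofReal hu2.contDiffAt)]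
  simp_rw [hcomm] at hibp
  have hint : Integrable fun z => dz v (dzb v fun z => ((u z ^ 2 : ℝ) : ℂ)) z * (θ z : ℂ) :=
    (hθ.mul fun z hz => ((hS z hz).wirt _ v).wirt _ v).integrable
  have hre := congrArg Complex.re hibp
  have e2 : (∫ z, dz v (dzb v fun z => ((u z ^ 2 : ℝ) : ℂ)) z * (θ z : ℂ)).re
      = ∫ z, (dz v (dzb v fun z => ((u z ^ 2 : ℝ) : ℂ)) z).re * θ z := by
    rw [← RCLike.re_eq_complex_re, ← integral_re hint]
    simp
  rw [e2] at hre
  have hN : IsTest (fun z => ((‖dz v (fun y => (u y : ℂ)) z‖ ^ 2 : ℝ) : ℂ) * (θ z : ℂ)) Ω := by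
    refine hθ.mul fun z hz => ?_
    have h1 := (hSu z hz).wirt (-I) v
    have : (fun z => ((‖dz v (fun y => (u y : ℂ)) z‖ ^ 2 : ℝ) : ℂ))
        = fun z => dz v (fun y => (u y : ℂ)) z * conj (dz v (fun y => (u y : ℂ)) z) := by
      funext z; rw [mul_conj, normSq_eq_norm_sq]
    rw [this]
    exact h1.mul h1.conj
  have hNint : Integrable fun z => θ z * ‖dz v (fun y => (u y : ℂ)) z‖ ^ 2 := by
    have := hN.integrable.re
    refine this.congr (.of_forall fun z => ?_)
    simp only [RCLike.re_eq_complex_re]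
    rw [re_ofReal_mul, ofReal_re]; ring
  have hreint : Integrable fun z => (dz v (dzb v fun z => ((u z ^ 2 : ℝ) : ℂ)) z).re * θ z := by
    refine hint.re.congr (.of_forall fun z => ?_)
    simp
  have hθint : Integrable fun z => ‖dz v (dzb v fun z => (θ z : ℂ)) z‖ :=
    ((hθ.wirt _ v).wirt _ v).integrable.norm
  calc ∫ z, θ z * ‖dz v (fun y => (u y : ℂ)) z‖ ^ 2
      ≤ ∫ z, (dz v (dzb v fun z => ((u z ^ 2 : ℝ) : ℂ)) z).re * θ z := by
        refine integral_mono hNint hreint fun z => ?_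
        by_cases hz : z ∈ Ω
        · have h1 := (hlp z hz).norm_dz_sq_le (h0 z) v
          have h2 := levi_sq (hu.contDiffAt (x := z)) v
          simp only [h2]
          nlinarith [hθ0 z, sq_nonneg ‖dz v (fun y => (u y : ℂ)) z‖]
        · have : θ z = 0 := by simpa using hθ.zero_of_notMem hz
          simp [this]
    _ = (∫ z, ((u z ^ 2 : ℝ) : ℂ) * dz v (dzb v fun z => (θ z : ℂ)) z).re := hre.symm
    _ ≤ ‖∫ z, ((u z ^ 2 : ℝ) : ℂ) * dz v (dzb v fun z => (θ z : ℂ)) z‖ := Complex.re_le_norm _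
    _ ≤ ∫ z, C ^ 2 * ‖dz v (dzb v fun z => (θ z : ℂ)) z‖ := by
        refine norm_integral_le_of_norm_le (hθint.const_mul _) (.of_forall fun z => ?_)
        rw [norm_mul, norm_real, norm_of_nonneg (sq_nonneg _)]
        have := h0 z
        have := hC z
        gcongr
    _ = _ := integral_const_mul _ _

end LogPsh

/-! ### Mollification -/

section Mollification

variable {n : ℕ} {u : Cn n → ℝ} {C : ℝ} {Ω Ω' : Set (Cn n)}

/-- The mollification of `u` by a normed bump function. -/
def moll (φ : ContDiffBump (0 : Cn n)) (u : Cn n → ℝ) : Cn n → ℝ :=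
  convolution (φ.normed volume) u (ContinuousLinearMap.lsmul ℝ ℝ) volume

theorem moll_apply (φ : ContDiffBump (0 : Cn n)) (z : Cn n) :
    moll φ u z = ∫ t, φ.normed volume t * u (z - t) := by
  simp [moll, convolution]

theorem integrable_of_bound (hu : Measurable u) (h0 : ∀ z, 0 ≤ u z) (hC : ∀ z, u z ≤ C) :
    LocallyIntegrable u := by
  refine (locallyIntegrable_const C).mono hu.aestronglyMeasurable ?_
  refine .of_forall fun z => ?_
  rw [norm_of_nonneg (h0 z)]
  exact (hC z).trans (le_abs_self _)

theorem contDiff_moll (φ : ContDiffBump (0 : Cn n)) (hu : LocallyIntegrable u) :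
    ContDiff ℝ ∞ (moll φ u) :=
  φ.hasCompactSupport_normed.contDiff_convolution_left _ (n := ⊤) φ.contDiff_normed hu

theorem moll_nonneg (φ : ContDiffBump (0 : Cn n)) (h0 : ∀ z, 0 ≤ u z) (z : Cn n) :
    0 ≤ moll φ u z := by
  rw [moll_apply]
  exact integral_nonneg fun t => mul_nonneg (φ.nonneg_normed t) (h0 _)

theorem integrable_normed_mul (φ : ContDiffBump (0 : Cn n)) {f : Cn n → ℝ} (hf : Measurable f)
    (hC : ∀ z, |f z| ≤ C) : Integrable fun t => φ.normed volume t * f t :=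
  φ.integrable_normed.mul_bdd hf.aestronglyMeasurable (.of_forall fun z => hC z)

theorem moll_le (φ : ContDiffBump (0 : Cn n)) (hu : Measurable u) (h0 : ∀ z, 0 ≤ u z)
    (hC : ∀ z, u z ≤ C) (z : Cn n) : moll φ u z ≤ C := by
  rw [moll_apply]
  calc ∫ t, φ.normed volume t * u (z - t) ≤ ∫ t, φ.normed volume t * C := by
        refine integral_mono (integrable_normed_mul φ (C := C) (by fun_prop) fun t => ?_)
          (φ.integrable_normed.mul_const C) fun t => ?_
        · rw [abs_of_nonneg (h0 _)]; exact hC _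
        · exact mul_le_mul_of_nonneg_left (hC _) (φ.nonneg_normed t)
    _ = C := by rw [integral_mul_const, φ.integral_normed, one_mul]

theorem LogSubmean.moll (h : LogSubmean u Ω) (φ : ContDiffBump (0 : Cn n)) (hu : Measurable u)
    (h0 : ∀ z, 0 ≤ u z) (hC : ∀ z, u z ≤ C)
    (hsub : ∀ z ∈ Ω', ∀ t ∈ ball (0 : Cn n) φ.rOut, z - t ∈ Ω) :
    LogSubmean (moll φ u) Ω' := by
  intro a z w hdisc
  set E : Cn n → ℝ := fun y => exp (2 * (a y).re) with hE
  have hEc : Continuous E := by fun_prop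
  set c : ℝ → Cn n := fun θ => z + circleMap 0 1 θ • w with hc
  have hcc : Continuous c := by fun_prop
  have hC0 : 0 ≤ C := (h0 0).trans (hC 0)
  obtain ⟨K, hK⟩ : ∃ K, ∀ θ ∈ Set.Icc 0 (2 * Real.pi), E (c θ) ≤ K := by
    obtain ⟨K, hK⟩ := (isCompact_Icc (a := (0 : ℝ)) (b := 2 * Real.pi)).exists_bound_of_continuousOn
      ((hEc.comp hcc).continuousOn)
    exact ⟨K, fun θ hθ => (le_abs_self _).trans (hK θ hθ)⟩
  set f : Cn n → ℝ → ℝ := fun t θ => φ.normed volume t * (E (c θ) * u (c θ - t)) with hf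
  have hint : Integrable (Function.uncurry f)
      ((volume : Measure (Cn n)).prod (volume.restrict (Set.Ioc 0 (2 * Real.pi)))) := by
    have h1 : Integrable (fun q : Cn n × ℝ => φ.normed volume q.1 * (1 : ℝ))
        ((volume : Measure (Cn n)).prod (volume.restrict (Set.Ioc 0 (2 * Real.pi)))) :=
      Integrable.mul_prod φ.integrable_normed (integrable_const (1 : ℝ))
    simp only [mul_one] at h1
    refine h1.mul_bdd (c := K * C) (g := fun q : Cn n × ℝ => E (c q.2) * u (c q.2 - q.1)) ?_ ?_
    · refine Measurable.aestronglyMeasurable ?_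
      exact ((hEc.comp hcc).measurable.comp measurable_snd).mul
        (hu.comp ((hcc.measurable.comp measurable_snd).sub measurable_fst))
    · have : ∀ᵐ q : Cn n × ℝ ∂((volume : Measure (Cn n)).prod
          (volume.restrict (Set.Ioc 0 (2 * Real.pi)))), q.2 ∈ Set.Ioc 0 (2 * Real.pi) := by
        have h2 : ∀ᵐ θ ∂(volume.restrict (Set.Ioc 0 (2 * Real.pi))), θ ∈ Set.Ioc 0 (2 * Real.pi) :=
          ae_restrict_mem measurableSet_Ioc
        exact Measure.quasiMeasurePreserving_snd.ae h2
      filter_upwards [this] with q hq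
      rw [norm_eq_abs, abs_of_nonneg (mul_nonneg (exp_pos _).le (h0 _))]
      have h3 := hK q.2 ⟨hq.1.le, hq.2⟩
      have h4 := hC (c q.2 - q.1)
      have h5 : 0 ≤ E (c q.2) := (exp_pos _).le
      have h6 := h0 (c q.2 - q.1)
      exact mul_le_mul h3 h4 h6 (h5.trans h3)
  have hR : circleAverage (fun ζ : ℂ => exp (2 * (a (z + ζ • w)).re)
      * BochnerRatio.moll φ u (z + ζ • w)) 0 1
      = ∫ t, (2 * Real.pi)⁻¹ * ∫ θ in Set.Ioc 0 (2 * Real.pi), f t θ := by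
    rw [circleAverage_def, intervalIntegral.integral_of_le Real.two_pi_pos.le,
      integral_const_mul, integral_integral_swap hint, smul_eq_mul]
    congr 1
    refine setIntegral_congr_fun measurableSet_Ioc fun θ _ => ?_
    simp only [moll_apply, hf]
    rw [← integral_const_mul]
    refine integral_congr_ae (.of_forall fun t => ?_)
    simp only [hE, hc]
    ring
  rw [hR, moll_apply, ← integral_const_mul]
  refine integral_mono ?_ (hint.integral_prod_left.const_mul _) fun t => ?_
  · refine Integrable.const_mul (integrable_normed_mul φ (C := C) (by fun_prop) fun t => ?_) _
    rw [abs_of_nonneg (h0 _)]; exact hC _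
  simp only
  by_cases ht : t ∈ ball (0 : Cn n) φ.rOut
  · have h1 := h a (z - t) w fun ζ hζ => by
      have := hsub _ (hdisc ζ hζ) t ht
      rwa [show z - t + ζ • w = z + ζ • w - t by abel]
    rw [circleAverage_def, intervalIntegral.integral_of_le Real.two_pi_pos.le, smul_eq_mul] at h1
    have h2 : ∫ θ in Set.Ioc 0 (2 * Real.pi), f t θ = φ.normed volume t * (E t *
        ∫ θ in Set.Ioc 0 (2 * Real.pi), exp (2 * (a (z - t + circleMap 0 1 θ • w)).re)
          * u (z - t + circleMap 0 1 θ • w)) := by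
      rw [← integral_const_mul, ← integral_const_mul]
      refine setIntegral_congr_fun measurableSet_Ioc fun θ _ => ?_
      simp only [hf, hE, hc]
      have e1 : z - t + circleMap 0 1 θ • w = z + circleMap 0 1 θ • w - t := by abel
      rw [e1, ← mul_assoc (exp (2 * (a t).re)), ← exp_add]
      congr 4
      simp only [map_sub, sub_re]; ring
    rw [h2]
    have h3 : E t * (exp (2 * (a (z - t)).re) * u (z - t)) = exp (2 * (a z).re) * u (z - t) := by
      rw [← mul_assoc, hE, ← exp_add]
      congr 2
      simp only [map_sub, sub_re]; ring
    have h4 := mul_le_mul_of_nonneg_left (mul_le_mul_of_nonneg_left h1 (exp_pos (2 * (a t).re)).le)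
      (φ.nonneg_normed (μ := volume) t)
    change φ.normed volume t * (E t * (exp (2 * (a (z - t)).re) * u (z - t))) ≤ _ at h4
    rw [h3] at h4
    calc _ = φ.normed volume t * (exp (2 * (a z).re) * u (z - t)) := by ring
      _ ≤ _ := h4
      _ = _ := by simp only [hE]; ring
  · have : φ.normed volume t = 0 := by
      by_contra hne
      exact ht (φ.support_normed_eq (μ := volume) ▸ hne)
    simp [hf, this]

/-- The bump functions of radius tending to zero that are used for mollification. -/
def bump (n : ℕ) {r : ℝ} (hr : 0 < r) (m : ℕ) : ContDiffBump (0 : Cn n) where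
  rIn := r / (2 * (m + 2))
  rOut := r / (m + 2)
  rIn_pos := by positivity
  rIn_lt_rOut := by
    have : (0 : ℝ) < m + 2 := by positivity
    exact div_lt_div_of_pos_left hr this (by linarith)

theorem bump_rOut_lt {r : ℝ} (hr : 0 < r) (m : ℕ) : (bump n hr m).rOut < r := by
  have : (1 : ℝ) < m + 2 := by have : (0 : ℝ) ≤ m := by positivity
                               linarith
  exact div_lt_self hr this

theorem ae_tendsto_moll {E : Type*} [NormedAddCommGroup E] [NormedSpace ℝ E] [CompleteSpace E]
    {g : Cn n → E} {r : ℝ} (hr : 0 < r) (hg : LocallyIntegrable g) :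
    ∀ᵐ z, Tendsto (fun m => convolution ((bump n hr m).normed volume) g
      (ContinuousLinearMap.lsmul ℝ ℝ) volume z) atTop (nhds (g z)) := by
  refine ContDiffBump.ae_convolution_tendsto_right_of_locallyIntegrable (K := 2) ?_ ?_ hg
  · have h1 : Tendsto (fun m : ℕ => (m : ℝ) + 2) atTop atTop :=
      tendsto_atTop_add_const_right _ _ tendsto_natCast_atTop_atTop
    exact h1.const_div_atTop r
  · refine .of_forall fun m => le_of_eq ?_
    simp only [bump]
    field_simp

theorem wirt_moll {Gu : Cn n → ℂ} {e : ℂ} {v : Cn n} (φ : ContDiffBump (0 : Cn n))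
    (hu : LocallyIntegrable u) {z : Cn n} {U : Set (Cn n)}
    (hU : ∀ t ∈ closedBall (0 : Cn n) φ.rOut, z - t ∈ U)
    (hG : ∀ θ : Cn n → ℂ, IsTest θ U → ∫ y, (u y : ℂ) * wirt e v θ y = -∫ y, Gu y * θ y) :
    wirt e v (fun y => (moll φ u y : ℂ)) z
      = convolution (φ.normed volume) Gu (ContinuousLinearMap.lsmul ℝ ℝ) volume z := by
  have hρ : ContDiff ℝ ∞ (φ.normed volume) := φ.contDiff_normed (n := ⊤)
  have hd := φ.hasCompactSupport_normed.hasFDerivAt_convolution_left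
    (ContinuousLinearMap.lsmul ℝ ℝ) (hρ.of_le (by exact_mod_cast le_top)) hu z
  have hcs := φ.hasCompactSupport_normed (μ := (volume : Measure (Cn n)))
  have hfd : ∀ v, fderiv ℝ (moll φ u) z v = ∫ t, fderiv ℝ (φ.normed volume) (z - t) v * u t := by
    intro v
    rw [show fderiv ℝ (moll φ u) z = _ from hd.fderiv, convolution_eq_swap]
    rw [ContinuousLinearMap.integral_apply]
    · simp [ContinuousLinearMap.precompL_apply]
    · have hce := HasCompactSupport.convolutionExists_left
        (ContinuousLinearMap.precompL (Cn n) (ContinuousLinearMap.lsmul ℝ ℝ))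
        (hcs.fderiv (𝕜 := ℝ)) (hρ.continuous_fderiv (by simp)) hu (μ := volume) z
      simpa using hce.integrable_swap
  have hθ : IsTest (fun y => ((φ.normed volume (z - y) : ℝ) : ℂ)) U := by
    have hts : ∀ y, y ∈ tsupport (fun y => ((φ.normed volume (z - y) : ℝ) : ℂ)) →
        z - y ∈ closedBall (0 : Cn n) φ.rOut := by
      intro y hy
      rw [← φ.tsupport_normed_eq (μ := volume)]
      have hsub : tsupport (fun y => ((φ.normed volume (z - y) : ℝ) : ℂ))
          ⊆ (fun y => z - y) ⁻¹' tsupport (φ.normed volume) := by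
        refine closure_minimal (fun y hy => subset_tsupport _ ?_)
          ((isClosed_tsupport _).preimage (by fun_prop))
        intro h0
        exact hy (by simp [h0])
      exact hsub hy
    refine ⟨?_, ?_, fun y hy => ?_⟩
    · exact ofRealCLM.contDiff.comp (hρ.comp (contDiff_const.sub contDiff_id))
    · refine HasCompactSupport.intro (isCompact_closedBall z φ.rOut) fun y hy => ?_
      by_contra hne
      have := hts y (subset_tsupport _ hne)
      exact hy (by simpa [dist_eq_norm, norm_sub_rev] using this)
    · have := hU _ (hts y hy)
      simpa using this
  have hwθ : ∀ y, wirt e v (fun y => ((φ.normed volume (z - y) : ℝ) : ℂ)) y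
      = -((fderiv ℝ (φ.normed volume) (z - y) v : ℝ)
        + e * (fderiv ℝ (φ.normed volume) (z - y) (I • v) : ℝ)) / 2 := by
    intro y
    have hdy : HasFDerivAt (fun y => φ.normed volume (z - y))
        ((fderiv ℝ (φ.normed volume) (z - y)).comp (-ContinuousLinearMap.id ℝ (Cn n))) y :=
      ((hρ.differentiable (by simp) (z - y)).hasFDerivAt).comp y
        ((hasFDerivAt_id y).const_sub z)
    rw [wirt, fderiv_ofReal hdy.differentiableAt, fderiv_ofReal hdy.differentiableAt, hdy.fderiv]
    simp
    ring
  have hsm := contDiff_moll φ hu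
  rw [wirt, fderiv_ofReal (hsm.differentiable (by simp) z),
    fderiv_ofReal (hsm.differentiable (by simp) z), hfd, hfd, convolution_eq_swap]
  have hg := hG _ hθ
  have hint : ∀ v, Integrable fun t => fderiv ℝ (φ.normed volume) (z - t) v * u t := fun v => by
    have hce := HasCompactSupport.convolutionExists_left
        (ContinuousLinearMap.lsmul ℝ ℝ)
        (hcs.fderiv_apply (𝕜 := ℝ) v)
        ((hρ.continuous_fderiv (by simp)).clm_apply continuous_const) hu (μ := volume) z
    simpa using hce.integrable_swap
  have hintc : ∀ v, Integrable fun t => ((fderiv ℝ (φ.normed volume) (z - t) v * u t : ℝ) : ℂ) :=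
    fun v => (hint v).ofReal
  have h2 : ∫ t, ((ContinuousLinearMap.lsmul ℝ ℝ) (φ.normed volume (z - t))) (Gu t)
      = ∫ y, Gu y * ((φ.normed volume (z - y) : ℝ) : ℂ) := by
    refine integral_congr_ae (.of_forall fun t => ?_)
    simp [mul_comm]
  rw [h2, ← neg_eq_iff_eq_neg.2 hg, ← integral_complex_ofReal, ← integral_complex_ofReal, ← integral_const_mul,
    ← integral_add (hintc v) ((hintc _).const_mul e), ← integral_div, ← integral_neg]
  refine integral_congr_ae (.of_forall fun t => ?_)
  simp only [hwθ]
  push_cast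
  ring

end Mollification

/-! ### Regularization of log-plurisubharmonic functions -/

section Regularization

theorem exists_weak_limit {α : Type*} [MeasurableSpace α] (μ : Measure α) {f : ℕ → α → ℂ}
    (hf : ∀ m, MemLp (f m) 2 μ) {C : ℝ} (hC : ∀ m, ∫ x, ‖f m x‖ ^ 2 ∂μ ≤ C) :
    ∃ g : α → ℂ, MemLp g 2 μ ∧ ∀ h : α → ℂ, MemLp h 2 μ → ∀ L : ℂ,
      Tendsto (fun m => ∫ x, f m x * h x ∂μ) atTop (nhds L) →
        ∫ x, g x * h x ∂μ = L := by
  let T : ℕ → WeakDual ℂ (Lp ℂ 2 μ) := fun m =>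
    StrongDual.toWeakDual (InnerProductSpace.toDual ℂ (Lp ℂ 2 μ) ((hf m).toLp (f m)))
  have hball : ∀ m, T m ∈ WeakDual.toStrongDual ⁻¹'
      closedBall (0 : StrongDual ℂ (Lp ℂ 2 μ)) (Real.sqrt C) := by
    intro m
    have h1 : ‖(hf m).toLp (f m)‖ ^ 2 = ∫ x, ‖f m x‖ ^ 2 ∂μ := by
      rw [@norm_sq_eq_re_inner ℂ, L2.inner_def, ← integral_re (L2.integrable_inner _ _)]
      refine integral_congr_ae ?_
      filter_upwards [(hf m).coeFn_toLp] with x hx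
      rw [hx, inner_self_eq_norm_sq]
    have h2 : ‖(hf m).toLp (f m)‖ ≤ Real.sqrt C := by
      apply Real.le_sqrt_of_sq_le
      rw [h1]; exact hC m
    simpa [T] using h2
  obtain ⟨S, -, hS⟩ := (WeakDual.isCompact_closedBall (0 : StrongDual ℂ (Lp ℂ 2 μ))
    (Real.sqrt C)).ultrafilter_le_nhds ((Filter.hyperfilter ℕ).map T) (by
      rw [le_principal_iff]
      exact Eventually.of_forall (f := (Filter.hyperfilter ℕ : Filter ℕ)) hball)
  set g := (InnerProductSpace.toDual ℂ (Lp ℂ 2 μ)).symm (WeakDual.toStrongDual S) with hg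
  refine ⟨g, Lp.memLp g, fun h hh L hL => ?_⟩
  have hhc : MemLp (fun x => conj (h x)) 2 μ := hh.star
  have h1 : Tendsto (fun m => T m (hhc.toLp _)) (Filter.hyperfilter ℕ)
      (nhds (S (hhc.toLp _))) := ((WeakDual.eval_continuous (hhc.toLp _)).tendsto S).comp hS
  have hin : ∀ (k : α → ℂ) (hk : MemLp k 2 μ), inner ℂ (hk.toLp k) (hhc.toLp _)
      = conj (∫ x, k x * h x ∂μ) := by
    intro k hk
    rw [L2.inner_def, ← integral_conj]
    refine integral_congr_ae ?_
    filter_upwards [hk.coeFn_toLp, hhc.coeFn_toLp] with x hx hx'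
    rw [hx, hx']
    simp [mul_comm]
  have h2 : ∀ m, T m (hhc.toLp _) = conj (∫ x, f m x * h x ∂μ) := fun m => by
    rw [← hin (f m) (hf m)]; rfl
  have h3 : S (hhc.toLp _) = conj (∫ x, g x * h x ∂μ) := by
    have h4 : S (hhc.toLp _) = inner ℂ g (hhc.toLp _) := by
      rw [hg, InnerProductSpace.toDual_symm_apply]; rfl
    rw [h4, ← hin g (Lp.memLp g), Lp.toLp_coeFn]
  simp_rw [h2, h3] at h1
  have h5 := (hL.mono_left Nat.hyperfilter_le_atTop).star
  have h6 := tendsto_nhds_unique h1 h5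
  exact (starRingEnd ℂ).injective h6

variable {n : ℕ}

theorem tendsto_integral_mul {𝕜 : Type*} [RCLike 𝕜] {a : ℕ → Cn n → 𝕜} {b f : Cn n → 𝕜} {B : ℝ}
    (hf : Integrable f) (ha : ∀ m, Continuous (a m)) (hB : ∀ m z, ‖a m z‖ ≤ B)
    (hlim : ∀ᵐ z, Tendsto (fun m => a m z) atTop (nhds (b z))) :
    Tendsto (fun m => ∫ z, a m z * f z) atTop (nhds (∫ z, b z * f z)) := by
  refine tendsto_integral_of_dominated_convergence (fun z => B * ‖f z‖)
    (fun m => (ha m).aestronglyMeasurable.mul hf.aestronglyMeasurable) (hf.norm.const_mul B)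
    (fun m => .of_forall fun z => ?_) (hlim.mono fun z hz => hz.mul_const _)
  rw [norm_mul]
  exact mul_le_mul_of_nonneg_right (hB m z) (norm_nonneg _)

theorem exists_cutoff {z₀ : Cn n} {r : ℝ} {S : Set (Cn n)} (hr : 0 < r) (hS : IsCompact S) (hs : S ⊆ ball z₀ r) :
    ∃ χ : Cn n → ℝ, IsTest (fun x => (χ x : ℂ)) (ball z₀ r) ∧ (∀ x, 0 ≤ χ x) ∧
      ∀ x ∈ S, χ x = 1 := by
  obtain ⟨r', ⟨hr0, hr'⟩, hsub⟩ := exists_pos_lt_subset_ball hr hS.isClosed hs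
  let φ : ContDiffBump z₀ := ⟨r', (r' + r) / 2, hr0, by linarith⟩
  refine ⟨φ, ⟨ofRealCLM.contDiff.comp φ.contDiff,
    φ.hasCompactSupport.comp_left (g := Complex.ofReal) rfl, ?_⟩, fun x => φ.nonneg, fun x hx => ?_⟩
  · have h1 : tsupport (fun x => (φ x : ℂ)) ⊆ tsupport φ :=
      closure_mono fun x hx h0 => hx (by simp [h0])
    refine h1.trans ?_
    rw [φ.tsupport_eq]
    exact closedBall_subset_ball (by change (r' + r) / 2 < r; linarith)
  · exact φ.one_of_mem_closedBall (ball_subset_closedBall (hsub hx))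

theorem continuous_wd_ofReal {f : Cn n → ℝ} (hf : ContDiff ℝ ∞ f) (i : Fin n) :
    Continuous (wd i fun y => (f y : ℂ)) := continuous_iff_continuousAt.2 fun z => by
  rw [show (wd i fun y => (f y : ℂ)) = dz (Pi.single i 1) fun y => (f y : ℂ) from
    funext fun y => wd_eq_dz i _ y]
  exact ((Sm.ofReal hf.contDiffAt).wirt _ _).continuousAt

theorem memLp_wd_ofReal {f : Cn n → ℝ} (hf : ContDiff ℝ ∞ f) (i : Fin n) (z₀ : Cn n) (r : ℝ) :
    MemLp (wd i fun y => (f y : ℂ)) 2 (volume.restrict (ball z₀ r)) := by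
  have hc := continuous_wd_ofReal hf i
  obtain ⟨A, hA⟩ := (isCompact_closedBall z₀ r).exists_bound_of_continuousOn hc.continuousOn
  have : IsFiniteMeasure ((volume : Measure (Cn n)).restrict (ball z₀ r)) :=
    isFiniteMeasure_restrict.2 Metric.isBounded_ball.measure_lt_top.ne
  refine .of_bound hc.aestronglyMeasurable A ?_
  filter_upwards [ae_restrict_mem isOpen_ball.measurableSet] with z hz using
    hA z (ball_subset_closedBall hz)

/-- `U m` are smooth log-plurisubharmonic functions near the ball `B(z₀, r)` that converge to `u`,
and whose derivatives converge to the weak derivative `G` of `u`. -/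
structure IsRegularization (u : Cn n → ℝ) (U : ℕ → Cn n → ℝ) (G : Fin n → Cn n → ℂ) (z₀ : Cn n)
    (r C K : ℝ) : Prop where
  smooth : ∀ m, ContDiff ℝ ∞ (U m)
  nonneg : ∀ m z, 0 ≤ U m z
  le : ∀ m z, U m z ≤ C
  logPsh : ∀ m, ∀ z ∈ ball z₀ r, LogPshAt (U m) z
  tendsto : ∀ᵐ z, Tendsto (fun m => U m z) atTop (nhds (u z))
  memLp : ∀ i, MemLp (G i) 2
  tendsto_wd : ∀ i, ∀ᵐ z ∂(volume.restrict (ball z₀ r)),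
    Tendsto (fun m => wd i (fun y => (U m y : ℂ)) z) atTop (nhds (G i z))
  bound : ∀ i m, ∫ z in ball z₀ r, ‖wd i (fun y => (U m y : ℂ)) z‖ ^ 2 ≤ K

theorem exists_regularization {u : Cn n → ℝ} {z₀ : Cn n} {r C : ℝ} (hr : 0 < r)
    (hu : Measurable u) (h0 : ∀ z, 0 ≤ u z) (hC : ∀ z, u z ≤ C)
    (hlog : LogSubmean u (ball z₀ (4 * r))) :
    ∃ U G K, IsRegularization u U G z₀ r C K := by
  have hloc := integrable_of_bound hu h0 hC
  set U : ℕ → Cn n → ℝ := fun m => moll (bump n hr m) u with hU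
  have hsm : ∀ m, ContDiff ℝ ∞ (U m) := fun m => contDiff_moll _ hloc
  have hU0 : ∀ m z, 0 ≤ U m z := fun m z => moll_nonneg _ h0 z
  have hUC : ∀ m z, U m z ≤ C := fun m z => moll_le _ hu h0 hC z
  have hlp : ∀ m, ∀ z ∈ ball z₀ (3 * r), LogPshAt (U m) z := by
    intro m z hz
    refine LogPshAt.of_submean isOpen_ball hz (hsm m) (hU0 m z)
      (hlog.moll _ hu h0 hC fun y hy t ht => ?_)
    have h1 := bump_rOut_lt (n := n) hr m
    rw [mem_ball] at hy ht ⊢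
    rw [dist_eq_norm] at hy ⊢
    rw [dist_zero_right] at ht
    calc ‖y - t - z₀‖ = ‖(y - z₀) - t‖ := by congr 1; abel
      _ ≤ ‖y - z₀‖ + ‖t‖ := norm_sub_le _ _
      _ < 4 * r := by linarith
  have htend : ∀ᵐ z, Tendsto (fun m => U m z) atTop (nhds (u z)) := ae_tendsto_moll hr hloc
  -- the bound for the derivatives
  obtain ⟨b, hb, hb0, hb1⟩ := exists_cutoff (r := 3 * r) (by positivity)
    (isCompact_closedBall z₀ (2 * r)) (closedBall_subset_ball (by linarith))
  have hbc : HasCompactSupport b := hb.compact.comp_left (g := Complex.re) rfl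
  set K : ℝ := ∑ i : Fin n, C ^ 2 *
    ∫ z, ‖dz (Pi.single i 1) (dzb (Pi.single i 1) fun z => (b z : ℂ)) z‖ with hK
  have hbound : ∀ i m, ∫ z in ball z₀ (2 * r), ‖wd i (fun y => (U m y : ℂ)) z‖ ^ 2 ≤ K := by
    intro i m
    have h1 := caccioppoli (hsm m) (hlp m) (hU0 m) (hUC m) hb hb0 (Pi.single i 1)
    have h2 : C ^ 2 * ∫ z, ‖dz (Pi.single i 1) (dzb (Pi.single i 1) fun z => (b z : ℂ)) z‖ ≤ K :=
      single_le_sum (f := fun i : Fin n => C ^ 2 *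
        ∫ z, ‖dz (Pi.single i 1) (dzb (Pi.single i 1) fun z => (b z : ℂ)) z‖)
        (fun j _ => by positivity) (Finset.mem_univ i)
    refine le_trans ?_ (h1.trans h2)
    have h3 : Integrable fun z => b z * ‖dz (Pi.single i 1) (fun y => (U m y : ℂ)) z‖ ^ 2 := by
      simp_rw [← wd_eq_dz]
      refine Continuous.integrable_of_hasCompactSupport ?_ hbc.mul_right
      have := continuous_re.comp hb.continuous
      exact this.mul ((continuous_wd_ofReal (hsm m) i).norm.pow 2)
    rw [← integral_indicator isOpen_ball.measurableSet]
    refine integral_mono_of_nonneg (.of_forall fun z => ?_) h3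
      (.of_forall fun z => ?_)
    · exact Set.indicator_nonneg (fun _ _ => by positivity) z
    · by_cases hz : z ∈ ball z₀ (2 * r)
      · have : b z = 1 := hb1 z (ball_subset_closedBall hz)
        simp [Set.indicator_of_mem hz, wd_eq_dz, this]
      · simp only [Set.indicator_of_notMem hz]
        exact mul_nonneg (hb0 z) (by positivity)
  set μ := (volume : Measure (Cn n)).restrict (ball z₀ (2 * r)) with hμ
  have hmem := fun i m => memLp_wd_ofReal (hsm m) i z₀ (2 * r)
  choose g hg2 hg using fun i => exists_weak_limit μ (hmem i) (hbound i)
  set G : Fin n → Cn n → ℂ := fun i => (ball z₀ (2 * r)).indicator (g i) with hG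
  have hG2 : ∀ i, MemLp (G i) 2 := fun i =>
    (memLp_indicator_iff_restrict isOpen_ball.measurableSet).2 (hg2 i)
  have hweak : ∀ i, ∀ θ : Cn n → ℂ, IsTest θ (ball z₀ (2 * r)) →
      ∫ z, (u z : ℂ) * wd i θ z = -∫ z, G i z * θ z := by
    intro i θ hθ
    have hθ2 : MemLp θ 2 μ := (hθ.continuous.memLp_of_hasCompactSupport hθ.compact).restrict _
    have hset : ∀ k : Cn n → ℂ, ∫ z, k z * θ z ∂μ = ∫ z, k z * θ z := fun k => by
      refine setIntegral_eq_integral_of_forall_compl_eq_zero fun z hz => ?_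
      rw [hθ.zero_of_notMem hz, mul_zero]
    have hGi : ∫ z, G i z * θ z = ∫ z, g i z * θ z ∂μ := by
      rw [← hset]
      refine setIntegral_congr_fun isOpen_ball.measurableSet fun z hz => ?_
      simp only [hG, Set.indicator_of_mem hz]
    rw [hGi, hg i θ hθ2 (-∫ z, (u z : ℂ) * wd i θ z), neg_neg]
    have hm : ∀ m, ∫ z, wd i (fun y => (U m y : ℂ)) z * θ z ∂μ
        = -∫ z, (U m z : ℂ) * wd i θ z := fun m => by
      rw [hset]
      simp_rw [wd_eq_dz]
      rw [integral_mul_wirt hθ fun z _ => Sm.ofReal (hsm m).contDiffAt, neg_neg]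
    simp_rw [hm]
    refine Tendsto.neg ?_
    have hwd : (fun z => wd i θ z) = wirt (-I) (Pi.single i 1) θ := by
      funext z; exact wd_eq_dz i θ z
    have hti : Integrable fun z => wd i θ z := by rw [hwd]; exact (hθ.wirt _ _).integrable
    exact tendsto_integral_mul hti (fun m => continuous_ofReal.comp (hsm m).continuous)
      (fun m z => by rw [norm_real, norm_of_nonneg (hU0 m z)]; exact hUC m z)
      (htend.mono fun z hz => (continuous_ofReal.tendsto _).comp hz)
  have hsub : ball z₀ r ⊆ ball z₀ (2 * r) := ball_subset_ball (by linarith)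
  refine ⟨U, G, K, hsm, hU0, hUC, fun m z hz => hlp m z (ball_subset_ball (by linarith) hz),
    htend, hG2, fun i => ?_, fun i m => ?_⟩
  · have hGloc : LocallyIntegrable (G i) := (hG2 i).locallyIntegrable (by norm_num)
    have h1 := ae_restrict_of_ae (s := ball z₀ r) (ae_tendsto_moll hr hGloc)
    filter_upwards [h1, ae_restrict_mem isOpen_ball.measurableSet] with z hz hzb
    refine hz.congr fun m => ?_
    rw [wd_eq_dz, wirt_moll (bump n hr m) hloc (U := ball z₀ (2 * r)) ?_ ?_]
    · intro t ht
      have h1 := bump_rOut_lt (n := n) hr m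
      rw [mem_ball, dist_eq_norm] at hzb ⊢
      rw [Metric.mem_closedBall, dist_zero_right] at ht
      calc ‖z - t - z₀‖ = ‖(z - z₀) - t‖ := by congr 1; abel
        _ ≤ ‖z - z₀‖ + ‖t‖ := norm_sub_le _ _
        _ < 2 * r := by linarith
    · intro θ hθ
      simp_rw [← wd_eq_dz]
      exact hweak i θ hθ
  · refine le_trans ?_ (hbound i m)
    have hi : Integrable (fun z => ‖wd i (fun y => (U m y : ℂ)) z‖ ^ 2) μ := by
      simpa using (hmem i m).integrable_norm_pow (p := 2) (by norm_num)
    exact setIntegral_mono_set hi (.of_forall fun z => by positivity)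
      (.of_forall hsub)

end Regularization

/-! ### Hermitian forms and orthonormal frames -/

section HermitianForm

variable {n p : ℕ} {V : Type*} [AddCommGroup V] [Module ℂ V]

/-- A positive definite Hermitian form. -/
structure IsHermForm (H : V →ₗ[ℂ] V →ₗ⋆[ℂ] ℂ) : Prop where
  symm : ∀ u v, conj (H u v) = H v u
  pos : ∀ u, u ≠ 0 → 0 < (H u u).re

/-- Orthonormal families of a Hermitian form. -/
def IsOrtho {ι : Type*} [DecidableEq ι] (H : V →ₗ[ℂ] V →ₗ⋆[ℂ] ℂ) (o : ι → V) : Prop :=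
  ∀ i j, H (o i) (o j) = if i = j then 1 else 0

/-- The inner product of a positive definite Hermitian form. -/
@[reducible]
def IsHermForm.core {H : V →ₗ[ℂ] V →ₗ⋆[ℂ] ℂ} (h : IsHermForm H) : InnerProductSpace.Core ℂ V where
  inner u v := H v u
  conj_inner_symm u v := h.symm u v
  re_inner_nonneg u := by
    by_cases h0 : u = 0
    · simp [h0]
    · exact (h.pos u h0).le
  add_left u v w := by simp
  smul_left u v r := by simp
  definite u hu := by
    by_contra h0
    have h2 := h.pos u h0
    rw [hu] at h2
    simp at h2

variable {H : V →ₗ[ℂ] V →ₗ⋆[ℂ] ℂ}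

theorem IsHermForm.exists_extension [FiniteDimensional ℂ V] (h : IsHermForm H)
    (hn : finrank ℂ V = n) {v : Fin p → V} (hv : IsOrtho H v) :
    ∃ (hp : p ≤ n) (o : Fin n → V), IsOrtho H o ∧ ∀ i, o (Fin.castLE hp i) = v i := by
  let _ : NormedAddCommGroup V := h.core.toNormedAddCommGroup
  let _ : InnerProductSpace ℂ V := InnerProductSpace.ofCore h.core.toCore
  have hin : ∀ a b : V, inner ℂ a b = H b a := fun a b => rfl
  have hon : Orthonormal ℂ v := by
    rw [orthonormal_iff_ite]
    intro i j
    rw [hin, hv j i]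
    simp [eq_comm]
  have hp : p ≤ n := by
    have := hon.linearIndependent.fintype_card_le_finrank
    simpa [hn] using this
  let w : Fin n → V := fun i => if hi : (i : ℕ) < p then v ⟨i, hi⟩ else 0
  let s : Set (Fin n) := Set.range (Fin.castLE hp)
  have hw : Orthonormal ℂ (s.domRestrict w) := by
    rw [orthonormal_iff_ite]
    rintro ⟨_, i, rfl⟩ ⟨_, j, rfl⟩
    have := orthonormal_iff_ite.1 hon i j
    by_cases hij : i = j
    · subst hij
      simpa [w, Set.domRestrict] using this
    · rw [if_neg fun hh => hij (by simpa using congrArg Subtype.val hh)]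
      simpa [w, Set.domRestrict, hij] using this
  obtain ⟨o, ho⟩ := hw.exists_orthonormalBasis_extension_of_card_eq (by simpa using hn)
  refine ⟨hp, o, fun i j => ?_, fun i => ?_⟩
  · have := orthonormal_iff_ite.1 o.orthonormal j i
    rw [hin] at this
    rw [this]
    simp [eq_comm]
  · rw [ho _ ⟨i, rfl⟩]
    simp [w]

theorem IsHermForm.exists_adapted [FiniteDimensional ℂ V] (h : IsHermForm H)
    (hn : finrank ℂ V = n) (hp : p ≤ n) (w : Fin p → V) :
    ∃ v : Fin p → V, IsOrtho H v ∧ ∀ i, w i = ∑ j, H (w i) (v j) • v j := by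
  let _ : NormedAddCommGroup V := h.core.toNormedAddCommGroup
  let _ : InnerProductSpace ℂ V := InnerProductSpace.ofCore h.core.toCore
  have hin : ∀ a b : V, inner ℂ a b = H b a := fun a b => rfl
  let f : Fin n → V := fun i => if hi : (i : ℕ) < p then w ⟨i, hi⟩ else 0
  have hcard : finrank ℂ V = Fintype.card (Fin n) := by simpa using hn
  set o := InnerProductSpace.gramSchmidtOrthonormalBasis hcard f
  refine ⟨fun j => o (Fin.castLE hp j), fun i j => ?_, fun i => ?_⟩
  · have := orthonormal_iff_ite.1 o.orthonormal (Fin.castLE hp j) (Fin.castLE hp i)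
    rw [hin] at this
    rw [this]
    simp [eq_comm, Fin.ext_iff]
  · have hfi : f (Fin.castLE hp i) = w i := by simp [f]
    have h1 := o.sum_repr (w i)
    simp only [o.repr_apply_apply] at h1
    conv_lhs => rw [← h1]
    have himg : ∀ k : Fin n, k ∉ Finset.univ.map (Fin.castLEEmb hp) →
        inner ℂ (o k) (w i) • o k = 0 := by
      intro k hk
      have hlt : Fin.castLE hp i < k := by
        by_contra hle
        push Not at hle
        refine hk (Finset.mem_map.2 ⟨⟨k, ?_⟩, Finset.mem_univ _, ?_⟩)
        · have : (k : ℕ) ≤ i := by simpa [Fin.le_def] using hle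
          omega
        · ext; simp
      rw [← hfi, InnerProductSpace.gramSchmidtOrthonormalBasis_inv_triangular hcard f hlt, zero_smul]
    rw [← Finset.sum_subset (Finset.subset_univ (Finset.univ.map (Fin.castLEEmb hp)))
      fun k _ hk => himg k hk, Finset.sum_map]
    rfl

theorem IsHermForm.exists_ortho [FiniteDimensional ℂ V] (h : IsHermForm H)
    (hn : finrank ℂ V = n) : ∃ o : Fin n → V, IsOrtho H o :=
  let ⟨o, ho, _⟩ := h.exists_adapted hn le_rfl fun _ => 0
  ⟨o, ho⟩

theorem IsHermForm.eq_sum [FiniteDimensional ℂ V] (h : IsHermForm H)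
    (hn : finrank ℂ V = n) {o : Fin n → V} (ho : IsOrtho H o) (x : V) :
    x = ∑ i, H x (o i) • o i := by
  let _ : NormedAddCommGroup V := h.core.toNormedAddCommGroup
  let _ : InnerProductSpace ℂ V := InnerProductSpace.ofCore h.core.toCore
  have hin : ∀ a b : V, inner ℂ a b = H b a := fun a b => rfl
  have hon : Orthonormal ℂ o := by
    rw [orthonormal_iff_ite]
    intro i j
    rw [hin, ho j i]
    simp [eq_comm]
  have hcard : Fintype.card (Fin n) = finrank ℂ V := by simpa using hn.symm
  have hspan : ⊤ ≤ Submodule.span ℂ (Set.range o) := by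
    rw [hon.linearIndependent.span_eq_top_of_card_eq_finrank' hcard]
  let ob := OrthonormalBasis.mk hon hspan
  have h1 := ob.sum_repr x
  simp only [ob.repr_apply_apply, ob, OrthonormalBasis.coe_mk, hin] at h1
  exact h1.symm

end HermitianForm

section Frames

variable {n p q : ℕ} {V : Type*} [AddCommGroup V] [Module ℂ V] {H : V →ₗ[ℂ] V →ₗ⋆[ℂ] ℂ}

/-- The Gram matrix of a family of vectors. -/
def gramOf (H : V →ₗ[ℂ] V →ₗ⋆[ℂ] ℂ) (b : Fin n → V) : Matrix (Fin n) (Fin n) ℂ :=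
  Matrix.of fun i j => H (b i) (b j)

/-- The inverse of the Gram matrix, with the index convention `∑_q g^{i q̄} g_{k q̄} = δ_{ik}`. -/
def gramInvOf (H : V →ₗ[ℂ] V →ₗ⋆[ℂ] ℂ) (b : Fin n → V) (i j : Fin n) : ℂ := (gramOf H b)⁻¹ j i

theorem gram_change (b : Module.Basis (Fin n) ℂ V) (o : Fin n → V) :
    gramOf H o = (Matrix.of fun k i => b.repr (o k) i) * gramOf H b
      * (Matrix.of fun k i => b.repr (o k) i).conjTranspose := by
  ext k l
  have h1 : ∀ k, o k = ∑ i, b.repr (o k) i • b i := fun k => (b.sum_repr (o k)).symm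
  rw [gramOf, Matrix.of_apply, h1 k]
  conv_lhs => rw [h1 l]
  simp only [map_sum, map_smul, LinearMap.sum_apply, LinearMap.smul_apply, smul_eq_mul,
    LinearMap.map_smulₛₗ, Matrix.mul_apply, Matrix.conjTranspose_apply, Matrix.of_apply, gramOf,
    sum_mul, mul_sum]
  refine sum_ext fun i => sum_ext fun j => ?_
  simp only [RCLike.star_def]
  ring

theorem gramInvOf_eq (b : Module.Basis (Fin n) ℂ V) {o : Fin n → V} (ho : IsOrtho H o) (i j : Fin n) :
    gramInvOf H b i j = ∑ k, b.repr (o k) i * conj (b.repr (o k) j) := by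
  set A : Matrix (Fin n) (Fin n) ℂ := Matrix.of fun k i => b.repr (o k) i with hA
  have h1 : A * (gramOf H b * A.conjTranspose) = 1 := by
    rw [← Matrix.mul_assoc, ← gram_change b o]
    ext k l
    simp [gramOf, ho k l, Matrix.one_apply]
  have h2 : gramOf H b * (A.conjTranspose * A) = 1 := by
    rw [← Matrix.mul_assoc]; exact mul_eq_one_comm.1 h1
  rw [gramInvOf, Matrix.inv_eq_right_inv h2, Matrix.mul_apply]
  refine sum_ext fun k => ?_
  simp [hA, mul_comm]

theorem gramOf_det_ne_zero (b : Module.Basis (Fin n) ℂ V) {o : Fin n → V} (ho : IsOrtho H o) :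
    (gramOf H b).det = (((‖(Matrix.of fun k i => b.repr (o k) i).det‖ ^ 2)⁻¹ : ℝ) : ℂ)
      ∧ (gramOf H b).det ≠ 0 := by
  set A : Matrix (Fin n) (Fin n) ℂ := Matrix.of fun k i => b.repr (o k) i with hA
  have h1 : A * gramOf H b * A.conjTranspose = 1 := by
    rw [← gram_change b o]
    ext k l
    simp [gramOf, ho k l, Matrix.one_apply]
  have h2 := congrArg Matrix.det h1
  rw [Matrix.det_mul, Matrix.det_mul, Matrix.det_conjTranspose, Matrix.det_one] at h2
  have h3 : ((‖A.det‖ ^ 2 : ℝ) : ℂ) * (gramOf H b).det = 1 := by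
    rw [← h2, ← normSq_eq_norm_sq, ← mul_conj]
    simp only [RCLike.star_def]; ring
  constructor
  · rw [Complex.ofReal_inv]
    exact (eq_inv_of_mul_eq_one_right h3)
  · exact right_ne_zero_of_mul_eq_one h3

theorem gramOf_det_re_pos (b : Module.Basis (Fin n) ℂ V) {o : Fin n → V} (ho : IsOrtho H o) :
    0 < (gramOf H b).det.re ∧ (gramOf H b).det = ((gramOf H b).det.re : ℂ) := by
  obtain ⟨h1, h2⟩ := gramOf_det_ne_zero b ho
  have h3 : (gramOf H b).det = ((gramOf H b).det.re : ℂ) := by rw [h1, ofReal_re]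
  refine ⟨?_, h3⟩
  have h4 : (gramOf H b).det.re ≠ 0 := fun h0 => h2 (by rw [h3, h0]; simp)
  refine lt_of_le_of_ne ?_ h4.symm
  rw [h1, ofReal_re]
  positivity

/-- The array `I ↦ ∑_J γ(i₁, j₁) ⋯ γ(i_q, j_q) c̄_J`. -/
def raise (γ : Fin n → Fin n → ℂ) (c : (Fin q → Fin n) → ℂ) (I : Fin q → Fin n) : ℂ :=
  ∑ J : Fin q → Fin n, (∏ k, γ (I k) (J k)) * conj (c J)

/-- The contraction `∑_{I,J} γ(i₁, j₁) ⋯ γ(i_q, j_q) a_I c̄_J`. -/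
def apair (γ : Fin n → Fin n → ℂ) (a c : (Fin q → Fin n) → ℂ) : ℂ := ∑ I, a I * raise γ c I

/-- The components of an array in another frame. -/
def hat (A : Matrix (Fin n) (Fin n) ℂ) (a : (Fin q → Fin n) → ℂ) (K : Fin q → Fin n) : ℂ :=
  ∑ I : Fin q → Fin n, (∏ k, A (K k) (I k)) * a I

theorem apair_eq {γ : Fin n → Fin n → ℂ} {A : Matrix (Fin n) (Fin n) ℂ}
    (hγ : ∀ i j, γ i j = ∑ k, A k i * conj (A k j)) (a c : (Fin q → Fin n) → ℂ) :
    apair γ a c = ∑ K, hat A a K * conj (hat A c K) := by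
  have h1 : ∀ I J : Fin q → Fin n, ∏ k, γ (I k) (J k)
      = ∑ K : Fin q → Fin n, (∏ k, A (K k) (I k)) * conj (∏ k, A (K k) (J k)) := by
    intro I J
    simp_rw [hγ]
    rw [Finset.prod_univ_sum, Fintype.piFinset_univ]
    refine sum_ext fun K => ?_
    rw [map_prod, ← Finset.prod_mul_distrib]
  simp only [apair, raise, hat, h1, map_sum, map_mul, mul_sum, sum_mul]
  rw [sum_comm]
  conv_lhs => enter [2, J]; rw [sum_comm]
  refine sum_comm_ext fun K => ?_
  refine sum_ext fun J => sum_ext fun I => ?_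
  ring

theorem hat_multilinear (b : Module.Basis (Fin n) ℂ V) (o : Fin n → V)
    (η : MultilinearMap ℂ (fun _ : Fin q => V) ℂ) (K : Fin q → Fin n) :
    hat (Matrix.of fun k i => b.repr (o k) i) (fun I => η fun k => b (I k)) K
      = η fun k => o (K k) := by
  have h2 : (fun k => o (K k)) = fun k => ∑ i, b.repr (o (K k)) i • b i := by
    funext k; exact (b.sum_repr _).symm
  rw [h2, MultilinearMap.map_sum]
  refine sum_ext fun I => ?_
  rw [MultilinearMap.map_smul_univ]
  simp

theorem apair_multilinear (b : Module.Basis (Fin n) ℂ V) {o : Fin n → V} (ho : IsOrtho H o)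
    (η θ : MultilinearMap ℂ (fun _ : Fin q => V) ℂ) :
    apair (gramInvOf H b) (fun I => η fun k => b (I k)) (fun I => θ fun k => b (I k))
      = ∑ K : Fin q → Fin n, η (fun k => o (K k)) * conj (θ fun k => o (K k)) := by
  rw [apair_eq (A := Matrix.of fun k i => b.repr (o k) i) fun i j => by rw [gramInvOf_eq b ho]; rfl]
  simp_rw [hat_multilinear]

/-- Antisymmetrization of an array. -/
def aalt (a : (Fin q → Fin n) → ℂ) (I : Fin q → Fin n) : ℂ :=
  ∑ σ : Perm (Fin q), ((σ.sign : ℤ) : ℂ) * a (I ∘ σ)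

theorem aalt_comp (a : (Fin q → Fin n) → ℂ) (I : Fin q → Fin n) (τ : Perm (Fin q)) :
    aalt a (I ∘ τ) = ((τ.sign : ℤ) : ℂ) * aalt a I := by
  rw [aalt, aalt, mul_sum, ← Equiv.sum_comp (Equiv.mulLeft τ)
    fun σ => ((τ.sign : ℤ) : ℂ) * (((σ.sign : ℤ) : ℂ) * a (I ∘ σ))]
  refine sum_ext fun σ => ?_
  have h1 : ((τ.sign : ℤ) : ℂ) * ((τ.sign : ℤ) : ℂ) = 1 := by
    rw [← Int.cast_mul, ← Units.val_mul, Int.units_mul_self]; simp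
  simp only [Equiv.coe_mulLeft, Perm.sign_mul, Units.val_mul, Int.cast_mul, Perm.coe_mul,
    ← mul_assoc, h1, one_mul, Function.comp_assoc]

theorem hat_aalt (A : Matrix (Fin n) (Fin n) ℂ) (a : (Fin q → Fin n) → ℂ) (K : Fin q → Fin n) :
    hat A (aalt a) K = aalt (hat A a) K := by
  simp only [hat, aalt, mul_sum]
  refine sum_comm_ext fun σ => ?_
  rw [← Equiv.sum_comp (Equiv.arrowCongr σ (Equiv.refl (Fin n)))]
  refine sum_ext fun I => ?_
  have h1 : (Equiv.arrowCongr σ (Equiv.refl (Fin n)) I) ∘ σ = I := by funext k; simp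
  have h2 : ∏ k, A (K k) (Equiv.arrowCongr σ (Equiv.refl (Fin n)) I k)
      = ∏ k, A ((K ∘ σ) k) (I k) := by
    rw [← Equiv.prod_comp σ]
    simp
  rw [h1, h2]
  ring

theorem sum_aalt_mul (a c : (Fin q → Fin n) → ℂ) :
    ∑ K, aalt a K * conj (aalt c K) = (q.factorial : ℂ) * ∑ K, a K * conj (aalt c K) := by
  have h1 : ∀ σ : Perm (Fin q), ∑ K : Fin q → Fin n,
      ((σ.sign : ℤ) : ℂ) * a (K ∘ σ) * conj (aalt c K) = ∑ K, a K * conj (aalt c K) := by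
    intro σ
    rw [← Equiv.sum_comp (Equiv.arrowCongr σ (Equiv.refl (Fin n)))]
    refine sum_ext fun K => ?_
    have h2 : (Equiv.arrowCongr σ (Equiv.refl (Fin n)) K) ∘ σ = K := by funext k; simp
    have h3 : aalt c K = ((σ.sign : ℤ) : ℂ) * aalt c (Equiv.arrowCongr σ (Equiv.refl (Fin n)) K) := by
      rw [← aalt_comp, h2]
    rw [h2, h3, map_mul]
    simp
    ring
  calc ∑ K, aalt a K * conj (aalt c K)
      = ∑ σ : Perm (Fin q), ∑ K : Fin q → Fin n,
        ((σ.sign : ℤ) : ℂ) * a (K ∘ σ) * conj (aalt c K) := by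
        simp_rw [aalt.eq_1 a, sum_mul]
        exact sum_comm
    _ = _ := by
        simp_rw [h1]
        simp [Fintype.card_perm]

theorem apair_aalt {γ : Fin n → Fin n → ℂ} {A : Matrix (Fin n) (Fin n) ℂ}
    (hγ : ∀ i j, γ i j = ∑ k, A k i * conj (A k j)) (a c : (Fin q → Fin n) → ℂ) :
    apair γ a (aalt c)
      = (q.factorial : ℂ)⁻¹ * ∑ K, hat A (aalt a) K * conj (hat A (aalt c) K) := by
  rw [apair_eq hγ]
  simp_rw [hat_aalt]
  rw [sum_aalt_mul, ← mul_assoc, inv_mul_cancel₀ (by exact_mod_cast q.factorial_ne_zero), one_mul]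

theorem raise_comp (γ : Fin n → Fin n → ℂ) (c : (Fin q → Fin n) → ℂ) (I : Fin q → Fin n)
    (τ : Perm (Fin q)) :
    raise γ (aalt c) (I ∘ τ) = ((τ.sign : ℤ) : ℂ) * raise γ (aalt c) I := by
  rw [raise, raise, ← Equiv.sum_comp (Equiv.arrowCongr τ.symm (Equiv.refl (Fin n))), mul_sum]
  refine sum_ext fun J => ?_
  have h1 : Equiv.arrowCongr τ.symm (Equiv.refl (Fin n)) J = J ∘ τ := by funext k; simp
  rw [h1, aalt_comp, map_mul]
  have h2 : ∏ k, γ ((I ∘ τ) k) ((J ∘ τ) k) = ∏ k, γ (I k) (J k) :=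
    Equiv.prod_comp τ fun k => γ (I k) (J k)
  rw [h2]
  simp
  ring

/-! ### Decomposable forms -/

theorem wedge_apply (e : Fin p → (V →ₗ[ℂ] ℂ)) (s : Fin p → V) :
    wedge e s = (Matrix.of fun i j => e j (s i)).det := rfl

theorem wedge_apply_sum (e : Fin p → (V →ₗ[ℂ] ℂ)) (s : Fin p → V) :
    wedge e s = ∑ σ : Perm (Fin p), ((σ.sign : ℤ) : ℂ) * ∏ i, e i (s (σ i)) := by
  rw [wedge_apply, Matrix.det_apply']; rfl

theorem sum_wedge_mul_conj (l m : Fin q → (V →ₗ[ℂ] ℂ)) (o : Fin n → V) :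
    ∑ K : Fin q → Fin n, wedge l (fun k => o (K k)) * conj (wedge m fun k => o (K k))
      = (q.factorial : ℂ) * (Matrix.of fun i j => ∑ r, l j (o r) * conj (m i (o r))).det := by
  set M : Matrix (Fin q) (Fin q) ℂ := Matrix.of fun i j => ∑ r, l j (o r) * conj (m i (o r)) with hM
  have h1 : ∀ σ : Perm (Fin q), ∑ K : Fin q → Fin n, wedge l (fun k => o (K k))
      * ∏ i, conj (m i (o (K (σ i)))) = ((σ.sign : ℤ) : ℂ) * M.det := by
    intro σ
    have h2 : ∀ K : Fin q → Fin n, wedge l (fun k => o (K k)) * ∏ i, conj (m i (o (K (σ i))))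
        = (Matrix.detRowAlternating (R := ℂ) (n := Fin q)).toMultilinearMap
          fun k => conj (m (σ.symm k) (o (K k))) • fun j => l j (o (K k)) := by
      intro K
      rw [MultilinearMap.map_smul_univ, smul_eq_mul, mul_comm, wedge_apply]
      congr 1
      rw [← Equiv.prod_comp σ fun k => conj (m (σ.symm k) (o (K k)))]
      simp
    simp_rw [h2]
    rw [← MultilinearMap.map_sum (Matrix.detRowAlternating (R := ℂ) (n := Fin q)).toMultilinearMap
      (g := fun k r => conj (m (σ.symm k) (o r)) • fun j => l j (o r))]
    have h3 : (fun k => ∑ r, conj (m (σ.symm k) (o r)) • fun j => l j (o r))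
        = M.submatrix σ.symm id := by
      funext k j
      simp [hM, Finset.sum_apply, mul_comm]
    rw [h3]
    change (M.submatrix σ.symm id).det = _
    rw [Matrix.det_permute, Perm.sign_symm]
  have h4 : ∀ K : Fin q → Fin n, wedge l (fun k => o (K k)) * conj (wedge m fun k => o (K k))
      = ∑ σ : Perm (Fin q), ((σ.sign : ℤ) : ℂ) * (wedge l (fun k => o (K k))
        * ∏ i, conj (m i (o (K (σ i))))) := by
    intro K
    rw [wedge_apply_sum m, map_sum, mul_sum]
    refine sum_ext fun σ => ?_
    rw [map_mul, map_prod]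
    simp
    ring
  simp_rw [h4]
  rw [sum_comm]
  simp_rw [← mul_sum, h1, ← mul_assoc]
  have h5 : ∀ σ : Perm (Fin q), ((σ.sign : ℤ) : ℂ) * ((σ.sign : ℤ) : ℂ) = 1 := fun σ => by
    rw [← Int.cast_mul, ← Units.val_mul, Int.units_mul_self]; simp
  simp [h5, Fintype.card_perm]

theorem aalt_tensor (α : V →ₗ[ℂ] ℂ) (e : Fin p → (V →ₗ[ℂ] ℂ)) (o : Fin n → V)
    (K : Fin (p + 1) → Fin n) :
    aalt (fun K : Fin (p + 1) → Fin n => α (o (K 0)) * wedge e fun k => o (Fin.tail K k)) K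
      = (p.factorial : ℂ) * wedge (Fin.cons α e : Fin (p + 1) → (V →ₗ[ℂ] ℂ)) fun k => o (K k) := by
  set T : Perm (Fin (p + 1)) → ℂ := fun σ =>
    ((σ.sign : ℤ) : ℂ) * (α (o (K (σ 0))) * ∏ i : Fin p, e i (o (K (σ i.succ)))) with hT
  have h1 : wedge (Fin.cons α e : Fin (p + 1) → (V →ₗ[ℂ] ℂ)) (fun k => o (K k)) = ∑ σ, T σ := by
    rw [wedge_apply_sum]
    refine sum_ext fun σ => ?_
    rw [Fin.prod_univ_succ]
    simp [hT]
  have h2 : ∀ τ : Perm (Fin p), ∑ σ : Perm (Fin (p + 1)), ((σ.sign : ℤ) : ℂ)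
      * (α (o (K (σ 0))) * (((τ.sign : ℤ) : ℂ) * ∏ i, e i (o (K (σ (τ i).succ))))) = ∑ σ, T σ := by
    intro τ
    set τ' : Perm (Fin (p + 1)) := Perm.decomposeFin.symm (0, τ) with hτ'
    have e0 : τ' 0 = 0 := by simp [hτ']
    have es : ∀ i : Fin p, τ' i.succ = (τ i).succ := fun i => by simp [hτ']
    have esg : τ'.sign = τ.sign := by simp [hτ']
    rw [← Equiv.sum_comp (Equiv.mulRight τ') T]
    refine sum_ext fun σ => ?_
    simp only [hT, Equiv.coe_mulRight, Perm.coe_mul, Function.comp_apply, e0, es,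
      Perm.sign_mul, esg, Units.val_mul, Int.cast_mul]
    ring
  rw [h1]
  have h3 : aalt (fun K : Fin (p + 1) → Fin n => α (o (K 0)) * wedge e fun k => o (Fin.tail K k)) K
      = ∑ τ : Perm (Fin p), ∑ σ : Perm (Fin (p + 1)), ((σ.sign : ℤ) : ℂ)
      * (α (o (K (σ 0))) * (((τ.sign : ℤ) : ℂ) * ∏ i, e i (o (K (σ (τ i).succ))))) := by
    rw [sum_comm, aalt]
    refine sum_ext fun σ => ?_
    rw [wedge_apply_sum, mul_sum, mul_sum]
    rfl
  rw [h3]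
  simp_rw [h2]
  simp [Fintype.card_perm]

/-- The covectors `g(·, v̄_k)` of a family of vectors. -/
def dualFam (H : V →ₗ[ℂ] V →ₗ⋆[ℂ] ℂ) (v : Fin p → V) : Fin p → (V →ₗ[ℂ] ℂ) := fun i => H.flip (v i)

theorem wedge_dualFam_self {v : Fin p → V} (hv : IsOrtho H v) : wedge (dualFam H v) v = 1 := by
  rw [wedge_apply]
  have : (Matrix.of fun i j => dualFam H v j (v i)) = (1 : Matrix (Fin p) (Fin p) ℂ) := by
    ext i j
    simp [dualFam, hv i j, Matrix.one_apply]
  rw [this, Matrix.det_one]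

variable [FiniteDimensional ℂ V]

theorem IsHermForm.covector_apply (h : IsHermForm H) (hn : finrank ℂ V = n) {o : Fin n → V}
    (ho : IsOrtho H o) (α : V →ₗ[ℂ] ℂ) (x : V) : ∑ r, α (o r) * H x (o r) = α x := by
  conv_rhs => rw [h.eq_sum hn ho x]
  simp [mul_comm]

theorem sum_wedge_dualFam (h : IsHermForm H) (hn : finrank ℂ V = n) {o : Fin n → V}
    (ho : IsOrtho H o) (e : Fin p → (V →ₗ[ℂ] ℂ)) (s : Fin p → V) :
    ∑ K : Fin p → Fin n, wedge e (fun k => o (K k)) * conj (wedge (dualFam H s) fun k => o (K k))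
      = (p.factorial : ℂ) * wedge e s := by
  rw [sum_wedge_mul_conj, wedge_apply]
  congr 3
  ext i j
  simp only [Matrix.of_apply, dualFam, LinearMap.flip_apply, h.symm]
  exact h.covector_apply hn ho (e j) (s i)

theorem sum_normSq_decomposable (h : IsHermForm H) (hn : finrank ℂ V = n) {o : Fin n → V}
    (ho : IsOrtho H o) {v : Fin p → V} (hv : IsOrtho H v) (t : ℂ) :
    ∑ K : Fin p → Fin n, (t • wedge (dualFam H v)) (fun k => o (K k))
      * conj ((t • wedge (dualFam H v)) fun k => o (K k)) = (p.factorial : ℂ) * (‖t‖ ^ 2 : ℝ) := by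
  have h1 := sum_wedge_dualFam h hn ho (dualFam H v) v
  rw [wedge_dualFam_self hv, mul_one] at h1
  have h2 : ∀ K : Fin p → Fin n, (t • wedge (dualFam H v)) (fun k => o (K k))
      * conj ((t • wedge (dualFam H v)) fun k => o (K k)) = (t * conj t)
        * (wedge (dualFam H v) (fun k => o (K k)) * conj (wedge (dualFam H v) fun k => o (K k))) := by
    intro K
    simp only [AlternatingMap.smul_apply, smul_eq_mul, map_mul]
    ring
  simp_rw [h2]
  rw [← mul_sum, h1, mul_conj, normSq_eq_norm_sq]
  ring

theorem norm_sq_apply_le (h : IsHermForm H) (hn : finrank ℂ V = n) {o : Fin n → V}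
    (ho : IsOrtho H o) {v : Fin p → V} (hv : IsOrtho H v) (t : ℂ) (s : Fin p → V) :
    ‖(t • wedge (dualFam H v)) s‖ ^ 2 ≤ ‖t‖ ^ 2 * (gramOf H s).det.re := by
  set x : (Fin p → Fin n) → ℂ := fun K => wedge (dualFam H v) fun k => o (K k)
  set y : (Fin p → Fin n) → ℂ := fun K => wedge (dualFam H s) fun k => o (K k)
  have hf : (0 : ℝ) < p.factorial := by exact_mod_cast p.factorial_pos
  have h1 : ∑ K, x K * conj (y K) = (p.factorial : ℂ) * wedge (dualFam H v) s :=
    sum_wedge_dualFam h hn ho _ _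
  have hx : ∑ K, ‖x K‖ ^ 2 = (p.factorial : ℝ) := by
    have := sum_wedge_dualFam h hn ho (dualFam H v) v
    rw [wedge_dualFam_self hv, mul_one] at this
    simp_rw [mul_conj, normSq_eq_norm_sq] at this
    exact_mod_cast this
  have hy : ∑ K, ‖y K‖ ^ 2 = (p.factorial : ℝ) * (gramOf H s).det.re := by
    have := sum_wedge_dualFam h hn ho (dualFam H s) s
    simp_rw [mul_conj, normSq_eq_norm_sq] at this
    have h2 := congrArg Complex.re this
    rw [← Complex.ofReal_natCast, re_ofReal_mul, ← ofReal_sum, ofReal_re] at h2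
    exact h2
  have h3 : ‖(p.factorial : ℂ) * wedge (dualFam H v) s‖ ^ 2
      ≤ (p.factorial : ℝ) * ((p.factorial : ℝ) * (gramOf H s).det.re) := by
    calc _ = ‖∑ K, x K * conj (y K)‖ ^ 2 := by rw [h1]
      _ ≤ (∑ K, ‖x K‖ * ‖y K‖) ^ 2 := by
          gcongr
          refine (norm_sum_le _ _).trans (le_of_eq ?_)
          refine sum_ext fun K => ?_
          rw [norm_mul, RCLike.norm_conj]
      _ ≤ _ := Finset.sum_mul_sq_le_sq_mul_sq _ _ _
      _ = _ := by rw [hx, hy]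
  rw [norm_mul, Complex.norm_natCast, mul_pow] at h3
  have h4 : ‖wedge (dualFam H v) s‖ ^ 2 ≤ (gramOf H s).det.re := by
    have : (0 : ℝ) < (p.factorial : ℝ) ^ 2 := by positivity
    nlinarith
  rw [AlternatingMap.smul_apply, norm_smul, mul_pow]
  gcongr

theorem sum_aalt_tensor (h : IsHermForm H) (hn : finrank ℂ V = n) {o : Fin n → V}
    (ho : IsOrtho H o) {v : Fin p → V} (hv : IsOrtho H v) (t : ℂ) (α β : V →ₗ[ℂ] ℂ) :
    ∑ K : Fin (p + 1) → Fin n,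
      aalt (fun K : Fin (p + 1) → Fin n => α (o (K 0))
        * (t • wedge (dualFam H v)) fun k => o (Fin.tail K k)) K
      * conj (aalt (fun K : Fin (p + 1) → Fin n => β (o (K 0))
        * (t • wedge (dualFam H v)) fun k => o (Fin.tail K k)) K)
      = ((p + 1).factorial : ℂ) * (p.factorial : ℂ) ^ 2 * (‖t‖ ^ 2 : ℝ)
        * (∑ r, α (o r) * conj (β (o r)) - ∑ k, α (v k) * conj (β (v k))) := by
  have hsc : ∀ (α : V →ₗ[ℂ] ℂ) (K : Fin (p + 1) → Fin n),
      aalt (fun K : Fin (p + 1) → Fin n => α (o (K 0))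
        * (t • wedge (dualFam H v)) fun k => o (Fin.tail K k)) K
      = t * (p.factorial : ℂ)
        * wedge (Fin.cons α (dualFam H v) : Fin (p + 1) → (V →ₗ[ℂ] ℂ)) fun k => o (K k) := by
    intro α K
    rw [mul_assoc, ← aalt_tensor, aalt, aalt, mul_sum]
    refine sum_ext fun σ => ?_
    simp only [AlternatingMap.smul_apply, smul_eq_mul]
    ring
  simp_rw [hsc]
  have hpull : ∀ a b : ℂ, t * (p.factorial : ℂ) * a * conj (t * (p.factorial : ℂ) * b)
      = (p.factorial : ℂ) ^ 2 * (‖t‖ ^ 2 : ℝ) * (a * conj b) := by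
    intro a b
    rw [← normSq_eq_norm_sq, ← mul_conj]
    simp
    ring
  simp_rw [hpull]
  rw [← mul_sum, sum_wedge_mul_conj]
  set M : Matrix (Fin (p + 1)) (Fin (p + 1)) ℂ := Matrix.of fun i j =>
    ∑ r, (Fin.cons α (dualFam H v) : Fin (p + 1) → (V →ₗ[ℂ] ℂ)) j (o r)
      * conj ((Fin.cons β (dualFam H v) : Fin (p + 1) → (V →ₗ[ℂ] ℂ)) i (o r)) with hM
  have hcov : ∀ (γ : V →ₗ[ℂ] ℂ) (x : V), ∑ r, γ (o r) * conj (H (o r) x) = γ x := fun γ x => by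
    simp_rw [h.symm]
    exact h.covector_apply hn ho γ x
  have h00 : M 0 0 = ∑ r, α (o r) * conj (β (o r)) := by simp [hM]
  have h0s : ∀ j : Fin p, M 0 j.succ = conj (β (v j)) := fun j => by
    have := congrArg conj (hcov β (v j))
    rw [map_sum] at this
    rw [← this]
    simp [hM, dualFam, mul_comm]
  have hs0 : ∀ i : Fin p, M i.succ 0 = α (v i) := fun i => by
    rw [← hcov α (v i)]
    simp [hM, dualFam]
  have hss : ∀ i j : Fin p, M i.succ j.succ = if i = j then 1 else 0 := fun i j => by
    have h1 := hcov (dualFam H v j) (v i)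
    have h2 : dualFam H v j (v i) = if i = j then 1 else 0 := by simp [dualFam, hv i j]
    rw [← h2, ← h1]
    simp [hM, dualFam]
  let E : Fin p ⊕ Unit ≃ Fin (p + 1) := ((finSuccEquiv p).trans (Equiv.optionEquivSumPUnit _)).symm
  have hEl : ∀ i, E (Sum.inl i) = i.succ := fun i => by simp [E]
  have hEr : ∀ i, E (Sum.inr i) = 0 := fun i => by simp [E]
  have hdet : M.det = ∑ r, α (o r) * conj (β (o r)) - ∑ k, α (v k) * conj (β (v k)) := by
    rw [← Matrix.det_submatrix_equiv_self E M]
    have hblock : M.submatrix E E = Matrix.fromBlocks 1 (Matrix.of fun i _ => α (v i))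
        (Matrix.of fun _ j => conj (β (v j))) (Matrix.of fun _ _ => ∑ r, α (o r) * conj (β (o r))) := by
      ext i j
      rcases i with i | i <;> rcases j with j | j <;>
        simp [hEl, hEr, h00, h0s, hs0, hss, Matrix.one_apply]
    rw [hblock, Matrix.det_fromBlocks_one₁₁, Matrix.det_unique]
    simp [Matrix.mul_apply, mul_comm]
  rw [hdet]
  ring

theorem IsHermForm.exists_wedge_eq (h : IsHermForm H) (hn : finrank ℂ V = n) (hp : p ≤ n)
    (l : Fin p → (V →ₗ[ℂ] ℂ)) :
    ∃ (v : Fin p → V) (t : ℂ), IsOrtho H v ∧ wedge l = t • wedge (dualFam H v) := by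
  obtain ⟨o, ho⟩ := h.exists_ortho hn
  set w : Fin p → V := fun i => ∑ k, conj (l i (o k)) • o k with hw
  have hl : ∀ i x, l i x = H x (w i) := fun i x => by
    rw [← h.covector_apply hn ho (l i) x]
    simp [hw]
  obtain ⟨v, hv, hvw⟩ := h.exists_adapted hn hp w
  refine ⟨v, (Matrix.of fun j k => conj (H (w j) (v k))).det, hv, ?_⟩
  ext x
  rw [AlternatingMap.smul_apply, wedge_apply, wedge_apply, smul_eq_mul, mul_comm,
    ← Matrix.det_transpose (Matrix.of fun j k => conj (H (w j) (v k))), ← Matrix.det_mul]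
  congr 1
  ext i j
  rw [Matrix.of_apply, hl, Matrix.mul_apply]
  conv_lhs => rw [hvw j]
  simp [dualFam, mul_comm]

end Frames

/-! ### Kähler metrics in coordinates -/

section LocalMetric

variable {n p q : ℕ} {Ω : Set (Cn n)} {z : Cn n} {g : LocalMatrix n} {η : LocalForm n p}
  {u : Cn n → ℝ}

/-- The sesquilinear form of a matrix. -/
def sesq (A : Matrix (Fin n) (Fin n) ℂ) : Cn n →ₗ[ℂ] Cn n →ₗ⋆[ℂ] ℂ :=
  LinearMap.mk₂'ₛₗ (RingHom.id ℂ) (starRingEnd ℂ) (fun u v => ∑ i, ∑ j, A i j * u i * conj (v j))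
    (fun u v w => by simp [mul_add, add_mul, sum_add_distrib])
    (fun c u v => by
      simp only [Pi.smul_apply, smul_eq_mul, RingHom.id_apply, mul_sum]
      refine sum_ext fun i => sum_ext fun j => ?_
      ring)
    (fun u v w => by simp [mul_add, sum_add_distrib])
    (fun c u v => by
      simp only [Pi.smul_apply, smul_eq_mul, map_mul, mul_sum]
      refine sum_ext fun i => sum_ext fun j => ?_
      ring)

theorem sesq_apply (A : Matrix (Fin n) (Fin n) ℂ) (u v : Cn n) :
    sesq A u v = ∑ i, ∑ j, A i j * u i * conj (v j) := rfl

/-- The standard basis. -/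
abbrev stdB (n : ℕ) : Module.Basis (Fin n) ℂ (Cn n) := Pi.basisFun ℂ (Fin n)

theorem gramOf_sesq (A : Matrix (Fin n) (Fin n) ℂ) : gramOf (sesq A) (stdB n) = A := by
  ext i j
  simp [gramOf, sesq_apply, Pi.single_apply]

/-- A smooth Kähler metric on an open set of `ℂⁿ`. -/
structure IsKahlerOn (g : LocalMatrix n) (Ω : Set (Cn n)) : Prop where
  isOpen : IsOpen Ω
  smooth : ∀ i j, SmOn (fun z => g z i j) Ω
  herm : ∀ z ∈ Ω, IsHermForm (sesq (g z))
  kahler : ∀ z ∈ Ω, ∀ i j k, wd k (fun z => g z i j) z = wd i (fun z => g z k j) z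

/-- The inverse metric. -/
def ginv (g : LocalMatrix n) (z : Cn n) (i j : Fin n) : ℂ := (g z)⁻¹ j i

theorem gramInvOf_sesq (z : Cn n) : gramInvOf (sesq (g z)) (stdB n) = ginv g z := by
  funext i j
  rw [gramInvOf, gramOf_sesq, ginv]

namespace IsKahlerOn

theorem exists_ortho (h : IsKahlerOn g Ω) (hz : z ∈ Ω) : ∃ o : Fin n → Cn n, IsOrtho (sesq (g z)) o :=
  (h.herm z hz).exists_ortho (by simp)

theorem det_ne_zero (h : IsKahlerOn g Ω) (hz : z ∈ Ω) : (g z).det ≠ 0 := by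
  obtain ⟨o, ho⟩ := h.exists_ortho hz
  have := (gramOf_det_ne_zero (stdB n) ho).2
  rwa [gramOf_sesq] at this

theorem det_pos (h : IsKahlerOn g Ω) (hz : z ∈ Ω) :
    0 < (g z).det.re ∧ (g z).det = ((g z).det.re : ℂ) := by
  obtain ⟨o, ho⟩ := h.exists_ortho hz
  have := gramOf_det_re_pos (stdB n) ho
  rwa [gramOf_sesq] at this

theorem symm (h : IsKahlerOn g Ω) (hz : z ∈ Ω) (i j : Fin n) : conj (g z i j) = g z j i := by
  have := (h.herm z hz).symm (stdB n i) (stdB n j)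
  simpa [sesq_apply, Pi.single_apply] using this

theorem smOn_det (h : IsKahlerOn g Ω) : SmOn (fun z => (g z).det) Ω := fun z hz => by
  simp only [Matrix.det_apply']
  exact ContDiffAt.sum fun σ _ => contDiffAt_const.mul (contDiffAt_prod fun i _ => h.smooth _ _ z hz)

theorem smOn_ginv (h : IsKahlerOn g Ω) (i j : Fin n) : SmOn (fun z => ginv g z i j) Ω :=
    fun z hz => by
  simp only [ginv, Matrix.inv_def, Ring.inverse_eq_inv', Matrix.smul_apply, smul_eq_mul,
    Matrix.adjugate_apply, Matrix.det_apply']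
  refine ContDiffAt.mul ?_ ?_
  · have : Sm (fun z => ((g z).det)⁻¹) z := (h.smOn_det z hz).inv (h.det_ne_zero hz)
    simpa only [Matrix.det_apply'] using this
  · refine ContDiffAt.sum fun σ _ => contDiffAt_const.mul (contDiffAt_prod fun k _ => ?_)
    simp only [Matrix.updateRow_apply]
    split_ifs
    · exact contDiffAt_const
    · exact h.smooth _ _ z hz

theorem sum_mul_ginv (h : IsKahlerOn g Ω) (hz : z ∈ Ω) (k i : Fin n) :
    ∑ r, g z k r * ginv g z i r = if k = i then 1 else 0 := by
  have := congrFun (congrFun (Matrix.mul_nonsing_inv (g z) (h.det_ne_zero hz).isUnit) k) i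
  simpa [Matrix.mul_apply, Matrix.one_apply, ginv] using this

theorem sum_ginv_mul (h : IsKahlerOn g Ω) (hz : z ∈ Ω) (j r : Fin n) :
    ∑ k, ginv g z k j * g z k r = if j = r then 1 else 0 := by
  have := congrFun (congrFun (Matrix.nonsing_inv_mul (g z) (h.det_ne_zero hz).isUnit) j) r
  simpa [Matrix.mul_apply, Matrix.one_apply, ginv] using this

end IsKahlerOn

/-- The Christoffel symbols `Γⁱ_{ml}`. -/
def chris (g : LocalMatrix n) (z : Cn n) (i m l : Fin n) : ℂ :=
  ∑ r, ginv g z i r * wd m (fun y => g y l r) z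

namespace IsKahlerOn

theorem chris_symm (h : IsKahlerOn g Ω) (hz : z ∈ Ω) (i m l : Fin n) :
    chris g z i m l = chris g z i l m :=
  sum_ext fun r => by rw [h.kahler z hz l r m]

theorem wd_ginv (h : IsKahlerOn g Ω) (hz : z ∈ Ω) (m i j : Fin n) :
    wd m (fun y => ginv g y i j) z = -∑ l, chris g z i m l * ginv g z l j := by
  have h1 : ∀ k, ∑ r, (wd m (fun y => g y k r) z * ginv g z i r
      + g z k r * wd m (fun y => ginv g y i r) z) = 0 := by
    intro k
    have h2 : (fun y => ∑ r, g y k r * ginv g y i r) =ᶠ[nhds z] fun _ => if k = i then 1 else 0 := by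
      filter_upwards [h.isOpen.mem_nhds hz] with y hy using h.sum_mul_ginv hy k i
    have h3 := wirt_congr (e := -I) (v := Pi.single m 1) h2
    rw [wirt_const, wirt_sum _ fun r _ =>
      (h.smooth k r z hz).diff.fun_mul (h.smOn_ginv i r z hz).diff] at h3
    rw [← h3]
    refine sum_ext fun r => ?_
    rw [wirt_mul (h.smooth k r z hz).diff (h.smOn_ginv i r z hz).diff, wd_eq_dz, wd_eq_dz]
  have h4 : ∑ k, ginv g z k j * ∑ r, g z k r * wd m (fun y => ginv g y i r) z
      = wd m (fun y => ginv g y i j) z := by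
    simp_rw [mul_sum]
    rw [sum_comm]
    simp_rw [← mul_assoc, ← sum_mul, h.sum_ginv_mul hz]
    simp
  rw [← h4, ← sum_neg_distrib]
  refine sum_ext fun k => ?_
  have h5 := h1 k
  rw [sum_add_distrib] at h5
  have h6 : ∑ r, wd m (fun y => g y k r) z * ginv g z i r = chris g z i m k :=
    sum_ext fun r => mul_comm _ _
  rw [h6] at h5
  linear_combination ginv g z k j * h5

theorem wd_det (h : IsKahlerOn g Ω) (hz : z ∈ Ω) (m : Fin n) :
    wd m (fun y => (g y).det) z = (g z).det * ∑ l, chris g z l m l := by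
  rw [wd_eq_dz, wirt_det fun i j => (h.smooth i j z hz).diff, mul_sum]
  have hinv : ∀ i j, (g z).adjugate i j = (g z).det * ginv g z j i := fun i j => by
    rw [ginv, Matrix.inv_def, Ring.inverse_eq_inv', Matrix.smul_apply, smul_eq_mul,
      mul_inv_cancel_left₀ (h.det_ne_zero hz)]
  refine sum_comm_ext fun l => ?_
  rw [chris, mul_sum]
  refine sum_ext fun r => ?_
  rw [hinv, wd_eq_dz, mul_assoc]

theorem smOn_raise (h : IsKahlerOn g Ω) {c : Cn n → (Fin q → Fin n) → ℂ}
    (hc : ∀ J, SmOn (fun z => c z J) Ω) (I : Fin q → Fin n) :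
    SmOn (fun z => raise (ginv g z) (c z) I) Ω := fun z hz => by
  simp only [raise]
  exact ContDiffAt.sum fun J _ => (contDiffAt_prod fun k _ => h.smOn_ginv _ _ z hz).mul
    (hc J z hz).conj

theorem wd_raise (h : IsKahlerOn g Ω) (hz : z ∈ Ω) {c : Cn n → (Fin q → Fin n) → ℂ}
    (hc : ∀ J, DifferentiableAt ℂ (fun z => c z J) z) (m : Fin n) (I : Fin q → Fin n) :
    wd m (fun y => raise (ginv g y) (c y) I) z
      = -∑ k, ∑ l, chris g z (I k) m l * raise (ginv g z) (c z) (update I k l) := by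
  have hd : ∀ J : Fin q → Fin n, ∀ k, DifferentiableAt ℝ (fun y => ginv g y (I k) (J k)) z :=
    fun J k => (h.smOn_ginv _ _ z hz).diff
  have hp : ∀ J : Fin q → Fin n, DifferentiableAt ℝ (fun y => ∏ k, ginv g y (I k) (J k)) z :=
    fun J => (contDiffAt_prod (n := ∞) fun k _ => h.smOn_ginv (I k) (J k) z hz).differentiableAt
      (by simp)
  have hcc : ∀ J : Fin q → Fin n, DifferentiableAt ℝ (fun y => conj (c y J)) z := fun J =>
    (Complex.conjCLE.differentiable.differentiableAt).comp z ((hc J).restrictScalars ℝ)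
  have h1 : ∀ J : Fin q → Fin n, dz (Pi.single m 1)
      (fun y => (∏ k, ginv g y (I k) (J k)) * conj (c y J)) z
      = -∑ k, ∑ l, chris g z (I k) m l *
        ((∏ k', ginv g z (update I k l k') (J k')) * conj (c z J)) := by
    intro J
    rw [wirt_mul (hp J) (hcc J), dz_conj ((hc J).restrictScalars ℝ), dzb_holomorphic (hc J), map_zero,
      mul_zero, add_zero, wirt_prod (hd J), sum_mul, ← sum_neg_distrib]
    refine sum_ext fun k => ?_
    have h2 := h.wd_ginv hz m (I k) (J k)
    rw [wd_eq_dz] at h2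
    rw [h2, Fintype.prod_eq_mul_prod_compl k, Function.update_self, neg_mul, neg_mul, sum_mul,
      sum_mul]
    congr 1
    refine sum_ext fun l => ?_
    rw [Fintype.prod_eq_mul_prod_compl k (fun k' => ginv g z (update I k l k') (J k')),
      Function.update_self]
    have h3 : ∏ i ∈ {k}ᶜ, update (fun j => ginv g z (I j) (J j)) k
        (-∑ l, chris g z (I k) m l * ginv g z l (J k)) i
        = ∏ i ∈ {k}ᶜ, ginv g z (update I k l i) (J i) := by
      refine Finset.prod_congr rfl fun i hi => ?_
      have : i ≠ k := by simpa using hi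
      rw [Function.update_of_ne this, Function.update_of_ne this]
    rw [h3]; ring
  simp only [raise]
  rw [wd_eq_dz, wirt_sum _ fun J _ => (hp J).fun_mul (hcc J)]
  simp_rw [h1]
  rw [sum_neg_distrib, sum_comm]
  congr 1
  refine sum_ext fun k => ?_
  refine sum_comm_ext fun l => ?_
  rw [mul_sum]

theorem sum_wd_det_raise (h : IsKahlerOn g Ω) (hz : z ∈ Ω) {c : Cn n → (Fin (q + 1) → Fin n) → ℂ}
    (hc : ∀ J, DifferentiableAt ℂ (fun z => c z J) z) (hcs : ∀ J, SmOn (fun z => c z J) Ω)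
    (halt : ∀ (I : Fin (q + 1) → Fin n) (τ : Perm (Fin (q + 1))),
      raise (ginv g z) (c z) (I ∘ τ) = ((τ.sign : ℤ) : ℂ) * raise (ginv g z) (c z) I)
    (I : Fin q → Fin n) :
    ∑ i, wd i (fun y => (g y).det * raise (ginv g y) (c y) (Fin.cons i I)) z = 0 := by
  set B := raise (ginv g z) (c z) with hB
  have h1 : ∀ i, wd i (fun y => (g y).det * raise (ginv g y) (c y) (Fin.cons i I)) z
      = (g z).det * (∑ l, chris g z l i l * B (Fin.cons i I) - ∑ l, chris g z i i l * B (Fin.cons l I)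
        - ∑ k : Fin q, ∑ l, chris g z (I k) i l * B (Fin.cons i (update I k l))) := by
    intro i
    have e1 := h.wd_det hz i
    have e2 := h.wd_raise hz hc i (Fin.cons i I)
    rw [wd_eq_dz] at e1 e2 ⊢
    rw [wirt_mul (h.smOn_det z hz).diff (h.smOn_raise hcs _ z hz).diff, e1, e2, ← sum_mul,
      Fin.sum_univ_succ]
    simp only [Fin.cons_zero, Fin.cons_succ, Fin.update_cons_zero, ← Fin.cons_update]
    rw [← hB]
    ring
  simp_rw [h1]
  rw [← mul_sum, sum_sub_distrib, sum_sub_distrib]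
  have h2 : ∑ i, ∑ l, chris g z l i l * B (Fin.cons i I) = ∑ i, ∑ l, chris g z i i l * B (Fin.cons l I) := by
    refine sum_comm_ext fun i => sum_ext fun l => ?_
    rw [h.chris_symm hz]
  have h3 : ∀ k : Fin q, ∑ i, ∑ l, chris g z (I k) i l * B (Fin.cons i (update I k l)) = 0 := by
    intro k
    have h4 : ∀ i l, B (Fin.cons l (update I k i)) = -B (Fin.cons i (update I k l)) := by
      intro i l
      have := halt (Fin.cons i (update I k l)) (Equiv.swap 0 k.succ)
      rw [Perm.sign_swap (Fin.succ_ne_zero k).symm] at this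
      have e : (Fin.cons i (update I k l) : Fin (q + 1) → Fin n) ∘ Equiv.swap 0 k.succ
          = Fin.cons l (update I k i) := by
        funext a
        refine Fin.cases ?_ (fun b => ?_) a
        · simp
        · by_cases hb : b = k
          · subst hb; simp [-Fin.cons_update]
          · have : b.succ ≠ k.succ := fun hh => hb (Fin.succ_injective _ hh)
            simp [Equiv.swap_apply_of_ne_of_ne (Fin.succ_ne_zero b) this, hb]
      rw [e] at this
      simpa using this
    have h5 : ∑ i, ∑ l, chris g z (I k) i l * B (Fin.cons i (update I k l))
        = -∑ i, ∑ l, chris g z (I k) i l * B (Fin.cons i (update I k l)) := by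
      conv_lhs => rw [sum_comm]
      rw [← sum_neg_distrib]
      refine sum_ext fun i => ?_
      rw [← sum_neg_distrib]
      refine sum_ext fun l => ?_
      rw [h.chris_symm hz, h4 i l]; ring
    exact self_eq_neg.1 h5
  rw [h2, sub_self, zero_sub, sum_comm, sum_eq_zero fun k _ => h3 k, neg_zero, mul_zero]

end IsKahlerOn

/-! ### The matrix of the Levi form on `η ∧ Tₓ*` -/

/-- The components of a form. -/
def ec (η : LocalForm n p) (z : Cn n) (J : Fin p → Fin n) : ℂ := η z fun k => stdB n (J k)

/-- A decomposable holomorphic form. -/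
structure IsDecompOn (g : LocalMatrix n) (η : LocalForm n p)
    (Ω : Set (Cn n)) : Prop where
  holo : ∀ J, ∀ z ∈ Ω, ContDiffAt ℂ ω (fun z => ec η z J) z
  decomp : ∀ z ∈ Ω, ∃ (v : Fin p → Cn n) (t : ℂ), IsOrtho (sesq (g z)) v ∧
    η z = t • wedge (dualFam (sesq (g z)) v)

/-- The components of `∂η` (for `none`) and of `dzⁱ ⊗ η` (for `some i`). -/
def arr (η : LocalForm n p) (z : Cn n) :
    Option (Fin n) → (Fin (p + 1) → Fin n) → ℂ
  | none => fun I => wd (I 0) (fun y => ec η y (Fin.tail I)) z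
  | some i => fun I => if I 0 = i then ec η z (Fin.tail I) else 0

/-- The pairings of the `(p+1)`-forms `∂η`, `dzⁱ ∧ η`, times the volume density. -/
def pm (g : LocalMatrix n) (η : LocalForm n p)
    (μ ν : Option (Fin n)) (z : Cn n) : ℂ :=
  ((p.factorial : ℂ) ^ 2)⁻¹ * ((g z).det * apair (ginv g z) (arr η z μ) (aalt (arr η z ν)))

/-- The squared norm of `η`. -/
def nrm (g : LocalMatrix n) (η : LocalForm n p) (z : Cn n) : ℝ :=
  ((p.factorial : ℂ)⁻¹ * apair (ginv g z) (ec η z) (ec η z)).re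

theorem sum_fin_cons {M : Type*} [AddCommMonoid M] (F : (Fin (p + 1) → Fin n) → M) :
    ∑ I, F I = ∑ i, ∑ J : Fin p → Fin n, F (Fin.cons i J) := by
  rw [← Equiv.sum_comp (Fin.consEquiv fun _ => Fin n), Fintype.sum_prod_type]
  rfl

theorem contDiffAt_wd_holomorphic {F : Cn n → ℂ} (hF : ContDiffAt ℂ ω F z) (i : Fin n) :
    ContDiffAt ℂ ω (wd i F) z := by
  have h1 : ContDiffAt ℂ ω (fun y => fderiv ℂ F y (Pi.single i 1)) z :=
    (hF.fderiv_right (m := ω) (by simp)).clm_apply contDiffAt_const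
  refine h1.congr_of_eventuallyEq ?_
  filter_upwards [hF.eventually (by simp)] with y hy
  rw [wd_eq_dz, dz_holomorphic (hy.differentiableAt (by simp))]

theorem sm_of_holo {F : Cn n → ℂ} (hF : ContDiffAt ℂ ω F z) : Sm F z :=
  (hF.restrict_scalars ℝ).of_le le_top

namespace IsDecompOn

theorem holo_arr (hη : IsDecompOn g η Ω) (hz : z ∈ Ω) (μ : Option (Fin n)) (I : Fin (p + 1) → Fin n) :
    ContDiffAt ℂ ω (fun y => arr η y μ I) z := by
  rcases μ with - | i
  · exact contDiffAt_wd_holomorphic (hη.holo _ z hz) _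
  · by_cases h : I 0 = i
    · simpa only [arr, if_pos h] using hη.holo _ z hz
    · simpa only [arr, if_neg h] using contDiffAt_const

theorem holo_aalt (hη : IsDecompOn g η Ω) (hz : z ∈ Ω) (μ : Option (Fin n)) (I : Fin (p + 1) → Fin n) :
    ContDiffAt ℂ ω (fun y => aalt (arr η y μ) I) z :=
  ContDiffAt.sum fun _ _ => contDiffAt_const.mul (hη.holo_arr hz μ _)

theorem smOn_pm (hη : IsDecompOn g η Ω) (h : IsKahlerOn g Ω) (μ ν : Option (Fin n)) :
    SmOn (pm g η μ ν) Ω := fun z hz =>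
  contDiffAt_const.mul ((h.smOn_det z hz).mul (ContDiffAt.sum fun I _ =>
    (sm_of_holo (hη.holo_arr hz μ I)).mul (h.smOn_raise (fun J _ hz => sm_of_holo (hη.holo_aalt hz ν J)) I z hz)))

theorem sum_wd_pm (hη : IsDecompOn g η Ω) (h : IsKahlerOn g Ω) (hz : z ∈ Ω) (ν : Option (Fin n)) :
    ∑ i, wd i (pm g η (some i) ν) z = pm g η none ν z := by
  set B : Cn n → (Fin (p + 1) → Fin n) → ℂ := fun y => raise (ginv g y) (aalt (arr η y ν)) with hB
  have hBs : ∀ I, Sm (fun y => (g y).det * B y I) z := fun I =>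
    (h.smOn_det z hz).mul (h.smOn_raise (fun J _ hz => sm_of_holo (hη.holo_aalt hz ν J)) I z hz)
  have h1 : ∀ i, pm g η (some i) ν = fun y => ((p.factorial : ℂ) ^ 2)⁻¹ *
      ∑ J : Fin p → Fin n, ec η y J * ((g y).det * B y (Fin.cons i J)) := by
    intro i
    funext y
    rw [pm, apair, sum_fin_cons, sum_eq_single i, mul_sum]
    · congr 1
      refine sum_ext fun J => ?_
      simp [arr, hB]; ring
    · intro j _ hj
      exact sum_eq_zero fun J _ => by simp [arr, hj]
    · simp
  have h2 : ∀ i, wd i (pm g η (some i) ν) z = ((p.factorial : ℂ) ^ 2)⁻¹ *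
      ∑ J : Fin p → Fin n, (wd i (fun y => ec η y J) z * ((g z).det * B z (Fin.cons i J))
        + ec η z J * wd i (fun y => (g y).det * B y (Fin.cons i J)) z) := by
    intro i
    have hd : ∀ J : Fin p → Fin n, DifferentiableAt ℝ (fun y => ec η y J) z := fun J =>
      (sm_of_holo (hη.holo J z hz)).diff
    rw [h1, wd_eq_dz, wirt_const_mul _ (.fun_sum fun J _ => (hd J).fun_mul (hBs _).diff),
      wirt_sum _ fun J _ => (hd J).fun_mul (hBs _).diff]
    congr 1
    refine sum_ext fun J => ?_
    rw [wirt_mul (hd J) (hBs _).diff, wd_eq_dz, wd_eq_dz]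
  rw [sum_ext fun i => h2 i, ← mul_sum]
  simp_rw [sum_add_distrib]
  have h3 : ∑ i, ∑ J : Fin p → Fin n, ec η z J * wd i (fun y => (g y).det * B y (Fin.cons i J)) z = 0 := by
    rw [sum_comm]
    refine sum_eq_zero fun J _ => ?_
    rw [← mul_sum, h.sum_wd_det_raise hz
      (fun J => (hη.holo_aalt hz ν J).differentiableAt (by simp))
      (fun J _ hz => sm_of_holo (hη.holo_aalt hz ν J)) (fun I τ => raise_comp _ _ _ _), mul_zero]
  rw [h3, add_zero, pm, apair, sum_fin_cons]
  simp_rw [mul_sum]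
  refine sum_ext fun i => sum_ext fun J => ?_
  simp only [arr, hB, Fin.cons_zero, Fin.tail_cons]; ring

end IsDecompOn

theorem exists_gram_pm (h : IsKahlerOn g Ω) (hz : z ∈ Ω) :
    ∃ f : Option (Fin n) → (Fin (p + 1) → Fin n) → ℂ,
      ∀ μ ν, pm g η μ ν z = ∑ K, f μ K * conj (f ν K) := by
  obtain ⟨o, ho⟩ := h.exists_ortho hz
  obtain ⟨hV, hV'⟩ := h.det_pos hz
  set c : ℝ := ((p.factorial : ℝ) ^ 2)⁻¹ * (g z).det.re * ((p + 1).factorial : ℝ)⁻¹ with hc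
  have hc0 : 0 ≤ c := by positivity
  refine ⟨fun μ K => Real.sqrt c * hat (Matrix.of fun k i => (stdB n).repr (o k) i)
    (aalt (arr η z μ)) K, fun μ ν => ?_⟩
  rw [pm, apair_aalt (A := Matrix.of fun k i => (stdB n).repr (o k) i) fun i j => by
    rw [← gramInvOf_sesq, gramInvOf_eq _ ho]; rfl]
  have h1 : ((Real.sqrt c : ℝ) : ℂ) * (Real.sqrt c : ℝ) = ((p.factorial : ℂ) ^ 2)⁻¹ * (g z).det *
      ((p + 1).factorial : ℂ)⁻¹ := by
    rw [← ofReal_mul, Real.mul_self_sqrt hc0, hV', hc]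
    push_cast; simp
  rw [← mul_assoc, ← mul_assoc, ← h1, mul_sum]
  refine sum_ext fun K => ?_
  rw [map_mul, conj_ofReal]; ring

theorem conj_pm (h : IsKahlerOn g Ω) (hz : z ∈ Ω) (μ ν : Option (Fin n)) :
    conj (pm g η μ ν z) = pm g η ν μ z := by
  obtain ⟨f, hf⟩ := exists_gram_pm (η := η) h hz
  simp [hf, mul_comm]

theorem hat_arr_some (o : Fin n → Cn n) (i : Fin n) (K : Fin (p + 1) → Fin n) :
    hat (Matrix.of fun k i => (stdB n).repr (o k) i) (arr η z (some i)) K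
      = o (K 0) i * η z fun k => o (Fin.tail K k) := by
  have := hat_multilinear (stdB n) o (η z).toMultilinearMap (Fin.tail K)
  rw [AlternatingMap.coe_multilinearMap] at this
  rw [← this, hat, sum_fin_cons, sum_eq_single i, hat, mul_sum]
  · refine sum_ext fun J => ?_
    rw [Fin.prod_univ_succ]
    simp [arr, ec, Fin.tail]; ring
  · intro j _ hj
    exact sum_eq_zero fun J _ => by simp [arr, hj]
  · simp

theorem pm_some_some (h : IsKahlerOn g Ω) (hz : z ∈ Ω) {o : Fin n → Cn n} (ho : IsOrtho (sesq (g z)) o)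
    {v : Fin p → Cn n} {t : ℂ} (hv : IsOrtho (sesq (g z)) v)
    (ht : η z = t • wedge (dualFam (sesq (g z)) v)) (i j : Fin n) :
    pm g η (some i) (some j) z = (g z).det * (‖t‖ ^ 2 : ℝ) *
      (∑ r, o r i * conj (o r j) - ∑ k, v k i * conj (v k j)) := by
  rw [pm, apair_aalt (A := Matrix.of fun k i => (stdB n).repr (o k) i) fun i j => by
    rw [← gramInvOf_sesq, gramInvOf_eq _ ho]; rfl]
  simp_rw [hat_aalt]
  have h1 : ∀ i, hat (Matrix.of fun k i => (stdB n).repr (o k) i) (arr η z (some i))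
      = fun K : Fin (p + 1) → Fin n => (LinearMap.proj i : Cn n →ₗ[ℂ] ℂ) (o (K 0))
        * (t • wedge (dualFam (sesq (g z)) v)) fun k => o (Fin.tail K k) := fun i => by
    funext K
    rw [hat_arr_some, ht]; rfl
  simp_rw [h1]
  rw [sum_aalt_tensor (h.herm z hz) (by simp) ho hv]
  simp only [LinearMap.proj_apply]
  have h2 : ((p + 1).factorial : ℂ) ≠ 0 := by exact_mod_cast (p + 1).factorial_ne_zero
  have h3 : (p.factorial : ℂ) ≠ 0 := by exact_mod_cast p.factorial_ne_zero
  field_simp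

theorem apair_ec (h : IsKahlerOn g Ω) (hz : z ∈ Ω) {v : Fin p → Cn n} {t : ℂ}
    (hv : IsOrtho (sesq (g z)) v) (ht : η z = t • wedge (dualFam (sesq (g z)) v)) :
    (p.factorial : ℂ)⁻¹ * apair (ginv g z) (ec η z) (ec η z) = (‖t‖ ^ 2 : ℝ) := by
  obtain ⟨o, ho⟩ := h.exists_ortho hz
  have h1 := apair_multilinear (stdB n) ho (η z).toMultilinearMap (η z).toMultilinearMap
  rw [gramInvOf_sesq, AlternatingMap.coe_multilinearMap, ht,
    sum_normSq_decomposable (h.herm z hz) (by simp) ho hv, ← ht] at h1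
  have h3 : (p.factorial : ℂ) ≠ 0 := by exact_mod_cast p.factorial_ne_zero
  rw [show apair (ginv g z) (ec η z) (ec η z) = _ from h1, inv_mul_cancel_left₀ h3]

theorem nrm_eq (h : IsKahlerOn g Ω) (hz : z ∈ Ω) {v : Fin p → Cn n} {t : ℂ}
    (hv : IsOrtho (sesq (g z)) v) (ht : η z = t • wedge (dualFam (sesq (g z)) v)) :
    nrm g η z = ‖t‖ ^ 2 := by
  rw [nrm, apair_ec h hz hv ht, ofReal_re]

namespace IsDecompOn

theorem nrm_nonneg (hη : IsDecompOn g η Ω) (h : IsKahlerOn g Ω) (hz : z ∈ Ω) : 0 ≤ nrm g η z := by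
  obtain ⟨v, t, hv, ht⟩ := hη.decomp z hz
  rw [nrm_eq h hz hv ht]; positivity

theorem smOn_nrm (hη : IsDecompOn g η Ω) (h : IsKahlerOn g Ω) (hz : z ∈ Ω) :
    ContDiffAt ℝ ∞ (nrm g η) z :=
  reCLM.contDiff.contDiffAt.comp z (contDiffAt_const.mul (ContDiffAt.sum fun I _ =>
    (sm_of_holo (hη.holo I z hz)).mul (h.smOn_raise (fun J z hz => sm_of_holo (hη.holo J z hz)) I z hz)))

end IsDecompOn

/-- The components of `∑ |t|² v_k ⊗ v̄_k` for `η = t e₁ ∧ ⋯ ∧ e_p`. -/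
def qm (g : LocalMatrix n) (η : LocalForm n p) (i j : Fin n)
    (z : Cn n) : ℂ :=
  nrm g η z * ginv g z i j - ((g z).det)⁻¹ * pm g η (some i) (some j) z

theorem ginv_eq {o : Fin n → Cn n} (ho : IsOrtho (sesq (g z)) o)
    (i j : Fin n) : ginv g z i j = ∑ r, o r i * conj (o r j) := by
  rw [← gramInvOf_sesq, gramInvOf_eq _ ho]
  simp

theorem qm_eq (h : IsKahlerOn g Ω) (hz : z ∈ Ω) {v : Fin p → Cn n} {t : ℂ}
    (hv : IsOrtho (sesq (g z)) v) (ht : η z = t • wedge (dualFam (sesq (g z)) v)) (i j : Fin n) :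
    qm g η i j z = (‖t‖ ^ 2 : ℝ) * ∑ k, v k i * conj (v k j) := by
  obtain ⟨o, ho⟩ := h.exists_ortho hz
  rw [qm, nrm_eq h hz hv ht, pm_some_some h hz ho hv ht, ginv_eq ho]
  have := h.det_ne_zero hz
  field_simp
  ring

theorem IsDecompOn.smOn_qm (hη : IsDecompOn g η Ω) (h : IsKahlerOn g Ω) (i j : Fin n) :
    SmOn (qm g η i j) Ω := fun z hz =>
  ((Sm.ofReal (hη.smOn_nrm h hz)).mul (h.smOn_ginv i j z hz)).sub
    (((h.smOn_det z hz).inv (h.det_ne_zero hz)).mul (hη.smOn_pm h _ _ z hz))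

/-! ### The Levi form paired with `η ∧ η̄` -/

theorem wd_mul {F H : Cn n → ℂ} (i : Fin n) (hF : DifferentiableAt ℝ F z)
    (hH : DifferentiableAt ℝ H z) :
    wd i (fun y => F y * H y) z = wd i F z * H z + F z * wd i H z := by
  simp only [wd_eq_dz, wirt_mul hF hH]

theorem wdBar_mul {F H : Cn n → ℂ} (i : Fin n) (hF : DifferentiableAt ℝ F z)
    (hH : DifferentiableAt ℝ H z) :
    wdBar i (fun y => F y * H y) z = wdBar i F z * H z + F z * wdBar i H z := by
  simp only [wdBar_eq_dzb, wirt_mul hF hH]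

theorem wd_sum {ι : Type*} (s : Finset ι) {F : ι → Cn n → ℂ} (i : Fin n)
    (hF : ∀ k ∈ s, DifferentiableAt ℝ (F k) z) :
    wd i (fun y => ∑ k ∈ s, F k y) z = ∑ k ∈ s, wd i (F k) z := by
  simp only [wd_eq_dz, wirt_sum s hF]

theorem wdBar_sum {ι : Type*} (s : Finset ι) {F : ι → Cn n → ℂ} (i : Fin n)
    (hF : ∀ k ∈ s, DifferentiableAt ℝ (F k) z) :
    wdBar i (fun y => ∑ k ∈ s, F k y) z = ∑ k ∈ s, wdBar i (F k) z := by
  simp only [wdBar_eq_dzb, wirt_sum s hF]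

theorem wd_congr {F H : Cn n → ℂ} (i : Fin n) (h : F =ᶠ[nhds z] H) : wd i F z = wd i H z := by
  simp only [wd_eq_dz, wirt_congr h]

theorem wdBar_congr {F H : Cn n → ℂ} (i : Fin n) (h : F =ᶠ[nhds z] H) : wdBar i F z = wdBar i H z := by
  simp only [wdBar_eq_dzb, wirt_congr h]

theorem Sm.mul {F H : Cn n → ℂ} (hF : Sm F z) (hH : Sm H z) : Sm (fun y => F y * H y) z :=
  ContDiffAt.mul hF hH

theorem Sm.wd {F : Cn n → ℂ} (h : Sm F z) (i : Fin n) : Sm (BochnerRatio.wd i F) z := by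
  have : BochnerRatio.wd i F = dz (Pi.single i 1) F := funext fun y => wd_eq_dz i F y
  rw [this]; exact h.wirt _ _

theorem Sm.wdBar {F : Cn n → ℂ} (h : Sm F z) (i : Fin n) : Sm (BochnerRatio.wdBar i F) z := by
  have : BochnerRatio.wdBar i F = dzb (Pi.single i 1) F := funext fun y => wdBar_eq_dzb i F y
  rw [this]; exact h.wirt _ _

theorem wdBar_wd_comm {F : Cn n → ℂ} (h : Sm F z) (i j : Fin n) :
    wdBar j (wd i F) z = wd i (wdBar j F) z := by
  have h1 : BochnerRatio.wd i F = dz (Pi.single i 1) F := funext fun y => wd_eq_dz i F y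
  have h2 : BochnerRatio.wdBar j F = dzb (Pi.single j 1) F := funext fun y => wdBar_eq_dzb j F y
  rw [h1, h2, wdBar_eq_dzb, wd_eq_dz, wirt_comm h]

theorem wdBar_conj {F : Cn n → ℂ} (i : Fin n) (hF : DifferentiableAt ℝ F z) :
    wdBar i (fun y => conj (F y)) z = conj (wd i F z) := by
  rw [wdBar_eq_dzb, wd_eq_dz, dzb_conj hF]

theorem wdBar_ofReal (i : Fin n) (hu : DifferentiableAt ℝ u z) :
    wdBar i (fun y => (u y : ℂ)) z = conj (wd i (fun y => (u y : ℂ)) z) := by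
  rw [wdBar_eq_dzb, wd_eq_dz, dzb_eq_conj_dz hu]

/-- The divergence of `u ⟨dzⁱ ∧ η, dzʲ ∧ η⟩`. -/
def leviDiv (g : LocalMatrix n) (η : LocalForm n p)
    (u : Cn n → ℝ) (j : Fin n) (z : Cn n) : ℂ :=
  ∑ i, wd i (fun y => (u y : ℂ) * pm g η (some i) (some j) y) z

/-- The density of `√-1 ∂∂̄ (u η ∧ η̄)`. -/
def leviDen (g : LocalMatrix n) (η : LocalForm n p)
    (u : Cn n → ℝ) (z : Cn n) : ℂ :=
  ∑ j, wdBar j (leviDiv g η u j) z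

theorem leviDiv_eq (hη : IsDecompOn g η Ω) (h : IsKahlerOn g Ω) (hz : z ∈ Ω)
    (hu : DifferentiableAt ℝ (fun y => (u y : ℂ)) z) (j : Fin n) :
    leviDiv g η u j z = ∑ i, wd i (fun y => (u y : ℂ)) z * pm g η (some i) (some j) z
      + u z * pm g η none (some j) z := by
  rw [← hη.sum_wd_pm h hz, mul_sum, ← sum_add_distrib]
  exact sum_ext fun i => wd_mul i hu (hη.smOn_pm h _ _ z hz).diff

theorem sum_wdBar_pm (hη : IsDecompOn g η Ω) (h : IsKahlerOn g Ω) (hz : z ∈ Ω)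
    (μ : Option (Fin n)) : ∑ j, wdBar j (pm g η μ (some j)) z = pm g η μ none z := by
  rw [← conj_pm h hz, ← hη.sum_wd_pm h hz, map_sum]
  refine sum_ext fun j => ?_
  rw [← wdBar_conj j (hη.smOn_pm h _ _ z hz).diff]
  refine wdBar_congr j ?_
  filter_upwards [h.isOpen.mem_nhds hz] with y hy using (conj_pm h hy _ _).symm

theorem sum_wdBar_mul_pm (hη : IsDecompOn g η Ω) (h : IsKahlerOn g Ω) (hz : z ∈ Ω)
    (hu : DifferentiableAt ℝ (fun y => (u y : ℂ)) z) (i : Fin n) :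
    ∑ j, wdBar j (fun y => (u y : ℂ) * pm g η (some i) (some j) y) z = conj (leviDiv g η u i z) := by
  rw [leviDiv, map_sum]
  refine sum_ext fun j => ?_
  rw [← wdBar_conj j (hu.fun_mul (hη.smOn_pm h _ _ z hz).diff)]
  refine wdBar_congr j ?_
  filter_upwards [h.isOpen.mem_nhds hz] with y hy
  rw [map_mul, conj_pm h hy, conj_ofReal]

theorem leviDen_eq_sum (hη : IsDecompOn g η Ω) (h : IsKahlerOn g Ω) (hz : z ∈ Ω)
    (hu : ContDiffAt ℝ ∞ u z) :
    leviDen g η u z = ∑ i, ∑ j, wdBar j (wd i fun y => (u y : ℂ) * pm g η (some i) (some j) y) z := by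
  rw [leviDen, sum_comm]
  refine sum_ext fun j => ?_
  exact wdBar_sum _ j fun i _ => ((Sm.mul (Sm.ofReal hu) (hη.smOn_pm h _ _ z hz)).wd i).diff

theorem leviDen_eq (hη : IsDecompOn g η Ω) (h : IsKahlerOn g Ω) (hz : z ∈ Ω)
    (hu : ContDiffAt ℝ ∞ u z) :
    leviDen g η u z
      = ∑ i, ∑ j, wd i (wdBar j fun y => (u y : ℂ)) z * pm g η (some i) (some j) z
        + ∑ i, wd i (fun y => (u y : ℂ)) z * pm g η (some i) none z
        + ∑ j, conj (wd j (fun y => (u y : ℂ)) z) * pm g η none (some j) z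
        + u z * pm g η none none z := by
  have hU := Sm.ofReal hu
  have hud : DifferentiableAt ℝ u z := hu.differentiableAt (by simp)
  have h1 : ∀ j, wdBar j (leviDiv g η u j) z
      = ∑ i, (wd i (wdBar j fun y => (u y : ℂ)) z * pm g η (some i) (some j) z
        + wd i (fun y => (u y : ℂ)) z * wdBar j (pm g η (some i) (some j)) z)
        + (conj (wd j (fun y => (u y : ℂ)) z) * pm g η none (some j) z
          + u z * wdBar j (pm g η none (some j)) z) := by
    intro j
    have h2 : leviDiv g η u j =ᶠ[nhds z] fun y =>
        ∑ i, wd i (fun y => (u y : ℂ)) y * pm g η (some i) (some j) y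
          + u y * pm g η none (some j) y := by
      filter_upwards [h.isOpen.mem_nhds hz, hU.eventually] with y hy hyu using
        leviDiv_eq hη h hy hyu j
    have d1 : ∀ i ∈ Finset.univ, DifferentiableAt ℝ
        (fun y => wd i (fun y => (u y : ℂ)) y * pm g η (some i) (some j) y) z := fun i _ =>
      (Sm.mul (hU.wd i) (hη.smOn_pm h _ _ z hz)).diff
    rw [wdBar_congr j h2, wdBar_eq_dzb, wirt_add (.fun_sum d1)
      (Sm.mul hU (hη.smOn_pm h _ _ z hz)).diff, ← wdBar_eq_dzb, ← wdBar_eq_dzb, wdBar_sum _ j d1,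
      wdBar_mul j hU.diff (hη.smOn_pm h _ _ z hz).diff, wdBar_ofReal j hud]
    congr 1
    refine sum_ext fun i => ?_
    rw [wdBar_mul j (hU.wd i).diff (hη.smOn_pm h _ _ z hz).diff, wdBar_wd_comm hU]
  rw [leviDen, sum_ext fun j => h1 j]
  simp only [sum_add_distrib, ← mul_sum]
  rw [sum_wdBar_pm hη h hz, sum_comm]
  nth_rw 2 [sum_comm]
  simp only [← mul_sum, sum_wdBar_pm hη h hz]
  ring

theorem dz_dzb_eq_sum {F : Cn n → ℂ} (hF : Sm F z) (v w : Cn n) :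
    dz v (dzb w F) z = ∑ i, ∑ j, v i * conj (w j) * wd i (wdBar j F) z := by
  rw [dz_eq_sum]
  refine sum_ext fun i => ?_
  have h1 : dzb w F =ᶠ[nhds z] fun y => ∑ j, conj (w j) * wdBar j F y := by
    filter_upwards [hF.eventually] with y hy using dzb_eq_sum hy w
  rw [wd_congr i h1, wd_sum _ i fun j _ => (hF.wdBar j).diff.const_mul _, mul_sum]
  refine sum_ext fun j => ?_
  rw [wd_eq_dz, wirt_const_mul _ (hF.wdBar j).diff, wd_eq_dz]
  ring

theorem leviDen_gram (hη : IsDecompOn g η Ω) (h : IsKahlerOn g Ω) (hz : z ∈ Ω)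
    (hu : ContDiffAt ℝ ∞ u z) {f : Option (Fin n) → (Fin (p + 1) → Fin n) → ℂ}
    (hf : ∀ μ ν, pm g η μ ν z = ∑ K, f μ K * conj (f ν K)) :
    leviDen g η u z = ∑ K, (dz (fun i => f (some i) K) (dzb (fun i => f (some i) K) fun y => (u y : ℂ)) z
      + dz (fun i => f (some i) K) (fun y => (u y : ℂ)) z * conj (f none K)
      + conj (dz (fun i => f (some i) K) (fun y => (u y : ℂ)) z * conj (f none K))
      + (‖f none K‖ ^ 2 : ℝ) * u z) := by
  rw [leviDen_eq hη h hz hu]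
  simp only [hf, sum_add_distrib]
  congr 1
  · congr 1
    · congr 1
      · simp_rw [dz_dzb_eq_sum (Sm.ofReal hu)]
        simp_rw [mul_sum]
        refine sum_ext_comm fun i => ?_
        refine sum_ext_comm fun j => sum_ext fun K => ?_
        ring
      · simp_rw [dz_eq_sum, mul_sum, sum_mul]
        refine sum_comm_ext fun i => sum_ext fun K => ?_
        ring
    · simp_rw [dz_eq_sum, mul_sum, sum_mul, map_sum]
      refine sum_comm_ext fun i => sum_ext fun K => ?_
      simp; ring
  · rw [mul_sum]
    refine sum_ext fun K => ?_
    rw [mul_conj, normSq_eq_norm_sq]; ring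

theorem leviDen_re (hη : IsDecompOn g η Ω) (h : IsKahlerOn g Ω) (hz : z ∈ Ω)
    (hu : ContDiffAt ℝ ∞ u z) {f : Option (Fin n) → (Fin (p + 1) → Fin n) → ℂ}
    (hf : ∀ μ ν, pm g η μ ν z = ∑ K, f μ K * conj (f ν K)) :
    (leviDen g η u z).re = ∑ K,
      ((dz (fun i => f (some i) K) (dzb (fun i => f (some i) K) fun y => (u y : ℂ)) z).re
      + 2 * (conj (f none K) * dz (fun i => f (some i) K) (fun y => (u y : ℂ)) z).re
      + ‖f none K‖ ^ 2 * u z) := by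
  rw [leviDen_gram hη h hz hu hf, re_sum]
  refine sum_ext fun K => ?_
  rw [add_re, add_re, add_re, conj_re, re_ofReal_mul, ofReal_re, mul_comm (conj (f none K))]
  ring

theorem leviDen_nonneg (hη : IsDecompOn g η Ω) (h : IsKahlerOn g Ω) (hz : z ∈ Ω)
    (hu : ContDiffAt ℝ ∞ u z) (hl : LogPshAt u z) : 0 ≤ (leviDen g η u z).re := by
  obtain ⟨f, hf⟩ := exists_gram_pm (η := η) h hz
  rw [leviDen_re hη h hz hu hf]
  exact sum_nonneg fun K _ => hl _ _

theorem norm_leviDiv_sq_le (hη : IsDecompOn g η Ω) (h : IsKahlerOn g Ω) (hz : z ∈ Ω)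
    (hu : ContDiffAt ℝ ∞ u z) (h0 : 0 ≤ u z) (hl : LogPshAt u z) (j : Fin n) :
    ‖leviDiv g η u j z‖ ^ 2 ≤ u z * (leviDen g η u z).re * ‖pm g η (some j) (some j) z‖ := by
  obtain ⟨f, hf⟩ := exists_gram_pm (η := η) h hz
  set a : (Fin (p + 1) → Fin n) → ℂ := fun K =>
    dz (fun i => f (some i) K) (fun y => (u y : ℂ)) z + f none K * u z with ha
  have h1 : leviDiv g η u j z = ∑ K, a K * conj (f (some j) K) := by
    rw [leviDiv_eq hη h hz (Sm.ofReal hu).diff]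
    simp_rw [ha, hf, dz_eq_sum, add_mul, sum_add_distrib, mul_sum, sum_mul]
    rw [sum_comm]
    congr 1
    · refine sum_ext fun i => sum_ext fun K => ?_
      ring
    · refine sum_ext fun K => ?_
      ring
  have h2 : ∑ K, ‖f (some j) K‖ ^ 2 = ‖pm g η (some j) (some j) z‖ := by
    rw [hf]
    simp_rw [mul_conj, normSq_eq_norm_sq]
    rw [← ofReal_sum, norm_real, norm_of_nonneg (by positivity)]
  have h3 : ∑ K, ‖a K‖ ^ 2 ≤ u z * (leviDen g η u z).re := by
    rw [leviDen_re hη h hz hu hf, mul_sum]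
    exact sum_le_sum fun K _ => hl.form_bound h0 _ _
  calc ‖leviDiv g η u j z‖ ^ 2 ≤ (∑ K, ‖a K‖ * ‖f (some j) K‖) ^ 2 := by
        rw [h1]
        gcongr
        refine (norm_sum_le _ _).trans (le_of_eq ?_)
        refine sum_ext fun K => ?_
        rw [norm_mul, RCLike.norm_conj]
    _ ≤ (∑ K, ‖a K‖ ^ 2) * ∑ K, ‖f (some j) K‖ ^ 2 := Finset.sum_mul_sq_le_sq_mul_sq _ _ _
    _ ≤ _ := by rw [h2]; gcongr

theorem wdBar_wd_mul {F θ : Cn n → ℂ} (hF : Sm F z) (hθ : Sm θ z) (i j : Fin n) :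
    wdBar j (wd i fun y => F y * θ y) z = wdBar j (wd i F) z * θ z + wd i F z * wdBar j θ z
      + wdBar j F z * wd i θ z + F z * wd i (wdBar j θ) z := by
  have h2 : (wd i fun y => F y * θ y) =ᶠ[nhds z] fun y => wd i F y * θ y + F y * wd i θ y := by
    filter_upwards [hF.eventually, hθ.eventually] with y h1 h2 using wd_mul i h1 h2
  rw [wdBar_congr j h2, wdBar_eq_dzb, wirt_add (Sm.mul (hF.wd i) hθ).diff
    (Sm.mul hF (hθ.wd i)).diff, ← wdBar_eq_dzb, ← wdBar_eq_dzb,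
    wdBar_mul j (hF.wd i).diff hθ.diff, wdBar_mul j hF.diff (hθ.wd i).diff, wdBar_wd_comm hθ]
  ring

theorem sum_wdBar_wd_mul (hη : IsDecompOn g η Ω) (h : IsKahlerOn g Ω) (hz : z ∈ Ω)
    (hu : ContDiffAt ℝ ∞ u z) {θ : Cn n → ℂ} (hθ : Sm θ z) :
    ∑ i, ∑ j, wdBar j (wd i fun y => (u y : ℂ) * pm g η (some i) (some j) y * θ y) z
      = leviDen g η u z * θ z + ∑ j, leviDiv g η u j z * wdBar j θ z
        + ∑ i, conj (leviDiv g η u i z) * wd i θ z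
        + ∑ i, ∑ j, u z * pm g η (some i) (some j) z * wd i (wdBar j θ) z := by
  have hF : ∀ i j, Sm (fun y => (u y : ℂ) * pm g η (some i) (some j) y) z := fun i j =>
    Sm.mul (Sm.ofReal hu) (hη.smOn_pm h _ _ z hz)
  have e1 : ∑ i, ∑ j, wd i (fun y => (u y : ℂ) * pm g η (some i) (some j) y) z * wdBar j θ z
      = ∑ j, leviDiv g η u j z * wdBar j θ z := by
    rw [sum_comm]
    exact sum_ext fun j => (sum_mul _ _ _).symm
  have e2 : ∑ i, ∑ j, wdBar j (fun y => (u y : ℂ) * pm g η (some i) (some j) y) z * wd i θ z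
      = ∑ i, conj (leviDiv g η u i z) * wd i θ z :=
    sum_ext fun i => by rw [← sum_mul, sum_wdBar_mul_pm hη h hz (Sm.ofReal hu).diff]
  have e3 : ∑ i, ∑ j, wdBar j (wd i fun y => (u y : ℂ) * pm g η (some i) (some j) y) z * θ z
      = leviDen g η u z * θ z := by
    rw [leviDen_eq_sum hη h hz hu, sum_mul]
    exact sum_ext fun i => (sum_mul _ _ _).symm
  rw [sum_ext fun i => sum_ext fun j => wdBar_wd_mul (hF i j) hθ i j, ← e1, ← e2, ← e3]
  simp only [sum_add_distrib]

/-! ### The curvature of a Kähler metric -/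

/-- The components of the curvature tensor. -/
def rm (g : LocalMatrix n) (z : Cn n) (i j k l : Fin n) : ℂ :=
  -wd i (wdBar j fun y => g y k l) z
    + ∑ r, ∑ q, ginv g z r q * wd i (fun y => g y k q) z * wdBar j (fun y => g y r l) z

/-- The curvature tensor. -/
def Rm (g : LocalMatrix n) (z u v w s : Cn n) : ℂ :=
  ∑ i, ∑ j, ∑ k, ∑ l, rm g z i j k l * u i * conj (v j) * w k * conj (s l)

theorem wdBar_metric (h : IsKahlerOn g Ω) (hz : z ∈ Ω) (j k l : Fin n) :
    wdBar j (fun y => g y k l) z = conj (wd j (fun y => g y l k) z) := by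
  rw [← wdBar_conj j (h.smooth l k z hz).diff]
  refine wdBar_congr j ?_
  filter_upwards [h.isOpen.mem_nhds hz] with y hy using (h.symm hy l k).symm

theorem wdBar_kahler (h : IsKahlerOn g Ω) (hz : z ∈ Ω) (j k l : Fin n) :
    wdBar j (fun y => g y k l) z = wdBar l (fun y => g y k j) z := by
  rw [wdBar_metric h hz, wdBar_metric h hz, h.kahler z hz]

theorem rm_swap_left (h : IsKahlerOn g Ω) (hz : z ∈ Ω) (i j k l : Fin n) :
    rm g z i j k l = rm g z k j i l := by
  have h1 : wd i (wdBar j fun y => g y k l) z = wd k (wdBar j fun y => g y i l) z := by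
    rw [← wdBar_wd_comm (h.smooth k l z hz), ← wdBar_wd_comm (h.smooth i l z hz)]
    refine wdBar_congr j ?_
    filter_upwards [h.isOpen.mem_nhds hz] with y hy using h.kahler y hy k l i
  rw [rm, rm, h1]
  congr 1
  refine sum_ext fun r => sum_ext fun q => ?_
  rw [h.kahler z hz k q i]

theorem rm_swap_right (h : IsKahlerOn g Ω) (hz : z ∈ Ω) (i j k l : Fin n) :
    rm g z i j k l = rm g z i l k j := by
  have h1 : wd i (wdBar j fun y => g y k l) z = wd i (wdBar l fun y => g y k j) z := by
    refine wd_congr i ?_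
    filter_upwards [h.isOpen.mem_nhds hz] with y hy using wdBar_kahler h hy j k l
  rw [rm, rm, h1]
  congr 1
  refine sum_ext fun r => sum_ext fun q => ?_
  rw [wdBar_kahler h hz j r l]

theorem Rm_swap_left (h : IsKahlerOn g Ω) (hz : z ∈ Ω) (u v w s : Cn n) :
    Rm g z u v w s = Rm g z w v u s := by
  rw [Rm, Rm]
  calc _ = ∑ i, ∑ k, ∑ j, ∑ l, rm g z i j k l * u i * conj (v j) * w k * conj (s l) :=
        sum_ext fun i => sum_comm
    _ = ∑ k, ∑ i, ∑ j, ∑ l, rm g z i j k l * u i * conj (v j) * w k * conj (s l) := sum_comm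
    _ = ∑ k, ∑ j, ∑ i, ∑ l, rm g z i j k l * u i * conj (v j) * w k * conj (s l) :=
        sum_ext fun i => sum_comm
    _ = _ := by
        refine sum_ext fun i => sum_ext fun j => sum_ext fun k => sum_ext fun l => ?_
        rw [rm_swap_left h hz]; ring

theorem Rm_swap_right (h : IsKahlerOn g Ω) (hz : z ∈ Ω) (u v w s : Cn n) :
    Rm g z u v w s = Rm g z u s w v := by
  rw [Rm, Rm]
  refine sum_ext fun i => ?_
  calc _ = ∑ k, ∑ j, ∑ l, rm g z i j k l * u i * conj (v j) * w k * conj (s l) := sum_comm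
    _ = ∑ k, ∑ l, ∑ j, rm g z i j k l * u i * conj (v j) * w k * conj (s l) :=
        sum_ext fun i => sum_comm
    _ = ∑ l, ∑ k, ∑ j, rm g z i j k l * u i * conj (v j) * w k * conj (s l) := sum_comm
    _ = _ := by
        refine sum_ext fun l => sum_ext fun k => sum_ext fun j => ?_
        rw [rm_swap_right h hz]; ring

theorem sm_det {m : ℕ} {G : Cn n → Matrix (Fin m) (Fin m) ℂ} (hG : ∀ i j, Sm (fun y => G y i j) z) :
    Sm (fun y => (G y).det) z := by
  simp only [Matrix.det_apply']
  exact ContDiffAt.sum fun σ _ => contDiffAt_const.mul (contDiffAt_prod fun i _ => hG _ _)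

theorem sm_adjugate {m : ℕ} {G : Cn n → Matrix (Fin m) (Fin m) ℂ}
    (hG : ∀ i j, Sm (fun y => G y i j) z) (i j : Fin m) : Sm (fun y => (G y).adjugate i j) z := by
  simp only [Matrix.adjugate_apply]
  refine sm_det fun k l => ?_
  simp only [Matrix.updateRow_apply]
  split_ifs
  · exact contDiffAt_const
  · exact hG _ _

theorem levi_det {m : ℕ} {G : Cn n → Matrix (Fin m) (Fin m) ℂ} (hG : ∀ i j, Sm (fun y => G y i j) z)
    (h1 : G z = 1) {v : Cn n} (h0 : ∀ i j, dzb v (fun y => G y i j) z = 0) :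
    dz v (dzb v fun y => (G y).det) z = ∑ i, dz v (dzb v fun y => G y i i) z := by
  have hev : (dzb v fun y => (G y).det) =ᶠ[nhds z]
      fun y => ∑ i, ∑ j, (G y).adjugate i j * dzb v (fun y => G y j i) y := by
    filter_upwards [eventually_all.2 fun i => eventually_all.2 fun j =>
      (hG i j).eventually] with y hy using wirt_det hy
  have hd : ∀ i j, DifferentiableAt ℝ (fun y => (G y).adjugate i j * dzb v (fun y => G y j i) y) z :=
    fun i j => (Sm.mul (sm_adjugate hG i j) ((hG j i).wirt _ _)).diff
  rw [wirt_congr hev, wirt_sum _ fun i _ => .fun_sum fun j _ => hd i j]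
  refine sum_ext fun i => ?_
  rw [wirt_sum _ fun j _ => hd i j, sum_eq_single i]
  · rw [wirt_mul (sm_adjugate hG i i).diff ((hG i i).wirt _ _).diff, h0, h1]
    simp
  · intro j _ hj
    rw [wirt_mul (sm_adjugate hG i j).diff ((hG j i).wirt _ _).diff, h0, h1]
    simp [hj.symm]
  · simp

/-- The covariant derivative `∇_y s`. -/
def covd (g : LocalMatrix n) (y : Cn n) (s : Cn n → Cn n) (z : Cn n) : Cn n :=
  fun i => dz y (fun x => s x i) z + ∑ m, ∑ l, chris g z i m l * y m * s z l

theorem sum_metric_chris (h : IsKahlerOn g Ω) (hz : z ∈ Ω) (y s : Cn n) (l : Fin n) :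
    ∑ i, g z i l * ∑ m, ∑ k, chris g z i m k * y m * s k = ∑ k, dz y (fun x => g x k l) z * s k := by
  have h1 : ∀ m k, ∑ i, g z i l * chris g z i m k = wd m (fun x => g x k l) z := by
    intro m k
    simp_rw [chris, mul_sum]
    rw [sum_comm, sum_eq_single l]
    · simp_rw [← mul_assoc, ← sum_mul, mul_comm (g z _ l)]
      rw [h.sum_ginv_mul hz, if_pos rfl, one_mul]
    · intro r _ hr
      simp_rw [← mul_assoc, ← sum_mul, mul_comm (g z _ l)]
      rw [h.sum_ginv_mul hz, if_neg hr, zero_mul]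
    · simp
  calc _ = ∑ m, ∑ k, (∑ i, g z i l * chris g z i m k) * (y m * s k) := by
        simp_rw [mul_sum, sum_mul]
        refine sum_comm_ext fun m => ?_
        refine sum_comm_ext fun k => sum_ext fun i => ?_
        ring
    _ = _ := by
        simp_rw [h1, dz_eq_sum, sum_mul]
        refine sum_comm_ext fun k => sum_ext fun i => ?_
        ring

theorem dz_holo_conj {F : Cn n → ℂ} (hF : ContDiffAt ℂ ω F z) (v : Cn n) :
    dz v (fun x => conj (F x)) z = 0 := by
  rw [dz_conj (sm_of_holo hF).diff, dzb_holomorphic (hF.differentiableAt (by simp)), map_zero]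

theorem dzb_holo_conj {F : Cn n → ℂ} (hF : ContDiffAt ℂ ω F z) (v : Cn n) :
    dzb v (fun x => conj (F x)) z = conj (dz v F z) :=
  dzb_conj (sm_of_holo hF).diff

theorem sm_sesq (h : IsKahlerOn g Ω) (hz : z ∈ Ω) {s t : Cn n → Cn n}
    (hs : ∀ i, ContDiffAt ℂ ω (fun x => s x i) z) (ht : ∀ i, ContDiffAt ℂ ω (fun x => t x i) z) :
    Sm (fun x => sesq (g x) (s x) (t x)) z := by
  simp only [sesq_apply]
  exact ContDiffAt.sum fun i _ => ContDiffAt.sum fun j _ =>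
    ((h.smooth i j z hz).mul (sm_of_holo (hs i))).mul (sm_of_holo (ht j)).conj

theorem dz_sesq (h : IsKahlerOn g Ω) (hz : z ∈ Ω) {s t : Cn n → Cn n}
    (hs : ∀ i, ContDiffAt ℂ ω (fun x => s x i) z) (ht : ∀ i, ContDiffAt ℂ ω (fun x => t x i) z)
    (y : Cn n) :
    dz y (fun x => sesq (g x) (s x) (t x)) z = sesq (g z) (covd g y s z) (t z) := by
  simp only [sesq_apply]
  have d2 : ∀ i j, Sm (fun x => g x i j * s x i) z := fun i j =>
    Sm.mul (h.smooth i j z hz) (sm_of_holo (hs i))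
  have d3 : ∀ i j, Sm (fun x => g x i j * s x i * conj (t x j)) z := fun i j =>
    Sm.mul (d2 i j) (sm_of_holo (ht j)).conj
  rw [wirt_sum _ fun i _ => .fun_sum fun j _ => (d3 i j).diff]
  have h1 : ∀ i j, dz y (fun x => g x i j * s x i * conj (t x j)) z
      = (dz y (fun x => g x i j) z * s z i + g z i j * dz y (fun x => s x i) z) * conj (t z j) :=
    fun i j => by
      rw [wirt_mul (d2 i j).diff (sm_of_holo (ht j)).conj.diff, dz_holo_conj (ht j),
        wirt_mul (h.smooth i j z hz).diff (sm_of_holo (hs i)).diff]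
      ring
  rw [sum_ext fun i => wirt_sum _ fun j _ => (d3 i j).diff]
  simp_rw [h1]
  rw [sum_comm]
  refine sum_ext_comm fun l => ?_
  rw [← sum_mul, ← sum_mul]
  congr 1
  simp only [covd, mul_add, sum_add_distrib]
  rw [sum_metric_chris h hz y (s z) l]
  ring

theorem dzb_sesq (h : IsKahlerOn g Ω) (hz : z ∈ Ω) {s t : Cn n → Cn n}
    (hs : ∀ i, ContDiffAt ℂ ω (fun x => s x i) z) (ht : ∀ i, ContDiffAt ℂ ω (fun x => t x i) z)
    (y : Cn n) :
    dzb y (fun x => sesq (g x) (s x) (t x)) z = sesq (g z) (s z) (covd g y t z) := by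
  have h1 : (fun x => sesq (g x) (s x) (t x)) =ᶠ[nhds z]
      fun x => conj (sesq (g x) (t x) (s x)) := by
    filter_upwards [h.isOpen.mem_nhds hz] with x hx using ((h.herm x hx).symm _ _).symm
  rw [wirt_congr h1, dzb_conj (sm_sesq h hz ht hs).diff, dz_sesq h hz ht hs, (h.herm z hz).symm]

theorem mul_sum_mul_sum (c : ℂ) (A B : Fin n → Fin n → ℂ) :
    c * (∑ k, ∑ i, A k i) * (∑ l, ∑ j, B l j) = ∑ k, ∑ l, ∑ i, ∑ j, c * A k i * B l j := by
  rw [mul_assoc, sum_mul_sum, mul_sum]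
  refine sum_ext fun k => ?_
  rw [mul_sum]
  refine sum_ext fun l => ?_
  rw [sum_mul_sum, mul_sum]
  refine sum_ext fun i => ?_
  rw [mul_sum]
  refine sum_ext fun j => ?_
  ring

theorem Rm_self (h : IsKahlerOn g Ω) (hz : z ∈ Ω) (y s : Cn n) :
    Rm g z y y s s = -(∑ k, ∑ l, dz y (dzb y fun x => g x k l) z * s k * conj (s l))
      + ∑ r, ∑ q, ginv g z r q * (∑ k, dz y (fun x => g x k q) z * s k)
        * conj (∑ k, dz y (fun x => g x k r) z * s k) := by
  have e1 : ∀ k l, dz y (dzb y fun x => g x k l) z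
      = ∑ i, ∑ j, y i * conj (y j) * wd i (wdBar j fun x => g x k l) z := fun k l =>
    dz_dzb_eq_sum (h.smooth k l z hz) y y
  have e2 : ∀ r, conj (∑ k, dz y (fun x => g x k r) z * s k)
      = ∑ l, ∑ j, conj (y j) * wdBar j (fun x => g x r l) z * conj (s l) := fun r => by
    simp_rw [map_sum, map_mul, dz_eq_sum, map_sum, sum_mul, map_mul, wdBar_metric h hz]
  have e3 : ∀ q, ∑ k, dz y (fun x => g x k q) z * s k
      = ∑ k, ∑ i, y i * wd i (fun x => g x k q) z * s k := fun q => by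
    simp_rw [dz_eq_sum, sum_mul]
  have hL : Rm g z y y s s = ∑ k, ∑ l, ∑ i, ∑ j, rm g z i j k l * y i * conj (y j) * s k * conj (s l) := by
    rw [Rm]
    calc _ = ∑ i, ∑ k, ∑ j, ∑ l, rm g z i j k l * y i * conj (y j) * s k * conj (s l) :=
          sum_ext fun i => sum_comm
      _ = ∑ k, ∑ i, ∑ j, ∑ l, rm g z i j k l * y i * conj (y j) * s k * conj (s l) := sum_comm
      _ = ∑ k, ∑ i, ∑ l, ∑ j, rm g z i j k l * y i * conj (y j) * s k * conj (s l) :=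
          sum_ext fun i => sum_ext fun j => sum_comm
      _ = _ := sum_ext fun i => sum_comm
  have hR : ∑ r, ∑ q, ginv g z r q * (∑ k, ∑ i, y i * wd i (fun x => g x k q) z * s k)
        * (∑ l, ∑ j, conj (y j) * wdBar j (fun x => g x r l) z * conj (s l))
      = ∑ k, ∑ l, ∑ i, ∑ j, (∑ r, ∑ q, ginv g z r q * wd i (fun y => g y k q) z
        * wdBar j (fun y => g y r l) z) * y i * conj (y j) * s k * conj (s l) := by
    have : ∀ r q, ginv g z r q * (∑ k, ∑ i, y i * wd i (fun x => g x k q) z * s k)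
        * (∑ l, ∑ j, conj (y j) * wdBar j (fun x => g x r l) z * conj (s l))
        = ∑ k, ∑ l, ∑ i, ∑ j, ginv g z r q * wd i (fun y => g y k q) z
        * wdBar j (fun y => g y r l) z * y i * conj (y j) * s k * conj (s l) := fun r q => by
      rw [mul_sum_mul_sum]
      refine sum_ext fun k => sum_ext fun l => sum_ext fun i => sum_ext fun j => ?_
      ring
    simp_rw [this, sum_mul]
    have sw : ∀ F : Fin n → Fin n → Fin n → ℂ, ∑ a, ∑ b, ∑ c, F a b c = ∑ c, ∑ a, ∑ b, F a b c :=
      fun F => (sum_ext fun a => sum_comm).trans sum_comm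
    rw [sw]
    refine sum_ext fun k => ?_
    rw [sw]
    refine sum_ext fun l => ?_
    rw [sw]
    refine sum_ext fun i => ?_
    rw [sw]
  simp_rw [e2, e3]
  rw [hR, hL, ← sum_neg_distrib, ← sum_add_distrib]
  refine sum_ext fun k => ?_
  rw [← sum_neg_distrib, ← sum_add_distrib]
  refine sum_ext fun l => ?_
  rw [e1, sum_mul, sum_mul, ← sum_neg_distrib, ← sum_add_distrib]
  refine sum_ext fun i => ?_
  rw [sum_mul, sum_mul, ← sum_neg_distrib, ← sum_add_distrib]
  refine sum_ext fun j => ?_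
  rw [rm]
  ring

theorem levi_sesq (h : IsKahlerOn g Ω) (hz : z ∈ Ω) {s : Cn n → Cn n}
    (hs : ∀ i, ContDiffAt ℂ ω (fun x => s x i) z) (y : Cn n) :
    dz y (dzb y fun x => sesq (g x) (s x) (s x)) z
      = -Rm g z y y (s z) (s z) + sesq (g z) (covd g y s z) (covd g y s z) := by
  set D : Cn n := fun i => dz y (fun x => s x i) z with hD
  set a : Fin n → ℂ := fun l => ∑ k, dz y (fun x => g x k l) z * s z k with ha
  set E : Cn n := fun i => ∑ m, ∑ l, chris g z i m l * y m * s z l with hE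
  have hcov : covd g y s z = D + E := rfl
  have hgE : ∀ w : Cn n, sesq (g z) E w = ∑ l, a l * conj (w l) := by
    intro w
    rw [sesq_apply, sum_comm]
    refine sum_ext fun l => ?_
    rw [← sum_mul, sum_metric_chris h hz y (s z) l]
  have hEr : ∀ r, E r = ∑ q, ginv g z r q * a q := by
    intro r
    simp only [hE, ha, chris, dz_eq_sum, mul_sum, sum_mul]
    calc _ = ∑ m, ∑ q, ∑ k, ginv g z r q * wd m (fun y => g y k q) z * y m * s z k :=
          sum_ext fun m => sum_comm
      _ = ∑ q, ∑ m, ∑ k, ginv g z r q * wd m (fun y => g y k q) z * y m * s z k := sum_comm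
      _ = ∑ q, ∑ k, ∑ m, ginv g z r q * wd m (fun y => g y k q) z * y m * s z k :=
          sum_ext fun m => sum_comm
      _ = _ := by
          refine sum_ext fun q => sum_ext fun k => sum_ext fun m => ?_
          ring
  have hEE : sesq (g z) E E = ∑ r, ∑ q, ginv g z r q * a q * conj (a r) := by
    rw [← (h.herm z hz).symm, hgE, map_sum]
    refine sum_ext fun r => ?_
    rw [map_mul, conj_conj, hEr, mul_sum]
    refine sum_ext fun q => ?_
    ring
  have hDE : sesq (g z) D E = ∑ k, D k * conj (a k) := by
    rw [← (h.herm z hz).symm, hgE, map_sum]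
    refine sum_ext fun r => ?_
    rw [map_mul, conj_conj, mul_comm]
  have hs' : ∀ᶠ x in nhds z, ∀ i, ContDiffAt ℂ ω (fun x => s x i) x :=
    eventually_all.2 fun i => (hs i).eventually (by simp)
  have hDs : ∀ i, ContDiffAt ℂ ω (dz y fun x => s x i) z := fun i => by
    have h1 : (dz y fun x => s x i) = fun x => ∑ m, y m * wd m (fun x => s x i) x :=
      funext fun x => dz_eq_sum _ _ _
    rw [h1]
    exact ContDiffAt.sum fun m _ => contDiffAt_const.mul (contDiffAt_wd_holomorphic (hs i) m)
  have hb : (dzb y fun x => sesq (g x) (s x) (s x)) =ᶠ[nhds z] fun x => ∑ k, ∑ l,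
      (dzb y (fun x => g x k l) x * s x k * conj (s x l)
        + g x k l * s x k * conj (dz y (fun x => s x l) x)) := by
    filter_upwards [h.isOpen.mem_nhds hz, hs'] with x hx hsx
    simp only [sesq_apply]
    have d3 : ∀ i j, Sm (fun x => g x i j * s x i) x := fun i j =>
      Sm.mul (h.smooth i j x hx) (sm_of_holo (hsx i))
    have d4 : ∀ i j, Sm (fun x => g x i j * s x i * conj (s x j)) x := fun i j =>
      Sm.mul (d3 i j) (sm_of_holo (hsx j)).conj
    rw [wirt_sum _ fun i _ => .fun_sum fun j _ => (d4 i j).diff]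
    refine sum_ext fun k => ?_
    rw [wirt_sum _ fun j _ => (d4 k j).diff]
    refine sum_ext fun l => ?_
    rw [wirt_mul (d3 k l).diff (sm_of_holo (hsx l)).conj.diff, dzb_holo_conj (hsx l),
      wirt_mul (h.smooth k l x hx).diff (sm_of_holo (hsx k)).diff,
      dzb_holomorphic ((hsx k).differentiableAt (by simp))]
    ring
  have c1 : ∀ k l, Sm (fun x => dzb y (fun x => g x k l) x * s x k) z := fun k l =>
    Sm.mul ((h.smooth k l z hz).wirt _ _) (sm_of_holo (hs k))
  have c2 : ∀ k l, Sm (fun x => dzb y (fun x => g x k l) x * s x k * conj (s x l)) z := fun k l =>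
    Sm.mul (c1 k l) (sm_of_holo (hs l)).conj
  have c3 : ∀ k l, Sm (fun x => g x k l * s x k) z := fun k l =>
    Sm.mul (h.smooth k l z hz) (sm_of_holo (hs k))
  have c4 : ∀ k l, Sm (fun x => g x k l * s x k * conj (dz y (fun x => s x l) x)) z := fun k l =>
    Sm.mul (c3 k l) (sm_of_holo (hDs l)).conj
  have hfin : dz y (dzb y fun x => sesq (g x) (s x) (s x)) z = ∑ k, ∑ l,
      (dz y (dzb y fun x => g x k l) z * s z k * conj (s z l)
        + D k * conj (conj (dzb y (fun x => g x k l) z) * s z l)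
        + dz y (fun x => g x k l) z * s z k * conj (D l) + g z k l * D k * conj (D l)) := by
    rw [wirt_congr hb, wirt_sum _ fun k _ => .fun_sum fun l _ => (c2 k l).diff.fun_add (c4 k l).diff]
    refine sum_ext fun k => ?_
    rw [wirt_sum _ fun l _ => (c2 k l).diff.fun_add (c4 k l).diff]
    refine sum_ext fun l => ?_
    rw [wirt_add (c2 k l).diff (c4 k l).diff, wirt_mul (c1 k l).diff (sm_of_holo (hs l)).conj.diff,
      wirt_mul (c3 k l).diff (sm_of_holo (hDs l)).conj.diff, dz_holo_conj (hs l),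
      dz_holo_conj (hDs l), wirt_mul ((h.smooth k l z hz).wirt _ _).diff (sm_of_holo (hs k)).diff,
      wirt_mul (h.smooth k l z hz).diff (sm_of_holo (hs k)).diff, map_mul, conj_conj]
    ring
  have hgb : ∀ k l, conj (dzb y (fun x => g x k l) z) = dz y (fun x => g x l k) z := fun k l => by
    rw [← dz_conj (h.smooth k l z hz).diff]
    refine wirt_congr ?_
    filter_upwards [h.isOpen.mem_nhds hz] with x hx using h.symm hx k l
  rw [hfin, Rm_self h hz, hcov, map_add, map_add, LinearMap.add_apply, LinearMap.add_apply, hEE, hDE,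
    hgE]
  simp only [hgb, sum_add_distrib]
  have t1 : ∑ k, ∑ l, D k * conj (dz y (fun x => g x l k) z * s z l) = ∑ k, D k * conj (a k) := by
    refine sum_ext fun k => ?_
    rw [ha, map_sum, mul_sum]
  have t2 : ∑ k, ∑ l, dz y (fun x => g x k l) z * s z k * conj (D l) = ∑ l, a l * conj (D l) := by
    rw [sum_comm]
    exact sum_ext fun l => (sum_mul _ _ _).symm
  rw [t1, t2, sesq_apply]
  ring

theorem exists_adapted_field (g : LocalMatrix n) (z v : Cn n) :
    ∃ s : Cn n → Cn n, (∀ x i, ContDiffAt ℂ ω (fun x => s x i) x) ∧ s z = v ∧ ∀ y, covd g y s z = 0 := by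
  have hd : ∀ i, Differentiable ℂ fun x : Cn n =>
      v i - ∑ m, ∑ l, chris g z i m l * (x m - z m) * v l := fun i => by fun_prop
  refine ⟨fun x i => v i - ∑ m, ∑ l, chris g z i m l * (x m - z m) * v l, fun x i => ?_, ?_, fun y => ?_⟩
  · exact contDiffAt_const.sub (ContDiffAt.sum fun m _ => ContDiffAt.sum fun l _ =>
      (contDiffAt_const.mul ((contDiffAt_apply ℂ ℂ m x).sub contDiffAt_const)).mul contDiffAt_const)
  · funext i; simp
  · funext i
    have h1 : ∀ m l, DifferentiableAt ℝ (fun x : Cn n => chris g z i m l * (x m - z m) * v l) z :=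
      fun m l => by fun_prop
    have h2 : ∀ m l, dz y (fun x : Cn n => chris g z i m l * (x m - z m) * v l) z
        = chris g z i m l * y m * v l := fun m l => by
      have hdd : DifferentiableAt ℂ (fun x : Cn n => chris g z i m l * (x m - z m) * v l) z := by
        fun_prop
      rw [dz_holomorphic hdd]
      have h3 : HasFDerivAt (fun x : Cn n => chris g z i m l * (x m - z m) * v l)
          ((v l) • (chris g z i m l • (ContinuousLinearMap.proj m : Cn n →L[ℂ] ℂ))) z :=
        (((ContinuousLinearMap.proj m : Cn n →L[ℂ] ℂ).hasFDerivAt.sub_const _).const_mul _).mul_const _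
      rw [h3.fderiv]
      simp; ring
    simp only [covd]
    rw [wirt_sub (differentiableAt_const _) (.fun_sum fun m _ => .fun_sum fun l _ => h1 m l), wirt_const,
      wirt_sum _ fun m _ => .fun_sum fun l _ => h1 m l,
      sum_ext fun m => wirt_sum _ fun l _ => h1 m l]
    simp [h2]

/-! ### The Bochner inequality -/

theorem eval_fields (x : Cn n) (s : Fin p → Cn n) :
    η x s = ∑ J : Fin p → Fin n, (∏ k, s k (J k)) * ec η x J := by
  have h2 : s = fun k => ∑ i, (s k i) • stdB n i := by
    funext k; exact ((stdB n).sum_repr (s k)).symm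
  conv_lhs => rw [h2]
  rw [← AlternatingMap.coe_multilinearMap, MultilinearMap.map_sum]
  refine sum_ext fun J => ?_
  rw [MultilinearMap.map_smul_univ]
  rfl

theorem holo_eval (hη : IsDecompOn g η Ω) (hz : z ∈ Ω) {s : Fin p → Cn n → Cn n}
    (hs : ∀ k i, ContDiffAt ℂ ω (fun x => s k x i) z) :
    ContDiffAt ℂ ω (fun x => η x fun k => s k x) z := by
  simp only [eval_fields]
  exact ContDiffAt.sum fun J _ => (contDiffAt_prod fun k _ => hs k (J k)).mul (hη.holo J z hz)

theorem gramOf_det_real {V : Type*} [AddCommGroup V] [Module ℂ V] {H : V →ₗ[ℂ] V →ₗ⋆[ℂ] ℂ}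
    (h : IsHermForm H) {m : ℕ} (s : Fin m → V) : (gramOf H s).det = ((gramOf H s).det.re : ℂ) := by
  have h1 : (gramOf H s).conjTranspose = gramOf H s := by
    ext i j
    simpa [gramOf, Matrix.conjTranspose_apply] using h.symm (s j) (s i)
  have h2 : conj (gramOf H s).det = (gramOf H s).det := by
    conv_rhs => rw [← h1]
    rw [Matrix.det_conjTranspose]; rfl
  exact (Complex.conj_eq_iff_re.1 h2).symm

theorem norm_dz_sq_le_mul_holo (hu : ContDiffAt ℝ ∞ u z) (h0 : 0 ≤ u z) (hl : LogPshAt u z)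
    {q : Cn n → ℂ} (hq : ContDiffAt ℂ ω q z) (y : Cn n) :
    ‖dz y (fun x => (u x : ℂ) * (q x * conj (q x))) z‖ ^ 2
      ≤ u z * ‖q z‖ ^ 2 * (dz y (dzb y fun x => (u x : ℂ) * (q x * conj (q x))) z).re := by
  have hU := Sm.ofReal hu
  have hqs := sm_of_holo hq
  have hu' : ∀ᶠ x in nhds z, DifferentiableAt ℝ u x :=
    ((hu.of_le (m := 1) (by exact_mod_cast le_top)).eventually (by simp)).mono
      fun y hy => hy.differentiableAt (by simp)
  have hD : ∀ {x}, ContDiffAt ℂ ω q x → ∀ w : Cn n, dz w (fun x => q x * conj (q x)) x = dz w q x * conj (q x) :=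
    fun hq w => by
      rw [wirt_mul (sm_of_holo hq).diff (sm_of_holo hq).conj.diff, dz_holo_conj hq, mul_zero, add_zero]
  have hDb : ∀ {x}, ContDiffAt ℂ ω q x → ∀ w : Cn n,
      dzb w (fun x => q x * conj (q x)) x = q x * conj (dz w q x) := fun hq w => by
      rw [wirt_mul (sm_of_holo hq).diff (sm_of_holo hq).conj.diff, dzb_holo_conj hq,
        dzb_holomorphic (hq.differentiableAt (by simp)), zero_mul, zero_add]
  have hqq : Sm (fun x => q x * conj (q x)) z := Sm.mul hqs hqs.conj
  have hdq : ContDiffAt ℂ ω (dz y q) z := by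
    have h1 : dz y q = fun x => ∑ m, y m * wd m q x := funext fun x => dz_eq_sum _ _ _
    rw [h1]
    exact ContDiffAt.sum fun m _ => contDiffAt_const.mul (contDiffAt_wd_holomorphic hq m)
  set a := dz y (fun x => (u x : ℂ)) z with ha
  set b := dz y q z with hb
  set L := dz y (dzb y fun x => (u x : ℂ)) z with hL
  have h1 : dz y (fun x => (u x : ℂ) * (q x * conj (q x))) z = conj (q z) * (q z * a + b * u z) := by
    rw [wirt_mul hU.diff hqq.diff, hD hq]; ring
  have h2 : dz y (dzb y fun x => (u x : ℂ) * (q x * conj (q x))) z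
      = L * (q z * conj (q z)) + conj a * (b * conj (q z)) + a * (q z * conj b) + u z * (b * conj b) := by
    have hev : (dzb y fun x => (u x : ℂ) * (q x * conj (q x))) =ᶠ[nhds z] fun x =>
        dzb y (fun x => (u x : ℂ)) x * (q x * conj (q x)) + (u x : ℂ) * (q x * conj (dz y q x)) := by
      filter_upwards [hU.eventually, hqq.eventually, hq.eventually (by simp)] with x h1 h2 h3
      rw [wirt_mul h1 h2, hDb h3]
    have d1 : Sm (fun x => q x * conj (dz y q x)) z := Sm.mul hqs (sm_of_holo hdq).conj
    rw [wirt_congr hev, wirt_add (Sm.mul (hU.wirt _ _) hqq).diff (Sm.mul hU d1).diff,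
      wirt_mul (hU.wirt _ _).diff hqq.diff, wirt_mul hU.diff d1.diff, hD hq,
      wirt_mul hqs.diff (sm_of_holo hdq).conj.diff, dz_holo_conj hdq,
      dzb_eq_conj_dz (hu.differentiableAt (by simp))]
    ring
  have hfb := hl.form_bound h0 b (q z • y)
  have hlev : dz (q z • y) (dzb (q z • y) fun x => (u x : ℂ)) z = q z * conj (q z) * L := by
    have : (dzb (q z • y) fun x => (u x : ℂ)) =ᶠ[nhds z]
        fun x => conj (q z) * dzb y (fun x => (u x : ℂ)) x := by
      filter_upwards [hU.eventually] with x hx using dzb_smul_vec hx _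
    rw [wirt_congr this, wirt_const_mul _ (hU.wirt _ _).diff, dz_smul_vec]; ring
  rw [hlev, dz_smul_vec, ← ha] at hfb
  have h3 : (dz y (dzb y fun x => (u x : ℂ) * (q x * conj (q x))) z).re
      = (q z * conj (q z) * L).re + 2 * (conj b * (q z * a)).re + ‖b‖ ^ 2 * u z := by
    rw [h2]
    have e1 : u z * (b * conj b) = ((‖b‖ ^ 2 * u z : ℝ) : ℂ) := by
      rw [mul_conj, normSq_eq_norm_sq]; push_cast; ring
    have e2 : (conj a * (b * conj (q z))).re = (conj b * (q z * a)).re := by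
      rw [← conj_re]; congr 1; simp; ring
    rw [e1, add_re, add_re, add_re, e2, ofReal_re,
      mul_comm L, show a * (q z * conj b) = conj b * (q z * a) by ring]
    ring
  rw [h3, h1, norm_mul, RCLike.norm_conj, mul_pow]
  nlinarith [sq_nonneg ‖q z‖, mul_le_mul_of_nonneg_left hfb (sq_nonneg ‖q z‖)]

theorem bochner (h : IsKahlerOn g Ω) (hη : IsDecompOn g η Ω) (hz : z ∈ Ω) (hu : ContDiffAt ℝ ∞ u z)
    (h0 : ∀ᶠ x in nhds z, 0 ≤ u x) (hl : LogPshAt u z) {v : Fin p → Cn n} {t : ℂ}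
    (hv : IsOrtho (sesq (g z)) v) (ht : η z = t • wedge (dualFam (sesq (g z)) v)) (y : Cn n) :
    ‖dz y (fun x => ((u x * nrm g η x : ℝ) : ℂ)) z‖ ^ 2
      + (u z * nrm g η z) ^ 2 * ∑ k, (Rm g z y y (v k) (v k)).re
      ≤ u z * nrm g η z * (dz y (dzb y fun x => ((u x * nrm g η x : ℝ) : ℂ)) z).re := by
  choose s hs hsz hcov using fun k => exists_adapted_field g z (v k)
  set ψ : Cn n → ℝ := fun x => u x * nrm g η x with hψ
  have hψs : ContDiffAt ℝ ∞ ψ z := hu.mul (hη.smOn_nrm h hz)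
  set G : Cn n → Matrix (Fin p) (Fin p) ℂ := fun x => gramOf (sesq (g x)) fun k => s k x with hG
  have hGs : ∀ i j, Sm (fun x => G x i j) z := fun i j =>
    sm_sesq h hz (fun a => hs i z a) fun a => hs j z a
  have hG1 : G z = 1 := by
    ext i j
    simp [hG, gramOf, hsz, hv i j, Matrix.one_apply]
  set D : Cn n → ℝ := fun x => (G x).det.re with hD
  have hDs : ContDiffAt ℝ ∞ D z := reCLM.contDiff.contDiffAt.comp z (sm_det hGs)
  have hDc : (fun x => (D x : ℂ)) =ᶠ[nhds z] fun x => (G x).det := by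
    filter_upwards [h.isOpen.mem_nhds hz] with x hx using (gramOf_det_real (h.herm x hx) _).symm
  have hD1 : D z = 1 := by simp [hD, hG1]
  have hdb : ∀ i j, dzb y (fun x => G x i j) z = 0 := fun i j => by
    have := dzb_sesq h hz (s := s i) (t := s j) (fun a => hs i z a) (fun a => hs j z a) y
    rw [hcov, map_zero] at this
    exact this
  have hd : ∀ i j, dz y (fun x => G x i j) z = 0 := fun i j => by
    have := dz_sesq h hz (s := s i) (t := s j) (fun a => hs i z a) (fun a => hs j z a) y
    rw [hcov, map_zero, LinearMap.zero_apply] at this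
    exact this
  have hDz : dz y (fun x => (D x : ℂ)) z = 0 := by
    rw [wirt_congr hDc, wirt_det fun i j => (hGs i j).diff]
    simp [hd]
  have hDzb : dzb y (fun x => (D x : ℂ)) z = 0 := by
    rw [dzb_eq_conj_dz (hDs.differentiableAt (by simp)), hDz, map_zero]
  have hDL : dz y (dzb y fun x => (D x : ℂ)) z = -∑ k, Rm g z y y (v k) (v k) := by
    rw [wirt_congr (wirt_congr_eventually hDc), levi_det hGs hG1 hdb, ← sum_neg_distrib]
    refine sum_ext fun k => ?_
    have := levi_sesq h hz (fun a => hs k z a) y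
    rw [hcov, hsz, map_zero, add_zero] at this
    exact this
  set q : Cn n → ℂ := fun x => η x fun k => s k x with hq
  have hqh : ContDiffAt ℂ ω q z := holo_eval hη hz fun k i => hs k z i
  have hqz : ‖q z‖ ^ 2 = nrm g η z := by
    rw [nrm_eq h hz hv ht]
    simp only [hq, hsz, ht, AlternatingMap.smul_apply, wedge_dualFam_self hv]
    simp
  set f : Cn n → ℂ := fun x => (u x : ℂ) * (q x * conj (q x)) with hf
  have hfs : Sm f z := Sm.mul (Sm.ofReal hu) (Sm.mul (sm_of_holo hqh) (sm_of_holo hqh).conj)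
  set N : Cn n → ℝ := fun x => ψ x * D x - u x * ‖q x‖ ^ 2 with hN
  have hfr : ∀ x, f x = ((u x * ‖q x‖ ^ 2 : ℝ) : ℂ) := fun x => by
    simp only [hf]
    rw [mul_conj, normSq_eq_norm_sq]; push_cast; ring
  have hNc : (fun x => (N x : ℂ)) = fun x => (ψ x : ℂ) * (D x : ℂ) - f x := by
    funext x; rw [hfr]; simp only [hN]; push_cast; ring
  have hNs : ContDiffAt ℝ ∞ N z := by
    refine (hψs.mul hDs).sub ?_
    have : ContDiffAt ℝ ∞ (fun x => (f x).re) z := reCLM.contDiff.contDiffAt.comp z hfs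
    simpa only [hfr, ofReal_re] using this
  have hNz : N z = 0 := by simp only [hN, hψ, hD1, hqz]; ring
  have hmin : IsLocalMin N z := by
    filter_upwards [h.isOpen.mem_nhds hz, h0] with x hx hux
    rw [hNz]
    obtain ⟨v', t', hv', ht'⟩ := hη.decomp x hx
    obtain ⟨o, ho⟩ := h.exists_ortho hx
    have := norm_sq_apply_le (h.herm x hx) (by simp) ho hv' t' fun k => s k x
    rw [← ht', ← nrm_eq h hx hv' ht'] at this
    have h2 := mul_le_mul_of_nonneg_left this hux
    simp only [hN, hψ, hq, hD, hG]
    linarith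
  have hP := Sm.ofReal hψs
  have hDS := Sm.ofReal hDs
  have e1 := dz_eq_zero_of_isLocalMin (v := y) (hNs.differentiableAt (by simp)) hmin (-I)
  rw [hNc, wirt_sub (Sm.mul hP hDS).diff hfs.diff, wirt_mul hP.diff hDS.diff, hDz, hD1] at e1
  have e2 := levi_nonneg_of_isLocalMin (v := y) hNs hmin
  have hev : (dzb y fun x => (N x : ℂ)) =ᶠ[nhds z] fun x => dzb y (fun x => (ψ x : ℂ)) x * D x
      + ψ x * dzb y (fun x => (D x : ℂ)) x - dzb y f x := by
    filter_upwards [hP.eventually, hDS.eventually, hfs.eventually] with x h1 h2 h3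
    rw [hNc, wirt_sub (h1.fun_mul h2) h3, wirt_mul h1 h2]
  have d1 : Sm (fun x => dzb y (fun x => (ψ x : ℂ)) x * D x) z := Sm.mul (hP.wirt _ _) hDS
  have d2 : Sm (fun x => (ψ x : ℂ) * dzb y (fun x => (D x : ℂ)) x) z := Sm.mul hP (hDS.wirt _ _)
  rw [wirt_congr hev, wirt_sub (d1.diff.fun_add d2.diff) (hfs.wirt _ _).diff, wirt_add d1.diff d2.diff,
    wirt_mul (hP.wirt _ _).diff hDS.diff, wirt_mul hP.diff (hDS.wirt _ _).diff, hDz, hDzb, hDL,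
    hD1] at e2
  have e3 := norm_dz_sq_le_mul_holo hu h0.self_of_nhds hl hqh y
  rw [hqz] at e3
  have e4 : dz y (fun x => (ψ x : ℂ)) z = dz y f z := by simpa [sub_eq_zero] using e1
  rw [← hf, ← e4] at e3
  have e5 : 0 ≤ (dz y (dzb y fun x => (ψ x : ℂ)) z).re - ψ z * ∑ k, (Rm g z y y (v k) (v k)).re
      - (dz y (dzb y f) z).re := by
    have : (dz y (dzb y fun x => (ψ x : ℂ)) z * ((1 : ℝ) : ℂ) + dzb y (fun x => (ψ x : ℂ)) z * 0
      + (dz y (fun x => (ψ x : ℂ)) z * 0 + ψ z * -∑ k, Rm g z y y (v k) (v k)) - dz y (dzb y f) z).re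
      = (dz y (dzb y fun x => (ψ x : ℂ)) z).re - ψ z * ∑ k, (Rm g z y y (v k) (v k)).re
      - (dz y (dzb y f) z).re := by
      simp only [sub_re, add_re, mul_zero, Complex.ofReal_one, mul_one, add_zero,
        zero_add, re_ofReal_mul, neg_re, re_sum]
      ring
    rw [this] at e2
    exact e2
  have hψ0 : 0 ≤ ψ z := mul_nonneg h0.self_of_nhds (hη.nrm_nonneg h hz)
  have e6 := mul_nonneg hψ0 e5
  change _ + ψ z ^ 2 * _ ≤ ψ z * _
  change _ ≤ ψ z * _ at e3
  nlinarith

/-! ### The traced Bochner inequality -/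

/-- The squared norm of a covector. -/
def conorm (g : LocalMatrix n) (z : Cn n) (a : Fin n → ℂ) : ℝ :=
  (∑ i, ∑ j, ginv g z i j * a i * conj (a j)).re

/-- The integrand `|η|⁴ (c₁ ∑ Ric(v_k, v̄_k) + c₂ ∑ R(v_k, v̄_k, v_l, v̄_l))`. -/
def curvTerm (c₁ c₂ : ℝ) (g : LocalMatrix n)
    (η : LocalForm n p) (z : Cn n) : ℝ :=
  c₁ * nrm g η z * (∑ i, ∑ j, ∑ k, ∑ l, rm g z i j k l * qm g η i j z * ginv g z k l).re
    + c₂ * (∑ i, ∑ j, ∑ k, ∑ l, rm g z i j k l * qm g η i j z * qm g η k l z).re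

theorem conorm_eq {o : Fin n → Cn n} (ho : IsOrtho (sesq (g z)) o) (a : Fin n → ℂ) :
    conorm g z a = ∑ r, ‖∑ i, o r i * a i‖ ^ 2 := by
  have : ((∑ r, ‖∑ i, o r i * a i‖ ^ 2 : ℝ) : ℂ) = ∑ i, ∑ j, ginv g z i j * a i * conj (a j) := by
    push_cast
    simp_rw [← Complex.ofReal_pow, ← normSq_eq_norm_sq, ← mul_conj, map_sum,
      sum_mul_sum, ginv_eq ho, sum_mul]
    refine sum_comm_ext fun i => ?_
    refine sum_comm_ext fun j => sum_ext fun r => ?_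
    rw [map_mul]; ring
  rw [conorm, ← this, ofReal_re]

theorem conorm_nonneg (h : IsKahlerOn g Ω) (hz : z ∈ Ω) (a : Fin n → ℂ) : 0 ≤ conorm g z a := by
  obtain ⟨o, ho⟩ := h.exists_ortho hz
  rw [conorm_eq ho]; positivity

theorem conorm_dz {o : Fin n → Cn n} (ho : IsOrtho (sesq (g z)) o) (F : Cn n → ℂ) :
    conorm g z (fun i => wd i F z) = ∑ r, ‖dz (o r) F z‖ ^ 2 := by
  simp_rw [conorm_eq ho, dz_eq_sum]

theorem sum_levi {m : ℕ} (x : Fin m → Cn n) {F : Cn n → ℂ} (hF : Sm F z) :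
    ∑ i, ∑ j, (∑ r, x r i * conj (x r j)) * wd i (wdBar j F) z = ∑ r, dz (x r) (dzb (x r) F) z := by
  simp_rw [dz_dzb_eq_sum hF, sum_mul]
  refine sum_ext_comm fun i => ?_
  conv_rhs => rw [sum_comm]

theorem sum_rm {m m' : ℕ} (x : Fin m → Cn n) (y : Fin m' → Cn n) :
    ∑ i, ∑ j, ∑ k, ∑ l, rm g z i j k l * (∑ r, x r i * conj (x r j)) * (∑ s, y s k * conj (y s l))
      = ∑ r, ∑ s, Rm g z (x r) (x r) (y s) (y s) := by
  have h1 : ∀ i j k l, rm g z i j k l * (∑ r, x r i * conj (x r j)) * (∑ s, y s k * conj (y s l))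
      = ∑ q : Fin m × Fin m', rm g z i j k l * x q.1 i * conj (x q.1 j) * y q.2 k * conj (y q.2 l) := by
    intro i j k l
    rw [mul_assoc, sum_mul_sum, mul_sum, Fintype.sum_prod_type]
    refine sum_ext fun r => ?_
    rw [mul_sum]
    refine sum_ext fun s => ?_
    ring
  simp_rw [h1]
  rw [← Fintype.sum_prod_type' fun r s => Rm g z (x r) (x r) (y s) (y s)]
  simp only [Rm]
  refine sum_ext_comm fun i => ?_
  refine sum_ext_comm fun j => ?_
  refine sum_ext_comm fun k => ?_
  conv_rhs => rw [sum_comm]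

theorem curvTerm_eq (h : IsKahlerOn g Ω) (hz : z ∈ Ω) {o : Fin n → Cn n}
    (ho : IsOrtho (sesq (g z)) o) {v : Fin p → Cn n} {t : ℂ} (hv : IsOrtho (sesq (g z)) v)
    (ht : η z = t • wedge (dualFam (sesq (g z)) v)) (c₁ c₂ : ℝ) :
    curvTerm c₁ c₂ g η z = nrm g η z ^ 2 * (c₁ * ∑ k, ∑ r, (Rm g z (v k) (v k) (o r) (o r)).re
      + c₂ * ∑ k, ∑ l, (Rm g z (v k) (v k) (v l) (v l)).re) := by
  have h1 := sum_rm (g := g) (z := z) v o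
  have h2 := sum_rm (g := g) (z := z) v v
  have hn := nrm_eq h hz hv ht
  have e1 : ∑ i, ∑ j, ∑ k, ∑ l, rm g z i j k l * qm g η i j z * ginv g z k l
      = (nrm g η z : ℂ) * ∑ r, ∑ s, Rm g z (v r) (v r) (o s) (o s) := by
    rw [← h1]
    simp_rw [mul_sum (a := (nrm g η z : ℂ)), qm_eq h hz hv ht, ginv_eq ho, hn]
    refine sum_ext fun i => sum_ext fun j => sum_ext fun k => sum_ext fun l => ?_
    ring
  have e2 : ∑ i, ∑ j, ∑ k, ∑ l, rm g z i j k l * qm g η i j z * qm g η k l z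
      = ((nrm g η z ^ 2 : ℝ) : ℂ) * ∑ r, ∑ s, Rm g z (v r) (v r) (v s) (v s) := by
    rw [← h2]
    simp_rw [mul_sum (a := ((nrm g η z ^ 2 : ℝ) : ℂ)), qm_eq h hz hv ht, hn]
    refine sum_ext fun i => sum_ext fun j => sum_ext fun k => sum_ext fun l => ?_
    push_cast
    ring
  rw [curvTerm, e1, e2, re_ofReal_mul, re_ofReal_mul]
  simp only [re_sum]
  ring

theorem sum_le_of_extends {m : ℕ} (hp : m ≤ n) {F : Fin n → ℝ} (hF : ∀ r, 0 ≤ F r) :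
    ∑ k, F (Fin.castLE hp k) ≤ ∑ r, F r := by
  have := Finset.sum_map Finset.univ (Fin.castLEEmb hp) F
  simp only [Fin.castLEEmb_apply] at this
  rw [← this]
  exact Finset.sum_le_sum_of_subset_of_nonneg (Finset.subset_univ _) fun r _ _ => hF r

theorem bochner_trace (h : IsKahlerOn g Ω) (hη : IsDecompOn g η Ω) (hz : z ∈ Ω)
    (hu : ContDiffAt ℝ ∞ u z) (h0 : ∀ᶠ x in nhds z, 0 ≤ u x) (hl : LogPshAt u z) {c₁ c₂ : ℝ}
    (hc₁ : 0 ≤ c₁) (hc : 0 ≤ c₁ + c₂) :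
    (g z).det.re * ((c₁ + c₂) * conorm g z (fun i => wd i (fun x => ((u x * nrm g η x : ℝ) : ℂ)) z)
        + u z ^ 2 * curvTerm c₁ c₂ g η z)
      ≤ (c₁ + c₂) / 2 * (∑ i, ∑ j, (g z).det * ginv g z i j
          * wd i (wdBar j fun x => (((u x * nrm g η x) ^ 2 : ℝ) : ℂ)) z).re
        - c₂ * (∑ i, ∑ j, u z * pm g η (some i) (some j) z
          * wd i (wdBar j fun x => ((u x * nrm g η x : ℝ) : ℂ)) z).re := by
  obtain ⟨v, t, hv, ht⟩ := hη.decomp z hz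
  obtain ⟨hp, o, ho, hov⟩ := (h.herm z hz).exists_extension (n := n) (by simp) hv
  set ψ : Cn n → ℝ := fun x => u x * nrm g η x with hψ
  have hψs : ContDiffAt ℝ ∞ ψ z := hu.mul (hη.smOn_nrm h hz)
  have hB := bochner h hη hz hu h0 hl hv ht
  set A : Cn n → ℝ := fun y => ‖dz y (fun x => (ψ x : ℂ)) z‖ ^ 2 with hA
  set L : Cn n → ℝ := fun y => (dz y (dzb y fun x => (ψ x : ℂ)) z).re with hL
  set R : Cn n → ℝ := fun y => ∑ k, (Rm g z y y (v k) (v k)).re with hR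
  have hB' : ∀ y, 0 ≤ ψ z * L y - A y - ψ z ^ 2 * R y := fun y => by
    have := hB y
    simp only [hL, hA, hR]
    linarith
  have hV := (h.det_pos hz).1
  have hVc := (h.det_pos hz).2
  have s1 := sum_le_of_extends hp (F := fun r => A (o r)) fun r => by positivity
  have s2 := sum_le_of_extends hp (F := fun r => ψ z * L (o r) - A (o r) - ψ z ^ 2 * R (o r)) fun r => hB' _
  simp only [hov] at s1 s2
  have p1 : 0 ≤ ∑ k, A (v k) := by positivity
  have p2 : 0 ≤ ∑ k, (ψ z * L (v k) - A (v k) - ψ z ^ 2 * R (v k)) := sum_nonneg fun k _ => hB' _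
  simp only [sum_sub_distrib, ← mul_sum] at s2 p2
  have e1 : conorm g z (fun i => wd i (fun x => (ψ x : ℂ)) z) = ∑ r, A (o r) := conorm_dz ho _
  have e2 : curvTerm c₁ c₂ g η z = nrm g η z ^ 2 * (c₁ * ∑ r, R (o r) + c₂ * ∑ k, R (v k)) := by
    rw [curvTerm_eq h hz ho hv ht]
    have : ∑ k, ∑ r, (Rm g z (v k) (v k) (o r) (o r)).re = ∑ r, R (o r) := by
      refine sum_comm_ext fun r => sum_ext fun k => ?_
      rw [Rm_swap_left h hz, Rm_swap_right h hz]
    rw [this]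
  have e3 : (∑ i, ∑ j, (g z).det * ginv g z i j * wd i (wdBar j fun x => ((ψ x ^ 2 : ℝ) : ℂ)) z).re
      = (g z).det.re * (2 * ψ z * ∑ r, L (o r) + 2 * ∑ r, A (o r)) := by
    have : ∑ i, ∑ j, (g z).det * ginv g z i j * wd i (wdBar j fun x => ((ψ x ^ 2 : ℝ) : ℂ)) z
        = (g z).det * ∑ r, dz (o r) (dzb (o r) fun x => ((ψ x ^ 2 : ℝ) : ℂ)) z := by
      rw [← sum_levi o (Sm.ofReal (hψs.pow 2)), mul_sum]
      refine sum_ext fun i => ?_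
      rw [mul_sum]
      refine sum_ext fun j => ?_
      rw [ginv_eq ho]; ring
    rw [this, hVc, re_ofReal_mul, ofReal_re, re_sum]
    simp_rw [levi_sq hψs]
    rw [sum_add_distrib, ← mul_sum, ← mul_sum]
  have e4 : (∑ i, ∑ j, u z * pm g η (some i) (some j) z * wd i (wdBar j fun x => (ψ x : ℂ)) z).re
      = (g z).det.re * (ψ z * (∑ r, L (o r) - ∑ k, L (v k))) := by
    have : ∑ i, ∑ j, u z * pm g η (some i) (some j) z * wd i (wdBar j fun x => (ψ x : ℂ)) z
        = (g z).det * ((ψ z : ℝ) * (∑ r, dz (o r) (dzb (o r) fun x => (ψ x : ℂ)) z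
          - ∑ k, dz (v k) (dzb (v k) fun x => (ψ x : ℂ)) z)) := by
      rw [← sum_levi o (Sm.ofReal hψs), ← sum_levi v (Sm.ofReal hψs), ← sum_sub_distrib,
        mul_sum, mul_sum]
      refine sum_ext fun i => ?_
      rw [← sum_sub_distrib, mul_sum, mul_sum]
      refine sum_ext fun j => ?_
      rw [pm_some_some h hz ho hv ht, ← nrm_eq h hz hv ht]
      simp only [hψ]
      push_cast
      ring
    rw [this, hVc, re_ofReal_mul, ofReal_re, re_ofReal_mul, sub_re, re_sum, re_sum]
  rw [e1, e2, e3, e4]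
  have key : (c₁ + c₂) * ∑ r, A (o r) + u z ^ 2 * (nrm g η z ^ 2 * (c₁ * ∑ r, R (o r) + c₂ * ∑ k, R (v k)))
      ≤ (c₁ + c₂) / 2 * (2 * ψ z * ∑ r, L (o r) + 2 * ∑ r, A (o r))
        - c₂ * (ψ z * (∑ r, L (o r) - ∑ k, L (v k))) := by
    have hψz : u z ^ 2 * nrm g η z ^ 2 = ψ z ^ 2 := by simp only [hψ]; ring
    rw [← mul_assoc, hψz]
    have q1 := mul_nonneg hc₁ (sub_nonneg.2 s1)
    have q2 := mul_nonneg hc p1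
    have q3 := mul_nonneg hc₁ (sub_nonneg.2 s2)
    have q4 := mul_nonneg hc p2
    nlinarith
  have := mul_le_mul_of_nonneg_left key hV.le
  linarith

theorem IsDecompOn.continuousOn_curvTerm (hη : IsDecompOn g η Ω) (h : IsKahlerOn g Ω) (c₁ c₂ : ℝ) :
    ContinuousOn (curvTerm c₁ c₂ g η) Ω := by
  have hq : ∀ i j, ContinuousOn (qm g η i j) Ω := fun i j z hz =>
    (hη.smOn_qm h i j z hz).continuousAt.continuousWithinAt
  have hg : ∀ i j, ContinuousOn (fun z => ginv g z i j) Ω := fun i j z hz =>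
    (h.smOn_ginv i j z hz).continuousAt.continuousWithinAt
  have hr : ∀ i j k l, ContinuousOn (fun z => rm g z i j k l) Ω := fun i j k l z hz => by
    have : Sm (fun z => rm g z i j k l) z :=
      (((h.smooth k l z hz).wdBar j).wd i).neg.add (ContDiffAt.sum fun r _ => ContDiffAt.sum fun q _ =>
        ((h.smOn_ginv r q z hz).mul ((h.smooth k q z hz).wd i)).mul ((h.smooth r l z hz).wdBar j))
    exact this.continuousAt.continuousWithinAt
  have hn : ContinuousOn (nrm g η) Ω := fun z hz =>
    (hη.smOn_nrm h hz).continuousAt.continuousWithinAt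
  refine ((continuousOn_const.mul hn).mul ?_).add (continuousOn_const.mul ?_)
  · exact continuous_re.comp_continuousOn (continuousOn_finsetSum _ fun i _ =>
      continuousOn_finsetSum _ fun j _ => continuousOn_finsetSum _ fun k _ =>
      continuousOn_finsetSum _ fun l _ => ((hr i j k l).mul (hq i j)).mul (hg k l))
  · exact continuous_re.comp_continuousOn (continuousOn_finsetSum _ fun i _ =>
      continuousOn_finsetSum _ fun j _ => continuousOn_finsetSum _ fun k _ =>
      continuousOn_finsetSum _ fun l _ => ((hr i j k l).mul (hq i j)).mul (hq k l))

/-! ### Integration against test functions -/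

/-- Continuous functions with compact support in `Ω`. -/
structure IsCc (f : Cn n → ℝ) (Ω : Set (Cn n)) : Prop where
  continuous : Continuous f
  compact : HasCompactSupport f
  subset : tsupport f ⊆ Ω

namespace IsCc

variable {f F : Cn n → ℝ}

theorem eventually_zero (h : IsCc f Ω) (hz : z ∉ Ω) : f =ᶠ[nhds z] fun _ => 0 :=
  notMem_tsupport_iff_eventuallyEq.1 fun h' => hz (h.subset h')

theorem zero_of_notMem (h : IsCc f Ω) (hz : z ∉ Ω) : f z = 0 := (h.eventually_zero hz).eq_of_nhds

theorem mul (h : IsCc f Ω) (hΩ : IsOpen Ω) (hF : ContinuousOn F Ω) : IsCc (fun z => F z * f z) Ω where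
  continuous := continuous_iff_continuousAt.2 fun z => by
    by_cases hz : z ∈ Ω
    · exact (hF.continuousAt (hΩ.mem_nhds hz)).mul h.continuous.continuousAt
    · refine (continuousAt_const (y := (0 : ℝ))).congr ?_
      filter_upwards [h.eventually_zero hz] with y hy
      simp [hy]
  compact := h.compact.mul_left
  subset := tsupport_mul_subset_right.trans h.subset

theorem add (h : IsCc f Ω) (h' : IsCc F Ω) : IsCc (fun z => f z + F z) Ω where
  continuous := h.continuous.add h'.continuous
  compact := h.compact.add h'.compact
  subset := (tsupport_add _ _).trans (Set.union_subset h.subset h'.subset)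

theorem zero : IsCc (fun _ : Cn n => 0) Ω where
  continuous := continuous_const
  compact := HasCompactSupport.zero
  subset := by simp [tsupport]

theorem sum {ι : Type*} (s : Finset ι) {f : ι → Cn n → ℝ} (h : ∀ i ∈ s, IsCc (f i) Ω) :
    IsCc (fun z => ∑ i ∈ s, f i z) Ω := by
  classical
  induction s using Finset.induction_on with
  | empty => simpa using zero
  | insert a s ha ih =>
    simp_rw [Finset.sum_insert ha]
    exact (h a (Finset.mem_insert_self _ _)).add (ih fun i hi => h i (Finset.mem_insert_of_mem hi))

theorem integrable (h : IsCc f Ω) : Integrable f :=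
  h.continuous.integrable_of_hasCompactSupport h.compact

theorem bdd (h : IsCc f Ω) : ∃ B, ∀ z, |f z| ≤ B := h.compact.exists_bound_of_continuous h.continuous

end IsCc

theorem IsTest.re {θ : Cn n → ℂ} (h : IsTest θ Ω) : IsCc (fun z => (θ z).re) Ω where
  continuous := continuous_re.comp h.continuous
  compact := h.compact.comp_left (g := Complex.re) rfl
  subset := (closure_mono fun z hz => by intro h0; exact hz (by simp [h0])).trans h.subset

theorem IsTest.norm {θ : Cn n → ℂ} (h : IsTest θ Ω) : IsCc (fun z => ‖θ z‖) Ω where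
  continuous := h.continuous.norm
  compact := h.compact.norm
  subset := (closure_mono fun z hz => by intro h0; exact hz (by simp [h0])).trans h.subset

theorem IsTest.wd {θ : Cn n → ℂ} (h : IsTest θ Ω) (i : Fin n) : IsTest (BochnerRatio.wd i θ) Ω := by
  have : BochnerRatio.wd i θ = dz (Pi.single i 1) θ := funext fun y => wd_eq_dz i θ y
  rw [this]; exact h.wirt _ _

theorem IsTest.wdBar {θ : Cn n → ℂ} (h : IsTest θ Ω) (i : Fin n) :
    IsTest (BochnerRatio.wdBar i θ) Ω := by
  have : BochnerRatio.wdBar i θ = dzb (Pi.single i 1) θ := funext fun y => wdBar_eq_dzb i θ y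
  rw [this]; exact h.wirt _ _

theorem integral_mul_wd_wdBar {F θ : Cn n → ℂ} (h : IsTest θ Ω) (hF : SmOn F Ω) (i j : Fin n) :
    ∫ z, F z * wd i (wdBar j θ) z = ∫ z, wdBar j (wd i F) z * θ z := by
  have h1 : ∀ (i : Fin n) (F : Cn n → ℂ), wd i F = dz (Pi.single i 1) F := fun i F =>
    funext fun y => wd_eq_dz i F y
  have h2 : ∀ (i : Fin n) (F : Cn n → ℂ), wdBar i F = dzb (Pi.single i 1) F := fun i F =>
    funext fun y => wdBar_eq_dzb i F y
  simp only [h1, h2]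
  exact integral_mul_wirt_wirt h hF

theorem integral_mul_wdBar_wd {F θ : Cn n → ℂ} (h : IsTest θ Ω) (hF : SmOn F Ω) (i j : Fin n) :
    ∫ z, F z * wdBar j (wd i θ) z = ∫ z, wd i (wdBar j F) z * θ z := by
  have h1 : ∀ (i : Fin n) (F : Cn n → ℂ), wd i F = dz (Pi.single i 1) F := fun i F =>
    funext fun y => wd_eq_dz i F y
  have h2 : ∀ (i : Fin n) (F : Cn n → ℂ), wdBar i F = dzb (Pi.single i 1) F := fun i F =>
    funext fun y => wdBar_eq_dzb i F y
  simp only [h1, h2]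
  exact integral_mul_wirt_wirt h hF

theorem integral_eq_of_re {F H : Cn n → ℂ} {f k : Cn n → ℝ} (hF : Integrable F) (hH : Integrable H)
    (e : ∫ z, F z = ∫ z, H z) (hf : ∀ z, f z = (F z).re) (hk : ∀ z, k z = (H z).re) :
    ∫ z, f z = ∫ z, k z := by
  have h1 : ∀ {F : Cn n → ℂ}, Integrable F → ∫ z, (F z).re = (∫ z, F z).re := fun hF =>
    reCLM.integral_comp_comm hF
  simp_rw [hf, hk]
  rw [h1 hF, h1 hH, e]

/-- The pairing of `√-1 ∂∂̄θ ∧ η ∧ η̄`. -/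
def leviPair (g : LocalMatrix n) (η : LocalForm n p)
    (θ : Cn n → ℝ) (z : Cn n) : ℝ :=
  (∑ i, ∑ j, pm g η (some i) (some j) z * wd i (wdBar j fun x => (θ x : ℂ)) z).re

theorem isCc_leviPair (h : IsKahlerOn g Ω) (hη : IsDecompOn g η Ω) {θ : Cn n → ℝ}
    (hθ : IsTest (fun x => (θ x : ℂ)) Ω) : IsCc (leviPair g η θ) Ω := by
  have : leviPair g η θ = fun z => ∑ i, ∑ j, (pm g η (some i) (some j) z
      * wd i (wdBar j fun x => (θ x : ℂ)) z).re := funext fun z => by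
    simp only [leviPair, re_sum]
  rw [this]
  exact IsCc.sum _ fun i _ => IsCc.sum _ fun j _ =>
    (((hθ.wdBar j).wd i).mul (hη.smOn_pm h (some i) (some j))).re

theorem integral_mul_leviPair (h : IsKahlerOn g Ω) (hη : IsDecompOn g η Ω)
    (hu : ∀ z ∈ Ω, ContDiffAt ℝ ∞ u z) {θ : Cn n → ℝ} (hθ : IsTest (fun x => (θ x : ℂ)) Ω) :
    ∫ z, u z * leviPair g η θ z = ∫ z, (leviDen g η u z).re * θ z := by
  have hF : ∀ i j, SmOn (fun y => (u y : ℂ) * pm g η (some i) (some j) y) Ω := fun i j z hz =>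
    Sm.mul (Sm.ofReal (hu z hz)) (hη.smOn_pm h _ _ z hz)
  have i1 : ∀ i j, Integrable fun z => (u z : ℂ) * pm g η (some i) (some j) z
      * wd i (wdBar j fun x => (θ x : ℂ)) z := fun i j => (((hθ.wdBar j).wd i).mul (hF i j)).integrable
  have hFd : ∀ i j, SmOn (wdBar j (wd i fun y => (u y : ℂ) * pm g η (some i) (some j) y)) Ω :=
    fun i j z hz => ((hF i j z hz).wd i).wdBar j
  have i2 : ∀ i j, Integrable fun z =>
      wdBar j (wd i fun y => (u y : ℂ) * pm g η (some i) (some j) y) z * (θ z : ℂ) :=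
    fun i j => (hθ.mul (hFd i j)).integrable
  have e1 : ∫ z, ∑ i, ∑ j, (u z : ℂ) * pm g η (some i) (some j) z
      * wd i (wdBar j fun x => (θ x : ℂ)) z = ∫ z, leviDen g η u z * (θ z : ℂ) := by
    have : ∀ z, leviDen g η u z * (θ z : ℂ) = ∑ i, ∑ j,
        wdBar j (wd i fun y => (u y : ℂ) * pm g η (some i) (some j) y) z * (θ z : ℂ) := by
      intro z
      by_cases hz : z ∈ Ω
      · rw [leviDen_eq_sum hη h hz (hu z hz), sum_mul]
        exact sum_ext fun i => sum_mul _ _ _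
      · simp [hθ.zero_of_notMem hz]
    simp_rw [this]
    rw [integral_finsetSum _ fun i _ => integrable_finsetSum _ fun j _ => i1 i j,
      integral_finsetSum _ fun i _ => integrable_finsetSum _ fun j _ => i2 i j]
    refine sum_ext fun i => ?_
    rw [integral_finsetSum _ fun j _ => i1 i j, integral_finsetSum _ fun j _ => i2 i j]
    exact sum_ext fun j => integral_mul_wd_wdBar hθ (hF i j) i j
  have i3 : Integrable fun z => leviDen g η u z * (θ z : ℂ) := by
    have : SmOn (leviDen g η u) Ω := fun z hz => by
      have : SmOn (fun z => ∑ i, ∑ j,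
        wdBar j (wd i fun y => (u y : ℂ) * pm g η (some i) (some j) y) z) Ω := fun z hz =>
        ContDiffAt.sum fun i _ => ContDiffAt.sum fun j _ => hFd i j z hz
      refine (this z hz).congr_of_eventuallyEq ?_
      filter_upwards [h.isOpen.mem_nhds hz] with y hy using leviDen_eq_sum hη h hy (hu y hy)
    exact (hθ.mul this).integrable
  refine integral_eq_of_re (integrable_finsetSum _ fun i _ => integrable_finsetSum _ fun j _ => i1 i j)
    i3 e1 (fun z => ?_) fun z => ?_
  · rw [leviPair, ← re_ofReal_mul, mul_sum]
    congr 1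
    refine sum_ext fun i => ?_
    rw [mul_sum]
    exact sum_ext fun j => by ring
  · rw [mul_comm, ← re_ofReal_mul, mul_comm]

/-- The constant function `1` as a `0`-form. -/
def oneForm (n : ℕ) : Cn n → (Cn n) [⋀^Fin 0]→ₗ[ℂ] ℂ := fun _ =>
  AlternatingMap.constOfIsEmpty ℂ (Cn n) (Fin 0) 1

theorem isDecompOn_oneForm : IsDecompOn g (oneForm n) Ω where
  holo J z _ := by simpa [ec, oneForm] using contDiffAt_const
  decomp z _ := by
    refine ⟨Fin.elim0, 1, fun i => i.elim0, ?_⟩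
    ext s
    simp [oneForm, wedge_apply]

theorem pm_oneForm (h : IsKahlerOn g Ω) (hz : z ∈ Ω) (i j : Fin n) :
    pm g (oneForm n) (some i) (some j) z = (g z).det * ginv g z i j := by
  obtain ⟨o, ho⟩ := h.exists_ortho hz
  have hv : IsOrtho (sesq (g z)) (Fin.elim0 : Fin 0 → Cn n) := fun i => i.elim0
  have ht : oneForm n z = (1 : ℂ) • wedge (dualFam (sesq (g z)) (Fin.elim0 : Fin 0 → Cn n)) := by
    ext s
    simp [oneForm, wedge_apply]
  rw [pm_some_some h hz ho hv ht, ginv_eq ho]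
  simp

theorem leviDen_oneForm (h : IsKahlerOn g Ω) (hz : z ∈ Ω) (hu : ContDiffAt ℝ ∞ u z) :
    leviDen g (oneForm n) u z
      = ∑ i, ∑ j, (g z).det * ginv g z i j * wd i (wdBar j fun y => (u y : ℂ)) z := by
  have h0 : arr (oneForm n) z none = 0 := by
    funext I
    simp [arr, ec, oneForm, wd]
  have h1 : ∀ μ, pm g (oneForm n) none μ z = 0 := fun μ => by simp [pm, apair, h0]
  have h2 : ∀ μ, pm g (oneForm n) μ none z = 0 := fun μ => by rw [← conj_pm h hz, h1, map_zero]
  rw [leviDen_eq isDecompOn_oneForm h hz hu]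
  simp only [h1, h2, pm_oneForm h hz, mul_zero, sum_const_zero, add_zero]
  exact sum_ext fun i => sum_ext fun j => mul_comm _ _

theorem integral_leviPair_mul (h : IsKahlerOn g Ω) (hη : IsDecompOn g η Ω)
    (hu : ∀ z ∈ Ω, ContDiffAt ℝ ∞ u z) {ψ : Cn n → ℝ} (hψ : ∀ z ∈ Ω, ContDiffAt ℝ ∞ ψ z)
    {θ : Cn n → ℝ} (hθ : IsTest (fun x => (θ x : ℂ)) Ω) :
    ∫ z, u z * leviPair g η ψ z * θ z
      = ∫ z, (ψ z * ((leviDen g η u z).re * θ z) + u z * ψ z * leviPair g η θ z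
        + 2 * ∑ j, ψ z * (leviDiv g η u j z * wdBar j (fun x => (θ x : ℂ)) z).re) := by
  have hF : ∀ i j, SmOn (fun y => (u y : ℂ) * pm g η (some i) (some j) y) Ω := fun i j z hz =>
    Sm.mul (Sm.ofReal (hu z hz)) (hη.smOn_pm h _ _ z hz)
  have hP : SmOn (fun x => (ψ x : ℂ)) Ω := fun z hz => Sm.ofReal (hψ z hz)
  have hT : ∀ i j, IsTest (fun y => (u y : ℂ) * pm g η (some i) (some j) y * (θ y : ℂ)) Ω := fun i j =>
    hθ.mul (hF i j)
  have hi1 : ∀ i j, Integrable fun z => wd i (wdBar j fun x => (ψ x : ℂ)) z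
      * ((u z : ℂ) * pm g η (some i) (some j) z * (θ z : ℂ)) := fun i j =>
    ((hT i j).mul fun z hz => ((hP z hz).wdBar j).wd i).integrable
  have hi2 : ∀ i j, Integrable fun z => (ψ z : ℂ) *
      wdBar j (wd i fun y => (u y : ℂ) * pm g η (some i) (some j) y * (θ y : ℂ)) z := fun i j =>
    ((((hT i j).wd i).wdBar j).mul hP).integrable
  have e1 : ∫ z, ∑ i, ∑ j, wd i (wdBar j fun x => (ψ x : ℂ)) z
      * ((u z : ℂ) * pm g η (some i) (some j) z * (θ z : ℂ))
      = ∫ z, ∑ i, ∑ j, (ψ z : ℂ) *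
        wdBar j (wd i fun y => (u y : ℂ) * pm g η (some i) (some j) y * (θ y : ℂ)) z := by
    rw [integral_finsetSum _ fun i _ => integrable_finsetSum _ fun j _ => hi1 i j,
      integral_finsetSum _ fun i _ => integrable_finsetSum _ fun j _ => hi2 i j]
    refine sum_ext fun i => ?_
    rw [integral_finsetSum _ fun j _ => hi1 i j, integral_finsetSum _ fun j _ => hi2 i j]
    exact sum_ext fun j => (integral_mul_wdBar_wd (hT i j) hP i j).symm
  refine integral_eq_of_re (integrable_finsetSum _ fun i _ => integrable_finsetSum _ fun j _ => hi1 i j)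
    (integrable_finsetSum _ fun i _ => integrable_finsetSum _ fun j _ => hi2 i j) e1 (fun z => ?_)
    fun z => ?_
  · have : ∑ i, ∑ j, wd i (wdBar j fun x => (ψ x : ℂ)) z
        * ((u z : ℂ) * pm g η (some i) (some j) z * (θ z : ℂ))
        = ((u z * θ z : ℝ) : ℂ) * ∑ i, ∑ j, pm g η (some i) (some j) z
          * wd i (wdBar j fun x => (ψ x : ℂ)) z := by
      rw [mul_sum]
      refine sum_ext fun i => ?_
      rw [mul_sum]
      refine sum_ext fun j => ?_
      push_cast; ring
    rw [this, re_ofReal_mul, leviPair]; ring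
  · by_cases hz : z ∈ Ω
    · have hθs : Sm (fun x => (θ x : ℂ)) z := hθ.smooth.contDiffAt
      have hθr : DifferentiableAt ℝ θ z := by
        have : DifferentiableAt ℝ (fun x => ((θ x : ℂ)).re) z :=
          reCLM.differentiableAt.comp z hθs.diff
        simpa using this
      simp_rw [← mul_sum]
      rw [sum_wdBar_wd_mul hη h hz (hu z hz) hθs, re_ofReal_mul]
      have t1 : (leviDen g η u z * (θ z : ℂ)).re = (leviDen g η u z).re * θ z := by
        rw [mul_comm, re_ofReal_mul, mul_comm]
      have t2 : (∑ i, conj (leviDiv g η u i z) * wd i (fun x => (θ x : ℂ)) z).re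
          = ∑ j, (leviDiv g η u j z * wdBar j (fun x => (θ x : ℂ)) z).re := by
        rw [re_sum]
        refine sum_ext fun j => ?_
        rw [wdBar_ofReal j hθr, ← conj_re]; congr 1; simp
      have t3 : (∑ i, ∑ j, (u z : ℂ) * pm g η (some i) (some j) z
          * wd i (wdBar j fun x => (θ x : ℂ)) z).re = u z * leviPair g η θ z := by
        rw [leviPair, ← re_ofReal_mul, mul_sum]
        congr 1
        refine sum_ext fun i => ?_
        rw [mul_sum]
        exact sum_ext fun j => by ring
      rw [add_re, add_re, add_re, t1, t2, t3, re_sum]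
      ring
    · have z1 : θ z = 0 := by simpa using hθ.zero_of_notMem hz
      have z2 := fun j => (hθ.wdBar j).zero_of_notMem hz
      have z3 := (isCc_leviPair h hη hθ).zero_of_notMem hz
      have z4 := fun i j => (((hT i j).wd i).wdBar j).zero_of_notMem hz
      simp only [z1, z2, z3, z4]
      simp

end LocalMetric

/-! ### The local estimates -/

section LocalEstimate

variable {n p : ℕ} {z₀ : Cn n} {r C K : ℝ} {g : LocalMatrix n}
  {η : LocalForm n p} {u : Cn n → ℝ} {U : ℕ → Cn n → ℝ} {G : Fin n → Cn n → ℂ}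

theorem integral_le_of_tendsto {f : ℕ → Cn n → ℝ} {F : Cn n → ℝ} {κ : ℝ} {b : ℕ → ℝ} {B : ℝ}
    (hκ : 0 ≤ κ) (hf : ∀ m, Integrable (f m)) (hf0 : ∀ m z, 0 ≤ f m z)
    (hlim : ∀ᵐ z, Tendsto (fun m => f m z) atTop (nhds (F z))) (hb : ∀ m, κ * ∫ z, f m z ≤ b m)
    (hB : Tendsto b atTop (nhds B)) : (0 < κ → Integrable F) ∧ κ * ∫ z, F z ≤ B := by
  have hF0 : ∀ᵐ z, 0 ≤ F z := by
    filter_upwards [hlim] with z hz using ge_of_tendsto' hz fun m => hf0 m z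
  have hFm : AEStronglyMeasurable F volume :=
    aestronglyMeasurable_of_tendsto_ae atTop (fun m => (hf m).aestronglyMeasurable) hlim
  rcases hκ.eq_or_lt with hκ | hκ
  · refine ⟨fun h => absurd hκ h.ne, ?_⟩
    rw [← hκ, zero_mul]
    refine ge_of_tendsto' hB fun m => ?_
    have := hb m
    rwa [← hκ, zero_mul] at this
  · have hle : ∫⁻ z, ENNReal.ofReal (F z) ≤ ENNReal.ofReal (B / κ) := by
      calc ∫⁻ z, ENNReal.ofReal (F z)
          = ∫⁻ z, liminf (fun m => ENNReal.ofReal (f m z)) atTop := by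
            refine lintegral_congr_ae ?_
            filter_upwards [hlim] with z hz
            exact ((ENNReal.continuous_ofReal.tendsto _).comp hz).liminf_eq.symm
        _ ≤ liminf (fun m => ∫⁻ z, ENNReal.ofReal (f m z)) atTop :=
            lintegral_liminf_le' fun m => (hf m).aestronglyMeasurable.aemeasurable.ennreal_ofReal
        _ ≤ liminf (fun m => ENNReal.ofReal (b m / κ)) atTop := by
            refine liminf_le_liminf (.of_forall fun m => ?_)
            rw [← ofReal_integral_eq_lintegral_ofReal (hf m) (.of_forall (hf0 m))]
            exact ENNReal.ofReal_le_ofReal (by rw [le_div_iff₀ hκ, mul_comm]; exact hb m)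
        _ = _ := ((ENNReal.continuous_ofReal.tendsto _).comp (hB.div_const κ)).liminf_eq
    have hint : Integrable F := by
      refine ⟨hFm, ?_⟩
      rw [hasFiniteIntegral_iff_ofReal hF0]
      exact hle.trans_lt ENNReal.ofReal_lt_top
    refine ⟨fun _ => hint, ?_⟩
    have hB0 : 0 ≤ B / κ := div_nonneg (ge_of_tendsto' hB fun m =>
      (mul_nonneg hκ.le (integral_nonneg (hf0 m))).trans (hb m)) hκ.le
    rw [← ofReal_integral_eq_lintegral_ofReal hint hF0, ENNReal.ofReal_le_ofReal_iff hB0,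
      le_div_iff₀ hκ, mul_comm] at hle
    exact hle

theorem continuousOn_leviDiv {Ω : Set (Cn n)} (h : IsKahlerOn g Ω) (hη : IsDecompOn g η Ω)
    (hu : ∀ z ∈ Ω, ContDiffAt ℝ ∞ u z) (j : Fin n) : ContinuousOn (leviDiv g η u j) Ω := by
  intro z hz
  have : Sm (leviDiv g η u j) z := ContDiffAt.sum fun i _ =>
    (Sm.mul (Sm.ofReal (hu z hz)) (hη.smOn_pm h _ _ z hz)).wd i
  exact this.continuousAt.continuousWithinAt

theorem continuousOn_leviDen {Ω : Set (Cn n)} (h : IsKahlerOn g Ω) (hη : IsDecompOn g η Ω)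
    (hu : ∀ z ∈ Ω, ContDiffAt ℝ ∞ u z) : ContinuousOn (leviDen g η u) Ω := by
  intro z hz
  have : Sm (leviDen g η u) z := ContDiffAt.sum fun j _ => by
    have : Sm (leviDiv g η u j) z := ContDiffAt.sum fun i _ =>
      (Sm.mul (Sm.ofReal (hu z hz)) (hη.smOn_pm h _ _ z hz)).wd i
    exact this.wdBar j
  exact this.continuousAt.continuousWithinAt

theorem tendsto_zero_of_forall_le {a b : ℕ → ℝ} {F : ℝ} (ha : ∀ m, 0 ≤ a m) (hF : 0 ≤ F)
    (hb : Tendsto b atTop (nhds 0)) (hab : ∀ δ > 0, ∀ m, a m ≤ δ * F + b m / (4 * δ)) :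
    Tendsto a atTop (nhds 0) := by
  rw [Metric.tendsto_atTop]
  intro ε hε
  have hδ : 0 < ε / (2 * (F + 1)) := by positivity
  have h1 := hb.div_const (4 * (ε / (2 * (F + 1))))
  rw [zero_div] at h1
  obtain ⟨N, hN⟩ := (Metric.tendsto_atTop.1 h1) (ε / 2) (by positivity)
  refine ⟨N, fun m hm => ?_⟩
  have h2 := hN m hm
  rw [Real.dist_eq, sub_zero] at h2 ⊢
  rw [abs_of_nonneg (ha m)]
  have h3 := hab _ hδ m
  have h4 : ε / (2 * (F + 1)) * F ≤ ε / 2 := by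
    rw [div_mul_eq_mul_div, div_le_div_iff₀ (by positivity) (by positivity)]
    nlinarith
  linarith [(abs_lt.1 h2).2]

theorem leviPair_integral_tendsto {η : LocalForm n p}
    (h : IsKahlerOn g (ball z₀ r)) (hη : IsDecompOn g η (ball z₀ r))
    (hreg : IsRegularization u U G z₀ r C K) {θ : Cn n → ℝ}
    (hθ : IsTest (fun x => (θ x : ℂ)) (ball z₀ r)) :
    Tendsto (fun m => ∫ z, (leviDen g η (U m) z).re * θ z) atTop
      (nhds (∫ z, u z * leviPair g η θ z)) := by
  have h1 : ∀ m, ∫ z, (leviDen g η (U m) z).re * θ z = ∫ z, U m z * leviPair g η θ z := fun m =>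
    (integral_mul_leviPair h hη (fun z _ => (hreg.smooth m).contDiffAt) hθ).symm
  simp_rw [h1]
  exact tendsto_integral_mul (B := C) (isCc_leviPair h hη hθ).integrable
    (fun m => (hreg.smooth m).continuous)
    (fun m z => by rw [norm_of_nonneg (hreg.nonneg m z)]; exact hreg.le m z) hreg.tendsto

theorem leviPair_integral_nonneg
    (h : IsKahlerOn g (ball z₀ r)) (hη : IsDecompOn g η (ball z₀ r))
    (hreg : IsRegularization u U G z₀ r C K) {θ : Cn n → ℝ}
    (hθ : IsTest (fun x => (θ x : ℂ)) (ball z₀ r)) (hθ0 : ∀ x, 0 ≤ θ x) :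
    0 ≤ ∫ z, u z * leviPair g η θ z := by
  refine ge_of_tendsto' (leviPair_integral_tendsto h hη hreg hθ) fun m => integral_nonneg fun z => ?_
  by_cases hz : z ∈ ball z₀ r
  · exact mul_nonneg (leviDen_nonneg hη h hz (hreg.smooth m).contDiffAt (hreg.logPsh m z hz)) (hθ0 z)
  · have : θ z = 0 := by simpa using hθ.zero_of_notMem hz
    simp [this]

theorem leviDen_integral_tendsto_zero (hr : 0 < r)
    (h : IsKahlerOn g (ball z₀ r)) (hη : IsDecompOn g η (ball z₀ r))
    (hreg : IsRegularization u U G z₀ r C K)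
    (hnull : ∀ θ : Cn n → ℝ, IsTest (fun x => (θ x : ℂ)) (ball z₀ r) → (∀ x, 0 ≤ θ x) →
      ∫ z, u z * leviPair g η θ z = 0)
    {f : Cn n → ℝ} (hf : IsCc f (ball z₀ r)) (hf0 : ∀ z, 0 ≤ f z) :
    Tendsto (fun m => ∫ z, (leviDen g η (U m) z).re * f z) atTop (nhds 0) := by
  obtain ⟨χ, hχ, hχ0, hχ1⟩ := exists_cutoff hr hf.compact hf.subset
  obtain ⟨B, hB⟩ := hf.bdd
  have h1 := leviPair_integral_tendsto h hη hreg hχ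
  rw [hnull χ hχ hχ0] at h1
  have hN : ∀ m, ContinuousOn (fun z => (leviDen g η (U m) z).re) (ball z₀ r) := fun m =>
    continuous_re.comp_continuousOn
      (continuousOn_leviDen h hη fun z _ => (hreg.smooth m).contDiffAt)
  have hN0 : ∀ m, ∀ z ∈ ball z₀ r, 0 ≤ (leviDen g η (U m) z).re := fun m z hz =>
    leviDen_nonneg hη h hz (hreg.smooth m).contDiffAt (hreg.logPsh m z hz)
  have hχc : IsCc χ (ball z₀ r) := by simpa using hχ.re
  have h2 := h1.const_mul B
  rw [mul_zero] at h2
  refine squeeze_zero (fun m => integral_nonneg fun z => ?_) (fun m => ?_) h2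
  · by_cases hz : z ∈ ball z₀ r
    · exact mul_nonneg (hN0 m z hz) (hf0 z)
    · simp [hf.zero_of_notMem hz]
  · rw [← integral_const_mul]
    refine integral_mono (hf.mul isOpen_ball (hN m)).integrable
      ((hχc.mul isOpen_ball (hN m)).integrable.const_mul B) fun z => ?_
    dsimp only
    by_cases hz : z ∈ tsupport f
    · have hz' := hf.subset hz
      rw [hχ1 z hz, mul_one, mul_comm]
      exact mul_le_mul_of_nonneg_right ((le_abs_self _).trans (hB z)) (hN0 m z hz')
    · rw [image_eq_zero_of_notMem_tsupport hz, mul_zero]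
      by_cases hz' : z ∈ ball z₀ r
      · exact mul_nonneg ((abs_nonneg _).trans (hB z)) (mul_nonneg (hN0 m z hz') (hχ0 z))
      · simp [hχc.zero_of_notMem hz']

theorem leviDiv_integral_tendsto_zero (hr : 0 < r)
    (h : IsKahlerOn g (ball z₀ r)) (hη : IsDecompOn g η (ball z₀ r))
    (hreg : IsRegularization u U G z₀ r C K)
    (hnull : ∀ θ : Cn n → ℝ, IsTest (fun x => (θ x : ℂ)) (ball z₀ r) → (∀ x, 0 ≤ θ x) →
      ∫ z, u z * leviPair g η θ z = 0)
    {f : Cn n → ℝ} (hf : IsCc f (ball z₀ r)) (hf0 : ∀ z, 0 ≤ f z) (j : Fin n) :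
    Tendsto (fun m => ∫ z, ‖leviDiv g η (U m) j z‖ * f z) atTop (nhds 0) := by
  have hW : ∀ m, ContinuousOn (fun z => ‖leviDiv g η (U m) j z‖) (ball z₀ r) := fun m =>
    (continuousOn_leviDiv h hη (fun z _ => (hreg.smooth m).contDiffAt) j).norm
  have hN : ∀ m, ContinuousOn (fun z => (leviDen g η (U m) z).re) (ball z₀ r) := fun m =>
    continuous_re.comp_continuousOn
      (continuousOn_leviDen h hη fun z _ => (hreg.smooth m).contDiffAt)
  have hN0 : ∀ m, ∀ z ∈ ball z₀ r, 0 ≤ (leviDen g η (U m) z).re := fun m z hz =>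
    leviDen_nonneg hη h hz (hreg.smooth m).contDiffAt (hreg.logPsh m z hz)
  have hPc : ContinuousOn (fun z => C * ‖pm g η (some j) (some j) z‖) (ball z₀ r) :=
    continuousOn_const.mul (ContinuousOn.norm fun z hz =>
      (hη.smOn_pm h _ _ z hz).continuousAt.continuousWithinAt)
  have hC : 0 ≤ C := (hreg.nonneg 0 z₀).trans (hreg.le 0 z₀)
  have hf2 := hf.mul isOpen_ball hPc
  have h2 := leviDen_integral_tendsto_zero hr h hη hreg hnull hf2 fun z =>
    mul_nonneg (by positivity) (hf0 z)
  refine tendsto_zero_of_forall_le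
    (fun m => integral_nonneg fun z => mul_nonneg (norm_nonneg _) (hf0 z))
    (integral_nonneg (μ := volume) hf0) h2
    fun δ hδ m => ?_
  rw [← integral_const_mul, ← integral_div, ← integral_add (hf.integrable.const_mul δ)
    ((hf2.mul isOpen_ball (hN m)).integrable.div_const _)]
  refine integral_mono (hf.mul isOpen_ball (hW m)).integrable ((hf.integrable.const_mul δ).add
    ((hf2.mul isOpen_ball (hN m)).integrable.div_const _)) fun z => ?_
  change _ ≤ δ * f z + _
  by_cases hz : z ∈ ball z₀ r
  · have h3 := norm_leviDiv_sq_le hη h hz (hreg.smooth m).contDiffAt (hreg.nonneg m z)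
      (hreg.logPsh m z hz) j
    set W := ‖leviDiv g η (U m) j z‖
    have h4 : W ^ 2 ≤ (leviDen g η (U m) z).re * (C * ‖pm g η (some j) (some j) z‖) := by
      refine h3.trans ?_
      rw [mul_comm (U m z), mul_assoc]
      gcongr
      · exact hN0 m z hz
      · exact hreg.le m z
    have h5 : W ≤ δ + W ^ 2 / (4 * δ) := by
      have h6 : δ + W ^ 2 / (4 * δ) - W = (W - 2 * δ) ^ 2 / (4 * δ) := by field_simp; ring
      have h7 : 0 ≤ (W - 2 * δ) ^ 2 / (4 * δ) := by positivity
      linarith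
    have h8 : W ≤ δ + (leviDen g η (U m) z).re * (C * ‖pm g η (some j) (some j) z‖) / (4 * δ) :=
      h5.trans (by gcongr)
    calc W * f z ≤ (δ + (leviDen g η (U m) z).re * (C * ‖pm g η (some j) (some j) z‖) / (4 * δ)) * f z :=
          mul_le_mul_of_nonneg_right h8 (hf0 z)
      _ = _ := by ring
  · simp [hf.zero_of_notMem hz]

/-- The limit of the derivatives of the approximations of the Hermitian ratio. -/
def gradLim (g : LocalMatrix n) (η : LocalForm n p)
    (u : Cn n → ℝ) (G : Fin n → Cn n → ℂ) (i : Fin n) (z : Cn n) : ℂ :=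
  G i z * nrm g η z + u z * wd i (fun x => (nrm g η x : ℂ)) z

theorem wd_ratio {Ω : Set (Cn n)} (h : IsKahlerOn g Ω) (hη : IsDecompOn g η Ω) {z : Cn n} (hz : z ∈ Ω)
    (hu : ContDiffAt ℝ ∞ u z) (i : Fin n) :
    wd i (fun x => ((u x * nrm g η x : ℝ) : ℂ)) z
      = gradLim g η u (fun i z => wd i (fun x => (u x : ℂ)) z) i z := by
  have : (fun x => ((u x * nrm g η x : ℝ) : ℂ)) = fun x => (u x : ℂ) * (nrm g η x : ℂ) := by
    funext x; push_cast; ring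
  rw [this, wd_mul i (Sm.ofReal hu).diff (Sm.ofReal (hη.smOn_nrm h hz)).diff]
  rfl

theorem continuous_conorm (z : Cn n) : Continuous fun a : Fin n → ℂ => conorm g z a := by
  unfold conorm
  fun_prop

theorem local_estimate_aux (hr : 0 < r)
    (h : IsKahlerOn g (ball z₀ r)) (hη : IsDecompOn g η (ball z₀ r))
    (hreg : IsRegularization u U G z₀ r C K)
    (hnull : ∀ θ : Cn n → ℝ, IsTest (fun x => (θ x : ℂ)) (ball z₀ r) → (∀ x, 0 ≤ θ x) →
      ∫ z, u z * leviPair g η θ z = 0)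
    {θ : Cn n → ℝ} (hθ : IsTest (fun x => (θ x : ℂ)) (ball z₀ r)) (hθ0 : ∀ x, 0 ≤ θ x)
    {c₁ c₂ : ℝ} (hc₁ : 0 ≤ c₁) (hc : 0 ≤ c₁ + c₂) :
    (0 < c₁ + c₂ → Integrable fun z => (g z).det.re * conorm g z (fun i => gradLim g η u G i z) * θ z) ∧
    (c₁ + c₂) * (∫ z, (g z).det.re * conorm g z (fun i => gradLim g η u G i z) * θ z)
      ≤ (c₁ + c₂) / 2 * (∫ z, u z ^ 2 * (nrm g η z ^ 2 * leviPair g (oneForm n) θ z))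
        - c₂ * (∫ z, u z ^ 2 * (nrm g η z * leviPair g η θ z))
        - ∫ z, u z ^ 2 * ((g z).det.re * curvTerm c₁ c₂ g η z * θ z) := by
  have hB := isOpen_ball (x := z₀) (ε := r)
  have hC : 0 ≤ C := (hreg.nonneg 0 z₀).trans (hreg.le 0 z₀)
  have hUs : ∀ m z, ContDiffAt ℝ ∞ (U m) z := fun m z => (hreg.smooth m).contDiffAt
  have hνs : ∀ z ∈ ball z₀ r, ContDiffAt ℝ ∞ (nrm g η) z := fun z hz => hη.smOn_nrm h hz
  have hνc : ContinuousOn (nrm g η) (ball z₀ r) := fun z hz =>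
    (hνs z hz).continuousAt.continuousWithinAt
  have hVc : ContinuousOn (fun z => (g z).det.re) (ball z₀ r) := fun z hz =>
    (continuous_re.continuousAt.comp (h.smOn_det z hz).continuousAt).continuousWithinAt
  have hψs : ∀ m, ∀ z ∈ ball z₀ r, ContDiffAt ℝ ∞ (fun x => U m x * nrm g η x) z :=
    fun m z hz => (hUs m z).mul (hνs z hz)
  have hθc : IsCc θ (ball z₀ r) := by simpa using hθ.re
  have hL := isCc_leviPair h isDecompOn_oneForm hθ
  have hP := isCc_leviPair h hη hθ
  have hi1 : IsCc (fun z => nrm g η z ^ 2 * leviPair g (oneForm n) θ z) (ball z₀ r) :=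
    hL.mul hB (hνc.pow 2)
  have hi2 := hP.mul hB hνc
  have hi3 : IsCc (fun z => (g z).det.re * curvTerm c₁ c₂ g η z * θ z) (ball z₀ r) :=
    hθc.mul hB (hVc.mul (hη.continuousOn_curvTerm h c₁ c₂))
  have hsq : ∀ f : Cn n → ℝ, Integrable f →
      Tendsto (fun m => ∫ z, U m z ^ 2 * f z) atTop (nhds (∫ z, u z ^ 2 * f z)) := fun f hf =>
    tendsto_integral_mul (B := C ^ 2) hf (fun m => (hreg.smooth m).continuous.pow 2)
      (fun m z => by
        rw [norm_of_nonneg (sq_nonneg _)]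
        exact pow_le_pow_left₀ (hreg.nonneg m z) (hreg.le m z) 2)
      (by filter_upwards [hreg.tendsto] with z hz using hz.pow 2)
  have hUb : ∀ m z, |U m z| ≤ C := fun m z => by
    rw [abs_of_nonneg (hreg.nonneg m z)]; exact hreg.le m z
  have hν0 : ∀ z ∈ ball z₀ r, 0 ≤ nrm g η z := fun z hz => hη.nrm_nonneg h hz
  have hN0 : ∀ m, ∀ z ∈ ball z₀ r, 0 ≤ (leviDen g η (U m) z).re := fun m z hz =>
    leviDen_nonneg hη h hz (hUs m z) (hreg.logPsh m z hz)
  have hNc : ∀ m, ContinuousOn (fun z => (leviDen g η (U m) z).re) (ball z₀ r) := fun m =>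
    continuous_re.comp_continuousOn (continuousOn_leviDen h hη fun z _ => hUs m z)
  have hUc : ∀ m, ContinuousOn (U m) (ball z₀ r) := fun m => (hreg.smooth m).continuous.continuousOn
  have hψc : ∀ m, ContinuousOn (fun z => U m z * nrm g η z) (ball z₀ r) := fun m => (hUc m).mul hνc
  -- the error terms
  have t1i : ∀ m, IsCc (fun z => U m z * nrm g η z * ((leviDen g η (U m) z).re * θ z)) (ball z₀ r) :=
    fun m => (hθc.mul hB (hNc m)).mul hB (hψc m)
  have t1 : Tendsto (fun m => ∫ z, U m z * nrm g η z * ((leviDen g η (U m) z).re * θ z)) atTop (nhds 0) := by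
    have h2 := leviDen_integral_tendsto_zero hr h hη hreg hnull (f := fun z =>
      C * |nrm g η z| * θ z) (hθc.mul hB (continuousOn_const.mul hνc.abs)) fun z =>
        mul_nonneg (by positivity) (hθ0 z)
    refine squeeze_zero (fun m => integral_nonneg fun z => ?_) (fun m => ?_) h2
    · by_cases hz : z ∈ ball z₀ r
      · exact mul_nonneg (mul_nonneg (hreg.nonneg m z) (hν0 z hz)) (mul_nonneg (hN0 m z hz) (hθ0 z))
      · simp [hθc.zero_of_notMem hz]
    · refine integral_mono (t1i m).integrable
        ((hθc.mul hB (continuousOn_const.mul hνc.abs)).mul hB (hNc m)).integrable fun z => ?_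
      by_cases hz : z ∈ ball z₀ r
      · calc U m z * nrm g η z * ((leviDen g η (U m) z).re * θ z)
            ≤ C * |nrm g η z| * ((leviDen g η (U m) z).re * θ z) := by
              refine mul_le_mul_of_nonneg_right ?_ (mul_nonneg (hN0 m z hz) (hθ0 z))
              exact mul_le_mul (hreg.le m z) (le_abs_self _) (hν0 z hz) hC
          _ = _ := by ring
      · simp [hθc.zero_of_notMem hz]
  have hWc : ∀ m j, ContinuousOn (leviDiv g η (U m) j) (ball z₀ r) := fun m j =>
    continuousOn_leviDiv h hη (fun z _ => hUs m z) j
  have t3i : ∀ m j, IsCc (fun z => U m z * nrm g η z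
      * (leviDiv g η (U m) j z * wdBar j (fun x => (θ x : ℂ)) z).re) (ball z₀ r) := fun m j => by
    have : IsTest (fun z => leviDiv g η (U m) j z * wdBar j (fun x => (θ x : ℂ)) z) (ball z₀ r) :=
      (hθ.wdBar j).mul fun z hz => ContDiffAt.sum fun i _ =>
        (Sm.mul (Sm.ofReal (hUs m z)) (hη.smOn_pm h _ _ z hz)).wd i
    exact this.re.mul hB (hψc m)
  have t3 : ∀ j, Tendsto (fun m => ∫ z, U m z * nrm g η z
      * (leviDiv g η (U m) j z * wdBar j (fun x => (θ x : ℂ)) z).re) atTop (nhds 0) := fun j => by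
    have hf : IsCc (fun z => C * |nrm g η z| * ‖wdBar j (fun x => (θ x : ℂ)) z‖) (ball z₀ r) :=
      (hθ.wdBar j).norm.mul hB (continuousOn_const.mul hνc.abs)
    have h2 := leviDiv_integral_tendsto_zero hr h hη hreg hnull hf (fun z => by positivity) j
    refine squeeze_zero_norm (fun m => ?_) h2
    refine norm_integral_le_of_norm_le (hf.mul hB (hWc m j).norm).integrable
      (.of_forall fun z => ?_)
    rw [norm_mul, norm_mul, norm_eq_abs, norm_eq_abs, norm_eq_abs]
    have := Complex.abs_re_le_norm (leviDiv g η (U m) j z * wdBar j (fun x => (θ x : ℂ)) z)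
    rw [norm_mul] at this
    calc _ ≤ C * |nrm g η z| * (‖leviDiv g η (U m) j z‖ * ‖wdBar j (fun x => (θ x : ℂ)) z‖) := by
          gcongr
          exact hUb m z
      _ = _ := by ring
  -- the inequality for the approximations
  set b : ℕ → ℝ := fun m => (c₁ + c₂) / 2 * (∫ z, U m z ^ 2 * (nrm g η z ^ 2 * leviPair g (oneForm n) θ z))
    - c₂ * ((∫ z, U m z * nrm g η z * ((leviDen g η (U m) z).re * θ z))
      + (∫ z, U m z ^ 2 * (nrm g η z * leviPair g η θ z))
      + 2 * ∑ j, ∫ z, U m z * nrm g η z * (leviDiv g η (U m) j z * wdBar j (fun x => (θ x : ℂ)) z).re)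
    - ∫ z, U m z ^ 2 * ((g z).det.re * curvTerm c₁ c₂ g η z * θ z) with hb
  have hblim : Tendsto b atTop (nhds ((c₁ + c₂) / 2 *
      (∫ z, u z ^ 2 * (nrm g η z ^ 2 * leviPair g (oneForm n) θ z))
        - c₂ * (0 + (∫ z, u z ^ 2 * (nrm g η z * leviPair g η θ z)) + 2 * ∑ _j : Fin n, (0 : ℝ))
        - ∫ z, u z ^ 2 * ((g z).det.re * curvTerm c₁ c₂ g η z * θ z))) :=
    (((hsq _ hi1.integrable).const_mul _).sub (((t1.add (hsq _ hi2.integrable)).add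
      ((tendsto_finsetSum _ fun j _ => t3 j).const_mul 2)).const_mul c₂)).sub (hsq _ hi3.integrable)
  rw [sum_const_zero, mul_zero, add_zero, zero_add] at hblim
  set D : ℕ → Cn n → ℝ := fun m z => (g z).det.re
    * conorm g z (fun i => wd i (fun x => ((U m x * nrm g η x : ℝ) : ℂ)) z) * θ z with hD
  have hDi : ∀ m, IsCc (D m) (ball z₀ r) := fun m => by
    refine hθc.mul hB (hVc.mul fun z hz => ?_)
    have hw : ∀ i, Sm (wd i (fun x => ((U m x * nrm g η x : ℝ) : ℂ))) z := fun i =>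
      (Sm.ofReal (hψs m z hz)).wd i
    have : Sm (fun z => ∑ i, ∑ j, ginv g z i j * wd i (fun x => ((U m x * nrm g η x : ℝ) : ℂ)) z
        * conj (wd j (fun x => ((U m x * nrm g η x : ℝ) : ℂ)) z)) z :=
      ContDiffAt.sum fun i _ => ContDiffAt.sum fun j _ =>
        ((h.smOn_ginv i j z hz).mul (hw i)).mul (hw j).conj
    exact (continuous_re.continuousAt.comp this.continuousAt).continuousWithinAt
  have hD0 : ∀ m z, 0 ≤ D m z := fun m z => by
    by_cases hz : z ∈ ball z₀ r
    · exact mul_nonneg (mul_nonneg (h.det_pos hz).1.le (conorm_nonneg h hz _)) (hθ0 z)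
    · simp [hD, hθc.zero_of_notMem hz]
  have hDlim : ∀ᵐ z, Tendsto (fun m => D m z) atTop
      (nhds ((g z).det.re * conorm g z (fun i => gradLim g η u G i z) * θ z)) := by
    have h1 : ∀ᵐ z, z ∈ ball z₀ r → ∀ i, Tendsto (fun m => wd i (fun y => (U m y : ℂ)) z) atTop
        (nhds (G i z)) := by
      rw [← ae_restrict_iff' measurableSet_ball, ae_all_iff]
      exact hreg.tendsto_wd
    filter_upwards [h1, hreg.tendsto] with z hz1 hz2
    by_cases hz : z ∈ ball z₀ r
    · refine (Tendsto.const_mul _ ?_).mul_const _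
      refine ((continuous_conorm z).tendsto _).comp (tendsto_pi_nhds.2 fun i => ?_)
      simp_rw [fun m => wd_ratio h hη hz (hUs m z) i]
      exact ((hz1 hz i).mul_const _).add (((continuous_ofReal.tendsto _).comp hz2).mul_const _)
    · simp only [hD, hθc.zero_of_notMem hz, mul_zero]
      exact tendsto_const_nhds
  have hle : ∀ m, (c₁ + c₂) * ∫ z, D m z ≤ b m := by
    intro m
    have hpt : ∀ z, (c₁ + c₂) * D m z + U m z ^ 2 * ((g z).det.re * curvTerm c₁ c₂ g η z * θ z)
        ≤ (c₁ + c₂) / 2 * ((leviDen g (oneForm n) (fun x => (U m x * nrm g η x) ^ 2) z).re * θ z)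
          - c₂ * (U m z * leviPair g η (fun x => U m x * nrm g η x) z * θ z) := by
      intro z
      by_cases hz : z ∈ ball z₀ r
      · have h1 := bochner_trace h hη hz (hUs m z) (.of_forall (hreg.nonneg m))
          (hreg.logPsh m z hz) hc₁ hc
        rw [← leviDen_oneForm h hz ((hψs m z hz).pow 2)] at h1
        have h2 : (∑ i, ∑ j, U m z * pm g η (some i) (some j) z
            * wd i (wdBar j fun x => ((U m x * nrm g η x : ℝ) : ℂ)) z).re
            = U m z * leviPair g η (fun x => U m x * nrm g η x) z := by
          rw [leviPair, ← re_ofReal_mul, mul_sum]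
          congr 1
          refine sum_ext fun i => ?_
          rw [mul_sum]
          exact sum_ext fun j => by ring
        rw [h2] at h1
        have h3 := mul_le_mul_of_nonneg_right h1 (hθ0 z)
        simp only [hD]
        linarith
      · simp [hD, hθc.zero_of_notMem hz]
    have k1 : IsCc (fun z => (leviDen g (oneForm n) (fun x => (U m x * nrm g η x) ^ 2) z).re * θ z)
        (ball z₀ r) := hθc.mul hB (continuous_re.comp_continuousOn
      (continuousOn_leviDen h isDecompOn_oneForm fun z hz => (hψs m z hz).pow 2))
    have k2 : IsCc (fun z => U m z * leviPair g η (fun x => U m x * nrm g η x) z * θ z)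
        (ball z₀ r) := by
      refine hθc.mul hB ((hUc m).mul fun z hz => ?_)
      have : Sm (fun z => ∑ i, ∑ j, pm g η (some i) (some j) z
          * wd i (wdBar j fun x => ((U m x * nrm g η x : ℝ) : ℂ)) z) z :=
        ContDiffAt.sum fun i _ => ContDiffAt.sum fun j _ =>
          (hη.smOn_pm h _ _ z hz).mul (((Sm.ofReal (hψs m z hz)).wdBar j).wd i)
      exact (continuous_re.continuousAt.comp this.continuousAt).continuousWithinAt
    have k3 : Integrable (fun z => U m z ^ 2 * ((g z).det.re * curvTerm c₁ c₂ g η z * θ z)) :=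
      (hi3.mul hB ((hUc m).pow 2)).integrable
    have h4 := integral_mono (((hDi m).integrable.const_mul (c₁ + c₂)).add k3)
      ((k1.integrable.const_mul _).sub (k2.integrable.const_mul _)) hpt
    simp only [Pi.add_apply, Pi.sub_apply] at h4
    rw [integral_add ((hDi m).integrable.const_mul (c₁ + c₂)) k3,
      integral_sub (k1.integrable.const_mul _) (k2.integrable.const_mul _), integral_const_mul,
      integral_const_mul, integral_const_mul,
      ← integral_mul_leviPair h isDecompOn_oneForm (fun z hz => (hψs m z hz).pow 2) hθ,
      integral_leviPair_mul h hη (fun z _ => hUs m z) (hψs m) hθ] at h4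
    have k4 : IsCc (fun z => U m z * (U m z * nrm g η z) * leviPair g η θ z) (ball z₀ r) :=
      hP.mul hB ((hUc m).mul (hψc m))
    have k5 := IsCc.sum Finset.univ fun j _ => t3i m j
    rw [integral_add ((t1i m).add k4).integrable (k5.integrable.const_mul 2),
      integral_add (t1i m).integrable k4.integrable, integral_const_mul,
      integral_finsetSum _ fun j _ => (t3i m j).integrable] at h4
    have e1 : ∀ z, (U m z * nrm g η z) ^ 2 * leviPair g (oneForm n) θ z
        = U m z ^ 2 * (nrm g η z ^ 2 * leviPair g (oneForm n) θ z) := fun z => by ring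
    have e2 : ∀ z, U m z * (U m z * nrm g η z) * leviPair g η θ z
        = U m z ^ 2 * (nrm g η z * leviPair g η θ z) := fun z => by ring
    simp_rw [e1, e2] at h4
    simp only [hb]
    linarith
  exact integral_le_of_tendsto hc (fun m => (hDi m).integrable) hD0 hDlim hle hblim

theorem local_estimate (hr : 0 < r)
    (h : IsKahlerOn g (ball z₀ r)) (hη : IsDecompOn g η (ball z₀ r))
    (hreg : IsRegularization u U G z₀ r C K)
    (hnull : ∀ θ : Cn n → ℝ, IsTest (fun x => (θ x : ℂ)) (ball z₀ r) → (∀ x, 0 ≤ θ x) →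
      ∫ z, u z * leviPair g η θ z = 0)
    {θ : Cn n → ℝ} (hθ : IsTest (fun x => (θ x : ℂ)) (ball z₀ r)) (hθ0 : ∀ x, 0 ≤ θ x)
    {c₁ c₂ : ℝ} (hc₁ : 0 ≤ c₁) (hc : 0 ≤ c₁ + c₂) :
    (Integrable fun z => (g z).det.re * conorm g z (fun i => gradLim g η u G i z) * θ z) ∧
    (c₁ + c₂) * (∫ z, (g z).det.re * conorm g z (fun i => gradLim g η u G i z) * θ z)
        + ∫ z, u z ^ 2 * ((g z).det.re * curvTerm c₁ c₂ g η z * θ z)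
      ≤ (c₁ + c₂) / 2 * (∫ z, u z ^ 2 * (nrm g η z ^ 2 * leviPair g (oneForm n) θ z))
        - c₂ * (∫ z, u z ^ 2 * (nrm g η z * leviPair g η θ z)) := by
  have h1 := local_estimate_aux hr h hη hreg hnull hθ hθ0 (c₁ := 1) (c₂ := 0) zero_le_one (by norm_num)
  have h2 := local_estimate_aux hr h hη hreg hnull hθ hθ0 hc₁ hc
  exact ⟨h1.1 (by norm_num), by linarith [h2.2]⟩

end LocalEstimate

/-! ### Averages over spheres -/

section Sphere

open scoped Pointwise in
theorem toSphere_map_eq {E : Type*} [NormedAddCommGroup E] [InnerProductSpace ℝ E]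
    [FiniteDimensional ℝ E] [MeasurableSpace E] [BorelSpace E] (T : E ≃ₗᵢ[ℝ] E) (F : E → ℂ) :
    ∫ v : sphere (0 : E) 1, F (T v) ∂((volume : Measure E).toSphere)
      = ∫ v : sphere (0 : E) 1, F v ∂((volume : Measure E).toSphere) := by
  have hT : ∀ v : E, v ∈ sphere (0 : E) 1 ↔ T v ∈ sphere (0 : E) 1 := fun v => by simp
  let τ : sphere (0 : E) 1 ≃ₜ sphere (0 : E) 1 := T.toHomeomorph.subtype hT
  have hτ : ((volume : Measure E).toSphere).map τ = (volume : Measure E).toSphere := by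
    ext s hs
    rw [Measure.map_apply τ.continuous.measurable hs, Measure.toSphere_apply' _ hs,
      Measure.toSphere_apply' _ (τ.continuous.measurable hs)]
    congr 1
    rw [← (LinearIsometryEquiv.measurePreserving T).measure_preimage_equiv
      (f := T.toMeasurableEquiv) (Set.Ioo (0 : ℝ) 1 • (Subtype.val '' s))]
    congr 1
    ext v
    simp only [Set.mem_smul, Set.mem_preimage, Set.mem_image, Subtype.exists, exists_and_right, exists_eq_right]
    constructor
    · rintro ⟨r, hr, w, ⟨hw, hws⟩, rfl⟩
      exact ⟨r, hr, T w, ⟨(hT w).1 hw, hws⟩, (T.map_smul r w).symm⟩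
    · rintro ⟨r, hr, w, ⟨hw, hws⟩, hv⟩
      have hw' : T.symm w ∈ sphere (0 : E) 1 := (hT _).2 (by simpa using hw)
      refine ⟨r, hr, T.symm w, ⟨hw', ?_⟩, ?_⟩
      · convert hws
        exact T.apply_symm_apply w
      · rw [← T.symm.map_smul, hv]
        exact T.symm_apply_apply v
  conv_rhs => rw [← hτ]
  rw [τ.measurableEmbedding.integral_map]
  rfl

variable {V : Type*} [NormedAddCommGroup V] [InnerProductSpace ℂ V] [FiniteDimensional ℂ V]

/-- A probability measure on the unit sphere that is invariant under unitary maps. -/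
structure IsSphereLaw [MeasurableSpace V] (σ : Measure V) : Prop where
  prob : IsProbabilityMeasure σ
  norm : ∀ᵐ v ∂σ, ‖v‖ = 1
  inv : ∀ (T : V ≃ₗᵢ[ℂ] V) (F : V → ℂ), ∫ v, F (T v) ∂σ = ∫ v, F v ∂σ

theorem exists_isSphereLaw [Nontrivial V] : ∃ (m : MeasurableSpace V) (_ : @BorelSpace V _ m)
    (σ : @Measure V m), IsSphereLaw σ ∧ ∀ F : V → ℝ, sphereMean F = ∫ v, F v ∂σ := by
  let _ : InnerProductSpace ℝ V := InnerProductSpace.complexToReal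
  have _ : FiniteDimensional ℝ V := FiniteDimensional.complexToReal V
  let _ : MeasurableSpace V := borel V
  have _ : BorelSpace V := ⟨rfl⟩
  let _ : MeasureSpace V := measureSpaceOfInnerProductSpace
  set μ := (volume : Measure V).toSphere with hμ
  have hμ0 : μ ≠ 0 := Measure.toSphere_ne_zero _
  have : NeZero μ := ⟨hμ0⟩
  have hemb : MeasurableEmbedding (Subtype.val : sphere (0 : V) 1 → V) :=
    MeasurableEmbedding.subtype_coe Metric.isClosed_sphere.measurableSet
  refine ⟨borel V, ⟨rfl⟩, ((μ Set.univ)⁻¹ • μ).map Subtype.val, ⟨?_, ?_, ?_⟩, ?_⟩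
  · exact Measure.isProbabilityMeasure_map hemb.measurable.aemeasurable
  · rw [hemb.ae_map_iff]
    exact .of_forall fun v => by simp
  · intro T F
    let T' : V ≃ₗᵢ[ℝ] V := ⟨T.toLinearEquiv.restrictScalars ℝ, T.norm_map⟩
    rw [hemb.integral_map, hemb.integral_map, integral_smul_measure, integral_smul_measure]
    congr 1
    exact toSphere_map_eq T' F
  · intro F
    rw [hemb.integral_map]
    rfl

variable {p : ℕ}

theorem exists_isometry_phase (b : OrthonormalBasis (Fin p) ℂ V) (a : Fin p) :
    ∃ T : V ≃ₗᵢ[ℂ] V, ∀ v i, b.repr (T v) i = (if i = a then I else 1) * b.repr v i := by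
  let c : Fin p → ℂ := fun i => if i = a then I else 1
  have hc : ∀ i, ‖c i‖ = 1 := fun i => by dsimp only [c]; split_ifs <;> simp
  have ho : Orthonormal ℂ fun i => c i • b i := by
    rw [orthonormal_iff_ite]
    intro i j
    rw [inner_smul_left, inner_smul_right, orthonormal_iff_ite.1 b.orthonormal]
    split_ifs with h
    · subst h
      have := Complex.conj_mul' (c i)
      rw [hc] at this
      rw [mul_one, this]; norm_num
    · simp
  have hs : ⊤ ≤ Submodule.span ℂ (Set.range fun i => c i • b i) := by
    rw [← b.toBasis.span_eq, Submodule.span_le]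
    rintro _ ⟨i, rfl⟩
    have h0 : c i ≠ 0 := fun h => by have := hc i; rw [h] at this; simp at this
    have : b.toBasis i = (c i)⁻¹ • (c i • b i) := by rw [smul_smul, inv_mul_cancel₀ h0]; simp
    rw [SetLike.mem_coe, this]
    exact Submodule.smul_mem _ _ (Submodule.subset_span ⟨i, rfl⟩)
  let b' := OrthonormalBasis.mk ho hs
  refine ⟨b.equiv b' (Equiv.refl _), fun v i => ?_⟩
  conv_lhs => rw [← b.sum_repr v]
  rw [map_sum]
  simp only [map_smul, OrthonormalBasis.equiv_apply_basis, Equiv.refl_apply]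
  rw [b.repr_apply_apply, inner_sum]
  simp only [b', OrthonormalBasis.coe_mk, inner_smul_right, orthonormal_iff_ite.1 b.orthonormal]
  simp only [c, ite_mul, mul_ite, mul_one, mul_zero]
  rw [sum_eq_single i (fun j _ hj => by simp [Ne.symm hj]) (by simp)]
  simp [mul_comm]

theorem exists_isometry_unit {w w' : V} (hw : ‖w‖ = 1) (hw' : ‖w'‖ = 1) :
    ∃ T : V ≃ₗᵢ[ℂ] V, T w = w' := by
  have key : ∀ w : V, ‖w‖ = 1 → ∃ (b : OrthonormalBasis (Fin (finrank ℂ V)) ℂ V) (i : Fin (finrank ℂ V)), b i = w := by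
    intro w hw
    have : Nontrivial V := ⟨w, 0, fun h => by simp [h] at hw⟩
    let i : Fin (finrank ℂ V) := ⟨0, Module.finrank_pos⟩
    have h1 : Orthonormal ℂ (({i} : Set (Fin (finrank ℂ V))).domRestrict fun _ => w) :=
      ⟨fun _ => hw, fun a b hab => absurd (Subsingleton.elim a b) hab⟩
    obtain ⟨b, hb⟩ := h1.exists_orthonormalBasis_extension_of_card_eq (by simp)
    exact ⟨b, i, hb i rfl⟩
  obtain ⟨b, i, hb⟩ := key w hw
  obtain ⟨b', i', hb'⟩ := key w' hw'
  refine ⟨b.equiv b' (Equiv.swap i i'), ?_⟩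
  rw [← hb, OrthonormalBasis.equiv_apply_basis, Equiv.swap_apply_left, hb']

variable [MeasurableSpace V] [BorelSpace V] {σ : Measure V}

theorem IsSphereLaw.integrable (hσ : IsSphereLaw σ) {F : V → ℂ} (hF : Continuous F) :
    Integrable F σ := by
  have := hσ.prob
  have : ProperSpace V := FiniteDimensional.proper ℂ V
  obtain ⟨B, hB⟩ := (isCompact_sphere (0 : V) 1).exists_bound_of_continuousOn hF.continuousOn
  refine Integrable.of_bound hF.aestronglyMeasurable B ?_
  filter_upwards [hσ.norm] with v hv using hB v (by simpa using hv)

theorem continuous_repr (b : OrthonormalBasis (Fin p) ℂ V) (i : Fin p) :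
    Continuous fun v => b.repr v i := by
  simp_rw [b.repr_apply_apply]
  fun_prop

/-- The fourth moments. -/
def quart (σ : Measure V) (b : OrthonormalBasis (Fin p) ℂ V) (i j k l : Fin p) : ℂ :=
  ∫ v, b.repr v i * conj (b.repr v j) * b.repr v k * conj (b.repr v l) ∂σ

theorem continuous_quart (b : OrthonormalBasis (Fin p) ℂ V) (i j k l : Fin p) :
    Continuous fun v => b.repr v i * conj (b.repr v j) * b.repr v k * conj (b.repr v l) :=
  (((continuous_repr b i).mul (continuous_conj.comp (continuous_repr b j))).mul
    (continuous_repr b k)).mul (continuous_conj.comp (continuous_repr b l))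

theorem IsSphereLaw.quart_phase (hσ : IsSphereLaw σ) (b : OrthonormalBasis (Fin p) ℂ V)
    (i j k l a : Fin p) (h : (if i = a then I else 1) * conj (if j = a then I else 1)
      * (if k = a then I else 1) * conj (if l = a then I else 1) ≠ 1) :
    quart σ b i j k l = 0 := by
  obtain ⟨T, hT⟩ := exists_isometry_phase b a
  have h1 := hσ.inv T fun v => b.repr v i * conj (b.repr v j) * b.repr v k * conj (b.repr v l)
  simp only [hT] at h1
  set c := (if i = a then I else 1) * conj (if j = a then I else 1)
      * (if k = a then I else 1) * conj (if l = a then I else 1) with hc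
  have h2 : ∀ v, (if i = a then I else 1) * b.repr v i
      * conj ((if j = a then I else 1) * b.repr v j)
      * ((if k = a then I else 1) * b.repr v k)
      * conj ((if l = a then I else 1) * b.repr v l)
      = c * (b.repr v i * conj (b.repr v j) * b.repr v k * conj (b.repr v l)) := fun v => by
    rw [hc]; simp only [map_mul]; ring
  rw [integral_congr_ae (.of_forall h2), integral_const_mul] at h1
  have h3 : (c - 1) * quart σ b i j k l = 0 := by rw [sub_mul, one_mul]; exact sub_eq_zero.2 h1
  exact (mul_eq_zero.1 h3).resolve_left (sub_ne_zero.2 h)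

theorem IsSphereLaw.quart_eq_zero (hσ : IsSphereLaw σ) (b : OrthonormalBasis (Fin p) ℂ V)
    {i j k l : Fin p} (h1 : ¬(i = j ∧ k = l)) (h2 : ¬(i = l ∧ k = j)) : quart σ b i j k l = 0 := by
  have hI : I ≠ 1 := fun h => by simpa using congrArg Complex.im h
  have hm : (-1 : ℂ) ≠ 1 := by norm_num
  by_cases hij : i = j
  · subst hij
    have hkl : l ≠ k := fun h => h1 ⟨rfl, h.symm⟩
    refine hσ.quart_phase b i i k l k ?_
    rw [if_pos rfl, if_neg hkl]
    split_ifs <;> simpa using hI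
  · by_cases hil : i = l
    · subst hil
      have hkj : j ≠ k := fun h => h2 ⟨rfl, h.symm⟩
      refine hσ.quart_phase b i j k i k ?_
      rw [if_pos rfl, if_neg hkj]
      split_ifs <;> simpa using hI
    · refine hσ.quart_phase b i j k l i ?_
      rw [if_pos rfl, if_neg (Ne.symm hij), if_neg (Ne.symm hil)]
      split_ifs
      · simpa using hm
      · simpa using hI

theorem IsSphereLaw.quart_eq (hσ : IsSphereLaw σ) (b : OrthonormalBasis (Fin p) ℂ V)
    (i j k l : Fin p) : quart σ b i j k l
      = ((if i = j ∧ k = l then 1 else 0) + (if i = l ∧ k = j then 1 else 0)) / (p * (p + 1)) := by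
  have _ := hσ.prob
  have hp : 0 < p := i.pos
  have hp' : (p : ℂ) ≠ 0 := by exact_mod_cast hp.ne'
  have hp1 : (p : ℂ) + 1 ≠ 0 := by exact_mod_cast hp.ne'.bot_lt.trans (Nat.lt_succ_self p) |>.ne'
  set Q := quart σ b with hQ
  have hint : ∀ i j k l, Integrable (fun v => b.repr v i * conj (b.repr v j) * b.repr v k
      * conj (b.repr v l)) σ := fun i j k l => hσ.integrable (continuous_quart b i j k l)
  -- the diagonal moments agree
  have hsym : ∀ (w w' : V), ‖w‖ = ‖w'‖ → ∫ v, ((inner ℂ w v * conj (inner ℂ w v)) ^ 2 : ℂ) ∂σ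
      = ∫ v, ((inner ℂ w' v * conj (inner ℂ w' v)) ^ 2 : ℂ) ∂σ := by
    intro w w' hw
    rcases eq_or_ne w 0 with h0 | h0
    · rw [h0, norm_zero] at hw
      rw [h0, norm_eq_zero.1 hw.symm]
    have hn : (‖w‖ : ℂ) ≠ 0 := by exact_mod_cast norm_ne_zero_iff.2 h0
    obtain ⟨T, hT⟩ := exists_isometry_unit (w := (‖w‖ : ℂ)⁻¹ • w) (w' := (‖w‖ : ℂ)⁻¹ • w')
      (by simp [norm_smul, norm_ne_zero_iff.2 h0])
      (by rw [norm_smul, ← hw]; simp [norm_ne_zero_iff.2 h0])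
    have hT' : T w = w' := by
      rw [T.map_smul] at hT
      exact smul_right_injective V (inv_ne_zero hn) hT
    rw [← hσ.inv T fun v => (inner ℂ w' v * conj (inner ℂ w' v)) ^ 2]
    simp_rw [← hT', T.inner_map_map]
  have hdiag : ∀ i, ∫ v, ((inner ℂ (b i) v * conj (inner ℂ (b i) v)) ^ 2 : ℂ) ∂σ = Q i i i i := by
    intro i
    refine integral_congr_ae (.of_forall fun v => ?_)
    simp only [b.repr_apply_apply]
    ring
  have hβ : ∀ i k, i ≠ k → Q i i i i = 2 * Q i i k k := by
    intro i k hik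
    have hα : Q k k k k = Q i i i i := by rw [← hdiag, ← hdiag]; exact hsym _ _ (by simp)
    have hw : ∀ c : ℂ, c * conj c = 1 →
        ∫ v, ((inner ℂ (b i + c • b k) v * conj (inner ℂ (b i + c • b k) v)) ^ 2 : ℂ) ∂σ
        = 4 * Q i i i i := by
      intro c hc
      have hc1 : ‖c‖ = 1 := by
        rw [mul_conj, normSq_eq_norm_sq] at hc
        have : ‖c‖ ^ 2 = 1 := by exact_mod_cast hc
        nlinarith [norm_nonneg c]
      have hn : ‖b i + c • b k‖ = ‖((Real.sqrt 2 : ℝ) : ℂ) • b i‖ := by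
        have h1 : ‖b i + c • b k‖ * ‖b i + c • b k‖ = 2 := by
          rw [norm_add_mul_self (𝕜 := ℂ), inner_smul_right, b.orthonormal.inner_eq_zero hik, norm_smul, hc1]
          simp; norm_num
        rw [norm_smul, b.orthonormal.norm_eq_one, mul_one, norm_real,
          norm_of_nonneg (Real.sqrt_nonneg _)]
        rw [← h1, Real.sqrt_mul_self (norm_nonneg _)]
      rw [hsym _ _ hn]
      have h2 : ∀ v, ((inner ℂ (((Real.sqrt 2 : ℝ) : ℂ) • b i) v
          * conj (inner ℂ (((Real.sqrt 2 : ℝ) : ℂ) • b i) v)) ^ 2 : ℂ)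
          = 4 * (inner ℂ (b i) v * conj (inner ℂ (b i) v)) ^ 2 := fun v => by
        have h3 : (((Real.sqrt 2 : ℝ) : ℂ)) ^ 2 = 2 := by
          rw [← Complex.ofReal_pow, Real.sq_sqrt (by norm_num)]; norm_num
        rw [inner_smul_left]
        simp only [map_mul, conj_ofReal]
        linear_combination (inner ℂ (b i) v * conj (inner ℂ (b i) v)) ^ 2
          * ((((Real.sqrt 2 : ℝ) : ℂ)) ^ 2 + 2) * h3
      rw [integral_congr_ae (.of_forall h2), integral_const_mul, hdiag]
    have hexp : ∀ v, (inner ℂ (b i + (1 : ℂ) • b k) v * conj (inner ℂ (b i + (1 : ℂ) • b k) v)) ^ 2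
        + (inner ℂ (b i + (-1 : ℂ) • b k) v * conj (inner ℂ (b i + (-1 : ℂ) • b k) v)) ^ 2
        + ((inner ℂ (b i + I • b k) v * conj (inner ℂ (b i + I • b k) v)) ^ 2
        + (inner ℂ (b i + (-I) • b k) v * conj (inner ℂ (b i + (-I) • b k) v)) ^ 2)
        = 4 * (b.repr v i * conj (b.repr v i) * b.repr v i * conj (b.repr v i)
          + b.repr v k * conj (b.repr v k) * b.repr v k * conj (b.repr v k)
          + 4 * (b.repr v i * conj (b.repr v i) * b.repr v k * conj (b.repr v k))) := by
      intro v
      simp only [inner_add_left, inner_smul_left, b.repr_apply_apply, map_add, map_mul, map_neg,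
        map_one, Complex.conj_I]
      ring_nf
      simp only [I_sq, Complex.I_pow_four]
      ring
    have hc4 : ∀ c : ℂ, Integrable (fun v => (inner ℂ (b i + c • b k) v
        * conj (inner ℂ (b i + c • b k) v)) ^ 2) σ := fun c => hσ.integrable (by
      refine Continuous.pow (Continuous.mul ?_ (continuous_conj.comp ?_)) 2 <;> fun_prop)
    have h5 := integral_congr_ae (μ := σ) (.of_forall hexp)
    set f : ℂ → V → ℂ := fun c v => (inner ℂ (b i + c • b k) v
        * conj (inner ℂ (b i + c • b k) v)) ^ 2 with hf
    change ∫ v, (f 1 v + f (-1) v + (f I v + f (-I) v)) ∂σ = _ at h5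
    rw [integral_add (f := fun v => f 1 v + f (-1) v)
        (g := fun v => f I v + f (-I) v) ((hc4 _).add (hc4 _)) ((hc4 _).add (hc4 _)),
      integral_add (hc4 _) (hc4 _),
      integral_add (hc4 _) (hc4 _), hw 1 (by simp), hw (-1) (by simp), hw I (by simp),
      hw (-I) (by simp), integral_const_mul,
      integral_add (f := fun v => b.repr v i * conj (b.repr v i) * b.repr v i * conj (b.repr v i)
        + b.repr v k * conj (b.repr v k) * b.repr v k * conj (b.repr v k))
        ((hint i i i i).add (hint k k k k)) ((hint i i k k).const_mul 4), integral_add (hint i i i i) (hint k k k k),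
      integral_const_mul] at h5
    change _ = 4 * (Q i i i i + Q k k k k + 4 * Q i i k k) at h5
    rw [hα] at h5
    linear_combination h5 / 8
  have hone : ∑ i, ∑ k, Q i i k k = 1 := by
    have h1 : ∀ᵐ v ∂σ, ∑ i, ∑ k, b.repr v i * conj (b.repr v i) * b.repr v k * conj (b.repr v k) = 1 := by
      filter_upwards [hσ.norm] with v hv
      have h2 : ∑ i, b.repr v i * conj (b.repr v i) = 1 := by
        have h3 := EuclideanSpace.norm_sq_eq (b.repr v)
        rw [LinearIsometryEquiv.norm_map, hv] at h3
        simp_rw [mul_conj, normSq_eq_norm_sq]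
        exact_mod_cast h3.symm.trans (by norm_num)
      simp_rw [mul_assoc (_ * _), ← mul_sum, ← sum_mul, h2]
      norm_num
    have h2 := integral_congr_ae h1
    rw [integral_const, integral_finsetSum _ fun i _ => integrable_finsetSum _ fun k _ => hint i i k k]
      at h2
    simp_rw [integral_finsetSum _ fun k _ => hint _ _ k k] at h2
    have h3 : ∑ i, ∑ k, Q i i k k = (σ.real Set.univ : ℝ) • (1 : ℂ) := h2
    rw [h3]
    simp
  have hc0 : ∀ i k, Q i i i i = Q k k k k := fun i k => by
    rw [← hdiag, ← hdiag]; exact hsym _ _ (by simp)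
  have hval : Q i i i i = 2 / (p * (p + 1)) := by
    obtain ⟨α, hα⟩ : ∃ α, α = Q i i i i := ⟨_, rfl⟩
    have h1 : ∀ j k : Fin p, Q j j k k = α / 2 + if j = k then α / 2 else 0 := by
      intro j k
      rw [hα]
      by_cases h : j = k
      · subst h; rw [if_pos rfl, hc0 j i]; ring
      · rw [if_neg h, hc0 i j, hβ j k h]; ring
    simp_rw [h1, sum_add_distrib] at hone
    simp at hone
    rw [← hα]
    field_simp
    linear_combination 2 * hone
  by_cases h1 : i = j ∧ k = l
  · obtain ⟨rfl, rfl⟩ := h1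
    by_cases hik : i = k
    · subst hik
      rw [hval]; norm_num
    · rw [show Q i i k k = Q i i i i / 2 by rw [hβ i k hik]; ring, hval, if_pos ⟨rfl, rfl⟩,
        if_neg fun h => hik h.1]
      field_simp
      norm_num
  · by_cases h2 : i = l ∧ k = j
    · obtain ⟨rfl, rfl⟩ := h2
      have hik : i ≠ k := fun h => h1 ⟨h, h.symm⟩
      have h3 : Q i k k i = Q i i k k := by
        refine integral_congr_ae (.of_forall fun v => ?_)
        ring
      rw [h3, show Q i i k k = Q i i i i / 2 by rw [hβ i k hik]; ring, hval,
        if_neg fun h => hik h.1, if_pos ⟨rfl, rfl⟩]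
      field_simp
      norm_num
    · rw [hQ, hσ.quart_eq_zero b h1 h2]
      simp [h1, h2]

theorem sphereMean_forms {V : Type*} [NormedAddCommGroup V] [InnerProductSpace ℂ V]
    [FiniteDimensional ℂ V] (hp : 0 < p) (b : OrthonormalBasis (Fin p) ℂ V) (F : V → ℝ)
    (B : Fin p → Fin p → ℂ) (A : Fin p → Fin p → Fin p → Fin p → ℂ)
    (hF : ∀ v, ‖v‖ = 1 → F v = (∑ i, ∑ j, B i j * (b.repr v i * conj (b.repr v j))
      + ∑ i, ∑ j, ∑ k, ∑ l, A i j k l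
        * (b.repr v i * conj (b.repr v j) * b.repr v k * conj (b.repr v l))).re) :
    sphereMean F = ((∑ i, B i i) / p
      + (∑ i, ∑ k, (A i i k k + A i k k i)) / (p * (p + 1))).re := by
  have hnt : Nontrivial V := ⟨b ⟨0, hp⟩, 0, fun h => by
    have := b.orthonormal.norm_eq_one ⟨0, hp⟩
    simp [h] at this⟩
  obtain ⟨mV, bV, σ, hσ, hmean⟩ := exists_isSphereLaw (V := V)
  have hint : ∀ i j k l, Integrable (fun v => b.repr v i * conj (b.repr v j) * b.repr v k
      * conj (b.repr v l)) σ := fun i j k l => hσ.integrable (continuous_quart b i j k l)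
  have hint2 : ∀ i j, Integrable (fun v => b.repr v i * conj (b.repr v j)) σ := fun i j =>
    hσ.integrable ((continuous_repr b i).mul (continuous_conj.comp (continuous_repr b j)))
  have hp' : (p : ℂ) ≠ 0 := by exact_mod_cast hp.ne'
  have hp1 : (p : ℂ) + 1 ≠ 0 := by exact_mod_cast hp.ne'.bot_lt.trans (Nat.lt_succ_self p) |>.ne'
  have h2 : ∀ i j, ∫ v, b.repr v i * conj (b.repr v j) ∂σ = if i = j then 1 / (p : ℂ) else 0 := by
    intro i j
    have h1 : ∀ᵐ v ∂σ, b.repr v i * conj (b.repr v j)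
        = ∑ k, b.repr v i * conj (b.repr v j) * b.repr v k * conj (b.repr v k) := by
      filter_upwards [hσ.norm] with v hv
      have h2 : ∑ i, b.repr v i * conj (b.repr v i) = 1 := by
        have h3 := EuclideanSpace.norm_sq_eq (b.repr v)
        rw [LinearIsometryEquiv.norm_map, hv] at h3
        simp_rw [mul_conj, normSq_eq_norm_sq]
        exact_mod_cast h3.symm.trans (by norm_num)
      simp_rw [mul_assoc (_ * _), ← mul_sum, h2, mul_one]
    rw [integral_congr_ae h1, integral_finsetSum _ fun k _ => hint i j k k]
    have h3 : ∀ k, ∫ v, b.repr v i * conj (b.repr v j) * b.repr v k * conj (b.repr v k) ∂σ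
        = _ := fun k => hσ.quart_eq b i j k k
    simp_rw [h3, ← sum_div, sum_add_distrib]
    by_cases h : i = j
    · subst h
      have : ∀ k, (if i = k ∧ k = i then (1 : ℂ) else 0) = if i = k then 1 else 0 := fun k =>
        if_congr ⟨fun h => h.1, fun h => ⟨h, h.symm⟩⟩ rfl rfl
      simp [this]
      field_simp
    · have : ∀ k, (if i = k ∧ k = j then (1 : ℂ) else 0) = 0 := fun k =>
        if_neg fun hk => h (hk.1.trans hk.2)
      simp [this, h]
  have hFae : ∀ᵐ v ∂σ, F v = (∑ i, ∑ j, B i j * (b.repr v i * conj (b.repr v j))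
      + ∑ i, ∑ j, ∑ k, ∑ l, A i j k l
        * (b.repr v i * conj (b.repr v j) * b.repr v k * conj (b.repr v l))).re := by
    filter_upwards [hσ.norm] with v hv using hF v hv
  have i2 : Integrable (fun v => ∑ i, ∑ j, B i j * (b.repr v i * conj (b.repr v j))) σ :=
    integrable_finsetSum _ fun i _ => integrable_finsetSum _ fun j _ => (hint2 i j).const_mul _
  have i4 : Integrable (fun v => ∑ i, ∑ j, ∑ k, ∑ l, A i j k l
      * (b.repr v i * conj (b.repr v j) * b.repr v k * conj (b.repr v l))) σ :=
    integrable_finsetSum _ fun i _ => integrable_finsetSum _ fun j _ =>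
      integrable_finsetSum _ fun k _ => integrable_finsetSum _ fun l _ => (hint i j k l).const_mul _
  rw [hmean, integral_congr_ae hFae]
  have h5 := (reCLM.integral_comp_comm (i2.add i4))
  simp only [Pi.add_apply, Complex.reCLM_apply] at h5
  rw [h5, integral_add i2 i4]
  congr 2
  · rw [integral_finsetSum _ fun i _ => integrable_finsetSum _ fun j _ => (hint2 i j).const_mul _,
      sum_div]
    refine sum_ext fun i => ?_
    rw [integral_finsetSum _ fun j _ => (hint2 i j).const_mul _]
    simp_rw [integral_const_mul, h2]
    simp [div_eq_mul_inv]
  · rw [integral_finsetSum _ fun i _ => integrable_finsetSum _ fun j _ =>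
      integrable_finsetSum _ fun k _ => integrable_finsetSum _ fun l _ => (hint i j k l).const_mul _,
      sum_div]
    refine sum_ext fun i => ?_
    rw [integral_finsetSum _ fun j _ =>
      integrable_finsetSum _ fun k _ => integrable_finsetSum _ fun l _ => (hint i j k l).const_mul _]
    have h6 : ∀ j, ∫ v, ∑ k, ∑ l, A i j k l
        * (b.repr v i * conj (b.repr v j) * b.repr v k * conj (b.repr v l)) ∂σ
        = ∑ k, ∑ l, A i j k l * (((if i = j ∧ k = l then 1 else 0)
          + (if i = l ∧ k = j then 1 else 0)) / (p * (p + 1))) := fun j => by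
      rw [integral_finsetSum _ fun k _ => integrable_finsetSum _ fun l _ => (hint i j k l).const_mul _]
      refine sum_ext fun k => ?_
      rw [integral_finsetSum _ fun l _ => (hint i j k l).const_mul _]
      refine sum_ext fun l => ?_
      rw [integral_const_mul]
      exact congrArg _ (hσ.quart_eq b i j k l)
    simp_rw [h6]
    rw [sum_comm, sum_div]
    refine sum_ext fun k => ?_
    simp_rw [add_div, mul_add, sum_add_distrib]
    congr 1
    · rw [sum_eq_single i (fun j _ hj => sum_eq_zero fun l _ => by
        rw [if_neg fun h => hj h.1.symm]; simp) (by simp),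
        sum_eq_single k (fun l _ hl => by rw [if_neg fun h => hl h.2.symm]; simp) (by simp)]
      simp [div_eq_mul_inv]
    · rw [sum_eq_single k (fun j _ hj => sum_eq_zero fun l _ => by
        rw [if_neg fun h => hj h.2.symm]; simp) (by simp),
        sum_eq_single i (fun l _ hl => by rw [if_neg fun h => hl h.1.symm]; simp) (by simp)]
      simp [div_eq_mul_inv]

end Sphere

/-! ### Charts -/

section Charts

variable {n p : ℕ} {X : Type*} [TopologicalSpace X] [ChartedSpace (Cn n) X]
  {χ χ' : OpenPartialHomeomorph X (Cn n)} {x : X} {z : Cn n}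

/-- The tangent vector with given components in the coordinates `χ`. -/
def vec (χ : OpenPartialHomeomorph X (Cn n)) (x : X) : Cn n →ₗ[ℂ] Tan n x :=
  ((mfderiv 𝓘(ℂ, Cn n) 𝓘(ℂ, Cn n) χ x).inverse : Cn n →L[ℂ] Tan n x).toLinearMap

theorem coordVec_eq (χ : OpenPartialHomeomorph X (Cn n)) (x : X) (i : Fin n) :
    coordVec χ x i = vec χ x (stdB n i) := by
  simp only [stdB, Pi.basisFun_apply]
  rfl

/-- The coordinate change from `χ` to `χ'`. -/
def trans (χ χ' : OpenPartialHomeomorph X (Cn n)) (z : Cn n) : Cn n := χ' (χ.symm z)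

theorem trans_mem (hz' : χ.symm z ∈ χ'.source) : trans χ χ' z ∈ χ'.target := χ'.map_source hz'

theorem symm_trans (hz' : χ.symm z ∈ χ'.source) : χ'.symm (trans χ χ' z) = χ.symm z :=
  χ'.left_inv hz'

theorem trans_trans (hz : z ∈ χ.target) (hz' : χ.symm z ∈ χ'.source) :
    trans χ' χ (trans χ χ' z) = z := by
  rw [trans, symm_trans hz', χ.right_inv hz]

theorem eventually_mem (hz : z ∈ χ.target) (hz' : χ.symm z ∈ χ'.source) :
    ∀ᶠ y in nhds z, y ∈ χ.target ∧ χ.symm y ∈ χ'.source :=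
  Eventually.mono ((χ.symm.trans χ').open_source.mem_nhds (x := z) (by
    rw [OpenPartialHomeomorph.trans_source]; exact ⟨hz, hz'⟩)) fun y hy => by
      rwa [OpenPartialHomeomorph.trans_source] at hy

variable [IsManifold 𝓘(ℂ, Cn n) ω X]

theorem isInvertible_mfderiv (hχ : χ ∈ atlas (Cn n) X) (hx : x ∈ χ.source) :
    (mfderiv 𝓘(ℂ, Cn n) 𝓘(ℂ, Cn n) χ x).IsInvertible :=
  have : IsManifold 𝓘(ℂ, Cn n) 1 X := .of_le (n := ω) le_top
  ⟨(mdifferentiable_of_mem_atlas (I := 𝓘(ℂ, Cn n)) hχ).mfderiv hx, rfl⟩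

theorem coord_vec (hχ : χ ∈ atlas (Cn n) X) (hx : x ∈ χ.source) (a : Cn n) :
    coord χ x (vec χ x a) = a := by
  obtain ⟨e, he⟩ := isInvertible_mfderiv hχ hx
  simp only [coord, vec, ← he, ContinuousLinearMap.inverse_equiv]
  exact e.apply_symm_apply a

theorem vec_coord (hχ : χ ∈ atlas (Cn n) X) (hx : x ∈ χ.source) (u : Tan n x) :
    vec χ x (coord χ x u) = u := by
  obtain ⟨e, he⟩ := isInvertible_mfderiv hχ hx
  simp only [coord, vec, ← he, ContinuousLinearMap.inverse_equiv]
  exact e.symm_apply_apply u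

theorem contDiffAt_trans (hχ : χ ∈ atlas (Cn n) X) (hχ' : χ' ∈ atlas (Cn n) X) (hz : z ∈ χ.target)
    (hz' : χ.symm z ∈ χ'.source) : ContDiffAt ℂ ω (trans χ χ') z := by
  have h1 := (contDiffGroupoid ω 𝓘(ℂ, Cn n)).compatible hχ hχ'
  rw [contDiffGroupoid, mem_groupoid_of_pregroupoid] at h1
  have h2 := h1.1
  simp only [contDiffPregroupoid, modelWithCornersSelf_coe, modelWithCornersSelf_coe_symm,
    Set.range_id, Set.inter_univ, Set.preimage_id, CompTriple.comp_eq] at h2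
  have h3 : z ∈ (χ.symm.trans χ').source := by
    rw [OpenPartialHomeomorph.trans_source]
    exact ⟨hz, hz'⟩
  exact h2.contDiffAt ((χ.symm.trans χ').open_source.mem_nhds h3)

theorem coord_vec_trans (hχ : χ ∈ atlas (Cn n) X) (hχ' : χ' ∈ atlas (Cn n) X) (hz : z ∈ χ.target)
    (hz' : χ.symm z ∈ χ'.source) (a : Cn n) :
    coord χ' (χ.symm z) (vec χ (χ.symm z) a) = fderiv ℂ (trans χ χ') z a := by
  have : IsManifold 𝓘(ℂ, Cn n) 1 X := .of_le (n := ω) le_top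
  have m1 := mdifferentiableAt_atlas (I := 𝓘(ℂ, Cn n)) hχ' hz'
  have m2 := mdifferentiableAt_atlas_symm (I := 𝓘(ℂ, Cn n)) hχ hz
  have h1 : mfderiv 𝓘(ℂ, Cn n) 𝓘(ℂ, Cn n) (trans χ χ') z
      = (mfderiv 𝓘(ℂ, Cn n) 𝓘(ℂ, Cn n) χ' (χ.symm z)).comp
        (mfderiv 𝓘(ℂ, Cn n) 𝓘(ℂ, Cn n) χ.symm z) := mfderiv_comp z m1 m2
  have h2 : mfderiv 𝓘(ℂ, Cn n) 𝓘(ℂ, Cn n) χ.symm z a = vec χ (χ.symm z) a := by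
    have h3 := (mdifferentiable_of_mem_atlas (I := 𝓘(ℂ, Cn n)) hχ).comp_symm_deriv hz
    have h4 := congrArg (fun L => L a) h3
    have h5 : coord χ (χ.symm z) (mfderiv 𝓘(ℂ, Cn n) 𝓘(ℂ, Cn n) χ.symm z a) = a := h4
    rw [← vec_coord hχ (χ.map_target hz) (mfderiv 𝓘(ℂ, Cn n) 𝓘(ℂ, Cn n) χ.symm z a), h5]
  rw [← mfderiv_eq_fderiv, h1, ← h2]
  rfl

theorem dz_dzb_comp {m : ℕ} {τ : Cn m → Cn n} {z : Cn m} {F : Cn n → ℂ} (hτ : ContDiffAt ℂ ω τ z)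
    (hF : Sm F (τ z)) (a b : Cn m) :
    dz a (dzb b fun y => F (τ y)) z
      = dz (fderiv ℂ τ z a) (dzb (fderiv ℂ τ z b) F) (τ z) := by
  have hd : ∀ᶠ y in nhds z, DifferentiableAt ℂ τ y :=
    (hτ.eventually (by simp)).mono fun y hy => hy.differentiableAt (by simp)
  have h1 : (dzb b fun y => F (τ y)) =ᶠ[nhds z]
      fun y => ∑ j, conj (fderiv ℂ τ y b j) * wdBar j F (τ y) := by
    filter_upwards [hd, hτ.continuousAt.eventually hF.eventually] with y hy hy'
    rw [wirt_comp hy hy', dzb_eq_sum hy']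
  have h2 : (dzb (fderiv ℂ τ z b) F) =ᶠ[nhds (τ z)]
      fun y => ∑ j, conj (fderiv ℂ τ z b j) * wdBar j F y := by
    filter_upwards [hF.eventually] with y hy
    rw [dzb_eq_sum hy]
  have hh : ∀ j, ContDiffAt ℂ ω (fun y => fderiv ℂ τ y b j) z := fun j => by
    have h3 : ContDiffAt ℂ ω (fderiv ℂ τ) z := hτ.fderiv_right (m := ω) (by simp)
    exact contDiffAt_pi.1 (h3.clm_apply contDiffAt_const) j
  have hs : ∀ j, Sm (fun y => wdBar j F (τ y)) z := fun j =>
    (hF.wdBar j).comp z ((hτ.restrict_scalars ℝ).of_le le_top)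
  rw [wirt_congr h1, wirt_congr h2, wirt_sum _ fun j _ => ((sm_of_holo (hh j)).conj.mul (hs j)).diff,
    wirt_sum _ fun j _ =>
      (Sm.mul (F := fun _ => conj (fderiv ℂ τ z b j)) contDiffAt_const (hF.wdBar j)).diff]
  refine sum_ext fun j => ?_
  rw [wirt_mul (sm_of_holo (hh j)).conj.diff (hs j).diff, dz_holo_conj (hh j), zero_mul, zero_add,
    wirt_const_mul _ (hF.wdBar j).diff, wirt_comp hd.self_of_nhds (hF.wdBar j).diff]

/-- A smooth real function, by its coordinate expressions. -/
def SmX (n : ℕ) {X : Type*} [TopologicalSpace X] [ChartedSpace (Cn n) X] (F : X → ℝ) : Prop :=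
  ∀ χ ∈ atlas (Cn n) X, ∀ z ∈ χ.target, ContDiffAt ℝ ∞ (fun z => F (χ.symm z)) z

/-- The Levi form of a real function. -/
def levi (F : X → ℝ) (x : X) (u : Tan n x) : ℝ :=
  let χ := chartAt (Cn n) x
  (dz (coord χ x u) (dzb (coord χ x u) fun z => (F (χ.symm z) : ℂ)) (χ x)).re

theorem levi_trans {F : X → ℝ} (hχ : χ ∈ atlas (Cn n) X) (hχ' : χ' ∈ atlas (Cn n) X)
    (hz : z ∈ χ.target) (hz' : χ.symm z ∈ χ'.source) (a : Cn n)
    (hF : ContDiffAt ℝ ∞ (fun z => F (χ'.symm z)) (trans χ χ' z)) :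
    dz a (dzb a fun z => (F (χ.symm z) : ℂ)) z
      = dz (fderiv ℂ (trans χ χ') z a) (dzb (fderiv ℂ (trans χ χ') z a)
        fun z => (F (χ'.symm z) : ℂ)) (trans χ χ' z) := by
  rw [← dz_dzb_comp (contDiffAt_trans hχ hχ' hz hz') (Sm.ofReal hF)]
  refine wirt_congr (wirt_congr_eventually ?_)
  filter_upwards [eventually_mem hz hz'] with y hy
  rw [symm_trans hy.2]

theorem levi_eq {F : X → ℝ} (hF : SmX n F) (hχ : χ ∈ atlas (Cn n) X) (hz : z ∈ χ.target) (a : Cn n) :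
    levi F (χ.symm z) (vec χ (χ.symm z) a) = (dz a (dzb a fun z => (F (χ.symm z) : ℂ)) z).re := by
  have hc := chart_mem_atlas (Cn n) (χ.symm z)
  have hm := mem_chart_source (Cn n) (χ.symm z)
  rw [levi_trans hχ hc hz hm a (hF _ hc _ (trans_mem hm)), ← coord_vec_trans hχ hc hz hm]
  rfl

end Charts

/-! ### The metric in coordinates -/

section ChartMetric

variable {n p : ℕ} {X : Type*} [TopologicalSpace X] [ChartedSpace (Cn n) X]
  {χ χ' : OpenPartialHomeomorph X (Cn n)} {x : X} {z : Cn n} (g : HermitianMetric n X)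

/-- The metric in the coordinates `χ`. -/
def gX (χ : OpenPartialHomeomorph X (Cn n)) (z : Cn n) : Matrix (Fin n) (Fin n) ℂ :=
  g.gram χ (χ.symm z)

/-- A form in the coordinates `χ`. -/
def eX (χ : OpenPartialHomeomorph X (Cn n)) (η : FormField n p X) (z : Cn n) :
    (Cn n) [⋀^Fin p]→ₗ[ℂ] ℂ :=
  (η (χ.symm z)).compLinearMap (vec χ (χ.symm z))

theorem isHermForm (x : X) : IsHermForm (g.form x) := ⟨g.conj_symm x, g.pos x⟩

theorem finrank_tan (x : X) : finrank ℂ (Tan n x) = n :=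
  (Module.finrank_fin_fun ℂ : finrank ℂ (Fin n → ℂ) = n)

theorem sesq_gX (z a b : Cn n) :
    sesq (gX g χ z) a b = g.form (χ.symm z) (vec χ (χ.symm z) a) (vec χ (χ.symm z) b) := by
  conv_rhs => rw [← (stdB n).sum_repr a, ← (stdB n).sum_repr b]
  simp only [map_sum, map_smul, LinearMap.sum_apply, LinearMap.smul_apply, map_smulₛₗ, smul_eq_mul]
  rw [sesq_apply, sum_comm]
  refine sum_ext fun j => ?_
  rw [mul_sum]
  refine sum_ext fun i => ?_
  simp only [gX, HermitianMetric.gram, Matrix.of_apply, coordVec_eq, Pi.basisFun_repr]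
  ring

theorem ec_eX (η : FormField n p X) (z : Cn n) (J : Fin p → Fin n) :
    ec (eX χ η) z J = η (χ.symm z) fun k => coordVec χ (χ.symm z) (J k) := by
  simp only [ec, eX, AlternatingMap.compLinearMap_apply, coordVec_eq]

variable {g}

theorem isOrtho_iff {m : ℕ} {a : Fin m → Cn n} :
    IsOrtho (sesq (gX g χ z)) a ↔ IsOrtho (g.form (χ.symm z)) fun i => vec χ (χ.symm z) (a i) := by
  simp only [IsOrtho, sesq_gX]

theorem eX_eq {η : FormField n p X} {a : Fin p → Cn n} {t : ℂ}
    (h : η (χ.symm z) = t • wedge (dualFam (g.form (χ.symm z)) fun i => vec χ (χ.symm z) (a i))) :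
    eX χ η z = t • wedge (dualFam (sesq (gX g χ z)) a) := by
  ext s
  simp only [eX, h, AlternatingMap.compLinearMap_apply, AlternatingMap.smul_apply, wedge_apply, dualFam]
  congr 3
  ext i j
  simp [sesq_gX]

theorem curv_eq_Rm (x : X) (u v w s : Tan n x) :
    g.curv x u v w s = Rm (gX g (chartAt (Cn n) x)) (chartAt (Cn n) x x)
      (coord (chartAt (Cn n) x) x u) (coord (chartAt (Cn n) x) x v)
      (coord (chartAt (Cn n) x) x w) (coord (chartAt (Cn n) x) x s) := by
  have h1 : (chartAt (Cn n) x).symm (chartAt (Cn n) x x) = x :=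
    (chartAt (Cn n) x).left_inv (mem_chart_source _ x)
  have h2 : ∀ i j k l, g.curvCoeff (chartAt (Cn n) x) x i j k l
      = rm (gX g (chartAt (Cn n) x)) (chartAt (Cn n) x x) i j k l := fun i j k l => by
    simp only [HermitianMetric.curvCoeff, rm, HermitianMetric.gramInv, ginv, gX, h1]
    rfl
  simp only [HermitianMetric.curv, Rm, h2]

variable [IsManifold 𝓘(ℂ, Cn n) ω X]

theorem exists_coord {m : ℕ} (hχ : χ ∈ atlas (Cn n) X) (hz : z ∈ χ.target)
    (v : Fin m → Tan n (χ.symm z)) : ∃ a : Fin m → Cn n, v = fun i => vec χ (χ.symm z) (a i) :=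
  ⟨fun i => coord χ _ (v i), funext fun i => (vec_coord hχ (χ.map_target hz) _).symm⟩

theorem isKahlerOn_gX (hg : g.IsKahler) (hχ : χ ∈ atlas (Cn n) X) :
    IsKahlerOn (gX g χ) χ.target where
  isOpen := χ.open_target
  smooth i j z hz := (g.smooth χ hχ i j).contDiffAt (χ.open_target.mem_nhds hz)
  herm z hz := by
    refine ⟨fun u v => ?_, fun u hu => ?_⟩
    · rw [sesq_gX, sesq_gX, g.conj_symm]
    · rw [sesq_gX]
      refine g.pos _ _ fun h0 => hu ?_
      rw [← coord_vec hχ (χ.map_target hz) u, h0]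
      exact map_zero (mfderiv 𝓘(ℂ, Cn n) 𝓘(ℂ, Cn n) χ (χ.symm z))
  kahler z hz i j k := hg χ hχ z hz i j k

theorem Rm_re_le (hg : g.IsKahler) (hχ : χ ∈ atlas (Cn n) X) (hχ' : χ' ∈ atlas (Cn n) X)
    (hz : z ∈ χ.target) (hz' : χ.symm z ∈ χ'.source) (a b : Cn n) :
    (Rm (gX g χ') (trans χ χ' z) (fderiv ℂ (trans χ χ') z a) (fderiv ℂ (trans χ χ') z a)
      (fderiv ℂ (trans χ χ') z b) (fderiv ℂ (trans χ χ') z b)).re ≤ (Rm (gX g χ) z a a b b).re := by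
  have hK := isKahlerOn_gX hg hχ
  have hK' := isKahlerOn_gX hg hχ'
  set w := trans χ χ' z with hw
  have hwt : w ∈ χ'.target := trans_mem hz'
  have hws : χ'.symm w ∈ χ.source := by rw [hw, symm_trans hz']; exact χ.map_target hz
  have hback : trans χ' χ w = z := trans_trans hz hz'
  obtain ⟨s, hs, hsb, hs0⟩ := exists_adapted_field (gX g χ') w (fderiv ℂ (trans χ χ') z b)
  -- the field in the coordinates `χ`
  have hτ := contDiffAt_trans hχ hχ' hz hz'
  have hσ := contDiffAt_trans hχ' hχ hwt hws
  have hderiv : ∀ y, y ∈ χ.target → χ.symm y ∈ χ'.source → ∀ c,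
      vec χ (χ.symm y) (fderiv ℂ (trans χ' χ) (trans χ χ' y) c) = vec χ' (χ.symm y) c := by
    intro y hy hy' c
    have h1 : trans χ χ' y ∈ χ'.target := trans_mem hy'
    have h2 : χ'.symm (trans χ χ' y) = χ.symm y := symm_trans hy'
    have h3 := coord_vec_trans hχ' hχ h1 (by rw [h2]; exact χ.map_target hy) c
    rw [← h3, h2, vec_coord hχ (χ.map_target hy)]
  let r : Cn n → Cn n := fun y => fderiv ℂ (trans χ' χ) (trans χ χ' y) (s (trans χ χ' y))
  have hr : ∀ i, ContDiffAt ℂ ω (fun y => r y i) z := by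
    have h1 : ContDiffAt ℂ ω (fderiv ℂ (trans χ' χ)) (trans χ χ' z) := hσ.fderiv_right (m := ω) (by simp)
    have h2 : ContDiffAt ℂ ω (fun y => fderiv ℂ (trans χ' χ) (trans χ χ' y)) z := h1.comp z hτ
    have h3 : ContDiffAt ℂ ω (fun y => s (trans χ χ' y)) z :=
      (contDiffAt_pi.2 fun i => hs w i : ContDiffAt ℂ ω s w).comp z hτ
    exact contDiffAt_pi.1 (h2.clm_apply h3)
  have hrb : r z = b := by
    have h1 : χ'.symm w = χ.symm z := symm_trans hz'
    have h2 := coord_vec hχ (χ.map_target hz) (r z)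
    rw [show vec χ (χ.symm z) (r z) = vec χ' (χ.symm z) (s w) from hderiv z hz hz' _, hsb,
      ← coord_vec_trans hχ hχ' hz hz', vec_coord hχ' hz', coord_vec hχ (χ.map_target hz)] at h2
    exact h2.symm
  have heq : (fun y => sesq (gX g χ y) (r y) (r y)) =ᶠ[nhds z]
      fun y => (fun y' => sesq (gX g χ' y') (s y') (s y')) (trans χ χ' y) := by
    filter_upwards [eventually_mem hz hz'] with y hy
    simp only [sesq_gX]
    rw [symm_trans hy.2, hderiv y hy.1 hy.2]
  have h1 := levi_sesq hK hz hr a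
  rw [wirt_congr (wirt_congr_eventually heq), dz_dzb_comp hτ (sm_sesq hK' hwt (hs w) (hs w)),
    levi_sesq hK' hwt (hs w), hs0, hrb, hsb] at h1
  have h2 : 0 ≤ (sesq (gX g χ z) (covd (gX g χ) a r z) (covd (gX g χ) a r z)).re := by
    by_cases h0 : covd (gX g χ) a r z = 0
    · rw [h0]; simp
    · exact ((hK.herm z hz).pos _ h0).le
  have h3 := congrArg Complex.re h1
  rw [map_zero, add_zero, add_re, neg_re, neg_re] at h3
  linarith

theorem Rm_re_trans (hg : g.IsKahler) (hχ : χ ∈ atlas (Cn n) X) (hχ' : χ' ∈ atlas (Cn n) X)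
    (hz : z ∈ χ.target) (hz' : χ.symm z ∈ χ'.source) (a b : Cn n) :
    (Rm (gX g χ) z a a b b).re = (Rm (gX g χ') (trans χ χ' z) (fderiv ℂ (trans χ χ') z a)
      (fderiv ℂ (trans χ χ') z a) (fderiv ℂ (trans χ χ') z b) (fderiv ℂ (trans χ χ') z b)).re := by
  refine le_antisymm ?_ (Rm_re_le hg hχ hχ' hz hz' a b)
  have h2 : χ'.symm (trans χ χ' z) = χ.symm z := symm_trans hz'
  have hws : χ'.symm (trans χ χ' z) ∈ χ.source := by rw [h2]; exact χ.map_target hz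
  have h1 := Rm_re_le hg hχ' hχ (trans_mem hz') hws (fderiv ℂ (trans χ χ') z a)
    (fderiv ℂ (trans χ χ') z b)
  have h3 : ∀ c, fderiv ℂ (trans χ' χ) (trans χ χ' z) (fderiv ℂ (trans χ χ') z c) = c := fun c => by
    rw [← coord_vec_trans hχ' hχ (trans_mem hz') hws, h2, ← coord_vec_trans hχ hχ' hz hz',
      vec_coord hχ' hz', coord_vec hχ (χ.map_target hz)]
  rwa [h3, h3, trans_trans hz hz'] at h1

theorem curv_re_eq (hg : g.IsKahler) (hχ : χ ∈ atlas (Cn n) X) (hz : z ∈ χ.target) (a b : Cn n) :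
    (g.curv (χ.symm z) (vec χ (χ.symm z) a) (vec χ (χ.symm z) a) (vec χ (χ.symm z) b)
      (vec χ (χ.symm z) b)).re = (Rm (gX g χ) z a a b b).re := by
  have hc := chart_mem_atlas (Cn n) (χ.symm z)
  have hm := mem_chart_source (Cn n) (χ.symm z)
  rw [curv_eq_Rm, coord_vec_trans hχ hc hz hm, coord_vec_trans hχ hc hz hm,
    Rm_re_trans hg hχ hc hz hm]
  rfl

end ChartMetric

/-! ### Pointwise identities -/

section Rmlinear

variable {n : ℕ} {g : LocalMatrix n} {z : Cn n} {m : ℕ}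

theorem Rm_sum₁ (c : Fin m → ℂ) (a : Fin m → Cn n) (v w s : Cn n) :
    Rm g z (∑ q, c q • a q) v w s = ∑ q, c q * Rm g z (a q) v w s := by
  simp only [Rm, mul_sum]
  refine sum_ext_comm fun i => ?_
  refine sum_ext_comm fun j => ?_
  refine sum_ext_comm fun k => ?_
  refine sum_ext_comm fun l => ?_
  simp only [Finset.sum_apply, Pi.smul_apply, smul_eq_mul, mul_sum, sum_mul]
  exact sum_ext fun q => by ring

theorem Rm_sum₂ (c : Fin m → ℂ) (a : Fin m → Cn n) (u w s : Cn n) :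
    Rm g z u (∑ q, c q • a q) w s = ∑ q, conj (c q) * Rm g z u (a q) w s := by
  simp only [Rm, mul_sum]
  refine sum_ext_comm fun i => ?_
  refine sum_ext_comm fun j => ?_
  refine sum_ext_comm fun k => ?_
  refine sum_ext_comm fun l => ?_
  simp only [Finset.sum_apply, Pi.smul_apply, smul_eq_mul, map_sum, map_mul, mul_sum, sum_mul]
  exact sum_ext fun q => by ring

theorem Rm_sum_pair (c : Fin m → ℂ) (a : Fin m → Cn n) (w s : Cn n) :
    Rm g z (∑ q, c q • a q) (∑ q, c q • a q) w s
      = ∑ i, ∑ j, Rm g z (a i) (a j) w s * (c i * conj (c j)) := by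
  rw [Rm_sum₁]
  refine sum_ext fun i => ?_
  rw [Rm_sum₂, mul_sum]
  exact sum_ext fun j => by ring

theorem Rm_sum_quad {Ω : Set (Cn n)} (h : IsKahlerOn g Ω) (hz : z ∈ Ω) (c : Fin m → ℂ)
    (a : Fin m → Cn n) :
    Rm g z (∑ q, c q • a q) (∑ q, c q • a q) (∑ q, c q • a q) (∑ q, c q • a q)
      = ∑ i, ∑ j, ∑ k, ∑ l, Rm g z (a i) (a j) (a k) (a l) * (c i * conj (c j) * c k * conj (c l)) := by
  rw [Rm_sum_pair]
  refine sum_ext fun i => sum_ext fun j => ?_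
  rw [Rm_swap_left h hz, Rm_swap_right h hz, Rm_sum_pair, sum_mul]
  refine sum_ext fun k => ?_
  rw [sum_mul]
  refine sum_ext fun l => ?_
  rw [Rm_swap_left h hz, Rm_swap_right h hz]
  ring

end Rmlinear

section Pointwise

variable {n p : ℕ} {X : Type*} [TopologicalSpace X] [ChartedSpace (Cn n) X]
  {χ : OpenPartialHomeomorph X (Cn n)} {x : X} {z : Cn n} {g : HermitianMetric n X}

theorem chart_symm (x : X) : (chartAt (Cn n) x).symm (chartAt (Cn n) x x) = x :=
  (chartAt (Cn n) x).left_inv (mem_chart_source _ x)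

theorem formNormSq_eq_nrm (η : FormField n p X) (x : X) :
    g.formNormSq x (η x) = nrm (gX g (chartAt (Cn n) x)) (eX (chartAt (Cn n) x) η) (chartAt (Cn n) x x) := by
  have h1 : ∀ J, ec (eX (chartAt (Cn n) x) η) (chartAt (Cn n) x x) J
      = η x fun k => coordVec (chartAt (Cn n) x) x (J k) := fun J => by rw [ec_eX, chart_symm]
  have h2 : ∀ i j, ginv (gX g (chartAt (Cn n) x)) (chartAt (Cn n) x x) i j
      = g.gramInv (chartAt (Cn n) x) x i j := fun i j => by
    rw [ginv, gX, chart_symm]; rfl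
  simp only [HermitianMetric.formNormSq, nrm, apair, raise, h1, h2, one_div]
  congr 2
  refine sum_ext fun I => ?_
  rw [mul_sum]
  exact sum_ext fun J => by ring

theorem covectorNormSq_eq_conorm (θ : Tan n x →ₗ[ℂ] ℂ) :
    g.covectorNormSq x θ = conorm (gX g (chartAt (Cn n) x)) (chartAt (Cn n) x x)
      fun i => θ (coordVec (chartAt (Cn n) x) x i) := by
  have h2 : ∀ i j, ginv (gX g (chartAt (Cn n) x)) (chartAt (Cn n) x x) i j
      = g.gramInv (chartAt (Cn n) x) x i j := fun i j => by
    rw [ginv, gX, chart_symm]; rfl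
  simp only [HermitianMetric.covectorNormSq, conorm, h2]

theorem coord_sum {m : ℕ} (χ : OpenPartialHomeomorph X (Cn n)) (x : X) (c : Fin m → ℂ)
    (v : Fin m → Tan n x) : coord χ x (∑ i, c i • v i) = ∑ i, c i • coord χ x (v i) := by
  have h1 : ∀ u, coord χ x u = (mfderiv 𝓘(ℂ, Cn n) 𝓘(ℂ, Cn n) χ x) u := fun _ => rfl
  simp only [h1, map_sum, map_smul]
  rfl

variable [IsManifold 𝓘(ℂ, Cn n) ω X]

theorem conorm_gX (hχ : χ ∈ atlas (Cn n) X) (hz : z ∈ χ.target) {o : Fin n → Tan n (χ.symm z)}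
    (ho : IsOrtho (g.form (χ.symm z)) o) (θ : Tan n (χ.symm z) →ₗ[ℂ] ℂ) :
    conorm (gX g χ) z (fun i => θ (coordVec χ (χ.symm z) i)) = ∑ r, ‖θ (o r)‖ ^ 2 := by
  obtain ⟨a, rfl⟩ := exists_coord hχ hz o
  rw [conorm_eq (isOrtho_iff.2 ho)]
  refine sum_ext fun r => ?_
  congr 2
  dsimp only
  conv_rhs => rw [← (stdB n).sum_repr (a r)]
  simp only [map_sum, map_smul, smul_eq_mul, coordVec_eq, Pi.basisFun_repr]

theorem covectorNormSq_eq (x : X) {o : Fin n → Tan n x} (ho : IsOrtho (g.form x) o)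
    (θ : Tan n x →ₗ[ℂ] ℂ) : g.covectorNormSq x θ = ∑ r, ‖θ (o r)‖ ^ 2 := by
  have h1 := chart_symm (n := n) x
  rw [covectorNormSq_eq_conorm]
  have key : ∀ y, y = x → ∀ (o : Fin n → Tan n y), IsOrtho (g.form y) o → ∀ (θ : Tan n y →ₗ[ℂ] ℂ),
      y = (chartAt (Cn n) x).symm (chartAt (Cn n) x x) →
      conorm (gX g (chartAt (Cn n) x)) (chartAt (Cn n) x x)
      (fun i => θ (coordVec (chartAt (Cn n) x) y i)) = ∑ r, ‖θ (o r)‖ ^ 2 := by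
    intro y _ o ho θ hy
    subst hy
    exact conorm_gX (chart_mem_atlas _ _) (mem_chart_target _ x) ho θ
  exact key x rfl o ho θ h1.symm

theorem covectorNormSq_symm (hχ : χ ∈ atlas (Cn n) X) (hz : z ∈ χ.target)
    (θ : Tan n (χ.symm z) →ₗ[ℂ] ℂ) :
    g.covectorNormSq (χ.symm z) θ = conorm (gX g χ) z fun i => θ (coordVec χ (χ.symm z) i) := by
  obtain ⟨o, ho⟩ := (isHermForm g (χ.symm z)).exists_ortho (finrank_tan _)
  rw [covectorNormSq_eq _ ho, conorm_gX hχ hz ho]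

theorem nrm_gX (hg : g.IsKahler) (hχ : χ ∈ atlas (Cn n) X) (hz : z ∈ χ.target) {η : FormField n p X}
    {v : Fin p → Tan n (χ.symm z)} {t : ℂ} (hv : IsOrtho (g.form (χ.symm z)) v)
    (ht : η (χ.symm z) = t • wedge (dualFam (g.form (χ.symm z)) v)) :
    nrm (gX g χ) (eX χ η) z = ‖t‖ ^ 2 := by
  obtain ⟨a, rfl⟩ := exists_coord hχ hz v
  exact nrm_eq (isKahlerOn_gX hg hχ) hz (isOrtho_iff.2 hv) (eX_eq ht)

theorem formNormSq_symm (hg : g.IsKahler) (hχ : χ ∈ atlas (Cn n) X) (hz : z ∈ χ.target)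
    {η : FormField n p X} {v : Fin p → Tan n (χ.symm z)} {t : ℂ}
    (hv : IsOrtho (g.form (χ.symm z)) v)
    (ht : η (χ.symm z) = t • wedge (dualFam (g.form (χ.symm z)) v)) :
    g.formNormSq (χ.symm z) (η (χ.symm z)) = nrm (gX g χ) (eX χ η) z := by
  rw [nrm_gX hg hχ hz hv ht, formNormSq_eq_nrm]
  have key : ∀ x y, y = (chartAt (Cn n) x).symm (chartAt (Cn n) x x) → ∀ (v : Fin p → Tan n y),
      IsOrtho (g.form y) v → η y = t • wedge (dualFam (g.form y) v) →
      nrm (gX g (chartAt (Cn n) x)) (eX (chartAt (Cn n) x) η) (chartAt (Cn n) x x) = ‖t‖ ^ 2 := by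
    intro x y hy v hv ht
    subst hy
    exact nrm_gX hg (chart_mem_atlas _ _) (mem_chart_target _ x) hv ht
  exact key _ _ (chart_symm _).symm v hv ht

theorem leviPair_gX (hg : g.IsKahler) (hχ : χ ∈ atlas (Cn n) X) (hz : z ∈ χ.target)
    {η : FormField n p X} {F : X → ℝ} (hF : SmX n F)
    {o : Fin n → Tan n (χ.symm z)} (ho : IsOrtho (g.form (χ.symm z)) o)
    {v : Fin p → Tan n (χ.symm z)} {t : ℂ} (hv : IsOrtho (g.form (χ.symm z)) v)
    (ht : η (χ.symm z) = t • wedge (dualFam (g.form (χ.symm z)) v)) :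
    leviPair (gX g χ) (eX χ η) (fun z => F (χ.symm z)) z = (gX g χ z).det.re * (nrm (gX g χ) (eX χ η) z
      * (∑ r, levi F (χ.symm z) (o r) - ∑ k, levi F (χ.symm z) (v k))) := by
  rw [nrm_gX hg hχ hz hv ht]
  obtain ⟨a, rfl⟩ := exists_coord hχ hz v
  obtain ⟨b, rfl⟩ := exists_coord hχ hz o
  have hK := isKahlerOn_gX hg hχ
  have hs := Sm.ofReal (hF χ hχ z hz)
  simp only [leviPair, pm_some_some hK hz (isOrtho_iff.2 ho) (isOrtho_iff.2 hv) (eX_eq ht),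
    levi_eq hF hχ hz]
  have h1 : ∑ i, ∑ j, (gX g χ z).det * (‖t‖ ^ 2 : ℝ) * (∑ r, b r i * conj (b r j)
      - ∑ k, a k i * conj (a k j)) * wd i (wdBar j fun x => (F (χ.symm x) : ℂ)) z
      = (((gX g χ z).det.re * ‖t‖ ^ 2 : ℝ) : ℂ)
        * (∑ r, dz (b r) (dzb (b r) fun x => (F (χ.symm x) : ℂ)) z
          - ∑ k, dz (a k) (dzb (a k) fun x => (F (χ.symm x) : ℂ)) z) := by
    rw [← sum_levi b hs, ← sum_levi a hs, ofReal_mul, ← (hK.det_pos hz).2,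
      ← sum_sub_distrib, mul_sum]
    refine sum_ext fun i => ?_
    rw [← sum_sub_distrib, mul_sum]
    exact sum_ext fun j => by ring
  rw [h1, re_ofReal_mul, sub_re, re_sum, re_sum, mul_assoc]

theorem leviPair_oneForm (hg : g.IsKahler) (hχ : χ ∈ atlas (Cn n) X) (hz : z ∈ χ.target)
    {F : X → ℝ} (hF : SmX n F) {o : Fin n → Tan n (χ.symm z)} (ho : IsOrtho (g.form (χ.symm z)) o) :
    leviPair (gX g χ) (oneForm n) (fun z => F (χ.symm z)) z
      = (gX g χ z).det.re * ∑ r, levi F (χ.symm z) (o r) := by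
  obtain ⟨b, rfl⟩ := exists_coord hχ hz o
  have hK := isKahlerOn_gX hg hχ
  have hs := Sm.ofReal (hF χ hχ z hz)
  simp only [leviPair, pm_oneForm hK hz, levi_eq hF hχ hz, ginv_eq (isOrtho_iff.2 ho)]
  have h1 : ∑ i, ∑ j, (gX g χ z).det * (∑ r, b r i * conj (b r j))
      * wd i (wdBar j fun x => (F (χ.symm x) : ℂ)) z
      = (((gX g χ z).det.re : ℝ) : ℂ)
        * ∑ r, dz (b r) (dzb (b r) fun x => (F (χ.symm x) : ℂ)) z := by
    rw [← sum_levi b hs, ← (hK.det_pos hz).2, mul_sum]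
    refine sum_ext fun i => ?_
    rw [mul_sum]
    exact sum_ext fun j => by ring
  rw [h1, re_ofReal_mul, re_sum]

theorem isOrtho_coord {m : ℕ} {x : X} {o : Fin m → Tan n x} (ho : IsOrtho (g.form x) o) :
    IsOrtho (sesq (gX g (chartAt (Cn n) x) (chartAt (Cn n) x x)))
      fun r => coord (chartAt (Cn n) x) x (o r) := by
  have key : ∀ y, y = (chartAt (Cn n) x).symm (chartAt (Cn n) x x) → ∀ (o : Fin m → Tan n y),
      IsOrtho (g.form y) o → IsOrtho (sesq (gX g (chartAt (Cn n) x) (chartAt (Cn n) x x)))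
      fun r => coord (chartAt (Cn n) x) y (o r) := by
    intro y hy o ho
    subst hy
    refine isOrtho_iff.2 ?_
    simpa only [vec_coord (chart_mem_atlas _ x)
      ((chartAt (Cn n) x).map_target (mem_chart_target _ x))] using ho
  exact key x (chart_symm x).symm o ho

theorem ric_eq (x : X) {o : Fin n → Tan n x} (ho : IsOrtho (g.form x) o) (u v : Tan n x) :
    g.ric x u v = ∑ r, g.curv x u v (o r) (o r) := by
  have hc := isOrtho_coord (g := g) ho
  have h2 : ∀ i j, g.gramInv (chartAt (Cn n) x) x i j
      = ginv (gX g (chartAt (Cn n) x)) (chartAt (Cn n) x x) i j := fun i j => by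
    rw [ginv, gX, chart_symm]; rfl
  have h3 : ∀ i j k l, g.curvCoeff (chartAt (Cn n) x) x i j k l
      = rm (gX g (chartAt (Cn n) x)) (chartAt (Cn n) x x) i j k l := fun i j k l => by
    simp only [HermitianMetric.curvCoeff, rm, HermitianMetric.gramInv, ginv, gX, chart_symm]
    rfl
  simp only [curv_eq_Rm, HermitianMetric.ric, h2, h3, ginv_eq hc, Rm]
  refine sum_ext_comm fun i => ?_
  refine sum_ext_comm fun j => ?_
  conv_rhs => rw [sum_comm]
  simp only [sum_mul]
  refine sum_ext fun k => ?_
  refine sum_ext_comm fun l => ?_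
  exact sum_ext fun r => by ring

theorem mixedCurv_eq (hg : g.IsKahler) (hp : 0 < p) (a b : ℝ) (x : X) {o : Fin n → Tan n x}
    (ho : IsOrtho (g.form x) o) {v : Fin p → Tan n x} (hv : IsOrtho (g.form x) v) :
    g.mixedCurv a b x (Submodule.span ℂ (Set.range v))
      = a / p * ∑ k, ∑ r, (g.curv x (v k) (v k) (o r) (o r)).re
        + 2 * b / (p * (p + 1)) * ∑ k, ∑ l, (g.curv x (v k) (v k) (v l) (v l)).re := by
  have hK := isKahlerOn_gX hg (chart_mem_atlas (Cn n) x)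
  have hz := mem_chart_target (Cn n) x
  set S := Submodule.span ℂ (Set.range v) with hS
  let w : Fin p → S := fun i => ⟨v i, Submodule.subset_span ⟨i, rfl⟩⟩
  let i₁ : NormedAddCommGroup S := (g.core x S).toNormedAddCommGroup
  let i₂ : InnerProductSpace ℂ S := InnerProductSpace.ofCore (g.core x S).toCore
  have hin : ∀ u u' : S, inner ℂ u u' = g.form x u' u := fun _ _ => rfl
  have ho' : Orthonormal ℂ w := by
    rw [orthonormal_iff_ite]
    intro i j
    rw [hin, hv]
    exact if_congr ⟨Eq.symm, Eq.symm⟩ rfl rfl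
  have hsp : ⊤ ≤ Submodule.span ℂ (Set.range w) := by
    rintro ⟨u, hu⟩ -
    obtain ⟨c, hc⟩ := (Submodule.mem_span_range_iff_exists_fun ℂ).1 hu
    have h1 : (⟨u, hu⟩ : S) = ∑ i, c i • w i := by
      refine Subtype.ext ?_
      simp only [w, Submodule.coe_sum, Submodule.coe_smul]
      exact hc.symm
    rw [h1]
    exact Submodule.sum_mem _ fun i _ => Submodule.smul_mem _ _ (Submodule.subset_span ⟨i, rfl⟩)
  let B := OrthonormalBasis.mk ho' hsp
  have hBw : ∀ i, B i = w i := fun i => by simp [B]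
  have hexp : ∀ u : S, (u : Tan n x) = ∑ i, B.repr u i • v i := fun u => by
    conv_lhs => rw [← B.sum_repr u]
    simp only [hBw, Submodule.coe_sum, Submodule.coe_smul]
    rfl
  have hmean := sphereMean_forms hp B
    (fun u : S => a * (g.ric x u u).re + b * g.hsc x u)
    (fun i j => a * ∑ r, g.curv x (v i) (v j) (o r) (o r))
    (fun i j k l => b * g.curv x (v i) (v j) (v k) (v l)) ?_
  · refine hmean.trans ?_
    have hs : ∀ i k, g.curv x (v i) (v k) (v k) (v i) = g.curv x (v i) (v i) (v k) (v k) := fun i k => by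
      rw [curv_eq_Rm, curv_eq_Rm, Rm_swap_right hK hz]
    have e1 : (∑ i, (a : ℂ) * ∑ r, g.curv x (v i) (v i) (o r) (o r)) / (p : ℂ)
        = ((a / p : ℝ) : ℂ) * ∑ k, ∑ r, g.curv x (v k) (v k) (o r) (o r) := by
      rw [← mul_sum]; push_cast; ring
    have e2 : (∑ i, ∑ k, ((b : ℂ) * g.curv x (v i) (v i) (v k) (v k)
          + b * g.curv x (v i) (v k) (v k) (v i))) / ((p : ℂ) * (p + 1))
        = ((2 * b / (p * (p + 1)) : ℝ) : ℂ) * ∑ k, ∑ l, g.curv x (v k) (v k) (v l) (v l) := by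
      simp only [hs, ← two_mul, ← mul_sum]
      push_cast
      ring
    rw [e1, e2, add_re, re_ofReal_mul, re_ofReal_mul]
    simp only [re_sum]
  · intro u hu
    have h1 : g.form x u u = 1 := by rw [← hin, inner_self_eq_norm_sq_to_K, hu]; simp
    rw [HermitianMetric.hsc, h1, ric_eq x ho]
    simp only [curv_eq_Rm]
    rw [hexp u, coord_sum, Rm_sum_quad hK hz]
    simp only [Rm_sum_pair]
    have e1 : ∑ i, ∑ j, (a : ℂ) * (∑ r, Rm (gX g (chartAt (Cn n) x)) (chartAt (Cn n) x x)
          (coord (chartAt (Cn n) x) x (v i)) (coord (chartAt (Cn n) x) x (v j))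
          (coord (chartAt (Cn n) x) x (o r)) (coord (chartAt (Cn n) x) x (o r)))
          * (B.repr u i * conj (B.repr u j))
        = a * ∑ r, ∑ i, ∑ j, Rm (gX g (chartAt (Cn n) x)) (chartAt (Cn n) x x)
          (coord (chartAt (Cn n) x) x (v i)) (coord (chartAt (Cn n) x) x (v j))
          (coord (chartAt (Cn n) x) x (o r)) (coord (chartAt (Cn n) x) x (o r))
          * (B.repr u i * conj (B.repr u j)) := by
      conv_rhs => rw [sum_comm, mul_sum]
      refine sum_ext fun i => ?_
      conv_rhs => rw [sum_comm, mul_sum]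
      refine sum_ext fun j => ?_
      rw [mul_assoc, sum_mul]
    rw [e1]
    simp only [mul_assoc (b : ℂ), ← mul_sum]
    rw [add_re, re_ofReal_mul, re_ofReal_mul]
    norm_num

theorem curvTerm_gX (hg : g.IsKahler) (hp : 0 < p) (a b : ℝ) (hχ : χ ∈ atlas (Cn n) X)
    (hz : z ∈ χ.target) {η : FormField n p X} {v : Fin p → Tan n (χ.symm z)} {t : ℂ}
    (hv : IsOrtho (g.form (χ.symm z)) v)
    (ht : η (χ.symm z) = t • wedge (dualFam (g.form (χ.symm z)) v)) :
    curvTerm (a / p) (2 * b / (p * (p + 1))) (gX g χ) (eX χ η) z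
      = nrm (gX g χ) (eX χ η) z ^ 2
        * g.mixedCurv a b (χ.symm z) (Submodule.span ℂ (Set.range v)) := by
  obtain ⟨o, ho⟩ := (isHermForm g (χ.symm z)).exists_ortho (finrank_tan _)
  rw [mixedCurv_eq hg hp a b _ ho hv]
  obtain ⟨a', rfl⟩ := exists_coord hχ hz v
  obtain ⟨b', rfl⟩ := exists_coord hχ hz o
  rw [curvTerm_eq (isKahlerOn_gX hg hχ) hz (isOrtho_iff.2 ho) (isOrtho_iff.2 hv) (eX_eq ht)]
  simp only [curv_re_eq hg hχ hz]

end Pointwise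

/-! ### Plurisubharmonic weights -/

section Weights

variable {n : ℕ} {Ω : Set (Cn n)} {z₀ : Cn n} {R : ℝ}

theorem circleIntegrable_of_bounded {f : ℂ → ℝ} (hf : Measurable f) {B : ℝ}
    (hB : ∀ ζ, ‖ζ‖ = 1 → |f ζ| ≤ B) : CircleIntegrable f 0 1 := by
  refine (intervalIntegrable_iff).2 ?_
  refine Measure.integrableOn_of_bounded (M := B) (by simp [Real.pi_ne_zero, ENNReal.mul_eq_top]) ?_ ?_
  · exact (hf.comp (continuous_circleMap 0 1).measurable).aestronglyMeasurable
  · exact .of_forall fun θ => hB _ (by simp)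

theorem exp_circleAverage_le {f : ℂ → ℝ} (hf : CircleIntegrable f 0 1)
    (he : CircleIntegrable (fun ζ => exp (f ζ)) 0 1) :
    exp (circleAverage f 0 1) ≤ circleAverage (fun ζ => exp (f ζ)) 0 1 := by
  set A := circleAverage f 0 1
  have hc : CircleIntegrable (fun _ : ℂ => exp A * (1 - A)) 0 1 := circleIntegrable_const _ _ _
  have h1 : CircleIntegrable (fun ζ => exp A * f ζ) 0 1 := hf.const_mul _
  have h2 : circleAverage (fun ζ => exp A * f ζ + exp A * (1 - A)) 0 1 = exp A := by
    rw [Real.circleAverage_fun_add h1 hc, Real.circleAverage_const]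
    have := Real.circleAverage_fun_smul (a := exp A) (f := f) (c := 0) (R := 1)
    simp only [smul_eq_mul] at this
    rw [this]
    ring
  rw [← h2]
  refine circleAverage_mono (h1.add hc) he fun ζ _ => ?_
  have := Real.add_one_le_exp (f ζ - A)
  calc exp A * f ζ + exp A * (1 - A) = exp A * (f ζ - A + 1) := by ring
    _ ≤ exp A * exp (f ζ - A) := by gcongr
    _ = exp (f ζ) := by rw [← exp_add]; ring_nf

theorem circleAverage_re_linear (a : Cn n →L[ℂ] ℂ) (z w : Cn n) :
    circleAverage (fun ζ : ℂ => 2 * (a (z + ζ • w)).re) 0 1 = 2 * (a z).re := by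
  let A : Cn n →L[ℝ] ℝ := (2 : ℝ) • reCLM.comp (a.restrictScalars ℝ)
  have h1 := circleAverage_quadratic (2 * (a z).re) A 0 w
  simp only [_root_.zero_apply, zero_div, add_zero] at h1
  have h2 : (fun ζ : ℂ => 2 * (a (z + ζ • w)).re) = fun ζ : ℂ => 2 * (a z).re + A (ζ • w) := by
    funext ζ
    simp [A, mul_add]
  rw [h2, h1]

theorem circleAverage_le_of_forall_add {A B : ℝ} {c : ℝ} (h : ∀ m : ℝ, A ≤ B + exp m * c) : A ≤ B := by
  have h1 : Tendsto (fun m : ℝ => B + exp m * c) Filter.atBot (nhds (B + 0 * c)) :=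
    (Real.tendsto_exp_atBot.mul_const c).const_add B
  rw [zero_mul, add_zero] at h1
  exact ge_of_tendsto' h1 h

theorem logSubmean_of_psh {Φ : Cn n → EReal} (hm : Measurable Φ) {M : ℝ} (hM : ∀ z, Φ z ≤ M)
    (h : ∀ z w : Cn n, (∀ ζ : ℂ, ‖ζ‖ ≤ 1 → z + ζ • w ∈ Ω) → ∀ m : ℝ,
      Φ z ≤ (circleAverage (fun ζ : ℂ => (max (Φ (z + ζ • w)) (m : EReal)).toReal) 0 1 : ℝ)) :
    LogSubmean (fun z => (EReal.exp (Φ z)).toReal) Ω := by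
  intro a z w hd
  have hline : Measurable fun ζ : ℂ => z + ζ • w := by fun_prop
  have hlc : Continuous fun ζ : ℂ => 2 * (a (z + ζ • w)).re := by fun_prop
  obtain ⟨L, hL⟩ := (isCompact_sphere (0 : ℂ) 1).exists_bound_of_continuousOn hlc.continuousOn
  have hL' : ∀ ζ : ℂ, ‖ζ‖ = 1 → |2 * (a (z + ζ • w)).re| ≤ L := fun ζ hζ => hL ζ (by simpa using hζ)
  have hexpM : ∀ z, (EReal.exp (Φ z)).toReal ≤ exp M := fun z => by
    rw [← ENNReal.toReal_ofReal (exp_pos M).le, ← EReal.exp_coe]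
    exact ENNReal.toReal_mono (by simp [EReal.exp_coe]) (EReal.exp_monotone (hM z))
  have hmeasu : Measurable fun z => (EReal.exp (Φ z)).toReal :=
    (EReal.measurable_exp.comp hm).ennreal_toReal
  have hI0 : CircleIntegrable (fun ζ : ℂ => exp (2 * (a (z + ζ • w)).re)) 0 1 :=
    circleIntegrable_of_bounded (B := exp L) (by fun_prop) fun ζ hζ => by
      rw [abs_of_pos (exp_pos _)]
      exact exp_le_exp.2 ((le_abs_self _).trans (hL' ζ hζ))
  have hI1 : CircleIntegrable (fun ζ : ℂ => exp (2 * (a (z + ζ • w)).re)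
      * (EReal.exp (Φ (z + ζ • w))).toReal) 0 1 :=
    circleIntegrable_of_bounded (B := exp L * exp M)
      (Measurable.mul (by fun_prop) (hmeasu.comp hline)) fun ζ hζ => by
      rw [abs_of_nonneg (by positivity)]
      exact mul_le_mul (exp_le_exp.2 ((le_abs_self _).trans (hL' ζ hζ))) (hexpM _)
        ENNReal.toReal_nonneg (exp_pos _).le
  by_cases hbot : Φ z = ⊥
  · simp only [hbot, EReal.exp_bot, ENNReal.toReal_zero, mul_zero]
    exact Real.circleAverage_nonneg_of_nonneg fun ζ _ => by positivity
  obtain ⟨s, hs⟩ : ∃ s : ℝ, Φ z = s := by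
    refine ⟨(Φ z).toReal, (EReal.coe_toReal ?_ hbot).symm⟩
    exact ((hM z).trans_lt (EReal.coe_lt_top M)).ne
  refine circleAverage_le_of_forall_add
    (c := circleAverage (fun ζ : ℂ => exp (2 * (a (z + ζ • w)).re)) 0 1) fun m => ?_
  set f : ℂ → ℝ := fun ζ => (max (Φ (z + ζ • w)) (m : EReal)).toReal with hf
  have hfin : ∀ ζ, ((f ζ : ℝ) : EReal) = max (Φ (z + ζ • w)) (m : EReal) := fun ζ => by
    refine EReal.coe_toReal ?_ ?_
    · exact (max_lt ((hM _).trans_lt (EReal.coe_lt_top M)) (EReal.coe_lt_top m)).ne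
    · exact ((EReal.bot_lt_coe m).trans_le (le_max_right _ _)).ne'
  have hfm : Measurable f := ((hm.comp hline).max measurable_const).ereal_toReal
  have hfB : ∀ ζ, |f ζ| ≤ max |M| |m| := fun ζ => by
    have h1 : f ζ ≤ max M m := by
      rw [← EReal.coe_le_coe_iff, hfin, EReal.coe_strictMono.monotone.map_max]
      exact max_le_max (hM _) le_rfl
    have h2 : m ≤ f ζ := by
      rw [← EReal.coe_le_coe_iff, hfin]
      exact le_max_right _ _
    rw [abs_le]
    constructor
    · have := neg_abs_le m
      have := le_max_right |M| |m|
      linarith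
    · exact h1.trans (max_le_max (le_abs_self _) (le_abs_self _))
  have hI2 : CircleIntegrable (fun ζ : ℂ => 2 * (a (z + ζ • w)).re) 0 1 :=
    circleIntegrable_of_bounded (by fun_prop) hL'
  have hI3 : CircleIntegrable f 0 1 := circleIntegrable_of_bounded hfm fun ζ _ => hfB ζ
  have hI4 : CircleIntegrable (fun ζ => exp (2 * (a (z + ζ • w)).re + f ζ)) 0 1 :=
    circleIntegrable_of_bounded (B := exp (L + max |M| |m|))
      (Measurable.exp (Measurable.add (by fun_prop) hfm)) fun ζ hζ => by
      rw [abs_of_pos (exp_pos _)]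
      exact exp_le_exp.2 (add_le_add ((le_abs_self _).trans (hL' ζ hζ))
        ((le_abs_self _).trans (hfB ζ)))
  have h1 : s ≤ circleAverage f 0 1 := by
    have := h z w hd m
    rw [hs] at this
    exact_mod_cast this
  have hexps : (EReal.exp (Φ z)).toReal = exp s := by
    rw [hs, EReal.exp_coe, ENNReal.toReal_ofReal (exp_pos s).le]
  calc exp (2 * (a z).re) * (EReal.exp (Φ z)).toReal
      = exp (2 * (a z).re + s) := by rw [hexps, exp_add]
    _ ≤ exp (circleAverage (fun ζ => 2 * (a (z + ζ • w)).re + f ζ) 0 1) := by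
        rw [Real.circleAverage_fun_add hI2 hI3, circleAverage_re_linear]
        exact exp_le_exp.2 (by linarith)
    _ ≤ circleAverage (fun ζ => exp (2 * (a (z + ζ • w)).re + f ζ)) 0 1 :=
        exp_circleAverage_le (hI2.add hI3) hI4
    _ ≤ circleAverage (fun ζ => exp (2 * (a (z + ζ • w)).re)
          * (EReal.exp (Φ (z + ζ • w))).toReal + exp m * exp (2 * (a (z + ζ • w)).re)) 0 1 := by
        refine circleAverage_mono hI4 (hI1.add (hI0.const_mul _)) fun ζ _ => ?_
        rw [exp_add, mul_comm (exp m), ← mul_add]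
        refine mul_le_mul_of_nonneg_left ?_ (exp_pos _).le
        have h2 : exp (f ζ) = (EReal.exp (max (Φ (z + ζ • w)) (m : EReal))).toReal := by
          rw [← hfin, EReal.exp_coe, ENNReal.toReal_ofReal (exp_pos _).le]
        rw [h2]
        rcases le_total (Φ (z + ζ • w)) m with h3 | h3
        · rw [max_eq_right h3, EReal.exp_coe, ENNReal.toReal_ofReal (exp_pos _).le]
          linarith [ENNReal.toReal_nonneg (a := EReal.exp (Φ (z + ζ • w)))]
        · rw [max_eq_left h3]
          linarith [exp_pos m]
    _ = _ := by
        have hI5 : CircleIntegrable (fun ζ : ℂ => exp m * exp (2 * (a (z + ζ • w)).re)) 0 1 :=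
          hI0.const_mul _
        rw [Real.circleAverage_fun_add hI1 hI5]
        congr 1
        have := Real.circleAverage_fun_smul (a := exp m)
          (f := fun ζ : ℂ => exp (2 * (a (z + ζ • w)).re)) (c := 0) (R := 1)
        simpa only [smul_eq_mul] using this

theorem exists_exp_weight {Φ : Cn n → EReal} (h : IsPlurisubharmonicOn Φ Ω)
    (hR : closedBall z₀ R ⊆ Ω) :
    ∃ (u : Cn n → ℝ) (C : ℝ), Measurable u ∧ (∀ z, 0 ≤ u z) ∧ (∀ z, u z ≤ C) ∧
      LogSubmean u (ball z₀ R) ∧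
      ∀ z ∈ ball z₀ R, u z = (EReal.exp (Φ z)).toReal := by
  classical
  have hsub : ball z₀ R ⊆ Ω := ball_subset_closedBall.trans hR
  obtain ⟨M, hM⟩ : ∃ M : ℝ, ∀ z ∈ closedBall z₀ R, Φ z ≤ M := by
    rcases (closedBall z₀ R).eq_empty_or_nonempty with he | hne
    · exact ⟨0, by simp [he]⟩
    obtain ⟨y, hy, hmax⟩ := (h.1.mono hR).exists_isMaxOn hne (isCompact_closedBall z₀ R)
    refine ⟨(Φ y).toReal, fun z hz => (hmax hz).trans (EReal.le_coe_toReal (h.2.1 y (hR hy)))⟩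
  let Φb : Cn n → EReal := fun z => if z ∈ ball z₀ R then Φ z else ⊥
  have hb : ∀ z ∈ ball z₀ R, Φb z = Φ z := fun z hz => if_pos hz
  have hb' : ∀ z, z ∉ ball z₀ R → Φb z = ⊥ := fun z hz => if_neg hz
  have hm : Measurable Φb := by
    refine measurable_of_Iio fun c => ?_
    obtain ⟨v, hv, he⟩ := upperSemicontinuousOn_iff_preimage_Iio.1 (h.1.mono hsub) c
    have : Φb ⁻¹' Set.Iio c = (ball z₀ R ∩ v) ∪ ((ball z₀ R)ᶜ ∩ {_z | ⊥ < c}) := by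
      ext z
      by_cases hz : z ∈ ball z₀ R
      · have : z ∈ ball z₀ R ∩ Φ ⁻¹' Set.Iio c ↔ z ∈ ball z₀ R ∩ v := by rw [he]
        simp only [Set.mem_inter_iff, hz, true_and, Set.mem_preimage, Set.mem_Iio] at this
        simp [hb z hz, hz, this]
      · simp [hb' z hz, hz]
    rw [this]
    exact (measurableSet_ball.inter hv.measurableSet).union
      (measurableSet_ball.compl.inter (MeasurableSet.const _))
  have hMb : ∀ z, Φb z ≤ M := fun z => by
    by_cases hz : z ∈ ball z₀ R
    · rw [hb z hz]; exact hM z (ball_subset_closedBall hz)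
    · simp [hb' z hz]
  refine ⟨fun z => (EReal.exp (Φb z)).toReal, exp M, (EReal.measurable_exp.comp hm).ennreal_toReal,
    fun z => ENNReal.toReal_nonneg, fun z => ?_, logSubmean_of_psh hm hMb fun z w hd m => ?_,
    fun z hz => by dsimp only; rw [hb z hz]⟩
  · rw [← ENNReal.toReal_ofReal (exp_pos M).le, ← EReal.exp_coe]
    exact ENNReal.toReal_mono (by simp [EReal.exp_coe]) (EReal.exp_monotone (hMb z))
  · have h0 : z ∈ ball z₀ R := by simpa using hd 0 (by simp)
    rw [hb z h0]
    refine (h.2.2 z w (fun ζ hζ => hsub (hd ζ hζ)) m).trans (le_of_eq ?_)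
    congr 1
    refine Real.circleAverage_congr_sphere fun ζ hζ => ?_
    change (max (Φ (z + ζ • w)) (m : EReal)).toReal = (max (Φb (z + ζ • w)) (m : EReal)).toReal
    rw [hb _ (hd ζ (by simpa using hζ.le))]

end Weights

/-! ### Decomposability -/

section Decomposable

variable {n p : ℕ}

theorem IsKahlerOn.mono {g : LocalMatrix n} {Ω Ω' : Set (Cn n)}
    (h : IsKahlerOn g Ω) (ho : IsOpen Ω') (hs : Ω' ⊆ Ω) : IsKahlerOn g Ω' :=
  ⟨ho, fun i j z hz => h.smooth i j z (hs hz), fun z hz => h.herm z (hs hz),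
    fun z hz => h.kahler z (hs hz)⟩

theorem IsDecompOn.mono {g : LocalMatrix n} {η : LocalForm n p}
    {Ω Ω' : Set (Cn n)} (h : IsDecompOn g η Ω) (hs : Ω' ⊆ Ω) : IsDecompOn g η Ω' :=
  ⟨fun J z hz => h.holo J z (hs hz), fun z hz => h.decomp z (hs hz)⟩

theorem decomp_of_dense {g : LocalMatrix n} {η : LocalForm n p}
    {Ω D : Set (Cn n)} (h : IsKahlerOn g Ω) (hη : ∀ J, ContinuousOn (fun z => ec η z J) Ω)
    (hD : Ω ⊆ closure D) (hdec : ∀ z ∈ Ω ∩ D, ∃ (v : Fin p → Cn n) (t : ℂ), IsOrtho (sesq (g z)) v ∧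
      η z = t • wedge (dualFam (sesq (g z)) v)) {z : Cn n} (hz : z ∈ Ω) :
    ∃ (v : Fin p → Cn n) (t : ℂ), IsOrtho (sesq (g z)) v ∧
      η z = t • wedge (dualFam (sesq (g z)) v) := by
  obtain ⟨r, hr, hrΩ⟩ := Metric.nhds_basis_closedBall.mem_iff.1 (h.isOpen.mem_nhds hz)
  set K := closedBall z r
  have hKc : IsCompact K := isCompact_closedBall z r
  set Q : Set (Cn n × (Fin p → Cn n)) := K ×ˢ Set.univ
  have hQ : IsClosed Q := hKc.isClosed.prod isClosed_univ
  have hfst : Set.MapsTo Prod.fst Q Ω := fun y hy => hrΩ hy.1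
  have cg : ∀ i j, ContinuousOn (fun y : Cn n × (Fin p → Cn n) => g y.1 i j) Q := fun i j =>
    ContinuousOn.comp (t := Ω) (fun w hw => (h.smooth i j w hw).continuousAt.continuousWithinAt)
      continuousOn_fst hfst
  have ce : ∀ J, ContinuousOn (fun y : Cn n × (Fin p → Cn n) => ec η y.1 J) Q := fun J =>
    (hη J).comp continuousOn_fst hfst
  have cv : ∀ k i, Continuous fun y : Cn n × (Fin p → Cn n) => y.2 k i := fun k i => by fun_prop
  have cs : ∀ (a b : Cn n × (Fin p → Cn n) → Cn n), Continuous a → Continuous b →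
      ContinuousOn (fun y => sesq (g y.1) (a y) (b y)) Q := fun a b ha hb => by
    simp only [sesq_apply]
    exact continuousOn_finsetSum _ fun i _ => continuousOn_finsetSum _ fun j _ =>
      ((cg i j).mul ((continuous_apply i).comp ha).continuousOn).mul
        (continuous_conj.comp ((continuous_apply j).comp hb)).continuousOn
  set T : Set (Cn n × (Fin p → Cn n)) := {y | y ∈ Q ∧ (∀ i j, sesq (g y.1) (y.2 i) (y.2 j)
    = if i = j then 1 else 0) ∧ ∀ J : Fin p → Fin n, ec η y.1 J
      = η y.1 y.2 * wedge (dualFam (sesq (g y.1)) y.2) fun k => stdB n (J k)} with hT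
  have hTclosed : IsClosed T := by
    have h1 : ∀ i j, IsClosed {y | y ∈ Q ∧ sesq (g y.1) (y.2 i) (y.2 j) = if i = j then 1 else 0} :=
      fun i j => (cs (fun y => y.2 i) (fun y => y.2 j) (by fun_prop) (by fun_prop)).preimage_isClosed_of_isClosed hQ
        (isClosed_singleton (x := if i = j then (1 : ℂ) else 0))
    have h2 : ∀ J : Fin p → Fin n, IsClosed {y | y ∈ Q ∧ ec η y.1 J
        - η y.1 y.2 * wedge (dualFam (sesq (g y.1)) y.2) (fun k => stdB n (J k)) = 0} := fun J => by
      refine ContinuousOn.preimage_isClosed_of_isClosed ((ce J).sub (ContinuousOn.mul ?_ ?_)) hQ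
        (isClosed_singleton (x := (0 : ℂ)))
      · simp only [eval_fields]
        exact continuousOn_finsetSum _ fun I _ =>
          (continuous_finsetProd _ fun k _ => cv k (I k)).continuousOn.mul (ce I)
      · simp only [wedge_apply_sum, dualFam, LinearMap.flip_apply]
        exact continuousOn_finsetSum _ fun σ _ => continuousOn_const.mul
          (continuousOn_finsetProd _ fun k _ => cs _ (fun y => y.2 k) continuous_const (by fun_prop))
    have : T = Q ∩ ((⋂ i, ⋂ j, {y | y ∈ Q ∧ sesq (g y.1) (y.2 i) (y.2 j) = if i = j then 1 else 0})
        ∩ ⋂ J : Fin p → Fin n, {y | y ∈ Q ∧ ec η y.1 J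
        - η y.1 y.2 * wedge (dualFam (sesq (g y.1)) y.2) (fun k => stdB n (J k)) = 0}) := by
      ext y
      simp only [hT, Set.mem_setOf_eq, Set.mem_inter_iff, Set.mem_iInter, sub_eq_zero]
      constructor
      · rintro ⟨a, b, c⟩
        exact ⟨a, fun i j => ⟨a, b i j⟩, fun J => ⟨a, c J⟩⟩
      · rintro ⟨a, b, c⟩
        exact ⟨a, fun i j => (b i j).2, fun J => (c J).2⟩
    rw [this]
    exact hQ.inter ((isClosed_iInter fun i => isClosed_iInter fun j => h1 i j).inter
      (isClosed_iInter h2))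
  have hTcompact : IsCompact T := by
    have hB : ∀ i, ∃ B, ∀ y ∈ K, ‖ginv g y i i‖ ≤ B := fun i =>
      hKc.exists_bound_of_continuousOn fun y hy =>
        (h.smOn_ginv i i y (hrΩ hy)).continuousAt.continuousWithinAt
    choose B hB using hB
    refine (hKc.prod (isCompact_closedBall (0 : Fin p → Cn n) (∑ i, |B i| + 1))).of_isClosed_subset
      hTclosed fun y hy => ⟨hy.1.1, ?_⟩
    rw [mem_closedBall_zero_iff]
    have hpos : 0 ≤ ∑ i, |B i| + 1 := by positivity
    refine (pi_norm_le_iff_of_nonneg hpos).2 fun k => (pi_norm_le_iff_of_nonneg hpos).2 fun i => ?_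
    have hyΩ := hrΩ hy.1.1
    obtain ⟨hp, o, ho, hov⟩ := (h.herm _ hyΩ).exists_extension (Module.finrank_fin_fun ℂ) hy.2.1
    have h1 : ‖y.2 k i‖ ^ 2 ≤ ‖ginv g y.1 i i‖ := by
      rw [ginv_eq ho i i]
      have h2 : ∑ r, o r i * conj (o r i) = ((∑ r, ‖o r i‖ ^ 2 : ℝ) : ℂ) := by
        push_cast
        exact sum_ext fun r => by rw [mul_conj, normSq_eq_norm_sq]; push_cast; rfl
      rw [h2, norm_real, norm_of_nonneg (sum_nonneg fun r _ => sq_nonneg _), ← hov k]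
      exact single_le_sum (f := fun r => ‖o r i‖ ^ 2) (fun r _ => sq_nonneg _) (Finset.mem_univ _)
    have h2 : ‖y.2 k i‖ ^ 2 ≤ ∑ i, |B i| := h1.trans ((hB i _ hy.1.1).trans ((le_abs_self _).trans
      (single_le_sum (f := fun i => |B i|) (fun r _ => abs_nonneg _) (Finset.mem_univ i))))
    nlinarith [norm_nonneg (y.2 k i), sq_nonneg (‖y.2 k i‖ - 1)]
  have hmem : z ∈ Prod.fst '' T := by
    have hcl : IsClosed (Prod.fst '' T) := (hTcompact.image continuous_fst).isClosed
    rw [← hcl.closure_eq]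
    have h1 : z ∈ closure (ball z r ∩ D) :=
      isOpen_ball.inter_closure ⟨Metric.mem_ball_self hr, hD hz⟩
    refine closure_mono ?_ h1
    rintro y ⟨hy, hyD⟩
    have hyK := ball_subset_closedBall hy
    obtain ⟨v, t, hv, ht⟩ := hdec y ⟨hrΩ hyK, hyD⟩
    refine ⟨(y, v), ⟨⟨hyK, trivial⟩, hv, fun J => ?_⟩, rfl⟩
    dsimp only
    rw [ec, ht]
    simp only [AlternatingMap.smul_apply, wedge_dualFam_self hv, smul_eq_mul, mul_one]
  obtain ⟨⟨y, v⟩, ⟨-, hv, hJ⟩, rfl⟩ := hmem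
  refine ⟨v, η y v, hv, ?_⟩
  refine Module.Basis.ext_alternating (stdB n) fun J _ => ?_
  exact hJ J

variable {X Y : Type*} [TopologicalSpace X] [ChartedSpace (Cn n) X]
  [TopologicalSpace Y] [ChartedSpace (Cn p) Y]

theorem IsAnalyticSubset.isClosed {E H M : Type*} [NormedAddCommGroup E] [NormedSpace ℂ E]
    [TopologicalSpace H] {I : ModelWithCorners ℂ E H} [TopologicalSpace M] [ChartedSpace H M]
    {S : Set M} (hS : IsAnalyticSubset I S) : IsClosed S := by
  rw [← isOpen_compl_iff, isOpen_iff_mem_nhds]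
  intro x hx
  obtain ⟨V, hV, hxV, k, h, hh, hm⟩ := hS x
  have h1 : IsOpen (V ∩ h ⁻¹' {0}ᶜ) := hh.continuousOn.isOpen_inter_preimage hV isOpen_compl_singleton
  refine mem_of_superset (h1.mem_nhds ⟨hxV, fun h0 => hx ((hm x hxV).2 h0)⟩) ?_
  rintro y ⟨hy, hy0⟩ hyS
  exact hy0 ((hm y hy).1 hyS)

theorem MeromorphicMap.exists_indeterminacy_subset [T2Space Y] (f : MeromorphicMap n p X Y) :
    ∃ A : Set X, IsClosed A ∧ interior A = ∅ ∧ f.indeterminacy ⊆ A := by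
  obtain ⟨A, f₀, hA, hi, hf, hg⟩ := f.generically_holomorphic
  have hAo : IsOpen Aᶜ := hA.isClosed.isOpen_compl
  refine ⟨A, hA.isClosed, hi, fun x hx => by_contra fun hxA => hx ⟨Aᶜ, f₀, hxA, hAo, hf, ?_⟩⟩
  intro x hx y
  constructor
  · intro h
    by_contra hne
    rw [hg] at h
    obtain ⟨u, v, hu, hv, hyu, hfv, huv⟩ := t2_separation hne
    have h1 : IsOpen (Aᶜ ∩ f₀ ⁻¹' v) := hf.continuousOn.isOpen_inter_preimage hAo hv
    obtain ⟨q, ⟨hq1, hq2⟩, w, hw, rfl⟩ := mem_closure_iff.1 h ((Aᶜ ∩ f₀ ⁻¹' v) ×ˢ u) (h1.prod hu)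
      ⟨⟨hx, hfv⟩, hyu⟩
    exact Set.disjoint_left.1 huv hq2 hq1.2
  · rintro rfl
    rw [hg]
    exact subset_closure ⟨x, hx, rfl⟩

variable {f : MeromorphicMap n p X Y}

theorem dim_le_of_generator {U : Set X} {η : FormField n p X} (hU : IsOpen U)
    (h : IsGenerator f.reflexivePullback U η) (hne : U.Nonempty) : p ≤ n := by
  by_contra hlt
  have h0 : ∀ x, η x = 0 := fun x => by
    refine Module.Basis.ext_alternating (stdB n) fun J hJ => ?_
    exact absurd (Fintype.card_le_of_injective J hJ) (by simpa using hlt)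
  obtain ⟨x, hx⟩ := hne
  have h1 := (h.2 U le_rfl hU).2 (fun _ => 0) (fun _ => 1) contMDiffOn_const contMDiffOn_const
    (fun x _ => by simp [h0]) hx
  simp at h1

variable {g : HermitianMetric n X}

theorem exists_decomp_off {U : Set X} {η : FormField n p X} (hpn : p ≤ n)
    (h : f.reflexivePullback U η) {x : X} (hx : x ∈ U) (hxi : x ∉ f.indeterminacy) :
    ∃ (v : Fin p → Tan n x) (t : ℂ), IsOrtho (g.form x) v ∧
      η x = t • wedge (dualFam (g.form x) v) := by
  obtain ⟨V, F, w, c, hxV, -, -, -, -, -, hη⟩ := h.2 x hx hxi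
  obtain ⟨v, t, hv, ht⟩ := (isHermForm g x).exists_wedge_eq (finrank_tan x) hpn fun j : Fin p =>
    (LinearMap.proj j : (Fin p → ℂ) →ₗ[ℂ] ℂ) ∘ₗ
      (mfderiv 𝓘(ℂ, Cn n) 𝓘(ℂ, Cn p) (fun y => w (F y)) x : Tan n x →L[ℂ] Cn p).toLinearMap
  refine ⟨v, c x * t, hv, ?_⟩
  rw [hη x hxV, mul_smul, ← ht]
  rfl

theorem isOpen_chart_inter {U : Set X} (hU : IsOpen U) (χ : OpenPartialHomeomorph X (Cn n)) :
    IsOpen (χ.target ∩ χ.symm ⁻¹' U) := χ.symm.isOpen_inter_preimage hU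

theorem isDecompOn_eX [T2Space Y] [IsManifold 𝓘(ℂ, Cn n) ω X] (hg : g.IsKahler)
    {U : Set X} {η : FormField n p X}
    (hU : IsOpen U) (h : IsGenerator f.reflexivePullback U η) {χ : OpenPartialHomeomorph X (Cn n)}
    (hχ : χ ∈ atlas (Cn n) X) : IsDecompOn (gX g χ) (eX χ η) (χ.target ∩ χ.symm ⁻¹' U) := by
  have hΩ := isOpen_chart_inter hU χ
  have hholo : ∀ J, ∀ z ∈ χ.target ∩ χ.symm ⁻¹' U, ContDiffAt ℂ ω (fun z => ec (eX χ η) z J) z := by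
    intro J z hz
    simp only [ec_eX]
    exact (h.1.1 χ hχ J).contDiffAt (hΩ.mem_nhds hz)
  refine ⟨hholo, fun z hz => ?_⟩
  obtain ⟨A, hA, hAi, hind⟩ := f.exists_indeterminacy_subset
  refine decomp_of_dense (D := χ.symm ⁻¹' Aᶜ) ((isKahlerOn_gX hg hχ).mono hΩ Set.inter_subset_left)
    (fun J z hz => (hholo J z hz).continuousAt.continuousWithinAt) ?_ ?_ hz
  · intro y hy
    rw [mem_closure_iff]
    intro W hW hyW
    by_contra hne
    rw [Set.not_nonempty_iff_eq_empty] at hne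
    have h1 : IsOpen (χ.source ∩ χ ⁻¹' W) := χ.isOpen_inter_preimage hW
    have h2 : χ.source ∩ χ ⁻¹' W ⊆ A := by
      rintro x ⟨hx, hxW⟩
      by_contra hxA
      have : χ x ∈ W ∩ χ.symm ⁻¹' Aᶜ := ⟨hxW, by
        rw [Set.mem_preimage, χ.left_inv hx]; exact hxA⟩
      rw [hne] at this
      exact this
    have h3 : χ.symm y ∈ interior A := interior_maximal h2 h1 ⟨χ.map_target hy.1, by
      rw [Set.mem_preimage, χ.right_inv hy.1]; exact hyW⟩
    rw [hAi] at h3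
    exact h3
  · rintro y ⟨hy, hyA⟩
    obtain ⟨v, t, hv, ht⟩ := exists_decomp_off (g := g) (dim_le_of_generator hU h ⟨_, hy.2⟩) h.1 hy.2
      fun hi => hyA (hind hi)
    obtain ⟨a, rfl⟩ := exists_coord hχ hy.1 v
    exact ⟨a, t, isOrtho_iff.2 hv, eX_eq ht⟩

theorem exists_frame [T2Space Y] [IsManifold 𝓘(ℂ, Cn n) ω X] (hg : g.IsKahler) {ι : Type*}
    (h : PseudoEffectiveMetric f.reflexivePullback ι) (x : X) :
    ∃ v : Fin p → Tan n x, IsOrtho (g.form x) v ∧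
      ∀ α, x ∈ h.U α → ∃ t : ℂ, h.η α x = t • wedge (dualFam (g.form x) v) := by
  obtain ⟨α₀, hα₀⟩ := h.cover x
  have key : ∃ (v : Fin p → Tan n x) (t : ℂ), IsOrtho (g.form x) v ∧
      h.η α₀ x = t • wedge (dualFam (g.form x) v) := by
    have hc := chart_mem_atlas (Cn n) x
    have hz := mem_chart_target (Cn n) x
    have hx := chart_symm (n := n) x
    have gen : ∀ y, y = (chartAt (Cn n) x).symm (chartAt (Cn n) x x) → y ∈ h.U α₀ →
        ∃ (v : Fin p → Tan n y) (t : ℂ), IsOrtho (g.form y) v ∧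
        h.η α₀ y = t • wedge (dualFam (g.form y) v) := by
      intro y hy hyU
      subst hy
      obtain ⟨a, t, ha, ht⟩ := (isDecompOn_eX hg (h.isOpen_U α₀) (h.generator α₀) hc).decomp _ ⟨hz, hyU⟩
      refine ⟨_, t, isOrtho_iff.1 ha, ?_⟩
      ext s
      obtain ⟨b, rfl⟩ := exists_coord hc hz s
      have h1 := congrArg (fun L => L b) ht
      simp only [eX, AlternatingMap.compLinearMap_apply, AlternatingMap.smul_apply, wedge_apply,
        dualFam, LinearMap.flip_apply, sesq_gX] at h1
      simpa only [AlternatingMap.smul_apply, wedge_apply, dualFam, LinearMap.flip_apply] using h1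
    exact gen x hx.symm hα₀
  obtain ⟨v, t, hv, ht⟩ := key
  refine ⟨v, hv, fun α hα => ?_⟩
  obtain ⟨b, -, hb⟩ := h.compatible α₀ α
  refine ⟨b x * t, ?_⟩
  rw [(hb x ⟨hα₀, hα⟩).2.1, ht, mul_smul]

end Decomposable

/-! ### The volume measure in coordinates -/

section Volume

variable {n : ℕ} {X : Type*} [TopologicalSpace X] [ChartedSpace (Cn n) X]
  {χ χ' : OpenPartialHomeomorph X (Cn n)} {z : Cn n} {g : HermitianMetric n X}

/-- The density of `ωⁿ` with respect to the Lebesgue measure. -/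
def dens (g : HermitianMetric n X) (χ : OpenPartialHomeomorph X (Cn n)) (z : Cn n) : ℝ :=
  n.factorial * 2 ^ n * (gX g χ z).det.re

theorem measurableSet_inter_symm [MeasurableSpace X] [BorelSpace X] {A : Set X}
    (hA : MeasurableSet A) : MeasurableSet (χ.target ∩ χ.symm ⁻¹' A) := by
  have h1 : Measurable fun y : χ.target => χ.symm y :=
    (continuousOn_iff_continuous_domRestrict.1 χ.continuousOn_symm).measurable
  have h2 := χ.open_target.measurableSet.subtype_image (h1 hA)
  convert h2 using 1
  ext y
  simp only [Set.mem_inter_iff, Set.mem_preimage, Set.mem_image, Subtype.exists, exists_and_right,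
    exists_eq_right]
  exact ⟨fun h => ⟨h.1, h.2⟩, fun h => ⟨h.1, h.2⟩⟩

theorem aemeasurable_symm [MeasurableSpace X] [BorelSpace X] :
    AEMeasurable χ.symm ((volume : Measure (Cn n)).restrict χ.target) :=
  χ.continuousOn_symm.aemeasurable χ.open_target.measurableSet

theorem chartVolume_apply [MeasurableSpace X] [BorelSpace X] {A : Set X} (hA : MeasurableSet A) :
    g.chartVolume χ A = ∫⁻ z in χ.target ∩ χ.symm ⁻¹' A, ENNReal.ofReal (dens g χ z) := by
  rw [HermitianMetric.chartVolume, Measure.map_apply_of_aemeasurable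
    (aemeasurable_symm.mono_ac (withDensity_absolutelyContinuous _ _)) hA, withDensity_apply',
    Measure.restrict_restrict' χ.open_target.measurableSet, Set.inter_comm]
  rfl

variable [IsManifold 𝓘(ℂ, Cn n) ω X]

theorem abs_det_restrictScalars (L : Cn n →L[ℂ] Cn n) :
    |(L.restrictScalars ℝ).det| = ‖L.toLinearMap.det‖ ^ 2 := by
  have h : (L.restrictScalars ℝ).det = Complex.normSq L.toLinearMap.det := by
    rw [← Algebra.norm_complex_apply, ← LinearMap.det_restrictScalars]
    rfl
  rw [h, abs_of_nonneg (Complex.normSq_nonneg _), normSq_eq_norm_sq]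

theorem det_gX_trans (hχ : χ ∈ atlas (Cn n) X) (hχ' : χ' ∈ atlas (Cn n) X) (hz : z ∈ χ.target)
    (hz' : χ.symm z ∈ χ'.source) :
    (gX g χ z).det.re = ‖(fderiv ℂ (trans χ χ') z).toLinearMap.det‖ ^ 2
      * (gX g χ' (trans χ χ' z)).det.re := by
  set L := fderiv ℂ (trans χ χ') z with hL
  set T := LinearMap.toMatrix' L.toLinearMap with hT
  have h1 : gX g χ z = T.transpose * gX g χ' (trans χ χ' z) * T.map conj := by
    ext i j
    have h2 : gX g χ z i j = sesq (gX g χ' (trans χ χ' z)) (L (stdB n i)) (L (stdB n j)) := by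
      rw [sesq_gX, symm_trans hz', ← coord_vec_trans hχ hχ' hz hz', ← coord_vec_trans hχ hχ' hz hz',
        vec_coord hχ' hz', vec_coord hχ' hz', ← coordVec_eq, ← coordVec_eq]
      rfl
    rw [h2, sesq_apply, Matrix.mul_apply]
    simp only [Matrix.mul_apply, Matrix.transpose_apply, Matrix.map_apply, hT,
      LinearMap.toMatrix'_apply, stdB, Pi.basisFun_apply, sum_mul,
      ContinuousLinearMap.coe_coe]
    refine sum_comm_ext fun a => sum_ext fun b => ?_
    ring
  have h3 : (T.map conj).det = conj T.det := (RingHom.map_det (starRingEnd ℂ) T).symm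
  have h4 : T.det = L.toLinearMap.det := LinearMap.det_toMatrix' _
  rw [h1, Matrix.det_mul, Matrix.det_mul, Matrix.det_transpose, h3, h4,
    show ∀ a b : ℂ, a * b * conj a = ((‖a‖ ^ 2 : ℝ) : ℂ) * b from fun a b => by
      rw [← normSq_eq_norm_sq, ← mul_conj]; ring, re_ofReal_mul]

theorem chartVolume_le [MeasurableSpace X] [BorelSpace X] (hχ : χ ∈ atlas (Cn n) X)
    (hχ' : χ' ∈ atlas (Cn n) X) {A : Set X} (hA : MeasurableSet A) (hs : A ⊆ χ.source) :
    g.chartVolume χ' A ≤ g.chartVolume χ A := by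
  rw [chartVolume_apply hA, chartVolume_apply hA]
  set S := χ.target ∩ χ.symm ⁻¹' (A ∩ χ'.source)
  have hS : MeasurableSet S := measurableSet_inter_symm (hA.inter χ'.open_source.measurableSet)
  have himg : χ'.target ∩ χ'.symm ⁻¹' A = trans χ χ' '' S := by
    ext w
    constructor
    · rintro ⟨hw, hwA⟩
      have hws : χ'.symm w ∈ χ.source := hs hwA
      refine ⟨trans χ' χ w, ⟨trans_mem hws, ?_⟩, trans_trans hw hws⟩
      rw [Set.mem_preimage, symm_trans hws]
      exact ⟨hwA, χ'.map_target hw⟩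
    · rintro ⟨y, ⟨hy, hyA⟩, rfl⟩
      refine ⟨trans_mem hyA.2, ?_⟩
      rw [Set.mem_preimage, symm_trans hyA.2]
      exact hyA.1
  have hinj : Set.InjOn (trans χ χ') S := fun y hy y' hy' e => by
    rw [← trans_trans hy.1 hy.2.2, e, trans_trans hy'.1 hy'.2.2]
  have hd : ∀ y ∈ S, HasFDerivWithinAt (trans χ χ')
      ((fderiv ℂ (trans χ χ') y).restrictScalars ℝ) S y := fun y hy =>
    (((contDiffAt_trans hχ hχ' hy.1 hy.2.2).differentiableAt (by simp)).hasFDerivAt.restrictScalars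
      ℝ).hasFDerivWithinAt
  rw [himg, lintegral_image_eq_lintegral_abs_det_fderiv_mul volume hS hd hinj]
  calc _ = ∫⁻ y in S, ENNReal.ofReal (dens g χ y) := by
        refine setLIntegral_congr_fun hS fun y hy => ?_
        rw [← ENNReal.ofReal_mul (abs_nonneg _), abs_det_restrictScalars, dens, dens,
          det_gX_trans hχ hχ' hy.1 hy.2.2]
        congr 1
        ring
    _ ≤ _ := lintegral_mono_set fun y (hy : y ∈ S) => (⟨hy.1, hy.2.1⟩ : _ ∧ _)

theorem volumeMeasure_restrict [MeasurableSpace X] [BorelSpace X] (hχ : χ ∈ atlas (Cn n) X) :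
    g.volumeMeasure.restrict χ.source = g.chartVolume χ := by
  have hsm : MeasurableSet χ.source := χ.open_source.measurableSet
  have hself : g.chartVolume χ = (g.chartVolume χ).restrict χ.source := by
    refine Measure.ext fun A hA => ?_
    rw [Measure.restrict_apply hA, chartVolume_apply hA, chartVolume_apply (hA.inter hsm)]
    congr 2
    ext y
    exact ⟨fun h => ⟨h.1, h.2, χ.map_target h.1⟩, fun h => ⟨h.1, h.2.1⟩⟩
  refine le_antisymm ?_ ?_
  · have h1 : g.volumeMeasure ≤ g.chartVolume χ + (⊤ : Measure X).restrict χ.sourceᶜ := by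
      refine iSup₂_le fun χ' hχ' => Measure.le_iff.2 fun A hA => ?_
      rw [← measure_inter_add_sdiff A hsm, Measure.add_apply, Measure.restrict_apply hA]
      refine add_le_add ((chartVolume_le hχ hχ' (hA.inter hsm) Set.inter_subset_right).trans
        (measure_mono Set.inter_subset_left)) ?_
      rw [Set.sdiff_eq]
      exact (le_top : g.chartVolume χ' ≤ ⊤) _
    refine (Measure.restrict_mono le_rfl h1).trans ?_
    rw [Measure.restrict_add, Measure.restrict_restrict hsm, Set.inter_compl_self,
      Measure.restrict_empty, add_zero]
    exact Measure.restrict_le_self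
  · rw [hself]
    exact Measure.restrict_mono le_rfl (le_iSup₂_of_le χ hχ le_rfl)

theorem dens_pos (hg : g.IsKahler) (hχ : χ ∈ atlas (Cn n) X) (hz : z ∈ χ.target) : 0 < dens g χ z := by
  have := (isKahlerOn_gX hg hχ).det_pos hz
  exact mul_pos (by positivity) this.1

theorem continuousOn_dens (hg : g.IsKahler) (hχ : χ ∈ atlas (Cn n) X) :
    ContinuousOn (dens g χ) χ.target := fun z hz =>
  (continuousAt_const.mul (continuous_re.continuousAt.comp
    ((isKahlerOn_gX hg hχ).smOn_det z hz).continuousAt)).continuousWithinAt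

variable [MeasurableSpace X] [BorelSpace X] {E : Type*} [NormedAddCommGroup E] [NormedSpace ℝ E]
  {H : X → E}

theorem exists_chartVolume_map : ∃ ν : Measure χ.target,
    ((volume : Measure (Cn n)).restrict χ.target).withDensity (fun z => ENNReal.ofReal (dens g χ z))
      = ν.map (fun y : χ.target => (y : Cn n)) ∧ g.chartVolume χ = ν.map fun y : χ.target => χ.symm y := by
  have hemb := MeasurableEmbedding.subtype_coe χ.open_target.measurableSet
  set m := ((volume : Measure (Cn n)).restrict χ.target).withDensity
    (fun z => ENNReal.ofReal (dens g χ z)) with hm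
  have h1 : m = (m.comap ((↑) : χ.target → Cn n)).map (↑) := by
    rw [hemb.map_comap, Subtype.range_coe, hm, restrict_withDensity χ.open_target.measurableSet,
      Measure.restrict_restrict χ.open_target.measurableSet, Set.inter_self]
  refine ⟨m.comap (↑), h1, ?_⟩
  have h2 : AEMeasurable χ.symm m := aemeasurable_symm.mono_ac (withDensity_absolutelyContinuous _ _)
  change m.map χ.symm = _
  rw [h1] at h2
  conv_lhs => rw [h1]
  rw [AEMeasurable.map_map_of_aemeasurable h2 measurable_subtype_coe.aemeasurable]
  rfl

theorem measurableEmbedding_symm : MeasurableEmbedding fun y : χ.target => χ.symm y :=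
  χ.symm.isOpenEmbedding_restrict.measurableEmbedding

theorem integrable_iff_chart (hg : g.IsKahler) (hχ : χ ∈ atlas (Cn n) X)
    (hH : ∀ x, x ∉ χ.source → H x = 0) : Integrable H g.volumeMeasure ↔
      IntegrableOn (fun z => dens g χ z • H (χ.symm z)) χ.target := by
  obtain ⟨ν, h1, h2⟩ := exists_chartVolume_map (g := g) (χ := χ)
  have hm := (continuousOn_dens hg hχ).aemeasurable χ.open_target.measurableSet (μ := volume)
  have hemb := MeasurableEmbedding.subtype_coe χ.open_target.measurableSet
  rw [← integrableOn_iff_integrable_of_support_subset (s := χ.source)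
    fun x hx => by_contra fun h => hx (hH x h), IntegrableOn, volumeMeasure_restrict hχ, h2,
    measurableEmbedding_symm.integrable_map_iff]
  change Integrable ((fun z => H (χ.symm z)) ∘ (↑)) ν ↔ _
  rw [← hemb.integrable_map_iff, ← h1, integrable_withDensity_iff_integrable_smul₀'
    hm.ennreal_ofReal (.of_forall fun _ => ENNReal.ofReal_lt_top)]
  refine integrableOn_congr_fun (fun z hz => ?_) χ.open_target.measurableSet
  rw [ENNReal.toReal_ofReal (dens_pos hg hχ hz).le]

theorem integral_eq_chart (hg : g.IsKahler) (hχ : χ ∈ atlas (Cn n) X)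
    (hH : ∀ x, x ∉ χ.source → H x = 0) : ∫ x, H x ∂g.volumeMeasure =
      ∫ z in χ.target, dens g χ z • H (χ.symm z) := by
  obtain ⟨ν, h1, h2⟩ := exists_chartVolume_map (g := g) (χ := χ)
  have hm := (continuousOn_dens hg hχ).aemeasurable χ.open_target.measurableSet (μ := volume)
  have hemb := MeasurableEmbedding.subtype_coe χ.open_target.measurableSet
  rw [← setIntegral_eq_integral_of_forall_compl_eq_zero (s := χ.source) hH,
    volumeMeasure_restrict hχ, h2, measurableEmbedding_symm.integral_map]
  refine (hemb.integral_map (μ := ν) fun z => H (χ.symm z)).symm.trans ?_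
  rw [← h1, integral_withDensity_eq_integral_toReal_smul₀
    hm.ennreal_ofReal (.of_forall fun _ => ENNReal.ofReal_lt_top)]
  refine setIntegral_congr_fun χ.open_target.measurableSet fun z hz => ?_
  rw [ENNReal.toReal_ofReal (dens_pos hg hχ hz).le]

end Volume

/-! ### Extension by zero of functions given in coordinates -/

section Extension

variable {n p : ℕ} {X : Type*} [TopologicalSpace X] [ChartedSpace (Cn n) X]
  {χ : OpenPartialHomeomorph X (Cn n)} {z : Cn n} {x : X} {g : HermitianMetric n X}
  {Ω : Set (Cn n)} {θ : Cn n → ℝ} {E : Type*} [NormedAddCommGroup E]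

open Classical in
/-- The extension by zero of a function on `χ.target`. -/
def extX (χ : OpenPartialHomeomorph X (Cn n)) (q : Cn n → E) (x : X) : E :=
  if x ∈ χ.source then q (χ x) else 0

theorem extX_of_mem (q : Cn n → E) (hx : x ∈ χ.source) : extX χ q x = q (χ x) := if_pos hx

theorem extX_of_notMem (q : Cn n → E) (hx : x ∉ χ.source) : extX χ q x = 0 := if_neg hx

theorem extX_symm (q : Cn n → E) (hz : z ∈ χ.target) : extX χ q (χ.symm z) = q z := by
  rw [extX_of_mem q (χ.map_target hz), χ.right_inv hz]

theorem extX_eventually_zero [T2Space X] {q : Cn n → E} {K : Set (Cn n)} (hK : IsCompact K)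
    (hs : K ⊆ χ.target) (hq : ∀ z ∉ K, q z = 0) (hx : x ∈ χ.source → χ x ∉ K) :
    extX χ q =ᶠ[nhds x] fun _ => 0 := by
  have hc : IsClosed (χ.symm '' K) := (hK.image_of_continuousOn (χ.continuousOn_symm.mono hs)).isClosed
  have hx' : x ∉ χ.symm '' K := by
    rintro ⟨w, hw, rfl⟩
    refine hx (χ.map_target (hs hw)) ?_
    rwa [χ.right_inv (hs hw)]
  filter_upwards [hc.isOpen_compl.mem_nhds hx'] with y hy
  by_cases hys : y ∈ χ.source
  · rw [extX_of_mem q hys]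
    exact hq _ fun h => hy ⟨_, h, χ.left_inv hys⟩
  · exact extX_of_notMem q hys

theorem levi_eq_zero {F : X → ℝ} (h : F =ᶠ[nhds x] fun _ => 0) (u : Tan n x) : levi F x u = 0 := by
  have hm := mem_chart_target (Cn n) x
  have h1 : (fun z => (F ((chartAt (Cn n) x).symm z) : ℂ)) =ᶠ[nhds (chartAt (Cn n) x x)]
      fun _ => 0 := by
    have h2 := (chartAt (Cn n) x).symm.continuousAt hm
    rw [ContinuousAt, chart_symm] at h2
    filter_upwards [h2.eventually h] with y hy
    rw [hy, Complex.ofReal_zero]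
  have h3 : ∀ (e : ℂ) (a : Cn n), wirt e a (fun _ : Cn n => (0 : ℂ)) = fun _ => 0 := fun e a => by
    funext y
    simp [wirt]
  simp only [levi]
  rw [wirt_congr (wirt_congr_eventually h1), h3, h3]
  rfl

theorem IsTest.isCompact {θ : Cn n → ℂ} (h : IsTest θ Ω) : IsCompact (tsupport θ) := h.compact

variable [T2Space X]

theorem IsTest.extX_eventually_zero (h : IsTest (fun z => (θ z : ℂ)) Ω) (hΩ : Ω ⊆ χ.target)
    (hx : x ∈ χ.source → χ x ∉ tsupport fun z => (θ z : ℂ)) : extX χ θ =ᶠ[nhds x] fun _ => 0 :=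
  BochnerRatio.extX_eventually_zero h.isCompact (h.subset.trans hΩ)
    (fun _ hw => by simpa using image_eq_zero_of_notMem_tsupport hw) hx

theorem IsTest.levi_eq_zero (h : IsTest (fun z => (θ z : ℂ)) Ω) (hΩ : Ω ⊆ χ.target)
    (hx : x ∈ χ.source → χ x ∉ Ω) (u : Tan n x) : levi (extX χ θ) x u = 0 :=
  BochnerRatio.levi_eq_zero (h.extX_eventually_zero hΩ fun hs hm => hx hs (h.subset hm)) u

variable [IsManifold 𝓘(ℂ, Cn n) ω X]

theorem IsTest.smX (h : IsTest (fun z => (θ z : ℂ)) Ω) (hΩ : Ω ⊆ χ.target)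
    (hχ : χ ∈ atlas (Cn n) X) : SmX n (extX χ θ) := by
  intro χ' hχ' z hz
  by_cases hx : χ'.symm z ∈ χ.source ∧ χ (χ'.symm z) ∈ tsupport fun z => (θ z : ℂ)
  · have h1 : ContDiff ℝ ∞ θ := reCLM.contDiff.comp h.smooth
    have h2 : ContDiffAt ℝ ∞ (trans χ' χ) z :=
      ((contDiffAt_trans hχ' hχ hz hx.1).restrict_scalars ℝ).of_le le_top
    refine (h1.contDiffAt.comp z h2).congr_of_eventuallyEq ?_
    filter_upwards [eventually_mem hz hx.1] with y hy
    exact extX_of_mem θ hy.2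
  · have h1 := h.extX_eventually_zero hΩ fun hs hm => hx ⟨hs, hm⟩
    refine (contDiffAt_const (c := (0 : ℝ))).congr_of_eventuallyEq ?_
    exact (χ'.symm.continuousAt hz).eventually h1

theorem levi_sub_sum {ι : Type*} (s : Finset ι) {F : ι → X → ℝ} (hF : ∀ k ∈ s, SmX n (F k)) (c : ℝ)
    (x : X) (u : Tan n x) :
    levi (fun y => c - ∑ k ∈ s, F k y) x u = -∑ k ∈ s, levi (F k) x u := by
  set χ := chartAt (Cn n) x
  have hc := chart_mem_atlas (Cn n) x
  have hm := mem_chart_target (Cn n) x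
  have hS : ∀ k ∈ s, ∀ y ∈ χ.target, Sm (fun z => (F k (χ.symm z) : ℂ)) y := fun k hk y hy =>
    Sm.ofReal (hF k hk χ hc y hy)
  have h1 : ∀ y ∈ χ.target, dzb (coord χ x u) (fun z => ((c - ∑ k ∈ s, F k (χ.symm z) : ℝ) : ℂ)) y
      = -∑ k ∈ s, dzb (coord χ x u) (fun z => (F k (χ.symm z) : ℂ)) y := by
    intro y hy
    have e : (fun z => ((c - ∑ k ∈ s, F k (χ.symm z) : ℝ) : ℂ))
        = fun z => (c : ℂ) - ∑ k ∈ s, (F k (χ.symm z) : ℂ) := by funext z; push_cast; rfl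
    rw [e, wirt_sub (F := fun _ => (c : ℂ)) (differentiableAt_const _)
      (DifferentiableAt.fun_sum fun k hk => (hS k hk y hy).diff),
      wirt_sum _ fun k hk => (hS k hk y hy).diff]
    simp [wirt]
  have h2 : dzb (coord χ x u) (fun z => ((c - ∑ k ∈ s, F k (χ.symm z) : ℝ) : ℂ)) =ᶠ[nhds (χ x)]
      fun y => -∑ k ∈ s, dzb (coord χ x u) (fun z => (F k (χ.symm z) : ℂ)) y := by
    filter_upwards [χ.open_target.mem_nhds hm] with y hy using h1 y hy
  change (dz (coord χ x u) (dzb (coord χ x u)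
    fun z => ((c - ∑ k ∈ s, F k (χ.symm z) : ℝ) : ℂ)) (χ x)).re = _
  rw [wirt_congr h2, wirt_neg, wirt_sum _ fun k hk => ((hS k hk _ hm).wirt _ _).diff,
    neg_re, re_sum]
  rfl

variable [MeasurableSpace X] [BorelSpace X]

theorem integral_transfer (hg : g.IsKahler) (hχ : χ ∈ atlas (Cn n) X) {H : X → ℝ} {q : Cn n → ℝ}
    (hH : ∀ x ∉ χ.source, H x = 0) (hq : ∀ z ∉ χ.target, q z = 0)
    (h : ∀ z ∈ χ.target, (gX g χ z).det.re * H (χ.symm z) = q z) :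
    (Integrable q → Integrable H g.volumeMeasure) ∧
      ∫ x, H x ∂g.volumeMeasure = n.factorial * 2 ^ n * ∫ z, q z := by
  have h1 : Set.EqOn (fun z => dens g χ z • H (χ.symm z)) (fun z => (n.factorial * 2 ^ n : ℝ) * q z)
      χ.target := fun z hz => by
    simp only [dens, smul_eq_mul]
    rw [← h z hz]
    ring
  constructor
  · intro hi
    rw [integrable_iff_chart hg hχ hH, integrableOn_congr_fun h1 χ.open_target.measurableSet]
    exact (hi.const_mul _).integrableOn
  · rw [integral_eq_chart hg hχ hH, setIntegral_congr_fun χ.open_target.measurableSet h1,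
      integral_const_mul, setIntegral_eq_integral_of_forall_compl_eq_zero hq]

end Extension

/-! ### Coordinate balls on which the Hermitian ratio is regularized -/

section Patches

variable {n p : ℕ} {X Y : Type*} [TopologicalSpace X] [ChartedSpace (Cn n) X]
  [TopologicalSpace Y] [ChartedSpace (Cn p) Y] {f : MeromorphicMap n p X Y} {ι : Type*}
  {g : HermitianMetric n X} {h : PseudoEffectiveMetric f.reflexivePullback ι}

/-- A coordinate ball with a regularization of `e^φ`. -/
structure Patch (h : PseudoEffectiveMetric f.reflexivePullback ι) where
  χ : OpenPartialHomeomorph X (Cn n)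
  mem_atlas : χ ∈ atlas (Cn n) X
  α : ι
  z₀ : Cn n
  r : ℝ
  r_pos : 0 < r
  subset : ball z₀ r ⊆ χ.target ∩ χ.symm ⁻¹' h.U α
  u : Cn n → ℝ
  U : ℕ → Cn n → ℝ
  G : Fin n → Cn n → ℂ
  C : ℝ
  K : ℝ
  reg : IsRegularization u U G z₀ r C K
  measurable : Measurable u
  nonneg : ∀ z, 0 ≤ u z
  le : ∀ z, u z ≤ C
  eq : ∀ z ∈ ball z₀ r, u z = (EReal.exp (h.φ α (χ.symm z))).toReal

namespace Patch

variable (P : Patch h)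

abbrev ball : Set (Cn n) := Metric.ball P.z₀ P.r

theorem ball_subset : P.ball ⊆ P.χ.target := fun _ hz => (P.subset hz).1

theorem exists_patch (x : X) : ∃ P : Patch h, x ∈ P.χ.source ∧ P.χ x = P.z₀ := by
  obtain ⟨α, hα⟩ := h.cover x
  have hc := chart_mem_atlas (Cn n) x
  have hopen := isOpen_chart_inter (h.isOpen_U α) (chartAt (Cn n) x)
  have hz : chartAt (Cn n) x x ∈ (chartAt (Cn n) x).target ∩ (chartAt (Cn n) x).symm ⁻¹' h.U α :=
    ⟨mem_chart_target (Cn n) x, by rw [Set.mem_preimage, chart_symm]; exact hα⟩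
  obtain ⟨R, hR, hsub⟩ := Metric.nhds_basis_closedBall.mem_iff.1 (hopen.mem_nhds hz)
  obtain ⟨u, C, hu, h0, hC, hlog, heq⟩ := exists_exp_weight (h.psh α _ hc).1 hsub
  have hR4 : 4 * (R / 4) = R := by ring
  obtain ⟨U, G, K, hreg⟩ := exists_regularization (r := R / 4) (by positivity) hu h0 hC
    (by rwa [hR4])
  have hb : Metric.ball (chartAt (Cn n) x x) (R / 4) ⊆ Metric.ball (chartAt (Cn n) x x) R :=
    ball_subset_ball (by linarith)
  exact ⟨⟨_, hc, α, _, R / 4, by positivity, (hb.trans ball_subset_closedBall).trans hsub,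
    u, U, G, C, K, hreg, hu, h0, hC, fun z hz => heq z (hb hz)⟩, mem_chart_source (Cn n) x, rfl⟩

variable [T2Space X] [IsManifold 𝓘(ℂ, Cn n) ω X]

theorem exists_partition [CompactSpace X] (h : PseudoEffectiveMetric f.reflexivePullback ι) :
    ∃ (s : Finset X) (P : X → Patch h) (θ : X → Cn n → ℝ),
      (∀ k, IsTest (fun z => (θ k z : ℂ)) (P k).ball) ∧ (∀ k z, 0 ≤ θ k z) ∧
      ∀ x, ∑ k ∈ s, extX (P k).χ (θ k) x = 1 := by
  choose P hP hz using exists_patch (h := h)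
  have hr := fun k => (P k).r_pos
  choose b hb hb0 hb1 using fun k => exists_cutoff (z₀ := (P k).z₀) (hr k)
    (isCompact_closedBall (P k).z₀ ((P k).r / 2))
    (closedBall_subset_ball (by have := hr k; linarith))
  have hbe : ∀ k x, 0 ≤ extX (P k).χ (b k) x := fun k x => by
    unfold extX
    split_ifs
    exacts [hb0 _ _, le_rfl]
  obtain ⟨s, hs⟩ := isCompact_univ.elim_finite_subcover
    (fun k => (P k).χ.source ∩ (P k).χ ⁻¹' Metric.ball (P k).z₀ ((P k).r / 2))
    (fun k => (P k).χ.isOpen_inter_preimage isOpen_ball) fun x _ =>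
      Set.mem_iUnion.2 ⟨x, hP x, by
        rw [Set.mem_preimage, hz]; exact Metric.mem_ball_self (by have := hr x; positivity)⟩
  set B : X → ℝ := fun x => ∑ k ∈ s, extX (P k).χ (b k) x with hB
  have hBpos : ∀ x, 0 < B x := fun x => by
    obtain ⟨k, hk⟩ := Set.mem_iUnion.1 (hs (Set.mem_univ x))
    obtain ⟨hks, hk1, hk2⟩ := Set.mem_iUnion.1 hk
    refine Finset.sum_pos' (fun k _ => hbe k x) ⟨k, hks, ?_⟩
    rw [extX_of_mem _ hk1, hb1 k _ (ball_subset_closedBall hk2)]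
    exact one_pos
  have hBs : SmX n B := fun χ hχ z hz => ContDiffAt.sum fun k _ =>
    (hb k).smX (P k).ball_subset (P k).mem_atlas χ hχ z hz
  refine ⟨s, P, fun k z => (B ((P k).χ.symm z))⁻¹ * b k z, fun k => ?_, fun k z =>
    mul_nonneg (inv_nonneg.2 (hBpos _).le) (hb0 k z), fun x => ?_⟩
  · have h1 := (hb k).mul (F := fun z => (((B ((P k).χ.symm z))⁻¹ : ℝ) : ℂ)) fun z hz =>
      Sm.ofReal ((hBs _ (P k).mem_atlas z ((P k).ball_subset hz)).inv (hBpos _).ne')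
    simpa only [ofReal_mul] using h1
  · have h1 : ∀ k, extX (P k).χ (fun z => (B ((P k).χ.symm z))⁻¹ * b k z) x
        = (B x)⁻¹ * extX (P k).χ (b k) x := fun k => by
      by_cases hx : x ∈ (P k).χ.source
      · rw [extX_of_mem _ hx, extX_of_mem _ hx, (P k).χ.left_inv hx]
      · rw [extX_of_notMem _ hx, extX_of_notMem _ hx, mul_zero]
    simp only [h1, ← mul_sum]
    exact inv_mul_cancel₀ (hBpos x).ne'

end Patch

/-! ### The global integral inequality -/

theorem leviPair_congr {g : LocalMatrix n} {η : LocalForm n p}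
    {θ θ' : Cn n → ℝ} {z : Cn n} (h : θ =ᶠ[nhds z] θ') : leviPair g η θ z = leviPair g η θ' z := by
  have h1 : (fun x => (θ x : ℂ)) =ᶠ[nhds z] fun x => (θ' x : ℂ) := by
    filter_upwards [h] with y hy using by rw [hy]
  have h2 : ∀ F : Cn n → ℂ, ∀ j, wdBar j F = dzb (Pi.single j 1) F := fun F j =>
    funext fun y => wdBar_eq_dzb j F y
  simp only [leviPair, wd_eq_dz, h2, wirt_congr (wirt_congr_eventually h1)]

/-- The gradient of the Hermitian ratio as a covector, on a coordinate ball. -/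
def Patch.cov (g : HermitianMetric n X) (P : Patch h) (x : X) : Tan n x →ₗ[ℂ] ℂ :=
  ∑ i, gradLim (gX g P.χ) (eX P.χ (h.η P.α)) P.u P.G i (P.χ x) •
    (LinearMap.proj i ∘ₗ (mfderiv 𝓘(ℂ, Cn n) 𝓘(ℂ, Cn n) P.χ x : Tan n x →L[ℂ] Cn n).toLinearMap :
      Tan n x →ₗ[ℂ] ℂ)

namespace Patch

variable (P : Patch h) {θ q : Cn n → ℝ}

theorem cov_apply (x : X) (a : Tan n x) : P.cov g x a
    = ∑ i, gradLim (gX g P.χ) (eX P.χ (h.η P.α)) P.u P.G i (P.χ x) * coord P.χ x a i := by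
  simp only [cov, LinearMap.sum_apply, LinearMap.smul_apply, smul_eq_mul]
  rfl

theorem integrable_pow_mul {Ω : Set (Cn n)} (m : ℕ) (hq : IsCc q Ω) :
    Integrable fun z => P.u z ^ m * q z := by
  refine hq.integrable.bdd_mul (c := P.C ^ m) (P.measurable.pow_const m).aestronglyMeasurable
    (.of_forall fun z => ?_)
  rw [norm_pow, norm_eq_abs, abs_of_nonneg (P.nonneg z)]
  exact pow_le_pow_left₀ (P.nonneg z) (P.le z) m

variable [IsManifold 𝓘(ℂ, Cn n) ω X]

theorem isKahlerOn (hg : g.IsKahler) : IsKahlerOn (gX g P.χ) P.ball :=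
  (isKahlerOn_gX hg P.mem_atlas).mono isOpen_ball P.ball_subset

theorem cov_coordVec {z : Cn n} (hz : z ∈ P.χ.target) (i : Fin n) :
    P.cov g (P.χ.symm z) (coordVec P.χ (P.χ.symm z) i)
      = gradLim (gX g P.χ) (eX P.χ (h.η P.α)) P.u P.G i z := by
  rw [cov_apply, coordVec_eq, coord_vec P.mem_atlas (P.χ.map_target hz), P.χ.right_inv hz]
  simp [stdB, Pi.basisFun_apply, Pi.single_apply]

variable [T2Space X] [T2Space Y]

theorem isDecompOn (hg : g.IsKahler) : IsDecompOn (gX g P.χ) (eX P.χ (h.η P.α)) P.ball :=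
  (isDecompOn_eX hg (h.isOpen_U _) (h.generator _) P.mem_atlas).mono P.subset

theorem ratio_symm (hg : g.IsKahler) {z : Cn n} (hz : z ∈ P.ball) :
    hermitianRatio g h (P.χ.symm z) = P.u z * nrm (gX g P.χ) (eX P.χ (h.η P.α)) z := by
  obtain ⟨v, hv, ht⟩ := exists_frame hg h (P.χ.symm z)
  obtain ⟨t, ht⟩ := ht P.α (P.subset hz).2
  rw [hermitianRatio_eq g h _ P.α (P.subset hz).2, ← P.eq z hz,
    formNormSq_symm hg P.mem_atlas (P.ball_subset hz) hv ht]

variable [MeasurableSpace X] [BorelSpace X]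

theorem pairing (hg : g.IsKahler) (m : ℕ) (hq : IsCc q P.ball) {H : X → ℝ}
    (hH0 : ∀ x, (x ∈ P.χ.source → P.χ x ∉ P.ball) → H x = 0)
    (hH : ∀ z ∈ P.ball, (gX g P.χ z).det.re * H (P.χ.symm z) = P.u z ^ m * q z) :
    Integrable H g.volumeMeasure ∧
      ∫ x, H x ∂g.volumeMeasure = n.factorial * 2 ^ n * ∫ z, P.u z ^ m * q z := by
  have h1 := integral_transfer hg P.mem_atlas (H := H) (q := fun z => P.u z ^ m * q z)
    (fun x hx => hH0 x fun h => absurd h hx)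
    (fun z hz => by rw [hq.zero_of_notMem fun h => hz (P.ball_subset h), mul_zero]) fun z hz => by
      by_cases hb : z ∈ P.ball
      · exact hH z hb
      · rw [hH0 _ fun _ => by rwa [P.χ.right_inv hz], hq.zero_of_notMem hb, mul_zero, mul_zero]
  exact ⟨h1.1 (P.integrable_pow_mul m hq), h1.2⟩

section Frames

variable {o : ∀ x : X, Fin n → Tan n x} {v : ∀ x : X, Fin p → Tan n x}
  (ho : ∀ x, IsOrtho (g.form x) (o x)) (hv : ∀ x, IsOrtho (g.form x) (v x))
  (ht : ∀ x α, x ∈ h.U α → ∃ t : ℂ, h.η α x = t • wedge (dualFam (g.form x) (v x)))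

include ho in
theorem integral_trace (hg : g.IsKahler) (hθ : IsTest (fun z => (θ z : ℂ)) P.ball) :
    Integrable (fun x => hermitianRatio g h x ^ 2 * ∑ r, levi (extX P.χ θ) x (o x r))
        g.volumeMeasure ∧
      ∫ x, hermitianRatio g h x ^ 2 * ∑ r, levi (extX P.χ θ) x (o x r) ∂g.volumeMeasure
        = n.factorial * 2 ^ n * ∫ z, P.u z ^ 2 * (nrm (gX g P.χ) (eX P.χ (h.η P.α)) z ^ 2
          * leviPair (gX g P.χ) (oneForm n) θ z) := by
  have hη := P.isDecompOn hg
  refine P.pairing hg 2 ((isCc_leviPair (P.isKahlerOn hg) isDecompOn_oneForm hθ).mul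
    isOpen_ball fun z hz =>
      ((hη.smOn_nrm (P.isKahlerOn hg) hz).pow 2).continuousAt.continuousWithinAt)
    (fun x hx => ?_) fun z hz => ?_
  · simp only [hθ.levi_eq_zero P.ball_subset hx, sum_const_zero, mul_zero]
  · have hz' := P.ball_subset hz
    rw [P.ratio_symm hg hz, ← leviPair_congr (θ := fun z => extX P.χ θ (P.χ.symm z)),
      leviPair_oneForm hg P.mem_atlas hz' (hθ.smX P.ball_subset P.mem_atlas) (ho _)]
    · ring
    · filter_upwards [P.χ.open_target.mem_nhds hz'] with y hy using extX_symm θ hy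

include ho hv ht in
theorem integral_perp (hg : g.IsKahler) (m : ℕ) (hθ : IsTest (fun z => (θ z : ℂ)) P.ball) :
    Integrable (fun x => hermitianRatio g h x ^ (m + 1) * (∑ r, levi (extX P.χ θ) x (o x r)
        - ∑ k, levi (extX P.χ θ) x (v x k))) g.volumeMeasure ∧
      ∫ x, hermitianRatio g h x ^ (m + 1) * (∑ r, levi (extX P.χ θ) x (o x r)
        - ∑ k, levi (extX P.χ θ) x (v x k)) ∂g.volumeMeasure
        = n.factorial * 2 ^ n * ∫ z, P.u z ^ (m + 1) * (nrm (gX g P.χ) (eX P.χ (h.η P.α)) z ^ m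
          * leviPair (gX g P.χ) (eX P.χ (h.η P.α)) θ z) := by
  have hη := P.isDecompOn hg
  refine P.pairing hg (m + 1) ((isCc_leviPair (P.isKahlerOn hg) hη hθ).mul isOpen_ball
    fun z hz => ((hη.smOn_nrm (P.isKahlerOn hg) hz).pow m).continuousAt.continuousWithinAt)
    (fun x hx => ?_) fun z hz => ?_
  · simp only [hθ.levi_eq_zero P.ball_subset hx, sum_const_zero, sub_zero, mul_zero]
  · have hz' := P.ball_subset hz
    obtain ⟨t, ht⟩ := ht _ P.α (P.subset hz).2
    rw [P.ratio_symm hg hz, ← leviPair_congr (θ := fun z => extX P.χ θ (P.χ.symm z)),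
      leviPair_gX hg P.mem_atlas hz' (hθ.smX P.ball_subset P.mem_atlas) (ho _) (hv _) ht]
    · ring
    · filter_upwards [P.χ.open_target.mem_nhds hz'] with y hy using extX_symm θ hy

end Frames

theorem exists_frames (hg : g.IsKahler) (h : PseudoEffectiveMetric f.reflexivePullback ι) :
    ∃ (o : ∀ x : X, Fin n → Tan n x) (v : ∀ x : X, Fin p → Tan n x),
      (∀ x, IsOrtho (g.form x) (o x)) ∧ (∀ x, IsOrtho (g.form x) (v x)) ∧
      ∀ x α, x ∈ h.U α → ∃ t : ℂ, h.η α x = t • wedge (dualFam (g.form x) (v x)) := by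
  choose v hv ht using exists_frame hg h
  choose o ho using fun x : X => (isHermForm g x).exists_ortho (finrank_tan x)
  exact ⟨o, v, ho, hv, ht⟩

variable [CompactSpace X]

theorem integral_leviPair_eq_zero (hg : g.IsKahler) (hθ : IsTest (fun z => (θ z : ℂ)) P.ball)
    (hθ0 : ∀ z, 0 ≤ θ z) :
    ∫ z, P.u z * leviPair (gX g P.χ) (eX P.χ (h.η P.α)) θ z = 0 := by
  obtain ⟨o, v, ho, hv, ht⟩ := exists_frames hg h
  obtain ⟨s, Q, b, hb, hb0, hb1⟩ := exists_partition h
  have hnn : ∀ (Q : Patch h) (θ : Cn n → ℝ), IsTest (fun z => (θ z : ℂ)) Q.ball → (∀ z, 0 ≤ θ z) →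
      0 ≤ ∫ z, Q.u z * leviPair (gX g Q.χ) (eX Q.χ (h.η Q.α)) θ z := fun Q θ hθ hθ0 =>
    leviPair_integral_nonneg (Q.isKahlerOn hg) (Q.isDecompOn hg) Q.reg hθ hθ0
  obtain ⟨M, hM⟩ := hθ.re.bdd
  simp only [ofReal_re] at hM
  have hM0 : 0 ≤ M := (abs_nonneg _).trans (hM 0)
  have hFM : ∀ x, extX P.χ θ x ≤ M := fun x => by
    unfold extX
    split_ifs
    exacts [(le_abs_self _).trans (hM _), hM0]
  have hF := hθ.smX P.ball_subset P.mem_atlas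
  set c : X → Cn n → ℝ := fun k z => (M - extX P.χ θ ((Q k).χ.symm z)) * b k z with hc
  have hct : ∀ k, IsTest (fun z => (c k z : ℂ)) (Q k).ball := fun k => by
    have h1 := (hb k).mul (F := fun z => ((M - extX P.χ θ ((Q k).χ.symm z) : ℝ) : ℂ)) fun z hz =>
      Sm.ofReal (contDiffAt_const.sub (hF _ (Q k).mem_atlas z ((Q k).ball_subset hz)))
    simpa only [hc, ofReal_mul] using h1
  have hce : ∀ k x, extX (Q k).χ (c k) x = (M - extX P.χ θ x) * extX (Q k).χ (b k) x := fun k x => by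
    by_cases hx : x ∈ (Q k).χ.source
    · rw [extX_of_mem _ hx, extX_of_mem _ hx, hc]
      simp only [(Q k).χ.left_inv hx]
    · rw [extX_of_notMem _ hx, extX_of_notMem _ hx, mul_zero]
  have hFe : extX P.χ θ = fun x => M - ∑ k ∈ s, extX (Q k).χ (c k) x := by
    funext x
    simp only [hce, ← mul_sum, hb1]
    ring
  have hlevi : ∀ x (a : Tan n x), levi (extX P.χ θ) x a = -∑ k ∈ s, levi (extX (Q k).χ (c k)) x a := by
    intro x a
    conv_lhs => rw [hFe]
    exact levi_sub_sum s (fun k _ => (hct k).smX (Q k).ball_subset (Q k).mem_atlas) M x a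
  have hP := P.integral_perp ho hv ht hg 0 hθ
  have hQ := fun k => (Q k).integral_perp ho hv ht hg 0 (hct k)
  simp only [zero_add, pow_one, pow_zero, one_mul] at hP hQ
  have hsum : ∫ x, hermitianRatio g h x * (∑ r, levi (extX P.χ θ) x (o x r)
      - ∑ k, levi (extX P.χ θ) x (v x k)) ∂g.volumeMeasure
      = -∑ k ∈ s, ∫ x, hermitianRatio g h x * (∑ r, levi (extX (Q k).χ (c k)) x (o x r)
        - ∑ i, levi (extX (Q k).χ (c k)) x (v x i)) ∂g.volumeMeasure := by
    rw [← integral_finsetSum _ fun k _ => (hQ k).1, ← integral_neg]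
    refine integral_congr_ae (.of_forall fun x => ?_)
    have e : ∀ {m : ℕ} (w : Fin m → Tan n x), ∑ r, levi (extX P.χ θ) x (w r)
        = -∑ k ∈ s, ∑ r, levi (extX (Q k).χ (c k)) x (w r) := fun w => by
      simp only [hlevi, sum_neg_distrib]
      rw [sum_comm]
    dsimp only
    rw [e, e, ← mul_sum, sum_sub_distrib]
    ring
  have hpos : (0 : ℝ) < n.factorial * 2 ^ n := by positivity
  have h1 := hnn P θ hθ hθ0
  have h2 : 0 ≤ ∑ k ∈ s, ∫ x, hermitianRatio g h x * (∑ r, levi (extX (Q k).χ (c k)) x (o x r)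
        - ∑ i, levi (extX (Q k).χ (c k)) x (v x i)) ∂g.volumeMeasure :=
    sum_nonneg fun k _ => by
      rw [(hQ k).2]
      exact mul_nonneg hpos.le (hnn (Q k) _ (hct k) fun z =>
        mul_nonneg (sub_nonneg.2 (hFM _)) (hb0 k z))
  rw [hP.2] at hsum
  nlinarith

end Patch

variable [IsManifold 𝓘(ℂ, Cn n) ω X] [T2Space X] [T2Space Y] [MeasurableSpace X] [BorelSpace X]
  [CompactSpace X]

/-- The gradient of the Hermitian ratio, glued from the coordinate balls. -/
def gradX (g : HermitianMetric n X) (s : Finset X) (P : X → Patch h) (θ : X → Cn n → ℝ) (x : X) :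
    Tan n x →ₗ[ℂ] ℂ :=
  ∑ k ∈ s, ((extX (P k).χ (θ k) x : ℝ) : ℂ) • (P k).cov g x

theorem covectorNormSq_nonneg (x : X) (a : Tan n x →ₗ[ℂ] ℂ) : 0 ≤ g.covectorNormSq x a := by
  obtain ⟨o, ho⟩ := (isHermForm g x).exists_ortho (finrank_tan x)
  rw [covectorNormSq_eq x ho]
  positivity

theorem covectorNormSq_sum_le (s : Finset X) (x : X) {b : X → ℝ} (hb : ∀ k, 0 ≤ b k)
    (hb1 : ∑ k ∈ s, b k = 1) (a : X → Tan n x →ₗ[ℂ] ℂ) :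
    g.covectorNormSq x (∑ k ∈ s, (b k : ℂ) • a k) ≤ ∑ k ∈ s, b k * g.covectorNormSq x (a k) := by
  obtain ⟨o, ho⟩ := (isHermForm g x).exists_ortho (finrank_tan x)
  simp only [covectorNormSq_eq x ho, mul_sum]
  rw [sum_comm]
  refine sum_le_sum fun r _ => ?_
  have h1 : ‖(∑ k ∈ s, (b k : ℂ) • a k) (o r)‖ ≤ ∑ k ∈ s, b k * ‖a k (o r)‖ := by
    rw [LinearMap.sum_apply]
    refine (norm_sum_le _ _).trans (sum_le_sum fun k _ => le_of_eq ?_)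
    rw [LinearMap.smul_apply, norm_smul, norm_real, norm_of_nonneg (hb k)]
  have h2 := Finset.sum_sq_le_sum_mul_sum_of_sq_le_mul s (r := fun k => b k * ‖a k (o r)‖)
    (f := b) (g := fun k => b k * ‖a k (o r)‖ ^ 2) (fun k _ => hb k)
    (fun k _ => mul_nonneg (hb k) (sq_nonneg _)) fun k _ => le_of_eq (by ring)
  rw [hb1, one_mul] at h2
  exact (pow_le_pow_left₀ (norm_nonneg _) h1 2).trans h2

variable {s : Finset X} {P : X → Patch h} {θ : X → Cn n → ℝ}

theorem ext_nonneg (hθ0 : ∀ k z, 0 ≤ θ k z) (k x : X) : 0 ≤ extX (P k).χ (θ k) x := by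
  unfold extX
  split_ifs
  exacts [hθ0 _ _, le_rfl]

section
variable (hθ : ∀ k, IsTest (fun z => (θ k z : ℂ)) (P k).ball) (hθ0 : ∀ k z, 0 ≤ θ k z)
  (hθ1 : ∀ x, ∑ k ∈ s, extX (P k).χ (θ k) x = 1)
include hθ hθ0

theorem integrable_cov (hg : g.IsKahler) (k : X) :
    Integrable (fun x => extX (P k).χ (θ k) x * g.covectorNormSq x ((P k).cov g x))
      g.volumeMeasure ∧
    ∫ x, extX (P k).χ (θ k) x * g.covectorNormSq x ((P k).cov g x) ∂g.volumeMeasure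
      = n.factorial * 2 ^ n * ∫ z, (gX g (P k).χ z).det.re * conorm (gX g (P k).χ) z (fun i =>
        gradLim (gX g (P k).χ) (eX (P k).χ (h.η (P k).α)) (P k).u (P k).G i z) * θ k z := by
  have h1 := integral_transfer hg (P k).mem_atlas
    (H := fun x => extX (P k).χ (θ k) x * g.covectorNormSq x ((P k).cov g x))
    (q := fun z => (gX g (P k).χ z).det.re * conorm (gX g (P k).χ) z (fun i =>
        gradLim (gX g (P k).χ) (eX (P k).χ (h.η (P k).α)) (P k).u (P k).G i z) * θ k z)
    (fun x hx => by rw [extX_of_notMem _ hx, zero_mul])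
    (fun z hz => by
      have := (hθ k).re.zero_of_notMem fun h => hz ((P k).ball_subset h)
      simp only [ofReal_re] at this
      rw [this, mul_zero]) fun z hz => by
      rw [extX_symm _ hz, covectorNormSq_symm (P k).mem_atlas hz]
      simp only [(P k).cov_coordVec hz]
      ring
  exact ⟨h1.1 (local_estimate (P k).r_pos ((P k).isKahlerOn hg) ((P k).isDecompOn hg) (P k).reg
    (fun b hb hb0 => (P k).integral_leviPair_eq_zero hg hb hb0) (hθ k) (hθ0 k)
    (c₁ := 0) (c₂ := 0) le_rfl (by simp)).1, h1.2⟩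

include hθ1

theorem global_estimate (hg : g.IsKahler) (hp : 0 < p) {a b : ℝ} (ha : 0 ≤ a)
    (hab : 0 ≤ a / p + 2 * b / (p * (p + 1))) {S : ∀ x : X, Submodule ℂ (Tan n x)}
    (hS : ∀ x α, x ∈ h.U α → g.IsDecompositionSpan x (h.η α x) (S x)) :
    Integrable (fun x => hermitianRatio g h x ^ 2 * g.mixedCurv a b x (S x)) g.volumeMeasure ∧
    (a / p + 2 * b / (p * (p + 1))) * (∑ k ∈ s, ∫ x, extX (P k).χ (θ k) x
        * g.covectorNormSq x ((P k).cov g x) ∂g.volumeMeasure)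
      + ∫ x, hermitianRatio g h x ^ 2 * g.mixedCurv a b x (S x) ∂g.volumeMeasure ≤ 0 := by
  obtain ⟨o, v, ho, hv, ht⟩ := Patch.exists_frames hg h
  have hcurv := fun k => (P k).pairing hg 2 (q := fun z => (gX g (P k).χ z).det.re
      * curvTerm (a / p) (2 * b / (p * (p + 1))) (gX g (P k).χ) (eX (P k).χ (h.η (P k).α)) z * θ k z)
    (H := fun x => extX (P k).χ (θ k) x * (hermitianRatio g h x ^ 2 * g.mixedCurv a b x (S x)))
    (by
      have := (hθ k).re
      simp only [ofReal_re] at this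
      exact this.mul isOpen_ball ((continuous_re.comp_continuousOn
        fun z hz => (((P k).isKahlerOn hg).smOn_det z hz).continuousAt.continuousWithinAt).mul
        (((P k).isDecompOn hg).continuousOn_curvTerm ((P k).isKahlerOn hg) _ _)))
    (fun x hx => by
      have := ((hθ k).extX_eventually_zero (P k).ball_subset
        fun hs hm => hx hs ((hθ k).subset hm)).eq_of_nhds
      rw [this, zero_mul])
    (fun z hz => by
      obtain ⟨w, t, hw, ht, hSw⟩ := hS _ (P k).α ((P k).subset hz).2
      rw [(P k).ratio_symm hg hz, extX_symm _ ((P k).ball_subset hz), hSw,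
        curvTerm_gX hg hp a b (P k).mem_atlas ((P k).ball_subset hz) hw ht]
      ring)
  have htr := fun k => (P k).integral_trace ho hg (hθ k)
  have hpe := fun k => (P k).integral_perp ho hv ht hg 1 (hθ k)
  have hcov := integrable_cov hθ hθ0 hg
  have hsum : (fun x => hermitianRatio g h x ^ 2 * g.mixedCurv a b x (S x)) = fun x => ∑ k ∈ s,
      extX (P k).χ (θ k) x * (hermitianRatio g h x ^ 2 * g.mixedCurv a b x (S x)) := by
    funext x
    rw [← sum_mul, hθ1, one_mul]
  have hzero : ∀ x {m : ℕ} (w : Fin m → Tan n x),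
      ∑ k ∈ s, ∑ r, levi (extX (P k).χ (θ k)) x (w r) = 0 := by
    intro x m w
    rw [sum_comm]
    refine sum_eq_zero fun r _ => ?_
    rw [← neg_eq_zero, ← levi_sub_sum s (fun k _ => (hθ k).smX (P k).ball_subset (P k).mem_atlas) 1]
    exact levi_eq_zero (.of_forall fun y => by rw [hθ1, sub_self]) _
  have h1 : ∑ k ∈ s, ∫ x, hermitianRatio g h x ^ 2
      * ∑ r, levi (extX (P k).χ (θ k)) x (o x r) ∂g.volumeMeasure = 0 := by
    rw [← integral_finsetSum _ fun k _ => (htr k).1]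
    simp only [← mul_sum, hzero, mul_zero, integral_zero]
  have h2 : ∑ k ∈ s, ∫ x, hermitianRatio g h x ^ (1 + 1) * (∑ r, levi (extX (P k).χ (θ k)) x (o x r)
      - ∑ i, levi (extX (P k).χ (θ k)) x (v x i)) ∂g.volumeMeasure = 0 := by
    rw [← integral_finsetSum _ fun k _ => (hpe k).1]
    simp only [← mul_sum, sum_sub_distrib, hzero, sub_zero, mul_zero, integral_zero]
  refine ⟨hsum ▸ integrable_finsetSum s fun k _ => (hcurv k).1, ?_⟩
  rw [hsum, integral_finsetSum _ fun k _ => (hcurv k).1, mul_sum, ← sum_add_distrib]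
  have h3 : ∀ k ∈ s, (a / p + 2 * b / (p * (p + 1))) * (∫ x, extX (P k).χ (θ k) x
        * g.covectorNormSq x ((P k).cov g x) ∂g.volumeMeasure)
      + ∫ x, extX (P k).χ (θ k) x
        * (hermitianRatio g h x ^ 2 * g.mixedCurv a b x (S x)) ∂g.volumeMeasure
      ≤ (a / p + 2 * b / (p * (p + 1))) / 2 * (∫ x, hermitianRatio g h x ^ 2
          * ∑ r, levi (extX (P k).χ (θ k)) x (o x r) ∂g.volumeMeasure)
        - 2 * b / (p * (p + 1)) * ∫ x, hermitianRatio g h x ^ (1 + 1)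
          * (∑ r, levi (extX (P k).χ (θ k)) x (o x r)
            - ∑ i, levi (extX (P k).χ (θ k)) x (v x i)) ∂g.volumeMeasure := by
    intro k _
    have hloc := (local_estimate (P k).r_pos ((P k).isKahlerOn hg) ((P k).isDecompOn hg) (P k).reg
      (fun b hb hb0 => (P k).integral_leviPair_eq_zero hg hb hb0) (hθ k) (hθ0 k)
      (c₁ := a / p) (c₂ := 2 * b / (p * (p + 1))) (by positivity) hab).2
    have hpos : (0 : ℝ) < n.factorial * 2 ^ n := by positivity
    rw [(hcov k).2, (hcurv k).2, (htr k).2, (hpe k).2]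
    have h4 := mul_le_mul_of_nonneg_left hloc hpos.le
    simp only [one_add_one_eq_two, pow_one]
    linarith
  refine (sum_le_sum h3).trans (le_of_eq ?_)
  rw [sum_sub_distrib, ← mul_sum, ← mul_sum, h1, h2, mul_zero, mul_zero, sub_zero]

end

end Patches

/-! ### The weak derivative of the Hermitian ratio -/

section Limits

variable {n : ℕ}

theorem tendsto_integral_norm_of_sq_bound {α : Type*} [MeasurableSpace α] {μ : Measure α}
    [IsFiniteMeasure μ] {d : ℕ → α → ℂ} (hd : ∀ m, MemLp (d m) 2 μ) {L : ℝ}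
    (hL : ∀ m, ∫ x, ‖d m x‖ ^ 2 ∂μ ≤ L) (hlim : ∀ᵐ x ∂μ, Tendsto (fun m => d m x) atTop (nhds 0)) :
    Tendsto (fun m => ∫ x, ‖d m x‖ ∂μ) atTop (nhds 0) := by
  have hsq : ∀ m, Integrable (fun x => ‖d m x‖ ^ 2) μ := fun m => (hd m).integrable_norm_pow (by simp)
  have hL0 : 0 ≤ L := (integral_nonneg fun x => sq_nonneg ‖d 0 x‖).trans (hL 0)
  have hy : ∀ m x, ‖(‖d m x‖ / (1 + ‖d m x‖)) ^ 2‖ ≤ 1 := fun m x => by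
    rw [norm_of_nonneg (by positivity)]
    exact pow_le_one₀ (by positivity) (div_le_one_of_le₀ (by linarith) (by positivity))
  have hym : ∀ m, AEStronglyMeasurable (fun x => (‖d m x‖ / (1 + ‖d m x‖)) ^ 2) μ := fun m =>
    (((hd m).1.norm.aemeasurable.div (aemeasurable_const.add (hd m).1.norm.aemeasurable)).pow_const
      2).aestronglyMeasurable
  have hb : Tendsto (fun m => ∫ x, (‖d m x‖ / (1 + ‖d m x‖)) ^ 2 ∂μ) atTop (nhds 0) := by
    have h1 : Tendsto (fun m => ∫ x, (‖d m x‖ / (1 + ‖d m x‖)) ^ 2 ∂μ) atTop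
        (nhds (∫ _, (0 : ℝ) ∂μ)) := by
      refine tendsto_integral_of_dominated_convergence (fun _ => 1) hym (integrable_const _)
        (fun m => .of_forall (hy m)) ?_
      filter_upwards [hlim] with x hx
      have h2 := hx.norm
      rw [norm_zero] at h2
      have h3 := (h2.div (tendsto_const_nhds.add h2) (a := 0) (b := 1 + 0) (by norm_num)).pow 2
      simpa using h3
    simpa using h1
  refine tendsto_zero_of_forall_le (F := 2 * μ.real Set.univ + 2 * L)
    (fun m => integral_nonneg fun x => norm_nonneg _) (by positivity) hb fun δ hδ m => ?_
  have hyi : Integrable (fun x => (‖d m x‖ / (1 + ‖d m x‖)) ^ 2) μ :=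
    (integrable_const (1 : ℝ)).mono' (hym m) (.of_forall (hy m))
  have hxi : Integrable (fun x => 2 + 2 * ‖d m x‖ ^ 2) μ :=
    (integrable_const _).add ((hsq m).const_mul 2)
  calc ∫ x, ‖d m x‖ ∂μ
      ≤ ∫ x, (δ * (2 + 2 * ‖d m x‖ ^ 2) + (4 * δ)⁻¹ * (‖d m x‖ / (1 + ‖d m x‖)) ^ 2) ∂μ := by
        refine integral_mono ((hd m).integrable (by simp)).norm
          ((hxi.const_mul δ).add (hyi.const_mul _)) fun x => ?_
        set t := ‖d m x‖
        have ht : 0 ≤ t := norm_nonneg _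
        have h1 : t = (1 + t) * (t / (1 + t)) := by field_simp
        have h2 : 0 ≤ (2 * δ * (1 + t) - t / (1 + t)) ^ 2 / (4 * δ) := by positivity
        have h3 : (2 * δ * (1 + t) - t / (1 + t)) ^ 2 / (4 * δ)
            = δ * (1 + t) ^ 2 + (4 * δ)⁻¹ * (t / (1 + t)) ^ 2 - (1 + t) * (t / (1 + t)) := by
          field_simp
          ring
        dsimp only
        nlinarith [mul_nonneg hδ.le (sq_nonneg (1 - t))]
    _ = δ * (2 * μ.real Set.univ + 2 * ∫ x, ‖d m x‖ ^ 2 ∂μ)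
        + (4 * δ)⁻¹ * ∫ x, (‖d m x‖ / (1 + ‖d m x‖)) ^ 2 ∂μ := by
        rw [integral_add (hxi.const_mul δ) (hyi.const_mul _), integral_const_mul, integral_const_mul,
          integral_add (integrable_const _) ((hsq m).const_mul 2), integral_const_mul, integral_const,
          smul_eq_mul, mul_comm (μ.real Set.univ)]
    _ ≤ _ := by
        rw [div_eq_inv_mul]
        gcongr
        exact hL m

/-- Bounded measurable functions that vanish off `S`. -/
structure IsBddOn (κ : Cn n → ℂ) (S : Set (Cn n)) : Prop where
  meas : AEStronglyMeasurable κ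
  bound : ∃ B, ∀ w, ‖κ w‖ ≤ B
  zero : ∀ w ∉ S, κ w = 0

variable {S : Set (Cn n)} {κ : Cn n → ℂ}

theorem IsBddOn.memLp (h : IsBddOn κ S) (hS : IsCompact S) (q : ENNReal) : MemLp κ q := by
  obtain ⟨B, hB⟩ := h.bound
  have h1 : MemLp κ q (volume.restrict S) := by
    have : IsFiniteMeasure ((volume : Measure (Cn n)).restrict S) :=
      isFiniteMeasure_restrict.2 hS.measure_lt_top.ne
    exact .of_bound h.meas.restrict B (.of_forall hB)
  have h2 := (memLp_indicator_iff_restrict hS.isClosed.measurableSet).2 h1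
  rwa [Set.indicator_eq_self.2 (Function.support_subset_iff'.2 h.zero)] at h2

theorem IsBddOn.integrable (h : IsBddOn κ S) (hS : IsCompact S) : Integrable κ :=
  memLp_one_iff_integrable.1 (h.memLp hS 1)

theorem IsBddOn.mul (h : IsBddOn κ S) (hS : IsCompact S) {F : Cn n → ℂ} (hF : ContinuousOn F S) :
    IsBddOn (fun w => F w * κ w) S := by
  obtain ⟨B, hB⟩ := h.bound
  obtain ⟨A, hA⟩ := hS.exists_bound_of_continuousOn hF
  have h0 : ∀ w ∉ S, F w * κ w = 0 := fun w hw => by rw [h.zero w hw, mul_zero]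
  refine ⟨?_, ⟨max A 0 * B, fun w => ?_⟩, h0⟩
  · have h1 := (hF.aestronglyMeasurable hS.isClosed.measurableSet (μ := volume)).mul h.meas.restrict
    have h2 : AEStronglyMeasurable (S.indicator fun w => F w * κ w) :=
      (aestronglyMeasurable_indicator_iff hS.isClosed.measurableSet).2 h1
    rwa [Set.indicator_eq_self.2 (Function.support_subset_iff'.2 h0)] at h2
  · by_cases hw : w ∈ S
    · rw [norm_mul]
      exact mul_le_mul ((hA w hw).trans (le_max_left _ _)) (hB w) (norm_nonneg _) (le_max_right _ _)
    · rw [h0 w hw, norm_zero]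
      exact mul_nonneg (le_max_right _ _) ((norm_nonneg _).trans (hB 0))

variable {z₀ : Cn n} {r C K : ℝ} {u : Cn n → ℝ} {U : ℕ → Cn n → ℝ} {G : Fin n → Cn n → ℂ}

theorem IsRegularization.tendsto_integral (hreg : IsRegularization u U G z₀ r C K)
    (hκ : Integrable κ) :
    Tendsto (fun m => ∫ w, (U m w : ℂ) * κ w) atTop (nhds (∫ w, (u w : ℂ) * κ w)) :=
  tendsto_integral_mul hκ
    (fun m => continuous_ofReal.comp (hreg.smooth m).continuous)
    (fun m w => by rw [norm_real, norm_of_nonneg (hreg.nonneg m w)]; exact hreg.le m w)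
    (hreg.tendsto.mono fun w hw => (continuous_ofReal.tendsto _).comp hw)

theorem IsRegularization.tendsto_integral_wd (hreg : IsRegularization u U G z₀ r C K)
    (hκ : IsBddOn κ S) (hs : S ⊆ ball z₀ r) (i : Fin n) :
    Tendsto (fun m => ∫ w, wd i (fun y => (U m y : ℂ)) w * κ w) atTop (nhds (∫ w, G i w * κ w)) := by
  set μ := (volume : Measure (Cn n)).restrict (ball z₀ r) with hμ
  have : IsFiniteMeasure μ := isFiniteMeasure_restrict.2 Metric.isBounded_ball.measure_lt_top.ne
  obtain ⟨B, hB⟩ := hκ.bound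
  have hG : MemLp (G i) 2 μ := (hreg.memLp i).restrict _
  have hm := fun m => memLp_wd_ofReal (hreg.smooth m) i z₀ r
  have hd := fun m => (hm m).sub hG
  have hL : ∀ m, ∫ x, ‖(wd i (fun y => (U m y : ℂ)) - G i) x‖ ^ 2 ∂μ
      ≤ 2 * K + 2 * ∫ x, ‖G i x‖ ^ 2 ∂μ := fun m => by
    have h1 := (hm m).integrable_norm_pow (p := 2) (by simp)
    have h2 := hG.integrable_norm_pow (p := 2) (by simp)
    calc _ ≤ ∫ x, (2 * ‖wd i (fun y => (U m y : ℂ)) x‖ ^ 2 + 2 * ‖G i x‖ ^ 2) ∂μ := by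
          refine integral_mono ((hd m).integrable_norm_pow (p := 2) (by simp))
            ((h1.const_mul 2).add (h2.const_mul 2)) fun x => ?_
          have h3 := norm_sub_le (wd i (fun y => (U m y : ℂ)) x) (G i x)
          have h4 := pow_le_pow_left₀ (norm_nonneg _) h3 2
          dsimp only [Pi.sub_apply]
          nlinarith [sq_nonneg (‖wd i (fun y => (U m y : ℂ)) x‖ - ‖G i x‖)]
      _ = 2 * (∫ x, ‖wd i (fun y => (U m y : ℂ)) x‖ ^ 2 ∂μ) + 2 * ∫ x, ‖G i x‖ ^ 2 ∂μ := by
          rw [integral_add (h1.const_mul 2) (h2.const_mul 2), integral_const_mul, integral_const_mul]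
      _ ≤ _ := by
          have := hreg.bound i m
          linarith
  have hlim := tendsto_integral_norm_of_sq_bound hd hL (by
    filter_upwards [hreg.tendsto_wd i] with w hw
    simpa using hw.sub_const (G i w))
  have hset : ∀ F : Cn n → ℂ, ∫ w, F w * κ w = ∫ w, F w * κ w ∂μ := fun F =>
    (setIntegral_eq_integral_of_forall_compl_eq_zero fun w hw => by
      rw [hκ.zero w fun h => hw (hs h), mul_zero]).symm
  simp only [hset]
  have hκ2 := hκ.meas.restrict (s := ball z₀ r)
  rw [tendsto_iff_norm_sub_tendsto_zero]
  refine squeeze_zero (fun _ => norm_nonneg _) (fun m => ?_) (by simpa using hlim.const_mul B)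
  have hi : ∀ F : Cn n → ℂ, MemLp F 2 μ → Integrable (fun w => F w * κ w) μ := fun F hF =>
    (hF.integrable (by simp)).mul_bdd (c := B) hκ2 (.of_forall hB)
  rw [← integral_sub (hi _ (hm m)) (hi _ hG), ← integral_const_mul]
  refine norm_integral_le_of_norm_le (((hd m).integrable (by simp)).norm.const_mul B)
    (.of_forall fun w => ?_)
  rw [← sub_mul, norm_mul, mul_comm]
  exact mul_le_mul_of_nonneg_right (hB w) (norm_nonneg _)

end Limits

section Transfer

variable {n : ℕ} {X : Type*} [TopologicalSpace X] [ChartedSpace (Cn n) X]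
  {χ χ' : OpenPartialHomeomorph X (Cn n)} {g : HermitianMetric n X} [IsManifold 𝓘(ℂ, Cn n) ω X]
  [MeasurableSpace X] [BorelSpace X] {T : Set (Cn n)} {Q : Cn n → ℂ}

theorem exists_transfer (hg : g.IsKahler) (hχ : χ ∈ atlas (Cn n) X) (hχ' : χ' ∈ atlas (Cn n) X)
    (hT : IsCompact T) (hTs : ∀ z ∈ T, z ∈ χ.target ∧ χ.symm z ∈ χ'.source) (hQ : Continuous Q)
    (hQ0 : ∀ z ∉ T, Q z = 0) :
    ∃ κ : Cn n → ℂ, IsBddOn κ (trans χ χ' '' T) ∧ ∀ q : Cn n → ℂ,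
      (Integrable (fun w => q w * κ w) → Integrable fun z => q (trans χ χ' z) * Q z) ∧
      ∫ z, q (trans χ χ' z) * Q z = ∫ w, q w * κ w := by
  set H : X → ℂ := extX χ fun z => (dens g χ z)⁻¹ • Q z with hH
  have hH0 : ∀ x ∉ χ.source, H x = 0 := fun x hx => extX_of_notMem _ hx
  have hHt : ∀ z ∈ χ.target, dens g χ z • H (χ.symm z) = Q z := fun z hz => by
    rw [hH, extX_symm _ hz, smul_inv_smul₀ (dens_pos hg hχ hz).ne']
  have hH0' : ∀ x ∉ χ'.source, H x = 0 := fun x hx => by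
    by_cases hxs : x ∈ χ.source
    · rw [hH, extX_of_mem _ hxs, hQ0 _ fun h => ?_, smul_zero]
      have := (hTs _ h).2
      rw [χ.left_inv hxs] at this
      exact hx this
    · exact hH0 x hxs
  set κ : Cn n → ℂ := χ'.target.indicator fun w => dens g χ' w • H (χ'.symm w) with hκ
  have hm := χ.open_target.measurableSet
  have hm' := χ'.open_target.measurableSet
  have key : ∀ q : Cn n → ℂ,
      (Integrable (fun z => q (trans χ χ' z) * Q z) ↔ Integrable fun w => q w * κ w) ∧
      ∫ z, q (trans χ χ' z) * Q z = ∫ w, q w * κ w := fun q => by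
    have e1 : Set.EqOn (fun z => dens g χ z • (q (χ' (χ.symm z)) * H (χ.symm z)))
        (fun z => q (trans χ χ' z) * Q z) χ.target := fun z hz => by
      dsimp only
      rw [← mul_smul_comm, hHt z hz]
      rfl
    have e2 : (fun w => q w * κ w)
        = χ'.target.indicator fun w => dens g χ' w • (q (χ' (χ'.symm w)) * H (χ'.symm w)) := by
      funext w
      by_cases hw : w ∈ χ'.target
      · rw [hκ, Set.indicator_of_mem hw, Set.indicator_of_mem hw, ← mul_smul_comm, χ'.right_inv hw]
      · rw [hκ, Set.indicator_of_notMem hw, Set.indicator_of_notMem hw, mul_zero]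
    have s1 : ∀ x ∉ χ.source, q (χ' x) * H x = 0 := fun x hx => by rw [hH0 x hx, mul_zero]
    have s2 : ∀ x ∉ χ'.source, q (χ' x) * H x = 0 := fun x hx => by rw [hH0' x hx, mul_zero]
    have s3 : ∀ z ∉ χ.target, q (trans χ χ' z) * Q z = 0 := fun z hz => by
      rw [hQ0 z fun h => hz (hTs z h).1, mul_zero]
    constructor
    · rw [e2, integrable_indicator_iff hm', ← integrable_iff_chart hg hχ' s2,
        integrable_iff_chart hg hχ s1, integrableOn_congr_fun e1 hm,
        integrableOn_iff_integrable_of_support_subset (Function.support_subset_iff'.2 s3)]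
    · rw [e2, integral_indicator hm', ← integral_eq_chart hg hχ' s2, integral_eq_chart hg hχ s1,
        setIntegral_congr_fun hm e1, setIntegral_eq_integral_of_forall_compl_eq_zero s3]
  have hcont : ContinuousOn (fun z => dens g χ' (trans χ χ' z) * (dens g χ z)⁻¹ * ‖Q z‖) T := by
    refine ContinuousOn.mul (ContinuousOn.mul ?_ ?_) hQ.norm.continuousOn
    · exact (continuousOn_dens hg hχ').comp (fun z hz => (contDiffAt_trans hχ hχ' (hTs z hz).1
        (hTs z hz).2).continuousAt.continuousWithinAt) fun z hz => trans_mem (hTs z hz).2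
    · exact ((continuousOn_dens hg hχ).mono fun z hz => (hTs z hz).1).inv₀ fun z hz =>
        (dens_pos hg hχ (hTs z hz).1).ne'
  obtain ⟨B, hB⟩ := hT.exists_bound_of_continuousOn hcont
  have hback : ∀ w, κ w ≠ 0 → ∃ z ∈ T, trans χ χ' z = w := fun w hw => by
    have h1 : w ∈ χ'.target := Set.mem_of_indicator_ne_zero hw
    rw [hκ, Set.indicator_of_mem h1] at hw
    have h2 : χ'.symm w ∈ χ.source := by_contra fun h => hw (by rw [hH0 _ h, smul_zero])
    refine ⟨trans χ' χ w, by_contra fun h => hw ?_, trans_trans h1 h2⟩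
    rw [hH, extX_of_mem _ h2, show Q (χ (χ'.symm w)) = 0 from hQ0 _ h, smul_zero, smul_zero]
  refine ⟨κ, ⟨?_, ⟨max B 0, fun w => ?_⟩, fun w hw => by_contra fun h => ?_⟩,
    fun q => ⟨(key q).1.2, (key q).2⟩⟩
  · have h1 : Integrable Q := hQ.integrable_of_hasCompactSupport (.intro hT hQ0)
    have h2 := (key fun _ => 1).1.1 (by simpa using h1)
    simpa using h2.aestronglyMeasurable
  · by_cases hw : κ w = 0
    · rw [hw, norm_zero]
      exact le_max_right _ _
    · obtain ⟨z, hz, rfl⟩ := hback w hw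
      refine le_max_of_le_left (le_trans (le_of_eq ?_) ((le_abs_self _).trans (hB z hz)))
      have h3 := trans_mem (hTs z hz).2 (z := z)
      rw [hκ, Set.indicator_of_mem h3, symm_trans (hTs z hz).2, hH, extX_symm _ (hTs z hz).1,
        norm_smul, norm_smul, norm_of_nonneg (dens_pos hg hχ' h3).le,
        norm_of_nonneg (inv_nonneg.2 (dens_pos hg hχ (hTs z hz).1).le), mul_assoc]
  · obtain ⟨z, hz, rfl⟩ := hback w h
    exact hw ⟨z, hz, rfl⟩

end Transfer

section WeakDerivative

variable {n p : ℕ} {X Y : Type*} [TopologicalSpace X] [ChartedSpace (Cn n) X]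
  [TopologicalSpace Y] [ChartedSpace (Cn p) Y] {f : MeromorphicMap n p X Y} {ι : Type*}
  {g : HermitianMetric n X} {h : PseudoEffectiveMetric f.reflexivePullback ι}
  [IsManifold 𝓘(ℂ, Cn n) ω X] [T2Space X] {χ χ' : OpenPartialHomeomorph X (Cn n)}
  {b : Cn n → ℝ} {Θ : Cn n → ℂ} {Ω : Set (Cn n)}

theorem IsTest.mul_ext (hb : IsTest (fun z => (b z : ℂ)) Ω) (hΩ : Ω ⊆ χ'.target)
    (hχ : χ ∈ atlas (Cn n) X) (hχ' : χ' ∈ atlas (Cn n) X) (hΘ : IsTest Θ χ.target) :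
    IsTest (fun z => ((extX χ' b (χ.symm z) : ℝ) : ℂ) * Θ z)
      {z | z ∈ χ.target ∧ χ.symm z ∈ χ'.source ∧ trans χ χ' z ∈ Ω} := by
  have h1 := hΘ.mul (F := fun z => ((extX χ' b (χ.symm z) : ℝ) : ℂ)) fun z hz =>
    Sm.ofReal (hb.smX hΩ hχ' χ hχ z hz)
  refine ⟨h1.smooth, h1.compact, fun z hz => ⟨h1.subset hz, ?_⟩⟩
  by_contra hc
  have h2 := hb.extX_eventually_zero hΩ (x := χ.symm z) fun hs hm => hc ⟨hs, hb.subset hm⟩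
  refine notMem_tsupport_iff_eventuallyEq.2 ?_ hz
  filter_upwards [(χ.symm.continuousAt (h1.subset hz)).eventually h2] with y hy
  simp [hy]

theorem wd_eq_zero_of_notMem_tsupport (i : Fin n) {z : Cn n} (hz : z ∉ tsupport Θ) :
    wd i Θ z = 0 := by
  rw [wd_eq_dz]
  exact image_eq_zero_of_notMem_tsupport fun h => hz (tsupport_wirt_subset h)

variable [MeasurableSpace X] [BorelSpace X] [T2Space Y]

theorem Patch.weak (hg : g.IsKahler) (P : Patch h) (hb : IsTest (fun z => (b z : ℂ)) P.ball)
    (hχ : χ ∈ atlas (Cn n) X) (hΘ : IsTest Θ χ.target) :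
    Integrable (fun z => (hermitianRatio g h (χ.symm z) : ℂ)
        * (((extX P.χ b (χ.symm z) : ℝ) : ℂ) * Θ z)) ∧ ∀ i,
    Integrable (fun z => (hermitianRatio g h (χ.symm z) : ℂ)
        * wd i (fun y => ((extX P.χ b (χ.symm y) : ℝ) : ℂ) * Θ y) z) ∧
    Integrable (fun z => P.cov g (χ.symm z) (coordVec χ (χ.symm z) i)
        * (((extX P.χ b (χ.symm z) : ℝ) : ℂ) * Θ z)) ∧
    ∫ z, (hermitianRatio g h (χ.symm z) : ℂ)
        * wd i (fun y => ((extX P.χ b (χ.symm y) : ℝ) : ℂ) * Θ y) z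
      = -∫ z, P.cov g (χ.symm z) (coordVec χ (χ.symm z) i)
        * (((extX P.χ b (χ.symm z) : ℝ) : ℂ) * Θ z) := by
  have hK := P.isKahlerOn hg
  have hη := P.isDecompOn hg
  set N : Cn n → ℝ := nrm (gX g P.χ) (eX P.χ (h.η P.α)) with hN
  have hNs : ∀ w ∈ P.ball, ContDiffAt ℝ ∞ N w := fun w hw => hη.smOn_nrm hK hw
  set τ := trans χ P.χ with hτ
  have hΘ' := hb.mul_ext P.ball_subset hχ P.mem_atlas hΘ
  set Θ' : Cn n → ℂ := fun z => ((extX P.χ b (χ.symm z) : ℝ) : ℂ) * Θ z with hΘ'_def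
  set O : Set (Cn n) := {z | z ∈ χ.target ∧ χ.symm z ∈ P.χ.source ∧ τ z ∈ P.ball} with hO
  set T := tsupport Θ' with hTdef
  have hT : IsCompact T := hΘ'.compact
  have hTO : T ⊆ O := hΘ'.subset
  have hτs : ∀ z ∈ O, ContDiffAt ℂ ω τ z := fun z hz => contDiffAt_trans hχ P.mem_atlas hz.1 hz.2.1
  set S := τ '' T
  have hS : IsCompact S := hT.image_of_continuousOn fun z hz =>
    (hτs z (hTO hz)).continuousAt.continuousWithinAt
  have hSb : S ⊆ P.ball := by
    rintro _ ⟨z, hz, rfl⟩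
    exact (hTO hz).2.2
  have htr : ∀ Q : Cn n → ℂ, Continuous Q → (∀ z ∉ T, Q z = 0) → ∃ κ : Cn n → ℂ, IsBddOn κ S ∧
      ∀ q : Cn n → ℂ, (Integrable (fun w => q w * κ w) → Integrable fun z => q (τ z) * Q z) ∧
        ∫ z, q (τ z) * Q z = ∫ w, q w * κ w := fun Q hQ hQ0 =>
    exists_transfer hg hχ P.mem_atlas hT (fun z hz => ⟨(hTO hz).1, (hTO hz).2.1⟩) hQ hQ0
  have hNc : ContinuousOn (fun w => (N w : ℂ)) S := fun w hw =>
    (Sm.ofReal (hNs w (hSb hw))).continuousAt.continuousWithinAt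
  have hratio : ∀ Q : Cn n → ℂ, (∀ z ∉ T, Q z = 0) →
      (fun z => (hermitianRatio g h (χ.symm z) : ℂ) * Q z)
        = fun z => ((P.u (τ z) : ℂ) * N (τ z)) * Q z := by
    intro Q hQ
    funext z
    by_cases hz : z ∈ T
    · have h1 := P.ratio_symm hg (hTO hz).2.2
      rw [hτ, symm_trans (hTO hz).2.1] at h1
      rw [h1, ofReal_mul]
    · rw [hQ z hz, mul_zero, mul_zero]
  have hint : ∀ κ : Cn n → ℂ, IsBddOn κ S → Integrable fun w => ((P.u w : ℂ) * N w) * κ w := by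
    intro κ hκ
    simp only [mul_assoc]
    refine ((hκ.mul hS hNc).integrable hS).bdd_mul (c := P.C)
      (Complex.measurable_ofReal.comp P.measurable).aestronglyMeasurable (.of_forall fun w => ?_)
    rw [norm_real, norm_of_nonneg (P.nonneg w)]
    exact P.le w
  -- the three test functions
  have hΘ0 : ∀ z ∉ T, Θ' z = 0 := fun z hz => image_eq_zero_of_notMem_tsupport hz
  obtain ⟨κ', hκ', ht'⟩ := htr Θ' hΘ'.continuous hΘ0
  refine ⟨?_, fun i => ?_⟩
  · rw [hratio _ hΘ0]
    exact (ht' fun w => (P.u w : ℂ) * N w).1 (hint _ hκ')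
  obtain ⟨κ, hκ, ht⟩ := htr (wd i Θ') (hΘ'.wd i).continuous fun z hz => wd_eq_zero_of_notMem_tsupport i hz
  have hQ : ∀ j, IsTest (fun z => fderiv ℂ τ z (Pi.single i 1) j * Θ' z) O := fun j =>
    hΘ'.mul fun z hz => sm_of_holo (contDiffAt_pi.1
      (((hτs z hz).fderiv_right (m := ω) (by simp)).clm_apply contDiffAt_const) j)
  choose κj hκj htj using fun j => htr _ (hQ j).continuous fun z hz => by rw [hΘ0 z hz, mul_zero]
  set Γ := gradLim (gX g P.χ) (eX P.χ (h.η P.α)) P.u P.G with hΓ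
  have hNw : ∀ j, ContinuousOn (wd j fun w => (N w : ℂ)) S := fun j => by
    rw [show (wd j fun w => (N w : ℂ)) = dz (Pi.single j 1) fun w => (N w : ℂ) from
      funext fun y => wd_eq_dz j _ y]
    exact fun w hw => ((Sm.ofReal (hNs w (hSb hw))).wirt _ _).continuousAt.continuousWithinAt
  have hΓe : ∀ j (u : Cn n → ℝ) (G : Fin n → Cn n → ℂ), (fun w => gradLim (gX g P.χ) (eX P.χ (h.η P.α)) u G j w * κj j w)
      = fun w => G j w * (N w * κj j w) + u w * (wd j (fun y => (N y : ℂ)) w * κj j w) := fun j u G => by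
    funext w
    rw [gradLim]
    ring
  have hA := fun j => (hκj j).mul hS hNc
  have hB := fun j => (hκj j).mul hS (hNw j)
  have hi1 : ∀ j, Integrable fun w => P.G j w * (N w * κj j w) := fun j =>
    (P.reg.memLp j).integrable_mul ((hA j).memLp hS 2)
  have hi2 : ∀ j, Integrable fun w => (P.u w : ℂ) * (wd j (fun y => (N y : ℂ)) w * κj j w) := fun j => by
    refine ((hB j).integrable hS).bdd_mul (c := P.C)
      (Complex.measurable_ofReal.comp P.measurable).aestronglyMeasurable (.of_forall fun w => ?_)
    rw [norm_real, norm_of_nonneg (P.nonneg w)]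
    exact P.le w
  have hΓi : ∀ j, Integrable fun w => Γ j w * κj j w := fun j => by
    rw [hΓ, hΓe]
    exact (hi1 j).add (hi2 j)
  have hcov : (fun z => P.cov g (χ.symm z) (coordVec χ (χ.symm z) i) * Θ' z)
      = fun z => ∑ j, Γ j (τ z) * (fderiv ℂ τ z (Pi.single i 1) j * Θ' z) := by
    funext z
    by_cases hz : z ∈ T
    · rw [P.cov_apply, coordVec_eq, coord_vec_trans hχ P.mem_atlas (hTO hz).1 (hTO hz).2.1,
        sum_mul]
      simp only [stdB, Pi.basisFun_apply, mul_assoc]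
      rfl
    · simp only [hΘ0 z hz, mul_zero, sum_const_zero]
  refine ⟨?_, ?_, ?_⟩
  · rw [hratio _ fun z hz => wd_eq_zero_of_notMem_tsupport i hz]
    exact (ht fun w => (P.u w : ℂ) * N w).1 (hint _ hκ)
  · rw [hcov]
    exact integrable_finsetSum _ fun j _ => (htj j _).1 (hΓi j)
  rw [hratio _ fun z hz => wd_eq_zero_of_notMem_tsupport i hz, (ht fun w => (P.u w : ℂ) * N w).2, hcov,
    integral_finsetSum _ fun j _ => (htj j _).1 (hΓi j)]
  simp only [(htj _ _).2]
  -- integration by parts for the regularizations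
  have hparts : ∀ m, ∫ w, (P.U m w : ℂ) * (N w * κ w)
      = -∑ j, ∫ w, gradLim (gX g P.χ) (eX P.χ (h.η P.α)) (P.U m)
          (fun i z => wd i (fun x => (P.U m x : ℂ)) z) j w * κj j w := by
    intro m
    set ψ : Cn n → ℂ := fun w => ((P.U m w * N w : ℝ) : ℂ) with hψ
    have hψs : ∀ w ∈ P.ball, Sm ψ w := fun w hw =>
      Sm.ofReal ((P.reg.smooth m).contDiffAt.mul (hNs w hw))
    have hτr : ∀ z ∈ O, ContDiffAt ℝ ∞ τ z := fun z hz => ((hτs z hz).restrict_scalars ℝ).of_le le_top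
    have hψτ : SmOn (fun z => ψ (τ z)) O := fun z hz => (hψs _ hz.2.2).comp z (hτr z hz)
    have h1 := integral_mul_wirt (e := -I) (v := Pi.single i 1) hΘ' hψτ
    have h2 : ∀ j, ∀ z ∈ O, wd j ψ (τ z) = gradLim (gX g P.χ) (eX P.χ (h.η P.α)) (P.U m)
          (fun i z => wd i (fun x => (P.U m x : ℂ)) z) j (τ z) := fun j z hz =>
      wd_ratio hK hη hz.2.2 (P.reg.smooth m).contDiffAt j
    have h3 : (fun z => dz (Pi.single i 1) (fun z => ψ (τ z)) z * Θ' z)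
        = fun z => ∑ j, wd j ψ (τ z) * (fderiv ℂ τ z (Pi.single i 1) j * Θ' z) := by
      funext z
      by_cases hz : z ∈ T
      · have hzO := hTO hz
        rw [wirt_comp ((hτs z hzO).differentiableAt (by simp)) (hψs _ hzO.2.2).diff, dz_eq_sum,
          sum_mul]
        exact sum_ext fun j => by ring
      · simp only [hΘ0 z hz, mul_zero, sum_const_zero]
    have h4 : ∀ j, Integrable fun z => wd j ψ (τ z) * (fderiv ℂ τ z (Pi.single i 1) j * Θ' z) := fun j =>
      ((hQ j).mul (F := fun z => wd j ψ (τ z)) fun z hz => by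
        simp only [wd_eq_dz]
        exact ((hψs _ hz.2.2).wirt _ _).comp z (hτr z hz)).integrable
    rw [h3, integral_finsetSum _ fun j _ => h4 j] at h1
    calc ∫ w, (P.U m w : ℂ) * (N w * κ w) = ∫ w, ψ w * κ w := by
          simp only [hψ, ofReal_mul, mul_assoc]
      _ = ∫ z, ψ (τ z) * wd i Θ' z := ((ht ψ).2).symm
      _ = -∑ j, ∫ z, wd j ψ (τ z) * (fderiv ℂ τ z (Pi.single i 1) j * Θ' z) := by
          simpa only [wd_eq_dz] using h1
      _ = _ := by
          congr 1
          refine sum_ext fun j => ?_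
          rw [← (htj j _).2]
          refine integral_congr_ae (.of_forall fun z => ?_)
          by_cases hz : z ∈ T
          · simp only [h2 j z (hTO hz)]
          · simp only [hΘ0 z hz, mul_zero]
  have hl1 := P.reg.tendsto_integral ((hκ.mul hS hNc).integrable hS)
  have hl2 : ∀ j, Tendsto (fun m => ∫ w, gradLim (gX g P.χ) (eX P.χ (h.η P.α)) (P.U m)
      (fun i z => wd i (fun x => (P.U m x : ℂ)) z) j w * κj j w) atTop
      (nhds (∫ w, Γ j w * κj j w)) := fun j => by
    rw [hΓ, hΓe, integral_add (hi1 j) (hi2 j)]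
    have h1 := (P.reg.tendsto_integral_wd (hA j) hSb j).add
      (P.reg.tendsto_integral ((hB j).integrable hS))
    refine h1.congr fun m => ?_
    have hc : ContinuousOn (fun w => (P.U m w : ℂ)) S :=
      (continuous_ofReal.comp (P.reg.smooth m).continuous).continuousOn
    rw [hΓe, integral_add (((hA j).mul hS (continuous_wd_ofReal (P.reg.smooth m) j).continuousOn).integrable hS)
      (((hB j).mul hS hc).integrable hS)]
  have h5 := tendsto_nhds_unique hl1 (by
    simp only [hparts]
    exact (tendsto_finsetSum _ fun j _ => hl2 j).neg)
  simpa only [mul_assoc] using h5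

end WeakDerivative

section Gluing

theorem locallyIntegrableOn_of_test {n : ℕ} {Ω : Set (Cn n)} {F : Cn n → ℂ} (hΩ : IsOpen Ω)
    (h : ∀ Θ, IsTest Θ Ω → Integrable fun z => F z * Θ z) : LocallyIntegrableOn F Ω := by
  intro z hz
  obtain ⟨r, hr, hrs⟩ := Metric.isOpen_iff.1 hΩ z hz
  obtain ⟨b, hb, -, hb1⟩ := exists_cutoff hr (isCompact_closedBall z (r / 2))
    (closedBall_subset_ball (by linarith))
  refine ⟨closedBall z (r / 2), mem_nhdsWithin_of_mem_nhds
    (Metric.closedBall_mem_nhds z (by positivity)), ?_⟩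
  refine (h _ (hb.mono hrs)).integrableOn.congr_fun (fun y hy => ?_)
    Metric.isClosed_closedBall.measurableSet
  simp [hb1 y hy]

variable {n p : ℕ} {X Y : Type*} [TopologicalSpace X] [ChartedSpace (Cn n) X]
  [TopologicalSpace Y] [ChartedSpace (Cn p) Y] {f : MeromorphicMap n p X Y} {ι : Type*}
  {g : HermitianMetric n X} {h : PseudoEffectiveMetric f.reflexivePullback ι}
  [IsManifold 𝓘(ℂ, Cn n) ω X] [T2Space X] [T2Space Y] [MeasurableSpace X] [BorelSpace X]
  {s : Finset X} {P : X → Patch h} {θ : X → Cn n → ℝ}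

theorem isWeakDel_gradX (hg : g.IsKahler)
    (hθ : ∀ k, IsTest (fun z => (θ k z : ℂ)) (P k).ball)
    (hθ1 : ∀ x, ∑ k ∈ s, extX (P k).χ (θ k) x = 1) :
    IsWeakDel n (hermitianRatio g h) (gradX g s P θ) := by
  intro χ hχ
  have hw := fun k (Θ : Cn n → ℂ) (hΘ : IsTest Θ χ.target) => (P k).weak hg (hθ k) hχ hΘ
  have h1 : ∀ (x : X) (a : ℂ), ∑ k ∈ s, ((extX (P k).χ (θ k) x : ℝ) : ℂ) * a = a := fun x a => by
    rw [← sum_mul, ← ofReal_sum, hθ1, Complex.ofReal_one, one_mul]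
  have hG : ∀ (i : Fin n) (Θ : Cn n → ℂ), (fun z => gradX g s P θ (χ.symm z)
      (coordVec χ (χ.symm z) i) * Θ z) = fun z => ∑ k ∈ s, (P k).cov g (χ.symm z)
        (coordVec χ (χ.symm z) i) * (((extX (P k).χ (θ k) (χ.symm z) : ℝ) : ℂ) * Θ z) := fun i Θ => by
    funext z
    simp only [gradX, LinearMap.sum_apply, LinearMap.smul_apply, smul_eq_mul, sum_mul]
    exact sum_ext fun k => by ring
  refine ⟨?_, fun i => ⟨locallyIntegrableOn_of_test χ.open_target fun Θ hΘ => ?_,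
    fun Θ hΘ1 hΘ2 hΘ3 => ?_⟩⟩
  · have h2 : LocallyIntegrableOn (fun z => (hermitianRatio g h (χ.symm z) : ℂ)) χ.target :=
      locallyIntegrableOn_of_test χ.open_target fun Θ hΘ => by
        have h3 : (fun z => (hermitianRatio g h (χ.symm z) : ℂ) * Θ z) = fun z => ∑ k ∈ s,
            (hermitianRatio g h (χ.symm z) : ℂ)
              * (((extX (P k).χ (θ k) (χ.symm z) : ℝ) : ℂ) * Θ z) := by
          funext z
          rw [← mul_sum, h1]
        rw [h3]
        exact integrable_finsetSum _ fun k _ => (hw k Θ hΘ).1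
    intro z hz
    obtain ⟨V, hV, hVi⟩ := h2 z hz
    exact ⟨V, hV, hVi.re⟩
  · rw [hG]
    exact integrable_finsetSum _ fun k _ => ((hw k Θ hΘ).2 i).2.1
  · have hΘ : IsTest Θ χ.target := ⟨hΘ1, hΘ2, hΘ3⟩
    have h3 : (fun z => (hermitianRatio g h (χ.symm z) : ℂ) * wd i Θ z) = fun z => ∑ k ∈ s,
        (hermitianRatio g h (χ.symm z) : ℂ)
          * wd i (fun y => ((extX (P k).χ (θ k) (χ.symm y) : ℝ) : ℂ) * Θ y) z := by
      funext z
      rw [← mul_sum]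
      simp only [wd_eq_dz]
      rw [← wirt_sum s fun k _ => ((hθ k).mul_ext (P k).ball_subset hχ (P k).mem_atlas
        hΘ).smooth.contDiffAt.differentiableAt (by simp)]
      simp only [h1]
    rw [h3, hG, integral_finsetSum _ fun k _ => ((hw k Θ hΘ).2 i).1,
      integral_finsetSum _ fun k _ => ((hw k Θ hΘ).2 i).2.1, ← sum_neg_distrib]
    exact sum_ext fun k => ((hw k Θ hΘ).2 i).2.2

theorem integrable_gradX [CompactSpace X] (hg : g.IsKahler)
    (hθ : ∀ k, IsTest (fun z => (θ k z : ℂ)) (P k).ball) (hθ0 : ∀ k z, 0 ≤ θ k z)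
    (hθ1 : ∀ x, ∑ k ∈ s, extX (P k).χ (θ k) x = 1) :
    Integrable (fun x => g.covectorNormSq x (gradX g s P θ x)) g.volumeMeasure ∧
    ∫ x, g.covectorNormSq x (gradX g s P θ x) ∂g.volumeMeasure ≤ ∑ k ∈ s, ∫ x,
      extX (P k).χ (θ k) x * g.covectorNormSq x ((P k).cov g x) ∂g.volumeMeasure := by
  have hcov := integrable_cov hθ hθ0 hg
  set D : X → ℝ := fun x => ∑ k ∈ s, extX (P k).χ (θ k) x * g.covectorNormSq x ((P k).cov g x) with hD
  have hDi : Integrable D g.volumeMeasure := integrable_finsetSum _ fun k _ => (hcov k).1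
  have hle : ∀ x, g.covectorNormSq x (gradX g s P θ x) ≤ D x := fun x =>
    covectorNormSq_sum_le s x (fun k => ext_nonneg hθ0 k x) (hθ1 x) _
  have hi : Integrable (fun x => g.covectorNormSq x (gradX g s P θ x)) g.volumeMeasure := by
    have h1 : (fun x => g.covectorNormSq x (gradX g s P θ x)) = fun x => ∑ k ∈ s,
        extX (P k).χ (θ k) x * g.covectorNormSq x (gradX g s P θ x) := by
      funext x
      rw [← sum_mul, hθ1, one_mul]
    rw [h1]
    refine integrable_finsetSum _ fun k hk => ?_
    have hχ := (P k).mem_atlas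
    have hm := (P k).χ.open_target.measurableSet
    have hK := isKahlerOn_gX hg hχ
    rw [integrable_iff_chart hg hχ fun x hx => by rw [extX_of_notMem _ hx, zero_mul]]
    have hDc := (integrable_iff_chart hg hχ (H := (P k).χ.source.indicator D) fun x hx =>
      Set.indicator_of_notMem hx _).1 (hDi.indicator (P k).χ.open_source.measurableSet)
    have hGm : ∀ i, AEStronglyMeasurable (fun z => gradX g s P θ ((P k).χ.symm z)
        (coordVec (P k).χ ((P k).χ.symm z) i)) (volume.restrict (P k).χ.target) := fun i =>
      ((isWeakDel_gradX hg hθ hθ1 _ hχ).2 i).1.aestronglyMeasurable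
    have hcm : AEStronglyMeasurable (fun z => conorm (gX g (P k).χ) z fun i =>
        gradX g s P θ ((P k).χ.symm z) (coordVec (P k).χ ((P k).χ.symm z) i))
        (volume.restrict (P k).χ.target) := by
      refine continuous_re.comp_aestronglyMeasurable
        (Finset.aestronglyMeasurable_fun_sum _ fun i _ => Finset.aestronglyMeasurable_fun_sum _ fun j _ => ?_)
      exact (((ContinuousOn.aestronglyMeasurable (fun z hz =>
        (hK.smOn_ginv i j z hz).continuousAt.continuousWithinAt) hm).mul (hGm i)).mul
        (continuous_conj.comp_aestronglyMeasurable (hGm j)))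
    have hθc : Continuous (θ k) := by
      have := (hθ k).re.continuous
      simpa only [ofReal_re] using this
    refine Integrable.mono' hDc ((((continuousOn_dens hg hχ).aestronglyMeasurable hm).mul
      (hθc.aestronglyMeasurable.mul hcm)).congr ?_) ?_
    · filter_upwards [ae_restrict_mem hm] with z hz
      simp only [Pi.mul_apply, smul_eq_mul, extX_symm _ hz, covectorNormSq_symm hχ hz]
    · filter_upwards [ae_restrict_mem hm] with z hz
      have h2 := covectorNormSq_nonneg (g := g) ((P k).χ.symm z) (gradX g s P θ ((P k).χ.symm z))
      have h3 := ext_nonneg (P := P) hθ0 k ((P k).χ.symm z)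
      have h4 : extX (P k).χ (θ k) ((P k).χ.symm z) ≤ 1 := by
        rw [← hθ1 ((P k).χ.symm z)]
        exact single_le_sum (f := fun k => extX (P k).χ (θ k) _)
          (fun k _ => ext_nonneg hθ0 k _) hk
      have h5 := (dens_pos hg hχ hz).le
      rw [Set.indicator_of_mem ((P k).χ.map_target hz), smul_eq_mul, smul_eq_mul,
        norm_of_nonneg (mul_nonneg h5 (mul_nonneg h3 h2))]
      exact mul_le_mul_of_nonneg_left ((mul_le_of_le_one_left h2 h4).trans (hle _)) h5
  refine ⟨hi, ?_⟩
  rw [← integral_finsetSum _ fun k _ => (hcov k).1]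
  exact integral_mono hi hDi hle

end Gluing

end BochnerRatio

end
open BochnerRatio in
theorem proposition3p3 (n p : ℕ) (hp : 1 ≤ p)
    {X : Type*} [TopologicalSpace X] [T2Space X] [CompactSpace X] [ChartedSpace (Fin n → ℂ) X]
    [IsManifold 𝓘(ℂ, Fin n → ℂ) ω X] [MeasurableSpace X] [BorelSpace X]
    {Y : Type*} [TopologicalSpace Y] [T2Space Y] [ChartedSpace (Fin p → ℂ) Y]
    [IsManifold 𝓘(ℂ, Fin p → ℂ) ω Y]
    (g : HermitianMetric n X) (hg : g.IsKahler)
    (f : MeromorphicMap n p X Y) (hf : f.Dominant)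
    {ι : Type*} (h : PseudoEffectiveMetric f.reflexivePullback ι)
    (a b : ℝ) (ha : 0 ≤ a) (hab : 0 ≤ a / p + 2 * b / (p * (p + 1))) :
    (∀ x : X, ∃ S : Submodule ℂ (Tan n x),
      ∀ α, x ∈ h.U α → g.IsDecompositionSpan x (h.η α x) S) ∧
    ∃ G : ∀ x : X, Tan n x →ₗ[ℂ] ℂ,
      IsWeakDel n (hermitianRatio g h) G ∧
      Integrable (fun x => g.covectorNormSq x (G x)) g.volumeMeasure ∧
      ∀ S : ∀ x : X, Submodule ℂ (Tan n x),
        (∀ x α, x ∈ h.U α → g.IsDecompositionSpan x (h.η α x) (S x)) →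
        Integrable (fun x => hermitianRatio g h x ^ 2 * g.mixedCurv a b x (S x))
          g.volumeMeasure ∧
        -(a / p + 2 * b / (p * (p + 1))) * ∫ x, g.covectorNormSq x (G x) ∂g.volumeMeasure
          ≥ ∫ x, hermitianRatio g h x ^ 2 * g.mixedCurv a b x (S x) ∂g.volumeMeasure := by
  refine ⟨fun x => ?_, ?_⟩
  · obtain ⟨v, hv, ht⟩ := exists_frame hg h x
    refine ⟨Submodule.span ℂ (Set.range v), fun α hα => ?_⟩
    obtain ⟨t, ht⟩ := ht α hα
    exact ⟨v, t, hv, ht, rfl⟩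
  · obtain ⟨s, P, θ, hθ, hθ0, hθ1⟩ := Patch.exists_partition h
    obtain ⟨hi, hle⟩ := integrable_gradX hg hθ hθ0 hθ1
    refine ⟨gradX g s P θ, isWeakDel_gradX hg hθ hθ1, hi, fun S hS => ?_⟩
    obtain ⟨hSi, hSle⟩ := global_estimate hθ hθ0 hθ1 hg hp ha hab hS
    refine ⟨hSi, ?_⟩
    have := mul_le_mul_of_nonneg_left hle hab
    linarith
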